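/- Let $\Omega\subset\mathbb{R}^2$ be a bounded domain, $\omega\subseteq\Omega$ measurable, and let $T,\mu,\gamma,\varepsilon,c_0>0$. Let $$\Phi_{ad}=\{\varphi\in H^1(\Omega): |\varphi(x)|\le 1\text{ for a.e. }x\in\Omega\},\qquad \boldsymbol V=\{\psi\in H^1_0(\Omega)^2:\operatorname{div}\psi=0\},$$ where $H^1_0(\Omega)$ is the closure of $C_c^\infty(\Omega)$ in $H^1(\Omega)$, and let $\boldsymbol H$ be the space of $\psi\in L^2(\Omega)^2$ with $\operatorname{div}\psi=0$ in $\Omega$ and $\psi\cdot\mathbf n=0$ on $\partial\Omega$ in the weak sense, i.e. $\int_\Omega\psi\cdot\nabla q\,dx=0$ for all $q\in H^1(\Omega)$. Assume: * (data) $\mathbf f\in L^2(0,T;L^2(\Omega)^2)$, $\mathbf f_s\in L^2(\Omega)^2$, $\mathbf u_0\in\boldsymbol H$, and homogeneous Dirichlet boundary conditions; * (porous medium) $\alpha,\beta:\mathbb{R}\to\mathbb{R}$ are nonnegative and Lipschitz continuous with $\alpha(1)=\beta(1)=0$, $\alpha(-1)>0$ and $\beta(-1)>0$; * (objective) $\mathbf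 u_d\in L^2(\omega)^2$, and $\Psi(s)=(1-s^2)/2$ for $|s|\le1$, $\Psi(s)=+\infty$ for $|s|>1$. For $\varphi\in\Phi_{ad}$ put $a_\varphi(\mathbf u,\mathbf v)=\mu\int_\Omega\nabla\mathbf u:\nabla\mathbf v\,dx+\int_\Omega\alpha(\varphi)\,\mathbf u\cdot\mathbf v\,dx$, $b(\mathbf u,\mathbf v,\mathbf w)=\int_\Omega[(\mathbf u\cdot\nabla)\mathbf v]\cdot\mathbf w\,dx$ and $$\mathbb E_\varepsilon(\varphi)=\frac1{2c_0}\int_\Omega\Big(\frac\varepsilon2|\nabla\varphi|^2+\frac1\varepsilon\Psi(\varphi)\Big)dx .$$ (1) For every $\varphi\in\Phi_{ad}$ there is a unique $\mathbf u=:\mathcal S_T(\varphi)\in L^2(0,T;\boldsymbol V)$ with $\partial_t\mathbf u\in L^2(0,T;\boldsymbol V^*)$ such that, for a.e. $t\in(0,T)$ and all $\psi\in\boldsymbol V$, $$\langle\partial_t\mathbf u(t),\psi\rangle+a_\varphi(\mathbf u(t),\psi)+b(\mathbf u(t),\mathbf u(t),\psi)=\int_\Omega\mathbf f(t)\cdot\psi\,dx,$$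 and $\mathbf u(0)=\mathbf u_0$ (for the representative of $\mathbf u$ in $C([0,T];L^2(\Omega)^2)$); and there is $\varphi^T\in\Phi_{ad}$ with $J_T(\varphi^T)\le J_T(\varphi)$ for all $\varphi\in\Phi_{ad}$, where $$J_T(\varphi)=\frac1T\int_0^T\!\Big[\int_\Omega\tfrac{\varphi+1}2|\mathcal S_T(\varphi)-\mathbf u_d|^2\chi_\omega\,dx+\int_\Omega\beta(\varphi)|\mathcal S_T(\varphi)|^2dx\Big]dt+\gamma\,\mathbb E_\varepsilon(\varphi).$$ (2) Let $c_P,c_L>0$ be constants such that $\|\mathbf v\|_{L^2}\le c_P\|\nabla\mathbf v\|_{L^2}$ and $\|\mathbf v\|_{L^4}\le\sqrt{c_L}\,\|\mathbf v\|_{L^2}^{1/2}\|\nabla\mathbf v\|_{L^2}^{1/2}$ for all $\mathbf v\in H^1_0(\Omega)^2$, and suppose $2c_P^2c_L\|\mathbf f_s\|_{L^2}<\mu^2$. Then for every $\varphi\in\Phi_{ad}$ there is a unique $\mathbf v=:\mathcal S_s(\varphi)\in\boldsymbol V$ with $a_\varphi(\mathbf v,\psi)+b(\mathbf v,\mathbf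 v,\psi)=\int_\Omega\mathbf f_s\cdot\psi\,dx$ for all $\psi\in\boldsymbol V$; and there is $\varphi^s\in\Phi_{ad}$ with $J_s(\varphi^s)\le J_s(\varphi)$ for all $\varphi\in\Phi_{ad}$, where $$J_s(\varphi)=\int_\Omega\tfrac{\varphi+1}2|\mathcal S_s(\varphi)-\mathbf u_d|^2\chi_\omega\,dx+\int_\Omega\beta(\varphi)|\mathcal S_s(\varphi)|^2dx+\gamma\,\mathbb E_\varepsilon(\varphi).$$ -/

import Mathlib

open MeasureTheory Set

noncomputable section

namespace PhaseFieldNS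

/-- The Euclidean plane `ℝ²`. -/
abbrev Plane : Type := EuclideanSpace ℝ (Fin 2)

/-- `L²(Ω; F)`. -/
abbrev L2 (Ω : Set Plane) (F : Type) [NormedAddCommGroup F] : Type :=
  Lp F 2 (volume.restrict Ω)

/-- Test functions: the elements of `C_c^∞(U)`, extended by zero. -/
def IsTestFunction {X : Type} [NormedAddCommGroup X] [NormedSpace ℝ X]
    (U : Set X) (η : X → ℝ) : Prop :=
  ContDiff ℝ ((⊤ : ℕ∞) : WithTop ℕ∞) η ∧ HasCompactSupport η ∧ tsupport η ⊆ U

/-- `g` is the weak (distributional) gradient of `u` in `Ω`. -/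
def HasWeakGradient (Ω : Set Plane) (u : Plane → ℝ) (g : Plane → Plane) : Prop :=
  ∀ η : Plane → ℝ, IsTestFunction Ω η → ∀ i : Fin 2,
    ∫ x in Ω, u x * fderiv ℝ η x (EuclideanSpace.single i 1) = - ∫ x in Ω, g x i * η x

lemma memLp_of_continuous_compact (Ω : Set Plane) {h : Plane → ℝ} (hc : Continuous h)
    (hs : HasCompactSupport h) : MemLp h 2 (volume.restrict Ω) :=
  (hc.memLp_of_hasCompactSupport (μ := volume) hs).mono_measure Measure.restrict_le_self

lemma test_deriv_memLp (Ω : Set Plane) {η : Plane → ℝ} (hη : IsTestFunction Ω η) (i : Fin 2) :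
    MemLp (fun x => fderiv ℝ η x (EuclideanSpace.single i 1)) 2 (volume.restrict Ω) :=
  memLp_of_continuous_compact Ω
    ((hη.1.continuous_fderiv (by simp)).clm_apply continuous_const)
    (hη.2.1.fderiv_apply (𝕜 := ℝ) _)

lemma test_memLp (Ω : Set Plane) {η : Plane → ℝ} (hη : IsTestFunction Ω η) :
    MemLp η 2 (volume.restrict Ω) :=
  memLp_of_continuous_compact Ω hη.1.continuous hη.2.1

lemma coord_memLp {Ω : Set Plane} {g : Plane → Plane} (hg : MemLp g 2 (volume.restrict Ω))
    (i : Fin 2) : MemLp (fun x => g x i) 2 (volume.restrict Ω) :=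
  (EuclideanSpace.proj (𝕜 := ℝ) i : Plane →L[ℝ] ℝ).comp_memLp' hg

/-- The Sobolev space `H¹(Ω)`: pairs of an `L²` function and its weak gradient in `L²`, with the
norm `(‖u‖² + ‖∇u‖²)^{1/2}`. -/
def H1Sub (Ω : Set Plane) : Submodule ℝ (WithLp 2 (L2 Ω ℝ × L2 Ω Plane)) where
  carrier := {p | HasWeakGradient Ω p.fst p.snd}
  zero_mem' := by
    intro η _ i
    have h1 : ∫ x in Ω, ((0 : L2 Ω ℝ) : Plane → ℝ) x
        * fderiv ℝ η x (EuclideanSpace.single i 1) = 0 := by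
      rw [integral_eq_zero_of_ae]
      filter_upwards [Lp.coeFn_zero ℝ 2 (volume.restrict Ω)] with x hx
      simp only [hx]
      simp
    have h2 : ∫ x in Ω, ((0 : L2 Ω Plane) : Plane → Plane) x i * η x = 0 := by
      rw [integral_eq_zero_of_ae]
      filter_upwards [Lp.coeFn_zero Plane 2 (volume.restrict Ω)] with x hx
      simp only [hx]
      simp
    exact h1.trans (by rw [← neg_zero, ← h2]; rfl)
  add_mem' := by
    intro p q hp hq η hη i
    have hp' := hp η hη i
    have hq' := hq η hη i
    have e1 : ∫ x in Ω, ((p.fst + q.fst : L2 Ω ℝ) : Plane → ℝ) x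
        * fderiv ℝ η x (EuclideanSpace.single i 1)
        = (∫ x in Ω, p.fst x * fderiv ℝ η x (EuclideanSpace.single i 1))
          + ∫ x in Ω, q.fst x * fderiv ℝ η x (EuclideanSpace.single i 1) := by
      refine Eq.trans ?_ (integral_add ((Lp.memLp p.fst).integrable_mul (test_deriv_memLp Ω hη i))
        ((Lp.memLp q.fst).integrable_mul (test_deriv_memLp Ω hη i)))
      apply integral_congr_ae
      filter_upwards [Lp.coeFn_add p.fst q.fst] with x hx
      simp only [hx, Pi.add_apply, add_mul]
    have e2 : ∫ x in Ω, ((p.snd + q.snd : L2 Ω Plane) : Plane → Plane) x i * η x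
        = (∫ x in Ω, p.snd x i * η x) + ∫ x in Ω, q.snd x i * η x := by
      refine Eq.trans ?_ (integral_add
        ((coord_memLp (Lp.memLp p.snd) i).integrable_mul (test_memLp Ω hη))
        ((coord_memLp (Lp.memLp q.snd) i).integrable_mul (test_memLp Ω hη)))
      apply integral_congr_ae
      filter_upwards [Lp.coeFn_add p.snd q.snd] with x hx
      simp only [hx, Pi.add_apply, PiLp.add_apply, add_mul]
    change ∫ x in Ω, ((p.fst + q.fst : L2 Ω ℝ) : Plane → ℝ) x
        * fderiv ℝ η x (EuclideanSpace.single i 1)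
      = - ∫ x in Ω, ((p.snd + q.snd : L2 Ω Plane) : Plane → Plane) x i * η x
    rw [e1, e2, hp', hq', neg_add]
  smul_mem' := by
    intro c p hp η hη i
    have hp' := hp η hη i
    have e1 : ∫ x in Ω, ((c • p.fst : L2 Ω ℝ) : Plane → ℝ) x
        * fderiv ℝ η x (EuclideanSpace.single i 1)
        = c * ∫ x in Ω, p.fst x * fderiv ℝ η x (EuclideanSpace.single i 1) := by
      rw [← integral_const_mul]
      apply integral_congr_ae
      filter_upwards [Lp.coeFn_smul c p.fst] with x hx
      simp [hx, mul_assoc]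
    have e2 : ∫ x in Ω, ((c • p.snd : L2 Ω Plane) : Plane → Plane) x i * η x
        = c * ∫ x in Ω, p.snd x i * η x := by
      rw [← integral_const_mul]
      apply integral_congr_ae
      filter_upwards [Lp.coeFn_smul c p.snd] with x hx
      simp [hx, mul_assoc]
    change ∫ x in Ω, ((c • p.fst : L2 Ω ℝ) : Plane → ℝ) x
        * fderiv ℝ η x (EuclideanSpace.single i 1)
      = - ∫ x in Ω, ((c • p.snd : L2 Ω Plane) : Plane → Plane) x i * η x
    rw [e1, e2, hp', mul_neg]

/-- `H¹(Ω)` as a type. -/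
def H1 (Ω : Set Plane) : Type := H1Sub Ω

instance (Ω : Set Plane) : NormedAddCommGroup (H1 Ω) :=
  inferInstanceAs (NormedAddCommGroup (H1Sub Ω))

instance (Ω : Set Plane) : InnerProductSpace ℝ (H1 Ω) :=
  inferInstanceAs (InnerProductSpace ℝ (H1Sub Ω))

/-- The function underlying an element of `H¹(Ω)`. -/
def sval {Ω : Set Plane} (φ : H1 Ω) : L2 Ω ℝ := φ.1.fst

/-- The weak gradient of an element of `H¹(Ω)`. -/
def sgrad {Ω : Set Plane} (φ : H1 Ω) : L2 Ω Plane := φ.1.snd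

/-- `H¹₀(Ω)`: the closure of `C_c^∞(Ω)` in `H¹(Ω)`. -/
def H10 (Ω : Set Plane) : Submodule ℝ (H1 Ω) :=
  (Submodule.span ℝ {p : H1 Ω | ∃ η : Plane → ℝ, IsTestFunction Ω η ∧
    sval p =ᵐ[volume.restrict Ω] η}).topologicalClosure

/-- Vector fields with components in `H¹(Ω)`. -/
abbrev H1Vec (Ω : Set Plane) : Type := PiLp 2 (fun _ : Fin 2 => H1 Ω)

/-- The pointwise values of a Sobolev vector field. -/
def vel {Ω : Set Plane} (v : H1Vec Ω) (x : Plane) : Plane :=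
  WithLp.toLp 2 (fun i => sval (v i) x)

/-- The Jacobian `∇v`; its `i`-th row is the weak gradient of the `i`-th component. The norm and
inner product of `PiLp 2 (fun _ : Fin 2 => Plane)` are the Frobenius ones. -/
def jac {Ω : Set Plane} (v : H1Vec Ω) (x : Plane) : PiLp 2 (fun _ : Fin 2 => Plane) :=
  WithLp.toLp 2 (fun i => sgrad (v i) x)

/-- `(u · ∇)v`. -/
def convection {Ω : Set Plane} (u v : H1Vec Ω) (x : Plane) : Plane :=
  WithLp.toLp 2 (fun i => ∑ j, vel u x j * jac v x i j)

/-- The space `V` of divergence-free fields in `H¹₀(Ω)²`, with the norm of `H¹(Ω)²` (equivalent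
to `‖∇v‖` by Poincaré's inequality). -/
def VSub (Ω : Set Plane) : Submodule ℝ (H1Vec Ω) where
  carrier := {v | (∀ i, v i ∈ H10 Ω) ∧ ∀ᵐ x ∂(volume.restrict Ω), ∑ i, jac v x i i = 0}
  zero_mem' := by
    refine ⟨fun i => (H10 Ω).zero_mem, ?_⟩
    filter_upwards [Lp.coeFn_zero Plane 2 (volume.restrict Ω)] with x hx
    have h : ∀ i : Fin 2, jac (0 : H1Vec Ω) x i = 0 := fun i => hx
    simp [h]
  add_mem' := by
    intro v w hv hw
    refine ⟨fun i => (H10 Ω).add_mem (hv.1 i) (hw.1 i), ?_⟩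
    have h : ∀ᵐ x ∂(volume.restrict Ω), ∀ i : Fin 2,
        jac (v + w) x i = jac v x i + jac w x i := by
      rw [ae_all_iff]
      exact fun i => Lp.coeFn_add (sgrad (v i)) (sgrad (w i))
    filter_upwards [hv.2, hw.2, h] with x h1 h2 h3
    simp only [h3, PiLp.add_apply, Finset.sum_add_distrib, h1, h2, add_zero]
  smul_mem' := by
    intro c v hv
    refine ⟨fun i => (H10 Ω).smul_mem c (hv.1 i), ?_⟩
    have h : ∀ᵐ x ∂(volume.restrict Ω), ∀ i : Fin 2, jac (c • v) x i = c • jac v x i := by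
      rw [ae_all_iff]
      exact fun i => Lp.coeFn_smul c (sgrad (v i))
    filter_upwards [hv.2, h] with x h1 h3
    simp only [h3, PiLp.smul_apply, ← Finset.smul_sum, h1, smul_zero]

/-- `V` as a type. -/
def V (Ω : Set Plane) : Type := VSub Ω

instance (Ω : Set Plane) : NormedAddCommGroup (V Ω) :=
  inferInstanceAs (NormedAddCommGroup (VSub Ω))

instance (Ω : Set Plane) : InnerProductSpace ℝ (V Ω) :=
  inferInstanceAs (InnerProductSpace ℝ (VSub Ω))

/-- The space `H` of square-integrable fields with `div ψ = 0` in `Ω` and `ψ · n = 0` on `∂Ω`,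
both conditions being read weakly: `∫_Ω ψ · ∇q = 0` for all `q ∈ H¹(Ω)`. -/
def H (Ω : Set Plane) : Set (L2 Ω Plane) :=
  {ψ | ∀ q : H1 Ω, ∫ x in Ω, inner ℝ (ψ x) (sgrad q x) = 0}

/-- The admissible designs `Φ_ad`. -/
def admissible (Ω : Set Plane) : Set (H1 Ω) :=
  {φ | ∀ᵐ x ∂(volume.restrict Ω), |sval φ x| ≤ 1}

/-- `c` is a constant in Poincaré's inequality on `H¹₀(Ω)²`. -/
def IsPoincareConstant (Ω : Set Plane) (c : ℝ) : Prop :=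
  0 < c ∧ ∀ v : H1Vec Ω, (∀ i, v i ∈ H10 Ω) →
    eLpNorm (vel v) 2 (volume.restrict Ω)
      ≤ ENNReal.ofReal c * eLpNorm (jac v) 2 (volume.restrict Ω)

/-- `c` is a constant in Ladyzhenskaya's inequality on `H¹₀(Ω)²`. -/
def IsLadyzhenskayaConstant (Ω : Set Plane) (c : ℝ) : Prop :=
  0 < c ∧ ∀ v : H1Vec Ω, (∀ i, v i ∈ H10 Ω) →
    eLpNorm (vel v) 4 (volume.restrict Ω)
      ≤ ENNReal.ofReal (Real.sqrt c) * eLpNorm (vel v) 2 (volume.restrict Ω) ^ (1 / 2 : ℝ)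
        * eLpNorm (jac v) 2 (volume.restrict Ω) ^ (1 / 2 : ℝ)

/-- The assumptions on the interpolation functions `α` and `β` of the porous medium. -/
structure PorousFunction (α : ℝ → ℝ) : Prop where
  nonneg : ∀ s, 0 ≤ α s
  lipschitz : ∃ K : NNReal, LipschitzWith K α
  at_one : α 1 = 0
  at_neg_one : 0 < α (-1)

/-- `a_φ(u, v) = μ ∫ ∇u : ∇v + ∫ α(φ) u · v`. -/
def aForm {Ω : Set Plane} (μ : ℝ) (α : ℝ → ℝ) (φ : H1 Ω) (u v : H1Vec Ω) : ℝ :=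
  μ * (∫ x in Ω, inner ℝ (jac u x) (jac v x))
    + ∫ x in Ω, α (sval φ x) * inner ℝ (vel u x) (vel v x)

/-- `b(u, v, w) = ∫ [(u · ∇)v] · w`. -/
def bForm {Ω : Set Plane} (u v w : H1Vec Ω) : ℝ :=
  ∫ x in Ω, inner ℝ (convection u v x) (vel w x)

/-- Lebesgue measure on `I_T = (0, T)`. -/
abbrev timeMeasure (T : ℝ) : Measure ℝ := volume.restrict (Ioo 0 T)

/-- `u'` is the distributional time derivative of `u` on `(0, T)` as a function with values in
`V*`, where `V` is embedded into `V*` through the `L²` inner product. -/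
def HasWeakTimeDeriv {Ω : Set Plane} (T : ℝ) (u : ℝ → V Ω) (u' : ℝ → StrongDual ℝ (V Ω)) : Prop :=
  ∀ η : ℝ → ℝ, IsTestFunction (Ioo 0 T) η → ∀ ψ : V Ω,
    ∫ t in Ioo 0 T, deriv η t * ∫ x in Ω, inner ℝ (vel (u t).1 x) (vel ψ.1 x)
      = - ∫ t in Ioo 0 T, η t * u' t ψ

/-- Weak solutions `u ∈ L²(0,T;V)`, `∂ₜu ∈ L²(0,T;V*)`, of the time-dependent Navier–Stokes
equations with design `φ`. The initial condition is imposed on the representative of `u` in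
`C([0,T]; L²(Ω)²)`. -/
def IsWeakSolutionT {Ω : Set Plane} (μ : ℝ) (α : ℝ → ℝ) (T : ℝ) (f : ℝ → L2 Ω Plane)
    (u₀ : L2 Ω Plane) (φ : H1 Ω) (u : Lp (V Ω) 2 (timeMeasure T)) : Prop :=
  (∃ u' : ℝ → StrongDual ℝ (V Ω), MemLp u' 2 (timeMeasure T) ∧ HasWeakTimeDeriv T u u' ∧
    ∀ᵐ t ∂(timeMeasure T), ∀ ψ : V Ω,
      u' t ψ + aForm μ α φ (u t).1 ψ.1 + bForm (u t).1 (u t).1 ψ.1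
        = ∫ x in Ω, inner ℝ (f t x) (vel ψ.1 x)) ∧
  ∃ w : ℝ → L2 Ω Plane, ContinuousOn w (Icc 0 T) ∧
    (∀ᵐ t ∂(timeMeasure T), w t =ᵐ[volume.restrict Ω] vel (u t).1) ∧ w 0 = u₀

/-- Weak solutions of the stationary Navier–Stokes equations with design `φ`. -/
def IsWeakSolutionS {Ω : Set Plane} (μ : ℝ) (α : ℝ → ℝ) (fs : L2 Ω Plane) (φ : H1 Ω)
    (v : V Ω) : Prop :=
  ∀ ψ : V Ω, aForm μ α φ v.1 ψ.1 + bForm v.1 v.1 ψ.1 = ∫ x in Ω, inner ℝ (fs x) (vel ψ.1 x)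

open Classical in
/-- The time-dependent design-to-state operator `S_T` (zero if there is no weak solution). -/
def stateT {Ω : Set Plane} (μ : ℝ) (α : ℝ → ℝ) (T : ℝ) (f : ℝ → L2 Ω Plane)
    (u₀ : L2 Ω Plane) (φ : H1 Ω) : Lp (V Ω) 2 (timeMeasure T) :=
  if h : ∃ u, IsWeakSolutionT μ α T f u₀ φ u then h.choose else 0

open Classical in
/-- The stationary design-to-state operator `S_s` (zero if there is no weak solution). -/
def stateS {Ω : Set Plane} (μ : ℝ) (α : ℝ → ℝ) (fs : L2 Ω Plane) (φ : H1 Ω) : V Ω :=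
  if h : ∃ v, IsWeakSolutionS μ α fs φ v then h.choose else 0

/-- The double-obstacle potential. -/
def doubleObstacle (s : ℝ) : EReal := if |s| ≤ 1 then (((1 - s ^ 2) / 2 : ℝ) : EReal) else ⊤

/-- The Ginzburg–Landau energy of an admissible design. (For `φ ∈ Φ_ad` the potential is finite
almost everywhere, so that `EReal.toReal` does not change it.) -/
def energy {Ω : Set Plane} (c₀ ε : ℝ) (φ : H1 Ω) : ℝ :=
  1 / (2 * c₀) * ∫ x in Ω, (ε / 2 * ‖sgrad φ x‖ ^ 2 + 1 / ε * (doubleObstacle (sval φ x)).toReal)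

/-- `∫_Ω (φ+1)/2 |v - u_d|² χ_ω + ∫_Ω β(φ) |v|²`. -/
def cost {Ω : Set Plane} (β : ℝ → ℝ) (ω : Set Plane) (ud : Plane → Plane) (v : H1Vec Ω)
    (φ : H1 Ω) : ℝ :=
  (∫ x in Ω, (sval φ x + 1) / 2 * ‖vel v x - ud x‖ ^ 2 * ω.indicator (fun _ => (1 : ℝ)) x)
    + ∫ x in Ω, β (sval φ x) * ‖vel v x‖ ^ 2

/-- The time-dependent objective `J_T(u, φ)`. -/
def objectiveT {Ω : Set Plane} (T : ℝ) (β : ℝ → ℝ) (ω : Set Plane) (ud : Plane → Plane)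
    (γ c₀ ε : ℝ) (u : Lp (V Ω) 2 (timeMeasure T)) (φ : H1 Ω) : ℝ :=
  1 / T * (∫ t in Ioo 0 T, cost β ω ud (u t).1 φ) + γ * energy c₀ ε φ

/-- The stationary objective `J_s(v, φ)`. -/
def objectiveS {Ω : Set Plane} (β : ℝ → ℝ) (ω : Set Plane) (ud : Plane → Plane)
    (γ c₀ ε : ℝ) (v : V Ω) (φ : H1 Ω) : ℝ :=
  cost β ω ud v.1 φ + γ * energy c₀ ε φ

/-- The reduced objective `J_T(φ) = J_T(S_T(φ), φ)`. -/
def reducedT {Ω : Set Plane} (μ : ℝ) (α β : ℝ → ℝ) (T : ℝ) (f : ℝ → L2 Ω Plane)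
    (u₀ : L2 Ω Plane) (ω : Set Plane) (ud : Plane → Plane) (γ c₀ ε : ℝ) (φ : H1 Ω) : ℝ :=
  objectiveT T β ω ud γ c₀ ε (stateT μ α T f u₀ φ) φ

/-- The reduced objective `J_s(φ) = J_s(S_s(φ), φ)`. -/
def reducedS {Ω : Set Plane} (μ : ℝ) (α β : ℝ → ℝ) (fs : L2 Ω Plane)
    (ω : Set Plane) (ud : Plane → Plane) (γ c₀ ε : ℝ) (φ : H1 Ω) : ℝ :=
  objectiveS β ω ud γ c₀ ε (stateS μ α fs φ) φ

end PhaseFieldNS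

end

open PhaseFieldNS

noncomputable section

open MeasureTheory Set Filter Topology
open scoped ENNReal NNReal InnerProductSpace ContDiff

set_option linter.unusedSectionVars false

namespace PhaseFieldNS

/-! ### Square-integrable functions -/

/-! Both minimization claims are instances of the direct method. Along a minimizing sequence the
Ginzburg–Landau energy bounds the gradients and `|φ| ≤ 1` bounds the values, so a subsequence
converges weakly in `H¹(Ω)` and almost everywhere (`exists_admissible_limit`). The Dirichlet energy
is weakly lower semicontinuous, and the rest of the objective is continuous under a.e. convergence
of admissible designs as soon as the states converge strongly (`exists_minimizer`, `tendsto_cost`,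
`tendsto_integral_cost`). Strong convergence of the states comes from stability estimates: their
distance is controlled by the norm of `(α(φₙ) - α(φ)) u` with `u` the limit state, and this tends to
zero by dominated convergence (`tendsto_stateT`, `tendsto_stateS`).

For the evolution problem the weak formulation becomes an equation in the Hilbert triple given by
the compact injective embedding `vJ` of `V` into `L²`. The eigenvectors of `J* J` yield the energy
identity (`IsTraj.energy`) and the solvability of the linear problem (`exists_linear_traj`). In two
dimensions Ladyzhenskaya's inequality and the antisymmetry of `b` bound the square of `B(u, v)` in
the dual norm by `C |u| ‖u‖ |v| ‖v‖`, where `|·|` is the `L²` norm. This makes Grönwall's inequality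
applicable to the difference of two solutions (`IsNSTraj.stability`), whence uniqueness and
continuous dependence. Existence is by continuation in the size of the data: a contraction in an
exponentially weighted norm leads from a solution for the data scaled by `j/m` to one for `(j+1)/m`,
and an a priori bound lets the same step serve throughout (`exists_nsTraj`).

The initial value must be a limit of elements of `V` in `L²`, although nothing is assumed about the
boundary of `Ω` (`mem_closure_range_vJ`). A field `g` orthogonal to the solenoidal test fields and
to all gradients agrees a.e. with a continuous field having the mean value property and, up to a
nonzero factor, has a potential `p` on the connected set `Ω`. The potential need not lie in `H¹(Ω)`,
but `arctan p` does, and testing with its gradient gives `∫ |g|² / (1 + p²) = 0`.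

For the stationary problem the solution map of the Oseen linearization is a contraction in the
Dirichlet norm. The smallness condition makes its constant less than `1/2`: less than `1` gives
existence, and `1/2` leaves room to absorb a term in the stability estimate
(`IsDirichletConvective.stability`). -/

lemma integrable_inner_of_memLp {α F : Type*} [MeasurableSpace α] {ν : Measure α}
    [NormedAddCommGroup F] [InnerProductSpace ℝ F] {f g : α → F} (hf : MemLp f 2 ν)
    (hg : MemLp g 2 ν) : Integrable (fun x => ⟪f x, g x⟫_ℝ) ν := by
  refine (hf.norm.integrable_mul hg.norm).mono' (hf.1.inner hg.1) ?_
  exact Eventually.of_forall fun x => norm_inner_le_norm _ _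

lemma integrable_norm_sq_of_memLp {α F : Type*} [MeasurableSpace α] {ν : Measure α}
    [NormedAddCommGroup F] {f : α → F} (hf : MemLp f 2 ν) :
    Integrable (fun x => ‖f x‖ ^ 2) ν :=
  (memLp_two_iff_integrable_sq_norm hf.1).1 hf

lemma Lp_norm_sq_eq_integral {α F : Type*} [MeasurableSpace α] {ν : Measure α}
    [NormedAddCommGroup F] [InnerProductSpace ℝ F] (f : Lp F 2 ν) :
    ‖f‖ ^ 2 = ∫ x, ‖f x‖ ^ 2 ∂ν := by
  rw [← real_inner_self_eq_norm_sq, L2.inner_def]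
  simp

/-! ### Primitives of integrable functions on `[0, T]` -/

lemma intervalIntegrable_iff_timeMeasure {E : Type*} [NormedAddCommGroup E] {T : ℝ} (hT : 0 ≤ T)
    {g : ℝ → E} : IntervalIntegrable g volume 0 T ↔ Integrable g (timeMeasure T) :=
  intervalIntegrable_iff_integrableOn_Ioo_of_le hT

lemma intervalIntegral_eq_timeMeasure {E : Type*} [NormedAddCommGroup E] [NormedSpace ℝ E]
    {T : ℝ} (hT : 0 ≤ T) (g : ℝ → E) : ∫ s in 0..T, g s = ∫ s, g s ∂(timeMeasure T) := by
  rw [intervalIntegral.integral_of_le hT, integral_Ioc_eq_integral_Ioo]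

/-- `y` is a primitive of the integrable function `g` on `[0, T]`. -/
structure IsPrimitiveOn (T : ℝ) (y g : ℝ → ℝ) : Prop where
  integrable : IntervalIntegrable g volume 0 T
  eq : ∀ t ∈ Icc 0 T, y t = y 0 + ∫ s in 0..t, g s

lemma isPrimitiveOn_integral {T : ℝ} {g : ℝ → ℝ} (hg : IntervalIntegrable g volume 0 T) :
    IsPrimitiveOn T (fun t => ∫ s in 0..t, g s) g :=
  ⟨hg, fun t _ => by simp⟩

namespace IsPrimitiveOn

variable {T : ℝ} {y z g h : ℝ → ℝ}

lemma absolutelyContinuous (hT : 0 ≤ T) (hy : IsPrimitiveOn T y g) :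
    AbsolutelyContinuousOnInterval y 0 T := by
  have h1 : AbsolutelyContinuousOnInterval (fun x ↦ y 0 + ∫ v in (0:ℝ)..x, g v) 0 T := by
    have h2 := hy.integrable.absolutelyContinuousOnInterval_intervalIntegral
      (c := 0) (by simp)
    have h3 : AbsolutelyContinuousOnInterval (fun _ : ℝ => y 0) 0 T :=
      (LipschitzOnWith.of_dist_le_mul (K := 0) (by simp)).absolutelyContinuousOnInterval
    exact h3.add h2
  refine Tendsto.congr' ?_ h1
  rw [EventuallyEq, eventually_inf_principal]
  refine Eventually.of_forall fun E hE => Finset.sum_congr rfl fun i hi => ?_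
  have hmem : ∀ x ∈ uIcc (0:ℝ) T, (y 0 + ∫ v in (0:ℝ)..x, g v) = y x := fun x hx => by
    rw [uIcc_of_le hT] at hx; exact (hy.eq x hx).symm
  beta_reduce
  rw [hmem _ (hE.1 i hi).1, hmem _ (hE.1 i hi).2]

lemma ae_hasDerivAt (hT : 0 ≤ T) (hy : IsPrimitiveOn T y g) :
    ∀ᵐ t, t ∈ Ioo 0 T → HasDerivAt y (g t) t := by
  filter_upwards [hy.integrable.ae_hasDerivAt_integral] with t ht htI
  have htI' : t ∈ uIcc 0 T := by rw [uIcc_of_le hT]; exact Ioo_subset_Icc_self htI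
  have := (ht htI' 0 (by simp)).const_add (y 0)
  refine this.congr_of_eventuallyEq ?_
  filter_upwards [Ioo_mem_nhds htI.1 htI.2] with s hs
  exact hy.eq s (Ioo_subset_Icc_self hs)

/-- An absolutely continuous function is a primitive of its almost everywhere derivative. -/
lemma of_ae_hasDerivAt (hT : 0 ≤ T) (hy : AbsolutelyContinuousOnInterval y 0 T)
    (hd : ∀ᵐ t, t ∈ Ioo 0 T → HasDerivAt y (g t) t) : IsPrimitiveOn T y g := by
  have key : ∀ᵐ t ∂(volume.restrict (Ioo 0 T)), deriv y t = g t := by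
    rw [ae_restrict_iff' measurableSet_Ioo]
    filter_upwards [hd] with t ht htI using (ht htI).deriv
  refine ⟨?_, fun t ht => ?_⟩
  · have := hy.intervalIntegrable_deriv
    rw [intervalIntegrable_iff_timeMeasure hT] at this ⊢
    exact this.congr key
  · have h1 := (hy.mono (c := 0) (d := t) (by
      rw [uIcc_of_le hT, uIcc_of_le ht.1]; exact Icc_subset_Icc_right ht.2)).integral_deriv_eq_sub
    have h2 : ∫ s in 0..t, deriv y s = ∫ s in 0..t, g s := by
      rw [intervalIntegral_eq_timeMeasure ht.1, intervalIntegral_eq_timeMeasure ht.1]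
      exact integral_congr_ae (ae_mono (Measure.restrict_mono (Ioo_subset_Ioo_right ht.2) le_rfl) key)
    linarith

lemma continuousOn (hT : 0 ≤ T) (hy : IsPrimitiveOn T y g) : ContinuousOn y (Icc 0 T) := by
  have := (hy.absolutelyContinuous hT).continuousOn
  rwa [uIcc_of_le hT] at this

lemma mul (hT : 0 ≤ T) (hy : IsPrimitiveOn T y g) (hz : IsPrimitiveOn T z h) :
    IsPrimitiveOn T (fun t => y t * z t) (fun t => g t * z t + y t * h t) := by
  refine of_ae_hasDerivAt hT ((hy.absolutelyContinuous hT).mul (hz.absolutelyContinuous hT)) ?_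
  filter_upwards [hy.ae_hasDerivAt hT, hz.ae_hasDerivAt hT] with t h1 h2 ht
  exact (h1 ht).mul (h2 ht)

lemma add (hy : IsPrimitiveOn T y g) (hz : IsPrimitiveOn T z h) :
    IsPrimitiveOn T (fun t => y t + z t) (fun t => g t + h t) := by
  refine ⟨hy.integrable.add hz.integrable, fun t ht => ?_⟩
  have hs : uIcc 0 t ⊆ uIcc 0 T := by
    rw [uIcc_of_le ht.1, uIcc_of_le (ht.1.trans ht.2)]; exact Icc_subset_Icc_right ht.2
  rw [intervalIntegral.integral_add (hy.integrable.mono_set hs) (hz.integrable.mono_set hs),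
    hy.eq t ht, hz.eq t ht]
  ring

lemma const_mul (c : ℝ) (hy : IsPrimitiveOn T y g) :
    IsPrimitiveOn T (fun t => c * y t) (fun t => c * g t) := by
  refine ⟨hy.integrable.const_mul c, fun t ht => ?_⟩
  rw [intervalIntegral.integral_const_mul, hy.eq t ht]
  ring

lemma comp_contDiff (hT : 0 ≤ T) (hy : IsPrimitiveOn T y g) {p p' : ℝ → ℝ}
    (hp : ContDiff ℝ 1 p) (hp' : ∀ x, HasDerivAt p (p' x) x) :
    IsPrimitiveOn T (fun t => p (y t)) (fun t => p' (y t) * g t) := by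
  have hac := hy.absolutelyContinuous hT
  obtain ⟨C, hC⟩ := hac.exists_bound
  obtain ⟨K, hK⟩ := (hp.contDiffOn (s := Icc (-C) C)).exists_lipschitzOnWith (by simp)
    (convex_Icc _ _) isCompact_Icc
  refine of_ae_hasDerivAt hT ?_ ?_
  -- `y` stays in `[-C, C]`, where `p` is `K`-Lipschitz, so absolute continuity survives the
  -- composition. Dividing by `K + 1` instead of `K` allows `K = 0`.
  · rw [absolutelyContinuousOnInterval_iff] at hac ⊢
    intro ε hε
    obtain ⟨δ, hδ, h⟩ := hac (ε / (K + 1)) (by positivity)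
    refine ⟨δ, hδ, fun E hE hEs => ?_⟩
    have h1 := h E hE hEs
    have h2 : ∑ i ∈ Finset.range E.1, dist (p (y (E.2 i).1)) (p (y (E.2 i).2))
        ≤ K * ∑ i ∈ Finset.range E.1, dist (y (E.2 i).1) (y (E.2 i).2) := by
      rw [Finset.mul_sum]
      refine Finset.sum_le_sum fun i hi => hK.dist_le_mul _ ?_ _ ?_
      · exact abs_le.1 (hC _ (hE.1 i hi).1)
      · exact abs_le.1 (hC _ (hE.1 i hi).2)
    have h3 : (K : ℝ) * ∑ i ∈ Finset.range E.1, dist (y (E.2 i).1) (y (E.2 i).2)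
        ≤ (K + 1) * ∑ i ∈ Finset.range E.1, dist (y (E.2 i).1) (y (E.2 i).2) := by
      gcongr; simp
    have h4 := (lt_div_iff₀' (by positivity : (0:ℝ) < K + 1)).1 h1
    linarith
  · filter_upwards [hy.ae_hasDerivAt hT] with t h1 ht
    exact (hp' _).comp t (h1 ht)

lemma exp_const_mul (hT : 0 ≤ T) (c : ℝ) (hy : IsPrimitiveOn T y g) :
    IsPrimitiveOn T (fun t => Real.exp (c * y t)) (fun t => c * g t * Real.exp (c * y t)) := by
  have := (hy.const_mul c).comp_contDiff hT Real.contDiff_exp Real.hasDerivAt_exp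
  simpa [mul_comm] using this

end IsPrimitiveOn

/-- Grönwall's inequality with an integrable coefficient. -/
lemma gronwall_integral {T K : ℝ} {y θ : ℝ → ℝ} (hT : 0 ≤ T)
    (hθ : IntervalIntegrable θ volume 0 T) (hθ0 : ∀ᵐ t ∂(timeMeasure T), 0 ≤ θ t)
    (hy : ContinuousOn y (Icc 0 T))
    (h : ∀ t ∈ Icc 0 T, y t ≤ K + ∫ s in 0..t, θ s * y s) :
    ∀ t ∈ Icc 0 T, y t ≤ K * Real.exp (∫ s in 0..t, θ s) := by
  have hInt : IntervalIntegrable (fun s => θ s * y s) volume 0 T :=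
    hθ.mul_continuousOn (by rwa [uIcc_of_le hT])
  have h1 := (isPrimitiveOn_integral hInt)
  have hK : IsPrimitiveOn T (fun _ => K) (fun _ => 0) := ⟨by simp, by simp⟩
  have hR := hK.add h1
  have hE := (isPrimitiveOn_integral hθ).exp_const_mul hT (-1)
  -- Integrating factor: `(K + ∫ θ y) exp (-∫ θ)` starts at `K` and does not increase, because `θ ≥
  -- 0` and `y ≤ K + ∫ θ y`.
  have hP := hR.mul hT hE
  intro t ht
  have e := hP.eq t ht
  have hneg : ∫ s in (0:ℝ)..t, ((0 + θ s * y s) * Real.exp (-1 * ∫ r in (0:ℝ)..s, θ r)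
      + (K + ∫ r in (0:ℝ)..s, θ r * y r) * (-1 * θ s * Real.exp (-1 * ∫ r in (0:ℝ)..s, θ r))) ≤ 0 := by
    rw [intervalIntegral_eq_timeMeasure ht.1]
    refine integral_nonpos_of_ae ?_
    have h0 := ae_mono (Measure.restrict_mono (Ioo_subset_Ioo_right ht.2) le_rfl) hθ0
    filter_upwards [h0, ae_restrict_mem measurableSet_Ioo] with s hs hsI
    have h2 := h s ⟨hsI.1.le, hsI.2.le.trans ht.2⟩
    have h3 := Real.exp_pos (-1 * ∫ r in (0:ℝ)..s, θ r)
    have h4 : 0 ≤ θ s * Real.exp (-1 * ∫ r in (0:ℝ)..s, θ r) := mul_nonneg hs h3.le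
    simp only [Pi.zero_apply]
    nlinarith
  simp only [intervalIntegral.integral_same, mul_zero, Real.exp_zero, add_zero, mul_one] at e
  have h5 : (K + ∫ s in (0:ℝ)..t, θ s * y s) * Real.exp (-1 * ∫ s in (0:ℝ)..t, θ s) ≤ K := by
    rw [e]; linarith
  have h6 : (K + ∫ s in (0:ℝ)..t, θ s * y s) ≤ K * Real.exp (∫ s in (0:ℝ)..t, θ s) := by
    rw [neg_one_mul, Real.exp_neg, ← div_eq_mul_inv, div_le_iff₀ (Real.exp_pos _)] at h5
    exact h5
  exact (h t ht).trans h6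

/-! ### Weak derivatives on an interval -/

/-- The product `η c` is absolutely continuous and vanishes at both ends of `[0, T]`, so the
integral of its derivative is zero. -/
lemma IsPrimitiveOn.integral_deriv_mul {T : ℝ} (hT : 0 < T) {c g : ℝ → ℝ}
    (h : IsPrimitiveOn T c g) {η : ℝ → ℝ} (hη : IsTestFunction (Ioo 0 T) η) :
    ∫ t in Ioo 0 T, deriv η t * c t = - ∫ t in Ioo 0 T, η t * g t := by
  have h0 : η 0 = 0 := image_eq_zero_of_notMem_tsupport fun h => (hη.2.2 h).1.false
  have h1 : η T = 0 := image_eq_zero_of_notMem_tsupport fun h => (hη.2.2 h).2.false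
  have hd : Continuous (deriv η) := hη.1.continuous_deriv (by simp)
  have hηp : IsPrimitiveOn T η (deriv η) := by
    refine ⟨hd.intervalIntegrable _ _, fun t ht => ?_⟩
    rw [intervalIntegral.integral_deriv_eq_sub (fun x _ => hη.1.differentiable (by simp) x)
      (hd.intervalIntegrable _ _)]
    ring
  have e := (hηp.mul hT.le h).eq T ⟨hT.le, le_rfl⟩
  have hc := h.continuousOn hT.le
  rw [intervalIntegral.integral_add] at e
  · rw [h0, h1, intervalIntegral_eq_timeMeasure hT.le, intervalIntegral_eq_timeMeasure hT.le] at e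
    linarith
  · exact (hd.continuousOn.mul (by rwa [uIcc_of_le hT.le])).intervalIntegrable
  · exact h.integrable.continuousOn_mul hη.1.continuous.continuousOn

lemma exists_testFunction_integral_one {T : ℝ} (hT : 0 < T) :
    ∃ θ : ℝ → ℝ, IsTestFunction (Ioo 0 T) θ ∧ ∫ t, θ t = 1 := by
  let f : ContDiffBump (T / 2 : ℝ) := ⟨T / 8, T / 4, by positivity, by linarith⟩
  refine ⟨f.normed volume, ⟨f.contDiff_normed, f.hasCompactSupport_normed, ?_⟩, f.integral_normed⟩
  rw [f.tsupport_normed_eq]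
  intro x hx
  rw [Metric.mem_closedBall, Real.dist_eq, abs_le] at hx
  simp only [f] at hx
  constructor <;> linarith [hx.1, hx.2]

/-- A smooth function of mean zero with compact support in an interval is the derivative of
a test function. -/
lemma exists_testFunction_deriv_eq {T : ℝ} {χ : ℝ → ℝ} (hχ : IsTestFunction (Ioo 0 T) χ)
    (h0 : ∫ t, χ t = 0) : ∃ η : ℝ → ℝ, IsTestFunction (Ioo 0 T) η ∧ deriv η = χ := by
  have hc := hχ.1.continuous
  have hi : Integrable χ := hc.integrable_of_hasCompactSupport hχ.2.1
  let η : ℝ → ℝ := fun t => ∫ s in (0:ℝ)..t, χ s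
  have hd : ∀ t, HasDerivAt η (χ t) t := fun t =>
    intervalIntegral.integral_hasDerivAt_right (hc.intervalIntegrable _ _)
      hc.aestronglyMeasurable.stronglyMeasurableAtFilter hc.continuousAt
  have hde : deriv η = χ := funext fun t => (hd t).deriv
  -- If `χ` vanishes identically any `a > 0` and `b < T` will do; they need not even be ordered.
  obtain ⟨a, b, ha, hb, hab⟩ : ∃ a b : ℝ, 0 < a ∧ b < T ∧ tsupport χ ⊆ Icc a b := by
    rcases (tsupport χ).eq_empty_or_nonempty with he | hne
    · exact ⟨1, T - 1, one_pos, by linarith, by simp [he]⟩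
    · obtain ⟨a, ha⟩ := hχ.2.1.isCompact.exists_isLeast hne
      obtain ⟨b, hb⟩ := hχ.2.1.isCompact.exists_isGreatest hne
      exact ⟨a, b, (hχ.2.2 ha.1).1, (hχ.2.2 hb.1).2, fun x hx => ⟨ha.2 hx, hb.2 hx⟩⟩
  have hsub : tsupport η ⊆ Icc a b := by
    refine closure_minimal (fun t ht => ?_) isClosed_Icc
    by_contra hcon
    -- Off `[a, b]` the support of `χ` lies entirely on one side of `t`. The integral up to `t`
    -- therefore sees either the whole support, and vanishes since `χ` has mean zero, or none of it.
    have hseg : (∀ s ∈ tsupport χ, s < t) ∨ (∀ s ∈ tsupport χ, t < s) := by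
      rw [mem_Icc, not_and_or, not_le, not_le] at hcon
      rcases hcon with h | h
      · exact Or.inr fun s hs => h.trans_le (hab hs).1
      · exact Or.inl fun s hs => (hab hs).2.trans_lt h
    apply ht
    have hz : ∀ s, χ s ≠ 0 → s ∈ tsupport χ := fun s hs => subset_tsupport _ hs
    rcases hseg with h | h
    · have h2 : ∫ s in (0:ℝ)..t, χ s = ∫ s in Iic t, χ s := by
        rw [← intervalIntegral.integral_Iic_sub_Iic hi.integrableOn hi.integrableOn]
        rw [setIntegral_eq_zero_of_forall_eq_zero (t := Iic 0), sub_zero]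
        intro s hs
        by_contra hne
        exact absurd (hχ.2.2 (hz s hne)).1 (not_lt.2 hs)
      rw [show η t = _ from h2, setIntegral_eq_integral_of_forall_compl_eq_zero, h0]
      intro s hs
      by_contra hne
      exact hs (h s (hz s hne)).le
    · refine intervalIntegral.integral_zero_ae (Eventually.of_forall fun s hs => ?_)
      by_contra hne
      rcases le_total 0 t with h3 | h3
      · rw [uIoc_of_le h3] at hs
        exact absurd (h s (hz s hne)) (not_lt.2 hs.2)
      · rw [uIoc_of_ge h3] at hs
        exact absurd (hχ.2.2 (hz s hne)).1 (not_lt.2 hs.2)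
  refine ⟨η, ⟨?_, ?_, ?_⟩, hde⟩
  · rw [contDiff_infty_iff_deriv, hde]
    exact ⟨fun t => (hd t).differentiableAt, hχ.1⟩
  · exact HasCompactSupport.of_support_subset_isCompact isCompact_Icc
      ((subset_tsupport _).trans hsub)
  · exact hsub.trans fun x hx => ⟨ha.trans_le hx.1, hx.2.trans_lt hb⟩

/-- The lemma of du Bois-Reymond. -/
lemma eqOn_const_of_integral_deriv_mul_eq_zero {T : ℝ} (hT : 0 < T) {f : ℝ → ℝ}
    (hf : ContinuousOn f (Icc 0 T))
    (h : ∀ η : ℝ → ℝ, IsTestFunction (Ioo 0 T) η → ∫ t in Ioo 0 T, deriv η t * f t = 0) :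
    ∀ t ∈ Icc 0 T, f t = f 0 := by
  obtain ⟨θ, hθ, hθ1⟩ := exists_testFunction_integral_one hT
  have hfi : IntegrableOn f (Ioo 0 T) := (hf.integrableOn_Icc).mono_set Ioo_subset_Icc_self
  have hmul : ∀ χ : ℝ → ℝ, IsTestFunction (Ioo 0 T) χ →
      IntegrableOn (fun t => χ t * f t) (Ioo 0 T) := fun χ hχ =>
    ((hχ.1.continuous.continuousOn.mul hf).integrableOn_Icc).mono_set Ioo_subset_Icc_self
  -- The candidate for the constant value of `f`: its average against a bump of total mass one.
  set k := ∫ t in Ioo 0 T, θ t * f t with hk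
  have hae : ∀ᵐ t, t ∈ Ioo 0 T → f t - k = 0 := by
    refine isOpen_Ioo.ae_eq_zero_of_integral_contDiff_smul_eq_zero
      ((hfi.sub (integrableOn_const (by simp))).locallyIntegrableOn) ?_
    intro χ h1 h2 h3
    have hχ : IsTestFunction (Ioo 0 T) χ := ⟨h1, h2, h3⟩
    have hχi := h1.continuous.integrable_of_hasCompactSupport (μ := volume) h2
    have hθi := hθ.1.continuous.integrable_of_hasCompactSupport (μ := volume) hθ.2.1
    set m := ∫ t, χ t with hm
    -- Subtracting `m θ` removes the mean of `χ`, so the difference is the derivative of a test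
    -- function and the hypothesis applies to it.
    have hg : IsTestFunction (Ioo 0 T) (fun t => χ t - m * θ t) := by
      refine ⟨h1.sub (contDiff_const.mul hθ.1), h2.sub (hθ.2.1.mul_left), ?_⟩
      refine (tsupport_sub _ _).trans (union_subset h3 ?_)
      exact (tsupport_mul_subset_right).trans hθ.2.2
    obtain ⟨η, hη, hde⟩ := exists_testFunction_deriv_eq hg (by
      rw [integral_sub hχi (hθi.const_mul m), integral_const_mul, hθ1, mul_one, sub_self])
    have e := h η hη
    rw [hde] at e
    have e2 : ∫ t in Ioo 0 T, (χ t - m * θ t) * f t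
        = (∫ t in Ioo 0 T, χ t * f t) - m * k := by
      rw [hk, ← integral_const_mul, ← integral_sub (hmul χ hχ) ((hmul θ hθ).const_mul m)]
      exact integral_congr_ae (Eventually.of_forall fun t => by simp only; ring)
    rw [e2] at e
    have hset : ∀ ξ : ℝ → ℝ, (∫ t in Ioo 0 T, χ t * ξ t) = ∫ t, χ t * ξ t := fun ξ =>
      setIntegral_eq_integral_of_forall_compl_eq_zero fun t ht => by
        rw [image_eq_zero_of_notMem_tsupport (fun hh => ht (h3 hh)), zero_mul]
    simp only [smul_eq_mul]
    rw [← hset]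
    have e3 : ∫ t in Ioo 0 T, χ t * (f t - k) = (∫ t in Ioo 0 T, χ t * f t) - m * k := by
      have e4 : m * k = ∫ t in Ioo 0 T, χ t * k := by
        rw [hset (fun _ => k), integral_mul_const]
      rw [e4, ← integral_sub (hmul χ hχ) (hχi.integrableOn.mul_const k)]
      exact integral_congr_ae (Eventually.of_forall fun t => by simp only; ring)
    rw [e3, e]
  have hfk : EqOn f (fun _ => k) (Icc 0 T) := by
    refine Measure.eqOn_Icc_of_ae_eq (μ := volume) hT.ne ?_ hf continuousOn_const
    rw [← restrict_Ioo_eq_restrict_Icc]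
    rw [EventuallyEq, ae_restrict_iff' measurableSet_Ioo]
    filter_upwards [hae] with t ht h using sub_eq_zero.1 (ht h)
  intro t ht
  rw [hfk ht, hfk ⟨le_rfl, hT.le⟩]

/-- A continuous function with an integrable weak derivative is a primitive of it. -/
lemma isPrimitiveOn_of_weakDeriv {T : ℝ} (hT : 0 < T) {c g : ℝ → ℝ}
    (hc : ContinuousOn c (Icc 0 T)) (hg : Integrable g (timeMeasure T))
    (h : ∀ η : ℝ → ℝ, IsTestFunction (Ioo 0 T) η →
      ∫ t in Ioo 0 T, deriv η t * c t = - ∫ t in Ioo 0 T, η t * g t) :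
    IsPrimitiveOn T c g := by
  have hg' := (intervalIntegrable_iff_timeMeasure hT.le).2 hg
  have hP := isPrimitiveOn_integral hg'
  have hPc := hP.continuousOn hT.le
  have key := eqOn_const_of_integral_deriv_mul_eq_zero hT (hc.sub hPc) (fun η hη => by
    have hd : Continuous (deriv η) := hη.1.continuous_deriv (by simp)
    have i1 : ∀ z : ℝ → ℝ, ContinuousOn z (Icc 0 T) →
        IntegrableOn (fun t => deriv η t * z t) (Ioo 0 T) := fun z hz =>
      ((hd.continuousOn.mul hz).integrableOn_Icc).mono_set Ioo_subset_Icc_self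
    have e : ∫ t in Ioo 0 T, deriv η t * (c - fun t => ∫ s in (0:ℝ)..t, g s) t
        = (∫ t in Ioo 0 T, deriv η t * c t)
          - ∫ t in Ioo 0 T, deriv η t * ∫ s in (0:ℝ)..t, g s := by
      rw [← integral_sub (i1 _ hc) (i1 _ hPc)]
      exact integral_congr_ae (Eventually.of_forall fun t => by simp only [Pi.sub_apply]; ring)
    rw [e, h η hη, hP.integral_deriv_mul hT hη, sub_self])
  refine ⟨hg', fun t ht => ?_⟩
  have := key t ht
  simp only [Pi.sub_apply, intervalIntegral.integral_same, sub_zero] at this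
  linarith

/-! ### Trajectories in a Hilbert triple -/

section Triple

universe u v

variable {E : Type u} {X : Type v} [NormedAddCommGroup E] [InnerProductSpace ℝ E]
  [NormedAddCommGroup X] [InnerProductSpace ℝ X]

/-- Orthonormal vectors are at distance `√2`, so the balls of radius `1/2` around them are disjoint
nonempty open sets, of which a separable space has only countably many. -/
lemma countable_of_orthonormal [TopologicalSpace.SeparableSpace E] {ι : Type*} {v : ι → E}
    (hv : Orthonormal ℝ v) : Countable ι := by
  refine Pairwise.countable_of_isOpen_disjoint (s := fun i => Metric.ball (v i) (1 / 2)) ?_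
    (fun i => Metric.isOpen_ball) (fun i => ⟨v i, Metric.mem_ball_self (by norm_num)⟩)
  intro i j hij
  refine Metric.ball_disjoint_ball ?_
  have h : ‖v i - v j‖ ^ 2 = 2 := by
    rw [norm_sub_sq_real, hv.1 i, hv.1 j, hv.2 hij]; norm_num
  rw [dist_eq_norm]
  nlinarith [norm_nonneg (v i - v j)]

/-- The eigenvectors of `J* J` for a compact injective operator `J`. -/
lemma exists_eigenbasis [CompleteSpace E] [CompleteSpace X]
    [TopologicalSpace.SeparableSpace E] (J : E →L[ℝ] X)
    (hJc : IsCompactOperator J) (hJ : Function.Injective J) :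
    ∃ (ι : Type u) (_ : Countable ι) (b : HilbertBasis ι ℝ E) (κ : ι → ℝ), (∀ i, 0 < κ i) ∧
      ∀ i ψ, ⟪J (b i), J ψ⟫_ℝ = κ i * ⟪b i, ψ⟫_ℝ := by
  set K : E →L[ℝ] E := J.adjoint ∘L J with hK
  have hKc : IsCompactOperator K := hJc.clm_comp J.adjoint
  have hKs : K.IsSymmetric := by
    intro x y
    simp [hK, ContinuousLinearMap.adjoint_inner_left, ContinuousLinearMap.adjoint_inner_right]
  have hortho := hKs.orthogonalFamily_eigenspaces
  have hcompl := ContinuousLinearMap.orthogonalComplement_iSup_eigenspaces_eq_bot hKc hKs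
  have hcs : ∀ μ : ℝ, CompleteSpace (Module.End.eigenspace (K : E →ₗ[ℝ] E) μ) := fun μ => by
    have : IsClosed ((Module.End.eigenspace (K : E →ₗ[ℝ] E) μ : Submodule ℝ E) : Set E) := by
      have : ((Module.End.eigenspace (K : E →ₗ[ℝ] E) μ : Submodule ℝ E) : Set E)
          = {x | K x = μ • x} := by
        ext x; simp
      rw [this]
      exact isClosed_eq K.continuous (continuous_const_smul μ)
    exact this.completeSpace_coe
  choose s bs hbs using fun μ : ℝ =>
    exists_hilbertBasis ℝ (Module.End.eigenspace (K : E →ₗ[ℝ] E) μ)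
  have hon := hortho.orthonormal_sigma_orthonormal (fun μ => (bs μ).orthonormal)
  -- Hilbert bases of all eigenspaces are put together; for the values `μ` that are not eigenvalues
  -- they are empty. By the spectral theorem for compact symmetric operators no nonzero vector is
  -- orthogonal to every eigenspace.
  have hbot : (Submodule.span ℝ (range fun a : Σ μ : ℝ, s μ =>
      (Module.End.eigenspace (K : E →ₗ[ℝ] E) a.1).subtypeₗᵢ (bs a.1 a.2)))ᗮ = ⊥ := by
    rw [eq_bot_iff, ← hcompl]
    intro x hx
    rw [Submodule.mem_orthogonal] at hx ⊢
    intro y hy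
    refine Submodule.iSup_induction _ (motive := fun y => ⟪y, x⟫_ℝ = 0) hy ?_ (by simp) ?_
    · intro μ y hy
      set P : Submodule ℝ (Module.End.eigenspace (K : E →ₗ[ℝ] E) μ) :=
        LinearMap.ker ((innerSL ℝ x : E →ₗ[ℝ] ℝ) ∘ₗ Submodule.subtype _) with hP
      have hPc : IsClosed (P : Set (Module.End.eigenspace (K : E →ₗ[ℝ] E) μ)) := by
        have : (P : Set (Module.End.eigenspace (K : E →ₗ[ℝ] E) μ)) 
            = {y : Module.End.eigenspace (K : E →ₗ[ℝ] E) μ | ⟪x, (y : E)⟫_ℝ = 0} := by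
          ext y; simp [hP]
        rw [this]
        exact isClosed_eq (by fun_prop) continuous_const
      have hle : Submodule.span ℝ (range (bs μ)) ≤ P := by
        rw [Submodule.span_le]
        rintro _ ⟨i, rfl⟩
        have := hx _ (Submodule.subset_span ⟨⟨μ, i⟩, rfl⟩)
        rw [real_inner_comm] at this
        simpa [hP] using this
      have htop : (⊤ : Submodule ℝ _) ≤ P := by
        rw [← (bs μ).dense_span]
        exact Submodule.topologicalClosure_minimal _ hle hPc
      have := htop (Submodule.mem_top (x := ⟨y, hy⟩))
      rw [real_inner_comm]
      simpa [hP] using this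
    · intro y z h1 h2
      rw [inner_add_left, h1, h2, add_zero]
  let b := HilbertBasis.mkOfOrthogonalEqBot hon hbot
  have hbc : ∀ a, b a = (bs a.1 a.2 : E) := fun a => by
    simp [b, HilbertBasis.coe_mkOfOrthogonalEqBot]
  have hrel : ∀ (i : Σ μ : ℝ, s μ) (ψ : E), ⟪J (b i), J ψ⟫_ℝ = i.1 * ⟪b i, ψ⟫_ℝ := fun i ψ => by
    have h1 : K (b i) = i.1 • b i := by
      rw [hbc]; exact Module.End.mem_eigenspace_iff.1 (bs i.1 i.2).2
    rw [← ContinuousLinearMap.adjoint_inner_left, ← ContinuousLinearMap.comp_apply, ← hK, h1,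
      real_inner_smul_left]
  refine ⟨_, countable_of_orthonormal b.orthonormal, b, Sigma.fst, fun i => ?_, hrel⟩
  -- Pairing the eigenvector with itself gives `κ i = ‖J (b i)‖²`, which is positive because `J` is
  -- injective.
  have h1 := hrel i (b i)
  rw [real_inner_self_eq_norm_sq, real_inner_self_eq_norm_sq, b.orthonormal.1 i] at h1
  have h2 : 0 < ‖J (b i)‖ := by
    rw [norm_pos_iff]
    intro h
    have : b i = 0 := hJ (by rw [h, map_zero])
    have h3 := b.orthonormal.1 i
    rw [this, norm_zero] at h3
    norm_num at h3
  have : 0 < ‖J (b i)‖ ^ 2 := by positivity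
  linarith

/-- `u ∈ L²(0,T;E)` has the weak derivative `F ∈ L²(0,T;E*)` (with `E*` identified with `E`
by the Riesz isomorphism) and the continuous representative `w ∈ C([0,T];X)`; here `E` is embedded
into `X` by `J`. -/
structure IsTraj (J : E →L[ℝ] X) (T : ℝ) (u F : ℝ → E) (w : ℝ → X) : Prop where
  memLp : MemLp u 2 (timeMeasure T)
  memLp_deriv : MemLp F 2 (timeMeasure T)
  continuousOn : ContinuousOn w (Icc 0 T)
  ae_eq : ∀ᵐ t ∂(timeMeasure T), w t = J (u t)
  primitive : ∀ ψ, IsPrimitiveOn T (fun t => ⟪w t, J ψ⟫_ℝ) (fun t => ⟪F t, ψ⟫_ℝ)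

namespace IsTraj

variable {J : E →L[ℝ] X} {T : ℝ} {u F u₁ F₁ u₂ F₂ : ℝ → E} {w w₁ w₂ : ℝ → X}

lemma const_smul (c : ℝ) (h : IsTraj J T u F w) :
    IsTraj J T (fun t => c • u t) (fun t => c • F t) (fun t => c • w t) where
  memLp := h.memLp.const_smul c
  memLp_deriv := h.memLp_deriv.const_smul c
  continuousOn := h.continuousOn.const_smul c
  ae_eq := by filter_upwards [h.ae_eq] with t ht; simp [ht]
  primitive ψ := by
    simpa [real_inner_smul_left] using (h.primitive ψ).const_mul c

lemma add (h₁ : IsTraj J T u₁ F₁ w₁) (h₂ : IsTraj J T u₂ F₂ w₂) :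
    IsTraj J T (fun t => u₁ t + u₂ t) (fun t => F₁ t + F₂ t) (fun t => w₁ t + w₂ t) where
  memLp := h₁.memLp.add h₂.memLp
  memLp_deriv := h₁.memLp_deriv.add h₂.memLp_deriv
  continuousOn := h₁.continuousOn.add h₂.continuousOn
  ae_eq := by filter_upwards [h₁.ae_eq, h₂.ae_eq] with t h1 h2; simp [h1, h2]
  primitive ψ := by
    simpa [inner_add_left] using (h₁.primitive ψ).add (h₂.primitive ψ)

lemma sub (h₁ : IsTraj J T u₁ F₁ w₁) (h₂ : IsTraj J T u₂ F₂ w₂) :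
    IsTraj J T (fun t => u₁ t - u₂ t) (fun t => F₁ t - F₂ t) (fun t => w₁ t - w₂ t) := by
  simpa [sub_eq_add_neg] using h₁.add (h₂.const_smul (-1))

lemma congr (hT : 0 ≤ T) (h : IsTraj J T u F w) {u' F' : ℝ → E} (hu : u =ᵐ[timeMeasure T] u')
    (hF : F =ᵐ[timeMeasure T] F') : IsTraj J T u' F' w where
  memLp := h.memLp.ae_eq hu
  memLp_deriv := h.memLp_deriv.ae_eq hF
  continuousOn := h.continuousOn
  ae_eq := by filter_upwards [h.ae_eq, hu] with t h1 h2; rw [h1, h2]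
  primitive ψ := by
    have key : (fun t => ⟪F t, ψ⟫_ℝ) =ᵐ[timeMeasure T] fun t => ⟪F' t, ψ⟫_ℝ := by
      filter_upwards [hF] with t ht; rw [ht]
    refine ⟨?_, fun t ht => ?_⟩
    · rw [intervalIntegrable_iff_timeMeasure hT]
      exact ((intervalIntegrable_iff_timeMeasure hT).1 (h.primitive ψ).integrable).congr key
    · rw [(h.primitive ψ).eq t ht, intervalIntegral_eq_timeMeasure ht.1,
        intervalIntegral_eq_timeMeasure ht.1]
      congr 1
      exact integral_congr_ae (ae_mono (Measure.restrict_mono (Ioo_subset_Ioo_right ht.2) le_rfl) key)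

/-- The energy identity. -/
lemma energy [CompleteSpace E] [CompleteSpace X] [TopologicalSpace.SeparableSpace E]
    (hT : 0 < T) (hJc : IsCompactOperator J)
    (hJ : Function.Injective J) (h : IsTraj J T u F w) :
    IsPrimitiveOn T (fun t => ‖w t‖ ^ 2) (fun t => 2 * ⟪F t, u t⟫_ℝ) := by
  obtain ⟨ι, hι, b, κ, hκ, hb⟩ := exists_eigenbasis J hJc hJ
  have hFu : Integrable (fun t => 2 * ⟪F t, u t⟫_ℝ) (timeMeasure T) :=
    (integrable_inner_of_memLp h.memLp_deriv h.memLp).const_mul 2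
  have hFu' := (intervalIntegrable_iff_timeMeasure hT.le).2 hFu
  have hP := isPrimitiveOn_integral hFu'
  -- Parseval's identity for the pair `J* J v` and `v`: since `⟪J (b i), J v⟫ = κ i ⟪b i, v⟫`, the
  -- norm in `X` is diagonal in the basis of `E`, with weights `(κ i)⁻¹`.
  have hsum : ∀ v : E, HasSum (fun i => (κ i)⁻¹ * (⟪J v, J (b i)⟫_ℝ * ⟪J v, J (b i)⟫_ℝ))
      (‖J v‖ ^ 2) := fun v => by
    have h1 := b.hasSum_inner_mul_inner (J.adjoint (J v)) v
    rw [ContinuousLinearMap.adjoint_inner_left, real_inner_self_eq_norm_sq] at h1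
    refine Eq.mp (congrArg (fun q => HasSum q _) (funext fun i => ?_)) h1
    rw [ContinuousLinearMap.adjoint_inner_left, real_inner_comm (J (b i)) (J v), hb]
    have := (hκ i).ne'
    field_simp
  -- Each coefficient `⟪w, J (b i)⟫` is absolutely continuous, so the product rule gives the
  -- identity mode by mode. Summing over `i` needs `w = J u` only at the two endpoints.
  have key : ∀ s ∈ Ioo 0 T, w s = J (u s) → ∀ t ∈ Ioo 0 T, w t = J (u t) →
      ‖w t‖ ^ 2 - ‖w s‖ ^ 2 = ∫ r in s..t, 2 * ⟪F r, u r⟫_ℝ := by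
    intro s hs hws t ht hwt
    have hsub : uIcc s t ⊆ uIcc 0 T := by
      rw [uIcc_of_le hT.le]; exact uIcc_subset_Icc ⟨hs.1.le, hs.2.le⟩ ⟨ht.1.le, ht.2.le⟩
    have hsub' : uIoc s t ⊆ Ioo 0 T := by
      intro r hr
      exact ⟨(lt_min hs.1 ht.1).trans hr.1, hr.2.trans_lt (max_lt hs.2 ht.2)⟩
    have e1 := (hsum (u t)).sub (hsum (u s))
    rw [← hwt, ← hws] at e1
    have e2 : ∀ i, (κ i)⁻¹ * (⟪w t, J (b i)⟫_ℝ * ⟪w t, J (b i)⟫_ℝ)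
        - (κ i)⁻¹ * (⟪w s, J (b i)⟫_ℝ * ⟪w s, J (b i)⟫_ℝ)
        = ∫ r in s..t, 2 * (⟪F r, b i⟫_ℝ * ⟪b i, u r⟫_ℝ) := by
      intro i
      have hp := ((h.primitive (b i)).mul hT.le (h.primitive (b i))).const_mul (κ i)⁻¹
      rw [hp.eq t ⟨ht.1.le, ht.2.le⟩, hp.eq s ⟨hs.1.le, hs.2.le⟩]
      rw [add_sub_add_left_eq_sub, intervalIntegral.integral_interval_sub_left
        (hp.integrable.mono_set (by
          rw [uIcc_of_le hT.le, uIcc_of_le ht.1.le]; exact Icc_subset_Icc_right ht.2.le))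
        (hp.integrable.mono_set (by
          rw [uIcc_of_le hT.le, uIcc_of_le hs.1.le]; exact Icc_subset_Icc_right hs.2.le))]
      refine intervalIntegral.integral_congr_ae ?_
      have h3 := (ae_restrict_iff' measurableSet_Ioo).1 h.ae_eq
      filter_upwards [h3] with r hr hrI
      rw [hr (hsub' hrI), real_inner_comm (J (b i)) (J (u r)), hb]
      have := (hκ i).ne'
      field_simp
      ring
    simp_rw [e2] at e1
    have e3 : HasSum (fun i => ∫ r in s..t, 2 * (⟪F r, b i⟫_ℝ * ⟪b i, u r⟫_ℝ))
        (∫ r in s..t, 2 * ⟪F r, u r⟫_ℝ) := by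
      have hsq : ∀ v : E, HasSum (fun i => ⟪v, b i⟫_ℝ * ⟪b i, v⟫_ℝ) (‖v‖ ^ 2) := fun v => by
        have := b.hasSum_inner_mul_inner v v
        rwa [real_inner_self_eq_norm_sq] at this
      have hmF : AEStronglyMeasurable F (volume.restrict (uIoc s t)) :=
        h.memLp_deriv.1.mono_measure (Measure.restrict_mono hsub' le_rfl)
      have hmu : AEStronglyMeasurable u (volume.restrict (uIoc s t)) :=
        h.memLp.1.mono_measure (Measure.restrict_mono hsub' le_rfl)
      -- The majorant comes from `2|ab| ≤ a² + b²`; its sum over the modes is `‖F‖² + ‖u‖²`, which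
      -- is integrable.
      refine intervalIntegral.hasSum_integral_of_dominated_convergence
        (fun i r => ⟪F r, b i⟫_ℝ * ⟪b i, F r⟫_ℝ + ⟪u r, b i⟫_ℝ * ⟪b i, u r⟫_ℝ)
        (fun i => ?_) (fun i => ?_) ?_ ?_ ?_
      · exact ((hmF.inner aestronglyMeasurable_const).mul
          (aestronglyMeasurable_const.inner hmu)).const_mul 2
      · refine Eventually.of_forall fun r _ => ?_
        rw [Real.norm_eq_abs, real_inner_comm (F r) (b i), real_inner_comm (u r) (b i), abs_le]
        constructor
        · nlinarith [sq_nonneg (⟪F r, b i⟫_ℝ + ⟪u r, b i⟫_ℝ)]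
        · nlinarith [sq_nonneg (⟪F r, b i⟫_ℝ - ⟪u r, b i⟫_ℝ)]
      · exact Eventually.of_forall fun r _ => ((hsq _).add (hsq _)).summable
      · have : (fun r => ∑' i, (⟪F r, b i⟫_ℝ * ⟪b i, F r⟫_ℝ + ⟪u r, b i⟫_ℝ * ⟪b i, u r⟫_ℝ))
            = fun r => ‖F r‖ ^ 2 + ‖u r‖ ^ 2 := funext fun r => ((hsq _).add (hsq _)).tsum_eq
        rw [this]
        refine IntervalIntegrable.mono_set ?_ hsub
        rw [intervalIntegrable_iff_timeMeasure hT.le]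
        exact (integrable_norm_sq_of_memLp h.memLp_deriv).add (integrable_norm_sq_of_memLp h.memLp)
      · exact Eventually.of_forall fun r _ => (b.hasSum_inner_mul_inner (F r) (u r)).mul_left 2
    exact e1.unique e3
  have hInt : ∀ s ∈ Icc 0 T, IntervalIntegrable (fun t => 2 * ⟪F t, u t⟫_ℝ) volume 0 s :=
    fun s hs => hFu'.mono_set (by
      rw [uIcc_of_le hT.le, uIcc_of_le hs.1]; exact Icc_subset_Icc_right hs.2)
  have hmem : ∀ᵐ t ∂(timeMeasure T), t ∈ Ioo 0 T := ae_restrict_mem measurableSet_Ioo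
  have : (ae (timeMeasure T)).NeBot := by
    rw [ae_neBot, Ne, Measure.restrict_eq_zero, Real.volume_Ioo]
    simpa using hT
  obtain ⟨s, hs, hws⟩ := (hmem.and h.ae_eq).exists
  -- Almost every time is a good endpoint. Both sides are continuous on `[0, T]`, so the identity
  -- extends to every time, in particular to `t = 0`.
  have hconst : EqOn (fun t => ‖w t‖ ^ 2 - ∫ r in (0:ℝ)..t, 2 * ⟪F r, u r⟫_ℝ)
      (fun _ => ‖w s‖ ^ 2 - ∫ r in (0:ℝ)..s, 2 * ⟪F r, u r⟫_ℝ) (Icc 0 T) := by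
    refine Measure.eqOn_Icc_of_ae_eq (μ := volume) hT.ne ?_
      ((h.continuousOn.norm.pow 2).sub (hP.continuousOn hT.le)) continuousOn_const
    rw [← restrict_Ioo_eq_restrict_Icc]
    filter_upwards [hmem, h.ae_eq] with t ht hwt
    have e := key s hs hws t ht hwt
    rw [← intervalIntegral.integral_interval_sub_left (hInt t ⟨ht.1.le, ht.2.le⟩)
      (hInt s ⟨hs.1.le, hs.2.le⟩)] at e
    linarith
  refine ⟨hFu', fun t ht => ?_⟩
  have e1 := hconst ht
  have e2 := hconst (⟨le_rfl, hT.le⟩ : (0:ℝ) ∈ Icc 0 T)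
  simp only [intervalIntegral.integral_same, sub_zero] at e1 e2
  linarith

end IsTraj

end Triple

/-! ### The linear evolution problem -/

section LinearProblem

universe u v

variable {E : Type u} {X : Type v} [NormedAddCommGroup E] [InnerProductSpace ℝ E] [CompleteSpace E]
  [TopologicalSpace.SeparableSpace E] [NormedAddCommGroup X] [InnerProductSpace ℝ X]
  [CompleteSpace X] {J : E →L[ℝ] X} {T μ : ℝ}

lemma intervalIntegrable_sub {F : Type*} [NormedAddCommGroup F] {g : ℝ → F}
    (h : IntervalIntegrable g volume 0 T) {t : ℝ} (ht : t ∈ Icc 0 T) :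
    IntervalIntegrable g volume 0 t :=
  h.mono_set (by
    rw [uIcc_of_le ht.1, uIcc_of_le (ht.1.trans ht.2)]; exact Icc_subset_Icc_right ht.2)

lemma intervalIntegral_mono_of_ae {g h : ℝ → ℝ} (hg : IntervalIntegrable g volume 0 T)
    (hh : IntervalIntegrable h volume 0 T) (hgh : ∀ᵐ s ∂(timeMeasure T), g s ≤ h s) {t : ℝ}
    (ht : t ∈ Icc 0 T) : ∫ s in 0..t, g s ≤ ∫ s in 0..t, h s := by
  have h1 := (intervalIntegrable_iff_timeMeasure ht.1).1 (intervalIntegrable_sub hg ht)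
  have h2 := (intervalIntegrable_iff_timeMeasure ht.1).1 (intervalIntegrable_sub hh ht)
  rw [intervalIntegral_eq_timeMeasure ht.1, intervalIntegral_eq_timeMeasure ht.1]
  exact integral_mono_ae h1 h2
    (ae_mono (Measure.restrict_mono (Ioo_subset_Ioo_right ht.2) le_rfl) hgh)

/-- The weighted energy estimate for the linear problem `u' + μ u = G`. -/
lemma IsTraj.weighted_bound (hT : 0 < T) (hJc : IsCompactOperator J) (hJ : Function.Injective J)
    (hμ : 0 < μ) {u G : ℝ → E} {w : ℝ → X} (hG : MemLp G 2 (timeMeasure T))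
    (h : IsTraj J T u (fun t => G t - μ • u t) w) {p p' : ℝ → ℝ} (hp : IsPrimitiveOn T p p')
    (hp0 : ∀ t ∈ Icc 0 T, 0 ≤ p t) {t : ℝ} (ht : t ∈ Icc 0 T) :
    p t * ‖w t‖ ^ 2 + (∫ s in 0..t, -p' s * ‖w s‖ ^ 2) + μ * (∫ s in 0..t, p s * ‖u s‖ ^ 2)
      ≤ p 0 * ‖w 0‖ ^ 2 + μ⁻¹ * ∫ s in 0..t, p s * ‖G s‖ ^ 2 := by
  have hpc : ContinuousOn p (uIcc 0 T) := by rw [uIcc_of_le hT.le]; exact hp.continuousOn hT.le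
  have hP := hp.mul hT.le (h.energy hT hJc hJ)
  have i1 : IntervalIntegrable (fun s => p' s * ‖w s‖ ^ 2) volume 0 T :=
    hp.integrable.mul_continuousOn (by rw [uIcc_of_le hT.le]; exact h.continuousOn.norm.pow 2)
  have i2 : IntervalIntegrable (fun s => p s * ‖u s‖ ^ 2) volume 0 T :=
    ((intervalIntegrable_iff_timeMeasure hT.le).2
      (integrable_norm_sq_of_memLp h.memLp)).continuousOn_mul hpc
  have i3 : IntervalIntegrable (fun s => p s * ‖G s‖ ^ 2) volume 0 T :=
    ((intervalIntegrable_iff_timeMeasure hT.le).2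
      (integrable_norm_sq_of_memLp hG)).continuousOn_mul hpc
  have e := hP.eq t ht
  have hle := intervalIntegral_mono_of_ae hP.integrable
    ((i1.add (i3.const_mul μ⁻¹)).sub (i2.const_mul μ)) (by
      filter_upwards [ae_restrict_mem measurableSet_Ioo] with s hs
      -- Young's inequality, spending half of the dissipation `2μ‖u‖²` on the forcing.
      have h1 : 2 * ⟪G s - μ • u s, u s⟫_ℝ ≤ μ⁻¹ * ‖G s‖ ^ 2 - μ * ‖u s‖ ^ 2 := by
        rw [inner_sub_left, real_inner_smul_left, real_inner_self_eq_norm_sq]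
        have h2 := real_inner_le_norm (G s) (u s)
        have h3 : 2 * (‖G s‖ * ‖u s‖) ≤ μ⁻¹ * ‖G s‖ ^ 2 + μ * ‖u s‖ ^ 2 := by
          have := sq_nonneg (‖G s‖ - μ * ‖u s‖)
          have h4 : μ⁻¹ * (‖G s‖ - μ * ‖u s‖) ^ 2
              = μ⁻¹ * ‖G s‖ ^ 2 - 2 * (‖G s‖ * ‖u s‖) + μ * ‖u s‖ ^ 2 := by
            field_simp
            ring
          have h5 : 0 ≤ μ⁻¹ * (‖G s‖ - μ * ‖u s‖) ^ 2 := by positivity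
          linarith
        linarith
      have h2 := mul_le_mul_of_nonneg_left h1 (hp0 s ⟨hs.1.le, hs.2.le⟩)
      linarith) ht
  rw [intervalIntegral.integral_sub ((intervalIntegrable_sub i1 ht).add
    ((intervalIntegrable_sub i3 ht).const_mul μ⁻¹)) ((intervalIntegrable_sub i2 ht).const_mul μ),
    intervalIntegral.integral_add (intervalIntegrable_sub i1 ht)
    ((intervalIntegrable_sub i3 ht).const_mul μ⁻¹), intervalIntegral.integral_const_mul,
    intervalIntegral.integral_const_mul] at hle
  have e2 : ∫ s in (0:ℝ)..t, -p' s * ‖w s‖ ^ 2 = - ∫ s in (0:ℝ)..t, p' s * ‖w s‖ ^ 2 := by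
    rw [← intervalIntegral.integral_neg]; simp
  rw [e2]
  linarith

lemma intervalIntegral_nonneg_of_ae {g : ℝ → ℝ} (hg : ∀ᵐ s ∂(timeMeasure T), 0 ≤ g s) {t : ℝ}
    (ht : t ∈ Icc 0 T) : 0 ≤ ∫ s in 0..t, g s := by
  rw [intervalIntegral_eq_timeMeasure ht.1]
  exact integral_nonneg_of_ae (ae_mono (Measure.restrict_mono (Ioo_subset_Ioo_right ht.2) le_rfl) hg)

/-- The case of the constant weight `1`. Applied to differences of solutions, it makes the solution
depend continuously on the data, uniformly in time in `X` and in `L²(0,T;E)`. -/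
lemma IsTraj.linear_bound (hT : 0 < T) (hJc : IsCompactOperator J) (hJ : Function.Injective J)
    (hμ : 0 < μ) {u G : ℝ → E} {w : ℝ → X} (hG : MemLp G 2 (timeMeasure T))
    (h : IsTraj J T u (fun t => G t - μ • u t) w) :
    (∀ t ∈ Icc 0 T, ‖w t‖ ^ 2 ≤ ‖w 0‖ ^ 2 + μ⁻¹ * ∫ s, ‖G s‖ ^ 2 ∂(timeMeasure T)) ∧
      μ * ∫ s, ‖u s‖ ^ 2 ∂(timeMeasure T)
        ≤ ‖w 0‖ ^ 2 + μ⁻¹ * ∫ s, ‖G s‖ ^ 2 ∂(timeMeasure T) := by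
  have hone : IsPrimitiveOn T (fun _ => (1:ℝ)) (fun _ => 0) := ⟨by simp, by simp⟩
  have key := fun t ht => h.weighted_bound hT hJc hJ hμ hG hone (fun _ _ => zero_le_one) (t := t) ht
  simp only [one_mul, neg_zero, zero_mul, intervalIntegral.integral_zero, add_zero] at key
  have hnn : ∀ f : ℝ → E, ∀ t ∈ Icc 0 T, 0 ≤ ∫ s in (0:ℝ)..t, ‖f s‖ ^ 2 := fun f t ht =>
    intervalIntegral_nonneg_of_ae (T := T) (Eventually.of_forall fun s => by positivity) ht
  constructor
  · intro t ht
    have h1 := key t ht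
    have h2 := mul_nonneg hμ.le (hnn u t ht)
    have h3 : ∫ s in (0:ℝ)..t, ‖G s‖ ^ 2 ≤ ∫ s, ‖G s‖ ^ 2 ∂(timeMeasure T) := by
      rw [intervalIntegral_eq_timeMeasure ht.1]
      exact setIntegral_mono_set (integrable_norm_sq_of_memLp hG)
        (Eventually.of_forall fun s => by positivity)
        (Ioo_subset_Ioo_right ht.2).eventuallyLE
    have h4 := mul_le_mul_of_nonneg_left h3 (inv_nonneg.2 hμ.le)
    linarith
  · have h1 := key T ⟨hT.le, le_rfl⟩
    rw [intervalIntegral_eq_timeMeasure hT.le, intervalIntegral_eq_timeMeasure hT.le] at h1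
    have h2 := sq_nonneg ‖w T‖
    linarith

/-- The data `(x, G)` for which the linear problem `u' + μ u = G`, `u(0) = x` is solvable. -/
def linearData (J : E →L[ℝ] X) (T μ : ℝ) (hT : 0 ≤ T) :
    Submodule ℝ (X × Lp E 2 (timeMeasure T)) where
  carrier := {p | ∃ u w, IsTraj J T u (fun t => p.2 t - μ • u t) w ∧ w 0 = p.1}
  zero_mem' := by
    refine ⟨fun _ => 0, fun _ => 0, ⟨MemLp.zero, ?_, continuousOn_const, by simp, fun ψ => ?_⟩, rfl⟩
    · simpa using Lp.memLp (0 : Lp E 2 (timeMeasure T))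
    · have : (fun t => ⟪((0 : X × Lp E 2 (timeMeasure T)).2 : ℝ → E) t - μ • (0 : E), ψ⟫_ℝ)
          =ᵐ[timeMeasure T] fun _ => 0 := by
        filter_upwards [Lp.coeFn_zero E 2 (timeMeasure T)] with t ht
        rw [Prod.snd_zero, ht]
        simp
      refine ⟨?_, fun t ht => ?_⟩
      · rw [intervalIntegrable_iff_timeMeasure hT]
        exact (integrable_zero _ _ _).congr this.symm
      · rw [intervalIntegral_eq_timeMeasure ht.1, integral_eq_zero_of_ae]
        · simp
        · exact ae_mono (Measure.restrict_mono (Ioo_subset_Ioo_right ht.2) le_rfl) this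
  add_mem' := by
    rintro p q ⟨u, w, h, h0⟩ ⟨u', w', h', h0'⟩
    refine ⟨_, _, (h.add h').congr hT EventuallyEq.rfl ?_, by simp [h0, h0']⟩
    filter_upwards [Lp.coeFn_add p.2 q.2] with t ht
    rw [Prod.snd_add, ht, Pi.add_apply, smul_add]
    abel
  smul_mem' := by
    rintro c p ⟨u, w, h, h0⟩
    refine ⟨_, _, (h.const_smul c).congr hT EventuallyEq.rfl ?_, by simp [h0]⟩
    filter_upwards [Lp.coeFn_smul c p.2] with t ht
    rw [Prod.smul_snd, ht, Pi.smul_apply, smul_sub, smul_comm]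

lemma mem_linearData {hT : 0 ≤ T} {p : X × Lp E 2 (timeMeasure T)} :
    p ∈ linearData J T μ hT ↔ ∃ u w, IsTraj J T u (fun t => p.2 t - μ • u t) w ∧ w 0 = p.1 :=
  Iff.rfl

/-- By linearity `IsTraj.linear_bound` controls differences. Convergent data therefore make `u n` a
Cauchy sequence in `L²(0,T;E)` and `w n` uniformly Cauchy in `X`, and the limits solve the limit
problem. Closedness reduces solvability to data that span a dense subspace. -/
lemma isClosed_linearData (hT : 0 < T) (hJc : IsCompactOperator J) (hJ : Function.Injective J)
    (hμ : 0 < μ) :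
    IsClosed (linearData J T μ hT.le : Set (X × Lp E 2 (timeMeasure T))) := by
  refine IsSeqClosed.isClosed fun p q hp hpq => ?_
  choose u w h h0 using fun n => mem_linearData.1 (hp n)
  have hfst : Tendsto (fun n => (p n).1) atTop (𝓝 q.1) := (continuous_fst.tendsto q).comp hpq
  have hsnd : Tendsto (fun n => (p n).2) atTop (𝓝 q.2) := (continuous_snd.tendsto q).comp hpq
  have hdiff : ∀ m n, IsTraj J T (fun t => u m t - u n t)
      (fun t => ((p m).2 - (p n).2 : Lp E 2 (timeMeasure T)) t - μ • (u m t - u n t))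
      (fun t => w m t - w n t) := fun m n => by
    refine ((h m).sub (h n)).congr hT.le EventuallyEq.rfl ?_
    filter_upwards [Lp.coeFn_sub (p m).2 (p n).2] with t ht
    rw [ht, Pi.sub_apply, smul_sub]
    abel
  have hb := fun m n => (hdiff m n).linear_bound hT hJc hJ hμ (Lp.memLp _)
  simp only [h0, ← Lp_norm_sq_eq_integral] at hb
  set U : ℕ → Lp E 2 (timeMeasure T) := fun n => (h n).memLp.toLp (u n) with hU
  have hUn : ∀ m n, ‖U m - U n‖ ^ 2 = ∫ s, ‖u m s - u n s‖ ^ 2 ∂(timeMeasure T) := fun m n => by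
    rw [Lp_norm_sq_eq_integral]
    refine integral_congr_ae ?_
    filter_upwards [Lp.coeFn_sub (U m) (U n), (h m).memLp.coeFn_toLp, (h n).memLp.coeFn_toLp]
      with t h1 h2 h3
    rw [h1, Pi.sub_apply, hU]
    simp only [h2, h3]
  set c : ℕ → ℕ → ℝ := fun m n => ‖(p m).1 - (p n).1‖ ^ 2 + μ⁻¹ * ‖(p m).2 - (p n).2‖ ^ 2 with hc
  have hcsmall : ∀ ε > 0, ∃ N, ∀ m ≥ N, ∀ n ≥ N, c m n < ε := by
    intro ε hε
    have h1 := (Metric.cauchySeq_iff.1 hfst.cauchySeq)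
    have h2 := (Metric.cauchySeq_iff.1 hsnd.cauchySeq)
    obtain ⟨N1, hN1⟩ := h1 (Real.sqrt (ε / 2)) (by positivity)
    obtain ⟨N2, hN2⟩ := h2 (Real.sqrt (μ * ε / 2)) (by positivity)
    refine ⟨max N1 N2, fun m hm n hn => ?_⟩
    have h3 := hN1 m (le_of_max_le_left hm) n (le_of_max_le_left hn)
    have h4 := hN2 m (le_of_max_le_right hm) n (le_of_max_le_right hn)
    rw [dist_eq_norm, Real.lt_sqrt (norm_nonneg _)] at h3 h4
    have h5 : μ⁻¹ * ‖(p m).2 - (p n).2‖ ^ 2 < μ⁻¹ * (μ * ε / 2) := by gcongr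
    have h6 : μ⁻¹ * (μ * ε / 2) = ε / 2 := by field_simp
    simp only [hc]
    linarith
  have hUC : CauchySeq U := by
    rw [Metric.cauchySeq_iff]
    intro ε hε
    obtain ⟨N, hN⟩ := hcsmall (μ * ε ^ 2) (by positivity)
    refine ⟨N, fun m hm n hn => ?_⟩
    have h1 := (hb m n).2.trans_lt (hN m hm n hn)
    rw [← hUn] at h1
    rw [dist_eq_norm]
    exact lt_of_pow_lt_pow_left₀ 2 hε.le (lt_of_mul_lt_mul_left h1 hμ.le)
  obtain ⟨Ulim, hUlim⟩ := cauchySeq_tendsto_of_complete hUC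
  have hwC : UniformCauchySeqOn w atTop (Icc 0 T) := by
    rw [Metric.uniformCauchySeqOn_iff]
    intro ε hε
    obtain ⟨N, hN⟩ := hcsmall (ε ^ 2) (by positivity)
    refine ⟨N, fun m hm n hn t ht => ?_⟩
    have h1 := ((hb m n).1 t ht).trans_lt (hN m hm n hn)
    rw [dist_eq_norm]
    exact lt_of_pow_lt_pow_left₀ 2 hε.le h1
  have hwlim : ∀ t ∈ Icc 0 T, ∃ x, Tendsto (fun n => w n t) atTop (𝓝 x) := fun t ht =>
    cauchySeq_tendsto_of_complete (hwC.cauchySeq ht)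
  choose! wl hwl using hwlim
  have hunif := hwC.tendstoUniformlyOn_of_tendsto hwl
  have hF : MemLp (fun t => q.2 t - μ • Ulim t) 2 (timeMeasure T) :=
    (Lp.memLp _).sub ((Lp.memLp _).const_smul μ)
  refine ⟨Ulim, wl, ⟨Lp.memLp _, hF, ?_, ?_, fun ψ => ?_⟩, ?_⟩
  · exact hunif.continuousOn (Frequently.of_forall fun n => (h n).continuousOn)
  -- Along a subsequence `u n` converges almost everywhere in time, which identifies the uniform
  -- limit of `w n` with `J` of the `L²` limit.
  · obtain ⟨ns, hns, hae⟩ := (tendstoInMeasure_of_tendsto_Lp hUlim).exists_seq_tendsto_ae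
    have hall : ∀ᵐ t ∂(timeMeasure T), ∀ n, U n t = u n t :=
      ae_all_iff.2 fun n => (h n).memLp.coeFn_toLp
    have hall2 : ∀ᵐ t ∂(timeMeasure T), ∀ n, w n t = J (u n t) :=
      ae_all_iff.2 fun n => (h n).ae_eq
    filter_upwards [hae, hall, hall2, ae_restrict_mem measurableSet_Ioo] with t h1 h2 h3 h4
    have h5 : Tendsto (fun n => w (ns n) t) atTop (𝓝 (J (Ulim t))) := by
      simp_rw [h3, ← h2]
      exact (J.continuous.tendsto _).comp h1
    exact tendsto_nhds_unique ((hwl t ⟨h4.1.le, h4.2.le⟩).comp hns.tendsto_atTop) h5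
  · have hFi : Integrable (fun t => ⟪q.2 t - μ • Ulim t, ψ⟫_ℝ) (timeMeasure T) :=
      (hF.integrable (by norm_num)).inner_const ψ
    refine ⟨(intervalIntegrable_iff_timeMeasure hT.le).2 hFi, fun t ht => ?_⟩
    have hsub : Ioo 0 t ⊆ Ioo 0 T := Ioo_subset_Ioo_right ht.2
    have hset : ∀ g : ℝ → ℝ, ∫ s in (0:ℝ)..t, g s = ∫ s in Ioo 0 t, g s ∂(timeMeasure T) :=
      fun g => by
        rw [intervalIntegral_eq_timeMeasure ht.1, timeMeasure, timeMeasure,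
          Measure.restrict_restrict measurableSet_Ioo, inter_eq_left.2 hsub]
    -- The integral up to `t` is an inner product in `L²(0,T;E)` with an indicator function, so it
    -- passes to the limit by continuity.
    have hrep : ∀ (A B : Lp E 2 (timeMeasure T)), ∫ s in (0:ℝ)..t, ⟪A s - μ • B s, ψ⟫_ℝ
        = ⟪indicatorConstLp 2 (measurableSet_Ioo (a := 0) (b := t)) (measure_ne_top _ _) ψ, A - μ • B⟫_ℝ := by
      intro A B
      rw [L2.inner_indicatorConstLp_eq_setIntegral_inner, hset]
      refine integral_congr_ae (ae_restrict_of_ae ?_)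
      filter_upwards [Lp.coeFn_sub A (μ • B), Lp.coeFn_smul μ B] with s h1 h2
      rw [h1, Pi.sub_apply, h2, Pi.smul_apply, real_inner_comm]
    have hn : ∀ n, ⟪w n t, J ψ⟫_ℝ = ⟪w n 0, J ψ⟫_ℝ + ∫ s in (0:ℝ)..t, ⟪(p n).2 s - μ • U n s, ψ⟫_ℝ :=
      fun n => by
        rw [((h n).primitive ψ).eq t ht]
        congr 1
        rw [hset, hset]
        refine integral_congr_ae (ae_restrict_of_ae ?_)
        filter_upwards [(h n).memLp.coeFn_toLp] with s hs
        simp only [hU, hs]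
    simp only [hrep] at hn ⊢
    have l1 : Tendsto (fun n => ⟪w n t, J ψ⟫_ℝ) atTop (𝓝 ⟪wl t, J ψ⟫_ℝ) :=
      (hwl t ht).inner tendsto_const_nhds
    have l2 : Tendsto (fun n => ⟪w n t, J ψ⟫_ℝ) atTop (𝓝 (⟪wl 0, J ψ⟫_ℝ
        + ⟪indicatorConstLp 2 (measurableSet_Ioo (a := 0) (b := t)) (measure_ne_top _ _) ψ, q.2 - μ • Ulim⟫_ℝ)) := by
      simp_rw [hn]
      exact ((hwl 0 ⟨le_rfl, hT.le⟩).inner tendsto_const_nhds).add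
        (tendsto_const_nhds.inner (hsnd.sub (hUlim.const_smul μ)))
    exact tendsto_nhds_unique l1 l2
  · refine tendsto_nhds_unique (hwl 0 ⟨le_rfl, hT.le⟩) ?_
    simp_rw [h0]
    exact hfst

/-- Solution of the linear problem in the direction of an eigenvector. -/
lemma exists_traj_eigenvector (hT : 0 < T) {e : E} {κ : ℝ} (hκ : 0 < κ)
    (he : ∀ ψ, ⟪J e, J ψ⟫_ℝ = κ * ⟪e, ψ⟫_ℝ) (μ x : ℝ) {f : ℝ → ℝ} (hf : MemLp f 2 (timeMeasure T)) :
    ∃ u w, IsTraj J T u (fun t => f t • e - μ • u t) w ∧ w 0 = x • J e := by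
  have hid : IsPrimitiveOn T (fun t => t) (fun _ => 1) := ⟨by simp, by simp⟩
  have hfi : IntervalIntegrable f volume 0 T :=
    (intervalIntegrable_iff_timeMeasure hT.le).2 (hf.integrable (by norm_num))
  -- In the direction of `e` the problem is the scalar equation `κ y' + μ y = f`, solved by
  -- variation of constants with rate `a = μ/κ`.
  set a := μ / κ with ha
  have hg : IntervalIntegrable (fun s => κ⁻¹ * (Real.exp (a * s) * f s)) volume 0 T :=
    (hfi.continuousOn_mul (by fun_prop)).const_mul _
  have hc : IsPrimitiveOn T (fun _ => x) (fun _ => 0) := ⟨by simp, by simp⟩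
  have hy := (hid.exp_const_mul hT.le (-a)).mul hT.le (hc.add (isPrimitiveOn_integral hg))
  set y : ℝ → ℝ := fun t => Real.exp (-a * t)
    * (x + ∫ s in (0:ℝ)..t, κ⁻¹ * (Real.exp (a * s) * f s)) with hydef
  have hyc : ContinuousOn y (Icc 0 T) := hy.continuousOn hT.le
  have hder : ∀ t, (-a * 1 * Real.exp (-a * t)) * (x + ∫ s in (0:ℝ)..t, κ⁻¹ * (Real.exp (a * s) * f s))
      + Real.exp (-a * t) * (0 + κ⁻¹ * (Real.exp (a * t) * f t)) = κ⁻¹ * (f t - μ * y t) := fun t => by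
    have h1 : Real.exp (-a * t) * Real.exp (a * t) = 1 := by
      rw [← Real.exp_add]; simp
    have h2 : Real.exp (-a * t) * (0 + κ⁻¹ * (Real.exp (a * t) * f t))
        = κ⁻¹ * f t * (Real.exp (-a * t) * Real.exp (a * t)) := by ring
    rw [h2, h1, hydef, ha]
    field_simp
    ring
  simp only [hder] at hy
  have hyM : MemLp y 2 (timeMeasure T) := by
    obtain ⟨C, hC⟩ := isCompact_Icc.exists_bound_of_continuousOn hyc
    refine MemLp.of_bound ((hyc.mono Ioo_subset_Icc_self).aestronglyMeasurable measurableSet_Ioo) C ?_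
    filter_upwards [ae_restrict_mem measurableSet_Ioo] with t ht using hC t ⟨ht.1.le, ht.2.le⟩
  have hsm : ∀ g : ℝ → ℝ, MemLp g 2 (timeMeasure T) →
      MemLp (fun t => g t • e) 2 (timeMeasure T) := fun g hg =>
    ((ContinuousLinearMap.toSpanSingleton ℝ e).comp_memLp' hg)
  refine ⟨fun t => y t • e, fun t => y t • J e, ⟨hsm y hyM, (hsm f hf).sub ((hsm y hyM).const_smul μ),
    hyc.smul continuousOn_const, Eventually.of_forall fun t => by simp, fun ψ => ?_⟩, ?_⟩
  · have := hy.const_mul (κ * ⟪e, ψ⟫_ℝ)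
    convert this using 2 with t t
    · rw [real_inner_smul_left, he]; ring
    · rw [inner_sub_left, real_inner_smul_left, real_inner_smul_left, real_inner_smul_left]
      field_simp
  · simp [hydef]

/-- The linear problem `u' + μ u = G`, `u(0) = x`. -/
theorem exists_linear_traj (hT : 0 < T) (hJc : IsCompactOperator J) (hJ : Function.Injective J)
    (hμ : 0 < μ) {x : X} (hx : x ∈ closure (range J)) {G : ℝ → E}
    (hG : MemLp G 2 (timeMeasure T)) :
    ∃ u w, IsTraj J T u (fun t => G t - μ • u t) w ∧ w 0 = x := by
  obtain ⟨ι, hι, b, κ, hκ, hb⟩ := exists_eigenbasis J hJc hJ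
  set D := linearData J T μ hT.le with hD
  have hDc : IsClosed (D : Set (X × Lp E 2 (timeMeasure T))) := isClosed_linearData hT hJc hJ hμ
  -- Data along a single eigenvector are solvable. Since `D` is a closed subspace, it remains to see
  -- that these data exhaust all initial values in the closure of `range J` and all forcings.
  have hbx : ∀ i (c : ℝ) (f : ℝ → ℝ) (hf : MemLp f 2 (timeMeasure T)) (g : Lp E 2 (timeMeasure T)),
      (g =ᵐ[timeMeasure T] fun t => f t • b i) → (c • J (b i), g) ∈ D := by
    intro i c f hf g hg
    obtain ⟨u, w, h, h0⟩ := exists_traj_eigenvector hT (hκ i) (hb i) μ c hf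
    refine ⟨u, w, h.congr hT.le EventuallyEq.rfl ?_, h0⟩
    filter_upwards [hg] with t ht
    rw [ht]
  have hinit : ∀ y ∈ closure (range J), (y, (0 : Lp E 2 (timeMeasure T))) ∈ D := by
    intro y hy
    have h1 : ∀ ψ : E, (J ψ, (0 : Lp E 2 (timeMeasure T))) ∈ D := by
      let L : E →L[ℝ] X × Lp E 2 (timeMeasure T) := J.prod 0
      have hle : Submodule.span ℝ (range b) ≤ D.comap (L : E →ₗ[ℝ] _) := by
        rw [Submodule.span_le]
        rintro _ ⟨i, rfl⟩
        have := hbx i 1 (fun _ => 0) MemLp.zero 0 (by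
          filter_upwards [Lp.coeFn_zero E 2 (timeMeasure T)] with t ht
          rw [ht]
          simp)
        simpa [L] using this
      have hcl : IsClosed ((D.comap (L : E →ₗ[ℝ] _) : Submodule ℝ E) : Set E) :=
        hDc.preimage L.continuous
      have := Submodule.topologicalClosure_minimal _ hle hcl
      rw [b.dense_span] at this
      exact fun ψ => this (Submodule.mem_top (x := ψ))
    have h2 : IsClosed {y : X | (y, (0 : Lp E 2 (timeMeasure T))) ∈ D} :=
      hDc.preimage (by fun_prop)
    exact closure_minimal (by rintro _ ⟨ψ, rfl⟩; exact h1 ψ) h2 hy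
  have hforce : ∀ g : Lp E 2 (timeMeasure T), ((0 : X), g) ∈ D := by
    let L : Lp E 2 (timeMeasure T) →ₗ[ℝ] X × Lp E 2 (timeMeasure T) := LinearMap.inr ℝ X _
    set S := D.comap L with hS
    have hSc : IsClosed (S : Set (Lp E 2 (timeMeasure T))) := hDc.preimage (by
      change Continuous fun g : Lp E 2 (timeMeasure T) => ((0 : X), g)
      fun_prop)
    have : CompleteSpace S := hSc.completeSpace_coe
    -- A forcing `g` orthogonal to `S` is orthogonal to its own component `⟪b i, g⟫ b i`, which lies
    -- in `S`; so all its components vanish.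
    have hbot : Sᗮ = ⊥ := by
      rw [eq_bot_iff]
      intro g hg
      rw [Submodule.mem_orthogonal] at hg
      have hz : ∀ i, ∀ᵐ t ∂(timeMeasure T), ⟪b i, g t⟫_ℝ = 0 := by
        intro i
        have hfm : MemLp (fun t => ⟪b i, g t⟫_ℝ) 2 (timeMeasure T) := (Lp.memLp g).const_inner _
        have hgm : MemLp (fun t => ⟪b i, g t⟫_ℝ • b i) 2 (timeMeasure T) :=
          ((ContinuousLinearMap.toSpanSingleton ℝ (b i)).comp_memLp' hfm)
        have hmem : hgm.toLp _ ∈ S := by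
          have := hbx i 0 _ hfm (hgm.toLp _) hgm.coeFn_toLp
          rw [zero_smul] at this
          exact this
        have h1 := hg _ hmem
        rw [L2.inner_def] at h1
        have h2 : ∫ t, ⟪b i, g t⟫_ℝ ^ 2 ∂(timeMeasure T) = 0 := by
          rw [← h1]
          refine integral_congr_ae ?_
          filter_upwards [hgm.coeFn_toLp] with t ht
          rw [ht, real_inner_smul_left, sq]
        rw [integral_eq_zero_iff_of_nonneg (fun t => by positivity) hfm.integrable_sq] at h2
        filter_upwards [h2] with t ht
        simpa using ht
      rw [Submodule.mem_bot]
      refine Lp.ext ?_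
      filter_upwards [ae_all_iff.2 hz, Lp.coeFn_zero E 2 (timeMeasure T)] with t ht h0
      rw [h0]
      have h3 := b.hasSum_inner_mul_inner (g t) (g t)
      simp only [ht, mul_zero] at h3
      simpa using (h3.unique hasSum_zero)
    rw [Submodule.orthogonal_eq_bot_iff] at hbot
    intro g
    have : g ∈ S := hbot ▸ Submodule.mem_top
    exact this
  have hmem : (x, hG.toLp G) ∈ D := by
    have := D.add_mem (hinit x hx) (hforce (hG.toLp G))
    simpa using this
  obtain ⟨u, w, h, h0⟩ := hmem
  refine ⟨u, w, h.congr hT.le EventuallyEq.rfl ?_, h0⟩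
  filter_upwards [hG.coeFn_toLp] with t ht
  rw [ht]

end LinearProblem

/-! ### The abstract Navier–Stokes problem -/

section AbstractNS

universe u v

variable {E : Type u} {X : Type v} [NormedAddCommGroup E] [InnerProductSpace ℝ E] [CompleteSpace E]
  [TopologicalSpace.SeparableSpace E] [NormedAddCommGroup X] [InnerProductSpace ℝ X]
  [CompleteSpace X] {J : E →L[ℝ] X} {T μ k Cb : ℝ} {K : E →L[ℝ] E} {B : E →L[ℝ] E →L[ℝ] E}

/-- The properties of the two-dimensional convective term. -/
structure IsConvective (J : E →L[ℝ] X) (B : E →L[ℝ] E →L[ℝ] E) (Cb : ℝ) : Prop where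
  nonneg : 0 ≤ Cb
  bound : ∀ u v, ‖B u v‖ ^ 2 ≤ Cb * ((‖J u‖ * ‖u‖) * (‖J v‖ * ‖v‖))
  skew : ∀ u v, ⟪B u v, v⟫_ℝ = 0

/-- The properties of the zeroth order terms. -/
structure IsZerothOrder (J : E →L[ℝ] X) (K : E →L[ℝ] E) (μ k : ℝ) : Prop where
  nonneg : 0 ≤ k
  bound : ∀ u, ‖K u‖ ≤ k * ‖J u‖
  lower : ∀ u, -(μ * ‖J u‖ ^ 2) ≤ ⟪K u, u⟫_ℝ

/-- Solutions of `u' + μ u + K u + B(u, u) = g`. -/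
def IsNSTraj (J : E →L[ℝ] X) (T μ : ℝ) (K : E →L[ℝ] E) (B : E →L[ℝ] E →L[ℝ] E) (g : ℝ → E)
    (u : ℝ → E) (w : ℝ → X) : Prop :=
  IsTraj J T u (fun t => g t - μ • u t - K (u t) - B (u t) (u t)) w

/-- Two applications of Young's inequality to the convective bound. In the difference of two
solutions this is the one convective term that skew-symmetry does not remove. The coefficient `(‖J
u‖ ‖u‖)²` of `‖J d‖²` is integrable in time along a trajectory, so Grönwall's inequality can absorb
it. -/
lemma IsConvective.inner_le (hB : IsConvective J B Cb) (hμ : 0 < μ) (d u : E) :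
    |⟪B d u, d⟫_ℝ| ≤ μ / 2 * ‖d‖ ^ 2 + Cb ^ 2 / μ ^ 3 * (‖J u‖ * ‖u‖) ^ 2 * ‖J d‖ ^ 2 := by
  set x := ‖J d‖
  set y := ‖d‖ with hy
  set z := ‖J u‖ * ‖u‖
  set β := ‖B d u‖ with hβ
  have h1 : |⟪B d u, d⟫_ℝ| ≤ β * y := abs_real_inner_le_norm _ _
  have h2 : β ^ 2 ≤ Cb * ((x * y) * z) := hB.bound d u
  have h3 : β * y ≤ μ / 4 * y ^ 2 + μ⁻¹ * β ^ 2 := by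
    have : 0 ≤ μ⁻¹ * (β - μ / 2 * y) ^ 2 := by positivity
    have e : μ⁻¹ * (β - μ / 2 * y) ^ 2 = μ⁻¹ * β ^ 2 - β * y + μ / 4 * y ^ 2 := by
      field_simp; ring
    linarith
  have h4 : μ⁻¹ * β ^ 2 ≤ μ⁻¹ * (Cb * ((x * y) * z)) := by gcongr
  have h5 : μ⁻¹ * (Cb * ((x * y) * z)) ≤ μ / 4 * y ^ 2 + Cb ^ 2 / μ ^ 3 * z ^ 2 * x ^ 2 := by
    have : 0 ≤ μ⁻¹ * (Cb * x * z / μ - μ / 2 * y) ^ 2 := by positivity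
    have e : μ⁻¹ * (Cb * x * z / μ - μ / 2 * y) ^ 2
        = Cb ^ 2 / μ ^ 3 * z ^ 2 * x ^ 2 - μ⁻¹ * (Cb * ((x * y) * z)) + μ / 4 * y ^ 2 := by
      field_simp; ring
    linarith
  linarith

lemma IsTraj.exists_bound {u F : ℝ → E} {w : ℝ → X} (h : IsTraj J T u F w) :
    ∃ C, 0 ≤ C ∧ ∀ t ∈ Icc 0 T, ‖w t‖ ≤ C := by
  obtain ⟨C, hC⟩ := isCompact_Icc.exists_bound_of_continuousOn h.continuousOn
  exact ⟨max C 0, le_max_right _ _, fun t ht => (hC t ht).trans (le_max_left _ _)⟩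

/-- `B(u, v) ∈ L²(0,T;E*)` for `u, v ∈ L²(0,T;E) ∩ C([0,T];X)`. -/
lemma IsConvective.memLp (hB : IsConvective J B Cb) {u v F F' : ℝ → E} {w z : ℝ → X}
    (hu : IsTraj J T u F w) (hv : IsTraj J T v F' z) :
    MemLp (fun t => B (u t) (v t)) 2 (timeMeasure T) := by
  have hm : AEStronglyMeasurable (fun t => B (u t) (v t)) (timeMeasure T) :=
    B.aestronglyMeasurable_comp₂ hu.memLp.1 hv.memLp.1
  rw [memLp_two_iff_integrable_sq_norm hm]
  obtain ⟨C, hC0, hC⟩ := hu.exists_bound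
  obtain ⟨C', hC0', hC'⟩ := hv.exists_bound
  refine Integrable.mono' (((hu.memLp.norm.integrable_mul hv.memLp.norm)).const_mul (Cb * C * C'))
    (hm.norm.pow 2) ?_
  filter_upwards [hu.ae_eq, hv.ae_eq, ae_restrict_mem measurableSet_Ioo] with t h1 h2 ht
  have h3 := hC t ⟨ht.1.le, ht.2.le⟩
  have h4 := hC' t ⟨ht.1.le, ht.2.le⟩
  rw [h1] at h3
  rw [h2] at h4
  have := hB.bound (u t) (v t)
  have hb := hB.nonneg
  rw [Real.norm_of_nonneg (by positivity)]
  calc ‖B (u t) (v t)‖ ^ 2 ≤ Cb * ((‖J (u t)‖ * ‖u t‖) * (‖J (v t)‖ * ‖v t‖)) := this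
    _ ≤ Cb * ((C * ‖u t‖) * (C' * ‖v t‖)) := by gcongr
    _ = Cb * C * C' * (‖u t‖ * ‖v t‖) := by ring

lemma IsTraj.integrable_sq_mul_sq {u F : ℝ → E} {w : ℝ → X} (h : IsTraj J T u F w) :
    Integrable (fun t => ‖w t‖ ^ 2 * ‖u t‖ ^ 2) (timeMeasure T) := by
  obtain ⟨C, hC0, hC⟩ := h.exists_bound
  have hwm : AEStronglyMeasurable w (timeMeasure T) :=
    (h.continuousOn.mono Ioo_subset_Icc_self).aestronglyMeasurable measurableSet_Ioo
  refine (integrable_norm_sq_of_memLp h.memLp).bdd_mul (c := C ^ 2) (hwm.norm.pow 2) ?_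
  filter_upwards [ae_restrict_mem measurableSet_Ioo] with t ht
  have := hC t ⟨ht.1.le, ht.2.le⟩
  simp only [norm_pow, norm_norm]
  gcongr

/-- Stability of solutions of the abstract Navier–Stokes problem. -/
lemma IsNSTraj.stability (hT : 0 < T) (hJc : IsCompactOperator J) (hJ : Function.Injective J)
    (hμ : 0 < μ) (hB : IsConvective J B Cb) {K₁ K₂ : E →L[ℝ] E} (hK : IsZerothOrder J K₁ μ k)
    {g₁ g₂ u₁ u₂ : ℝ → E} {w₁ w₂ : ℝ → X} (h₁ : IsNSTraj J T μ K₁ B g₁ u₁ w₁)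
    (h₂ : IsNSTraj J T μ K₂ B g₂ u₂ w₂) (hg₁ : MemLp g₁ 2 (timeMeasure T))
    (hg₂ : MemLp g₂ 2 (timeMeasure T)) {c Λ : ℝ}
    (hc : c = ‖w₁ 0 - w₂ 0‖ ^ 2
      + 2 / μ * ∫ t, ‖g₁ t - g₂ t - (K₁ (u₂ t) - K₂ (u₂ t))‖ ^ 2 ∂(timeMeasure T))
    (hΛ : Λ = ∫ t, (2 * μ + 2 * (Cb ^ 2 / μ ^ 3) * (‖w₂ t‖ ^ 2 * ‖u₂ t‖ ^ 2)) ∂(timeMeasure T)) :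
    (∀ t ∈ Icc 0 T, ‖w₁ t - w₂ t‖ ^ 2 ≤ c * Real.exp Λ) ∧
      μ / 2 * ∫ t, ‖u₁ t - u₂ t‖ ^ 2 ∂(timeMeasure T) ≤ c * (1 + Λ * Real.exp Λ) := by
  have hd := IsTraj.sub h₁ h₂
  have hE := hd.energy hT hJc hJ
  set r : ℝ → E := fun t => g₁ t - g₂ t - (K₁ (u₂ t) - K₂ (u₂ t)) with hr
  have hrM : MemLp r 2 (timeMeasure T) :=
    (hg₁.sub hg₂).sub ((K₁.comp_memLp' h₂.memLp).sub (K₂.comp_memLp' h₂.memLp))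
  set θ : ℝ → ℝ := fun t => 2 * μ + 2 * (Cb ^ 2 / μ ^ 3) * (‖w₂ t‖ ^ 2 * ‖u₂ t‖ ^ 2) with hθ
  have hθi : Integrable θ (timeMeasure T) :=
    (integrable_const _).add (h₂.integrable_sq_mul_sq.const_mul _)
  have hθ0 : ∀ t, 0 ≤ θ t := fun t => by positivity
  have hθi' := (intervalIntegrable_iff_timeMeasure hT.le).2 hθi
  have hri' := (intervalIntegrable_iff_timeMeasure hT.le).2 (integrable_norm_sq_of_memLp hrM)
  have hdi' := (intervalIntegrable_iff_timeMeasure hT.le).2 (integrable_norm_sq_of_memLp hd.memLp)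
  have hyc : ContinuousOn (fun t => ‖w₁ t - w₂ t‖ ^ 2) (Icc 0 T) := hd.continuousOn.norm.pow 2
  have hθy : IntervalIntegrable (fun t => θ t * ‖w₁ t - w₂ t‖ ^ 2) volume 0 T :=
    hθi'.mul_continuousOn (by rwa [uIcc_of_le hT.le])
  have hpt : ∀ᵐ t ∂(timeMeasure T),
      2 * ⟪g₁ t - μ • u₁ t - K₁ (u₁ t) - B (u₁ t) (u₁ t)
        - (g₂ t - μ • u₂ t - K₂ (u₂ t) - B (u₂ t) (u₂ t)), u₁ t - u₂ t⟫_ℝ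
      ≤ 2 / μ * ‖r t‖ ^ 2 + θ t * ‖w₁ t - w₂ t‖ ^ 2 - μ / 2 * ‖u₁ t - u₂ t‖ ^ 2 := by
    filter_upwards [h₂.ae_eq, hd.ae_eq] with t h1 h2
    set d := u₁ t - u₂ t with hdd
    -- The convective terms are split as `B(u₁, d) + B(d, u₂)`, the first of which is skew. The
    -- difference of the operators acts only on `u₂` and is collected in `r`.
    have e1 : g₁ t - μ • u₁ t - K₁ (u₁ t) - B (u₁ t) (u₁ t)
        - (g₂ t - μ • u₂ t - K₂ (u₂ t) - B (u₂ t) (u₂ t))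
        = r t - μ • d - K₁ d - B (u₁ t) d - B d (u₂ t) := by
      simp only [hr, hdd, map_sub, smul_sub, sub_apply]
      abel
    rw [e1, inner_sub_left, inner_sub_left, inner_sub_left, inner_sub_left, hB.skew,
      real_inner_smul_left, real_inner_self_eq_norm_sq, hθ]
    -- Of the dissipation `2μ‖d‖²` the convective term uses `μ‖d‖²` and the residual `μ/2 ‖d‖²`, so
    -- `μ/2 ‖d‖²` remains. The lower bound for `K₁` costs `2μ‖J d‖²`, which enters `θ`.
    have i1 := hK.lower d
    have i2 := abs_le.1 (hB.inner_le hμ d (u₂ t))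
    have i3 := real_inner_le_norm (r t) d
    have i4 : 2 * (‖r t‖ * ‖d‖) ≤ 2 / μ * ‖r t‖ ^ 2 + μ / 2 * ‖d‖ ^ 2 := by
      have : 0 ≤ 2 / μ * (‖r t‖ - μ / 2 * ‖d‖) ^ 2 := by positivity
      have e : 2 / μ * (‖r t‖ - μ / 2 * ‖d‖) ^ 2
          = 2 / μ * ‖r t‖ ^ 2 - 2 * (‖r t‖ * ‖d‖) + μ / 2 * ‖d‖ ^ 2 := by
        field_simp; ring
      linarith
    beta_reduce
    rw [h2, h1, ← mul_pow]
    linarith [i2.1]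
  have hmain : ∀ t ∈ Icc 0 T, ‖w₁ t - w₂ t‖ ^ 2 + μ / 2 * ∫ s in (0:ℝ)..t, ‖u₁ s - u₂ s‖ ^ 2
      ≤ c + ∫ s in (0:ℝ)..t, θ s * ‖w₁ s - w₂ s‖ ^ 2 := by
    intro t ht
    have e := hE.eq t ht
    have hle := intervalIntegral_mono_of_ae hE.integrable
      (((hri'.const_mul (2 / μ)).add hθy).sub (hdi'.const_mul (μ / 2))) hpt ht
    rw [intervalIntegral.integral_sub (((intervalIntegrable_sub hri' ht).const_mul _).add
      (intervalIntegrable_sub hθy ht)) ((intervalIntegrable_sub hdi' ht).const_mul _),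
      intervalIntegral.integral_add ((intervalIntegrable_sub hri' ht).const_mul _)
      (intervalIntegrable_sub hθy ht)] at hle
    simp only [intervalIntegral.integral_const_mul] at hle e
    have h3 : ∫ s in (0:ℝ)..t, ‖r s‖ ^ 2 ≤ ∫ s, ‖r s‖ ^ 2 ∂(timeMeasure T) := by
      rw [intervalIntegral_eq_timeMeasure ht.1]
      exact setIntegral_mono_set (integrable_norm_sq_of_memLp hrM)
        (Eventually.of_forall fun s => by positivity)
        (Ioo_subset_Ioo_right ht.2).eventuallyLE
    have h4 := mul_le_mul_of_nonneg_left h3 (by positivity : 0 ≤ 2 / μ)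
    rw [hc]
    linarith
  have hc0 : 0 ≤ c := by
    rw [hc]
    have : 0 ≤ ∫ t, ‖r t‖ ^ 2 ∂(timeMeasure T) := integral_nonneg fun t => by positivity
    positivity
  have hint0 : ∀ t ∈ Icc 0 T, 0 ≤ ∫ s in (0:ℝ)..t, ‖u₁ s - u₂ s‖ ^ 2 := fun t ht =>
    intervalIntegral_nonneg_of_ae (T := T) (Eventually.of_forall fun s => by positivity) ht
  have hgr := gronwall_integral hT.le hθi' (Eventually.of_forall hθ0) hyc (K := c) (fun t ht => by
    have h1 := hmain t ht
    have h2 := mul_nonneg (by positivity : 0 ≤ μ / 2) (hint0 t ht)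
    linarith)
  have hΛt : ∀ t ∈ Icc 0 T, ∫ s in (0:ℝ)..t, θ s ≤ Λ := fun t ht => by
    rw [hΛ, intervalIntegral_eq_timeMeasure ht.1]
    exact setIntegral_mono_set hθi (Eventually.of_forall hθ0)
      (Ioo_subset_Ioo_right ht.2).eventuallyLE
  have hfirst : ∀ t ∈ Icc 0 T, ‖w₁ t - w₂ t‖ ^ 2 ≤ c * Real.exp Λ := fun t ht =>
    (hgr t ht).trans (by gcongr; exact hΛt t ht)
  refine ⟨hfirst, ?_⟩
  -- The pointwise bound is fed back into the Grönwall term of the energy inequality at time `T`,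
  -- where `∫ θ = Λ`.
  have h1 := hmain T ⟨hT.le, le_rfl⟩
  have h2 : ∫ s in (0:ℝ)..T, θ s * ‖w₁ s - w₂ s‖ ^ 2 ≤ ∫ s in (0:ℝ)..T, θ s * (c * Real.exp Λ) := by
    refine intervalIntegral_mono_of_ae hθy (hθi'.mul_const _) ?_ ⟨hT.le, le_rfl⟩
    filter_upwards [ae_restrict_mem measurableSet_Ioo] with t ht
    exact mul_le_mul_of_nonneg_left (hfirst t ⟨ht.1.le, ht.2.le⟩) (hθ0 t)
  rw [intervalIntegral.integral_mul_const, intervalIntegral_eq_timeMeasure hT.le (g := θ), ← hΛ] at h2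
  rw [intervalIntegral_eq_timeMeasure hT.le] at h1
  have h3 := sq_nonneg ‖w₁ T - w₂ T‖
  linarith

end AbstractNS

/-! ### Exponentially weighted estimates for perturbations of a trajectory -/

section Existence

universe u v

variable {E : Type u} {X : Type v} [NormedAddCommGroup E] [InnerProductSpace ℝ E] [CompleteSpace E]
  [TopologicalSpace.SeparableSpace E] [NormedAddCommGroup X] [InnerProductSpace ℝ X]
  [CompleteSpace X] {J : E →L[ℝ] X} {T μ k Cb : ℝ} {K : E →L[ℝ] E} {B : E →L[ℝ] E →L[ℝ] E}

lemma isTraj_zero (J : E →L[ℝ] X) (T : ℝ) : IsTraj J T (fun _ => 0) (fun _ => 0) (fun _ => 0) where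
  memLp := MemLp.zero
  memLp_deriv := MemLp.zero
  continuousOn := continuousOn_const
  ae_eq := by simp
  primitive ψ := ⟨by simp, by simp⟩

lemma memLp_smul_of_continuousOn {r : ℝ → ℝ} (hr : ContinuousOn r (Icc 0 T)) {G : ℝ → E}
    (hG : MemLp G 2 (timeMeasure T)) : MemLp (fun t => r t • G t) 2 (timeMeasure T) := by
  obtain ⟨C, hC⟩ := isCompact_Icc.exists_bound_of_continuousOn hr
  have hm : AEStronglyMeasurable r (timeMeasure T) :=
    (hr.mono Ioo_subset_Icc_self).aestronglyMeasurable measurableSet_Ioo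
  refine MemLp.of_le_mul hG (hm.smul hG.1) (c := C) ?_
  filter_upwards [ae_restrict_mem measurableSet_Ioo] with t ht
  rw [norm_smul]
  exact mul_le_mul_of_nonneg_right (hC t ⟨ht.1.le, ht.2.le⟩) (norm_nonneg _)

/-- The rate `1 + |u|² ‖u‖²` of the exponential weight attached to a trajectory. -/
def weightRate (u : ℝ → E) (w : ℝ → X) (t : ℝ) : ℝ := 1 + ‖w t‖ ^ 2 * ‖u t‖ ^ 2

/-- The exponential weight attached to a trajectory. -/
def weight (c : ℝ) (u : ℝ → E) (w : ℝ → X) (t : ℝ) : ℝ :=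
  Real.exp (-c * ∫ s in 0..t, weightRate u w s)

lemma weightRate_pos (u : ℝ → E) (w : ℝ → X) (t : ℝ) : 1 ≤ weightRate u w t := by
  unfold weightRate
  have : 0 ≤ ‖w t‖ ^ 2 * ‖u t‖ ^ 2 := by positivity
  linarith

section Weight

variable {u F : ℝ → E} {w : ℝ → X}

lemma IsTraj.weightRate_integrable (hT : 0 < T) (hu : IsTraj J T u F w) :
    IntervalIntegrable (weightRate u w) volume 0 T :=
  (intervalIntegrable_iff_timeMeasure hT.le).2
    ((integrable_const _).add hu.integrable_sq_mul_sq)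

lemma IsTraj.weight_primitive (hT : 0 < T) (hu : IsTraj J T u F w) (c : ℝ) :
    IsPrimitiveOn T (weight c u w) (fun t => -c * weightRate u w t * weight c u w t) :=
  (isPrimitiveOn_integral (hu.weightRate_integrable hT)).exp_const_mul hT.le (-c)

lemma weight_pos (c : ℝ) (u : ℝ → E) (w : ℝ → X) (t : ℝ) : 0 < weight c u w t := Real.exp_pos _

lemma weight_le_one {c : ℝ} (hc : 0 ≤ c) {t : ℝ} (ht : 0 ≤ t) : weight c u w t ≤ 1 := by
  unfold weight
  rw [Real.exp_le_one_iff]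
  have : 0 ≤ ∫ s in (0:ℝ)..t, weightRate u w s :=
    intervalIntegral_nonneg_of_ae (T := t)
      (Eventually.of_forall fun s => zero_le_one.trans (weightRate_pos u w s)) ⟨ht, le_rfl⟩
  nlinarith

lemma IsTraj.one_le_exp_mul_weight (hT : 0 < T) (hu : IsTraj J T u F w) {c Θ : ℝ} (hc : 0 ≤ c)
    (hΘ : ∫ s in 0..T, weightRate u w s ≤ Θ) {t : ℝ} (ht : t ∈ Icc 0 T) :
    1 ≤ Real.exp (c * Θ) * weight c u w t := by
  unfold weight
  rw [← Real.exp_add, Real.one_le_exp_iff]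
  have : ∫ s in (0:ℝ)..t, weightRate u w s ≤ ∫ s in (0:ℝ)..T, weightRate u w s :=
    intervalIntegral.integral_mono_interval le_rfl ht.1 ht.2
      (Eventually.of_forall fun s => zero_le_one.trans (weightRate_pos u w s))
      (hu.weightRate_integrable hT)
  nlinarith

/-- Multiplying a forcing by the weight with half the exponent turns the weighted `L²` norm into the
unweighted one. -/
lemma weight_sq (c : ℝ) (t : ℝ) : weight (c / 2) u w t ^ 2 = weight c u w t := by
  unfold weight
  rw [← Real.exp_nat_mul]
  congr 1
  push_cast
  ring

/-- The derivative of the weight is `-c` times rate times weight, so the energy estimate keeps `c ∫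
rate · weight · ‖e‖²` on the left. A large `c` thus makes every term dominated by `rate · ‖e‖²`
small, however large the reference trajectory is. -/
lemma IsTraj.weighted_bounds (hT : 0 < T) (hJc : IsCompactOperator J)
    (hJ : Function.Injective J) (hμ : 0 < μ) (hu : IsTraj J T u F w) {c : ℝ} (hc : 0 ≤ c)
    {d G : ℝ → E} {e : ℝ → X} (hG : MemLp G 2 (timeMeasure T))
    (h : IsTraj J T d (fun t => G t - μ • d t) e) {Q : ℝ}
    (hQ : ‖e 0‖ ^ 2 + μ⁻¹ * ∫ s in 0..T, weight c u w s * ‖G s‖ ^ 2 ≤ Q) :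
    (∀ t ∈ Icc 0 T, weight c u w t * ‖e t‖ ^ 2 ≤ Q) ∧
      c * (∫ s in 0..T, weightRate u w s * (weight c u w s * ‖e s‖ ^ 2)) ≤ Q ∧
      μ * (∫ s in 0..T, weight c u w s * ‖d s‖ ^ 2) ≤ Q := by
  have hp := hu.weight_primitive hT c
  have hp0 : ∀ t, 0 ≤ weight c u w t := fun t => (weight_pos c u w t).le
  have key := fun t ht => h.weighted_bound hT hJc hJ hμ hG hp (fun t _ => hp0 t) (t := t) ht
  have h0 : weight c u w 0 = 1 := by simp [weight]
  have hre : ∀ t, ∫ s in (0:ℝ)..t, -(-c * weightRate u w s * weight c u w s) * ‖e s‖ ^ 2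
      = c * ∫ s in (0:ℝ)..t, weightRate u w s * (weight c u w s * ‖e s‖ ^ 2) := fun t => by
    rw [← intervalIntegral.integral_const_mul]
    congr 1
    ext s
    ring
  simp only [hre, h0, one_mul] at key
  have n1 : ∀ t ∈ Icc 0 T, 0 ≤ ∫ s in (0:ℝ)..t, weightRate u w s * (weight c u w s * ‖e s‖ ^ 2) :=
    fun t ht => intervalIntegral_nonneg_of_ae (T := T) (Eventually.of_forall fun s =>
      mul_nonneg (zero_le_one.trans (weightRate_pos u w s))
        (mul_nonneg (hp0 s) (by positivity))) ht
  have n2 : ∀ t ∈ Icc 0 T, 0 ≤ ∫ s in (0:ℝ)..t, weight c u w s * ‖d s‖ ^ 2 :=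
    fun t ht => intervalIntegral_nonneg_of_ae (T := T) (Eventually.of_forall fun s =>
      mul_nonneg (hp0 s) (by positivity)) ht
  have hGi : IntervalIntegrable (fun s => weight c u w s * ‖G s‖ ^ 2) volume 0 T :=
    ((intervalIntegrable_iff_timeMeasure hT.le).2
      (integrable_norm_sq_of_memLp hG)).continuousOn_mul
      (by rw [uIcc_of_le hT.le]; exact hp.continuousOn hT.le)
  have n3 : ∀ t ∈ Icc 0 T, μ⁻¹ * (∫ s in (0:ℝ)..t, weight c u w s * ‖G s‖ ^ 2)
      ≤ μ⁻¹ * ∫ s in (0:ℝ)..T, weight c u w s * ‖G s‖ ^ 2 := fun t ht => by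
    refine mul_le_mul_of_nonneg_left ?_ (inv_nonneg.2 hμ.le)
    exact intervalIntegral.integral_mono_interval le_rfl ht.1 ht.2
      (Eventually.of_forall fun s => mul_nonneg (hp0 s) (by positivity)) hGi
  have hTm : T ∈ Icc 0 T := ⟨hT.le, le_rfl⟩
  have m1 : ∀ t ∈ Icc 0 T, 0 ≤ c * ∫ s in (0:ℝ)..t, weightRate u w s * (weight c u w s * ‖e s‖ ^ 2) :=
    fun t ht => mul_nonneg hc (n1 t ht)
  have m2 : ∀ t ∈ Icc 0 T, 0 ≤ μ * ∫ s in (0:ℝ)..t, weight c u w s * ‖d s‖ ^ 2 :=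
    fun t ht => mul_nonneg hμ.le (n2 t ht)
  have m3 : 0 ≤ weight c u w T * ‖e T‖ ^ 2 := mul_nonneg (hp0 T) (by positivity)
  refine ⟨fun t ht => ?_, ?_, ?_⟩
  · linarith [key t ht, m1 t ht, m2 t ht, n3 t ht]
  · linarith [key T hTm, m1 T hTm, m2 T hTm, n3 T hTm]
  · linarith [key T hTm, m1 T hTm, m2 T hTm, n3 T hTm]

end Weight

/-- The lower order terms of the equation for a perturbation `d` of the trajectory `u`. -/
def perturbation (K : E →L[ℝ] E) (B : E →L[ℝ] E →L[ℝ] E) (u d : ℝ → E) (t : ℝ) : E :=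
  K (d t) + B (u t) (d t) + B (d t) (u t) + B (d t) (d t)

lemma IsConvective.memLp_perturbation (hB : IsConvective J B Cb) {u d F F' : ℝ → E} {w e : ℝ → X}
    (hu : IsTraj J T u F w) (hd : IsTraj J T d F' e) :
    MemLp (perturbation K B u d) 2 (timeMeasure T) :=
  (((K.comp_memLp' hd.memLp).add (hB.memLp hu hd)).add (hB.memLp hd hu)).add (hB.memLp hd hd)

lemma norm_add_five_sq_le (a b c d e : E) :
    ‖a + b + c + d + e‖ ^ 2 ≤ 5 * (‖a‖ ^ 2 + ‖b‖ ^ 2 + ‖c‖ ^ 2 + ‖d‖ ^ 2 + ‖e‖ ^ 2) := by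
  have h : ‖a + b + c + d + e‖ ≤ ‖a‖ + ‖b‖ + ‖c‖ + ‖d‖ + ‖e‖ :=
    (norm_add_le _ _).trans (add_le_add_left ((norm_add_le _ _).trans
      (add_le_add_left ((norm_add_le _ _).trans (add_le_add_left (norm_add_le _ _) _)) _)) _)
  have h2 : ‖a + b + c + d + e‖ ^ 2 ≤ (‖a‖ + ‖b‖ + ‖c‖ + ‖d‖ + ‖e‖) ^ 2 := by gcongr
  refine h2.trans ?_
  nlinarith [sq_nonneg (‖a‖ - ‖b‖), sq_nonneg (‖a‖ - ‖c‖), sq_nonneg (‖a‖ - ‖d‖),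
    sq_nonneg (‖a‖ - ‖e‖), sq_nonneg (‖b‖ - ‖c‖), sq_nonneg (‖b‖ - ‖d‖), sq_nonneg (‖b‖ - ‖e‖),
    sq_nonneg (‖c‖ - ‖d‖), sq_nonneg (‖c‖ - ‖e‖), sq_nonneg (‖d‖ - ‖e‖)]

set_option maxHeartbeats 1000000 in
/-- Lipschitz estimate in the weighted norm for the lower order terms. -/
lemma perturbation_lipschitz (hT : 0 < T) (hJc : IsCompactOperator J) (hJ : Function.Injective J)
    (hμ : 0 < μ) (hB : IsConvective J B Cb) (hK : IsZerothOrder J K μ k) {u F : ℝ → E} {w : ℝ → X}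
    (hu : IsTraj J T u F w) {a Θ Qm : ℝ} (ha : 0 < a)
    (hΘ : ∫ s in 0..T, weightRate u w s ≤ Θ)
    (hca : 5 * (k ^ 2 / a ^ 2 + Cb * (1 + 1 / μ) / a) ≤ μ / 8)
    (hQm : 10 * Cb * Real.exp (a ^ 2 * Θ) * Qm / μ ≤ μ / 8)
    {d₁ d₂ G₁ G₂ : ℝ → E} {e₁ e₂ : ℝ → X} (hG₁ : MemLp G₁ 2 (timeMeasure T))
    (hG₂ : MemLp G₂ 2 (timeMeasure T))
    (h₁ : IsTraj J T d₁ (fun t => G₁ t - μ • d₁ t) e₁)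
    (h₂ : IsTraj J T d₂ (fun t => G₂ t - μ • d₂ t) e₂)
    (hQ₁ : ‖e₁ 0‖ ^ 2 + μ⁻¹ * ∫ s in 0..T, weight (a ^ 2) u w s * ‖G₁ s‖ ^ 2 ≤ Qm)
    (hQ₂ : ‖e₂ 0‖ ^ 2 + μ⁻¹ * ∫ s in 0..T, weight (a ^ 2) u w s * ‖G₂ s‖ ^ 2 ≤ Qm) :
    ∫ s in 0..T, weight (a ^ 2) u w s * ‖perturbation K B u d₁ s - perturbation K B u d₂ s‖ ^ 2
      ≤ μ / 4 * (‖e₁ 0 - e₂ 0‖ ^ 2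
        + μ⁻¹ * ∫ s in 0..T, weight (a ^ 2) u w s * ‖G₁ s - G₂ s‖ ^ 2) := by
  set p := weight (a ^ 2) u w with hp
  set θ := weightRate u w with hθ
  set P := Real.exp (a ^ 2 * Θ) with hP
  set Q := ‖e₁ 0 - e₂ 0‖ ^ 2 + μ⁻¹ * ∫ s in (0:ℝ)..T, p s * ‖G₁ s - G₂ s‖ ^ 2 with hQ
  have hCb := hB.nonneg
  have hk := hK.nonneg
  have ha2 : (0:ℝ) ≤ a ^ 2 := by positivity
  have hd : IsTraj J T (fun t => d₁ t - d₂ t) (fun t => (G₁ t - G₂ t) - μ • (d₁ t - d₂ t))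
      (fun t => e₁ t - e₂ t) := by
    refine (h₁.sub h₂).congr hT.le EventuallyEq.rfl (Eventually.of_forall fun t => ?_)
    simp only [smul_sub]
    abel
  obtain ⟨a1, b1, c1⟩ := hu.weighted_bounds hT hJc hJ hμ ha2 hG₁ h₁ hQ₁
  obtain ⟨a2, b2, c2⟩ := hu.weighted_bounds hT hJc hJ hμ ha2 hG₂ h₂ hQ₂
  obtain ⟨a3, b3, c3⟩ := hu.weighted_bounds hT hJc hJ hμ ha2 (hG₁.sub hG₂) hd (le_refl Q)
  have hpc : ContinuousOn p (uIcc 0 T) := by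
    rw [uIcc_of_le hT.le]; exact (hu.weight_primitive hT _).continuousOn hT.le
  have hp0 : ∀ t, 0 < p t := fun t => weight_pos _ _ _ _
  have hInt : ∀ f : ℝ → E, MemLp f 2 (timeMeasure T) →
      IntervalIntegrable (fun s => p s * ‖f s‖ ^ 2) volume 0 T := fun f hf =>
    ((intervalIntegrable_iff_timeMeasure hT.le).2
      (integrable_norm_sq_of_memLp hf)).continuousOn_mul hpc
  have i1 : IntervalIntegrable (fun s => θ s * (p s * ‖e₁ s - e₂ s‖ ^ 2)) volume 0 T :=
    (hu.weightRate_integrable hT).mul_continuousOn (hpc.mul (by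
      rw [uIcc_of_le hT.le]; exact hd.continuousOn.norm.pow 2))
  have i2 := hInt _ hd.memLp
  have i3 := hInt _ h₁.memLp
  have i4 := hInt _ h₂.memLp
  have i0 := hInt _ ((hB.memLp_perturbation (K := K) hu h₁).sub
    (hB.memLp_perturbation (K := K) hu h₂))
  have hQ0 : 0 ≤ Q := (mul_nonneg (hp0 0).le (by positivity)).trans (a3 0 ⟨le_rfl, hT.le⟩)
  -- The difference of the lower order terms is a sum of five terms: `K d`, the two products of `d`
  -- with `u`, and the products of `d` with `d₁` and `d₂`. The first three are small through the
  -- choice of `a`, the last two through the smallness of `Qm`.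
  have hle := intervalIntegral_mono_of_ae i0
    ((((i1.const_mul (5 * (k ^ 2 + Cb * a))).add (i2.const_mul (5 * (Cb / a + Cb * P * Qm)))).add
      (i3.const_mul (5 * (Cb / 2 * P * Q)))).add (i4.const_mul (5 * (Cb / 2 * P * Q)))) (by
    filter_upwards [hu.ae_eq, h₁.ae_eq, h₂.ae_eq, hd.ae_eq, ae_restrict_mem measurableSet_Ioo]
      with t hw he1 he2 he ht
    have htI : t ∈ Icc 0 T := ⟨ht.1.le, ht.2.le⟩
    set d := d₁ t - d₂ t with hdd
    have e0 : perturbation K B u d₁ t - perturbation K B u d₂ t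
        = K d + B (u t) d + B d (u t) + B (d₁ t) d + B d (d₂ t) := by
      simp only [perturbation, hdd, map_sub, sub_apply]
      abel
    have f0 := norm_add_five_sq_le (K d) (B (u t) d) (B d (u t)) (B (d₁ t) d) (B d (d₂ t))
    have hpt := hp0 t
    have hθ1 : 1 ≤ θ t := weightRate_pos u w t
    have hPp : 1 ≤ P * p t := hu.one_le_exp_mul_weight hT ha2 hΘ htI
    have f1 : ‖K d‖ ^ 2 ≤ k ^ 2 * (θ t * ‖J d‖ ^ 2) := by
      have := hK.bound d
      calc ‖K d‖ ^ 2 ≤ (k * ‖J d‖) ^ 2 := by gcongr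
        _ = k ^ 2 * (1 * ‖J d‖ ^ 2) := by ring
        _ ≤ k ^ 2 * (θ t * ‖J d‖ ^ 2) := by gcongr
    have hz : (‖J (u t)‖ * ‖u t‖) ^ 2 ≤ θ t := by
      simp only [hθ, weightRate, hw, mul_pow]
      linarith
    -- Young's inequality with parameter `a`. The term with factor `a` is paired below with an
    -- integral of order `1/a²`, the other already carries `1/a`; both contributions are of order
    -- `1/a`.
    have f2 : (‖J (u t)‖ * ‖u t‖) * (‖J d‖ * ‖d‖)
        ≤ 1 / 2 * (a * (θ t * ‖J d‖ ^ 2) + 1 / a * ‖d‖ ^ 2) := by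
      have h1 : (‖J (u t)‖ * ‖u t‖) ^ 2 * ‖J d‖ ^ 2 ≤ θ t * ‖J d‖ ^ 2 := by gcongr
      have h2 : 0 ≤ 1 / a * (a * (‖J (u t)‖ * ‖u t‖ * ‖J d‖) - ‖d‖) ^ 2 := by positivity
      have h3 : 1 / a * (a * (‖J (u t)‖ * ‖u t‖ * ‖J d‖) - ‖d‖) ^ 2
          = a * ((‖J (u t)‖ * ‖u t‖) ^ 2 * ‖J d‖ ^ 2)
            - 2 * ((‖J (u t)‖ * ‖u t‖) * (‖J d‖ * ‖d‖)) + 1 / a * ‖d‖ ^ 2 := by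
        field_simp; ring
      have h4 := mul_le_mul_of_nonneg_left h1 ha.le
      linarith
    have f3 : ‖B (u t) d‖ ^ 2 ≤ Cb / 2 * (a * (θ t * ‖J d‖ ^ 2) + 1 / a * ‖d‖ ^ 2) := by
      have := (hB.bound (u t) d).trans (mul_le_mul_of_nonneg_left f2 hCb)
      linarith
    have f4 : ‖B d (u t)‖ ^ 2 ≤ Cb / 2 * (a * (θ t * ‖J d‖ ^ 2) + 1 / a * ‖d‖ ^ 2) := by
      have h1 := hB.bound d (u t)
      rw [mul_comm (‖J d‖ * ‖d‖)] at h1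
      have := h1.trans (mul_le_mul_of_nonneg_left f2 hCb)
      linarith
    -- Quadratic terms need the weight twice but contain it once. The missing factor is inserted
    -- through `1 ≤ P p`, which is where the bound `Θ` on the integrated rate enters.
    have f5 : ∀ v : E, p t * ‖J v‖ ^ 2 ≤ Qm →
        p t * (‖J v‖ * ‖v‖ * (‖J d‖ * ‖d‖))
          ≤ 1 / 2 * (P * Qm * (p t * ‖d‖ ^ 2) + P * Q * (p t * ‖v‖ ^ 2)) := by
      intro v hv
      have hdQ : p t * ‖J d‖ ^ 2 ≤ Q := by
        have := a3 t htI
        rwa [he] at this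
      have h1 : ‖J v‖ * ‖v‖ * (‖J d‖ * ‖d‖) ≤ 1 / 2 * (‖J v‖ ^ 2 * ‖d‖ ^ 2 + ‖J d‖ ^ 2 * ‖v‖ ^ 2) := by
        nlinarith [sq_nonneg (‖J v‖ * ‖d‖ - ‖J d‖ * ‖v‖)]
      have h2 : ∀ x y q : ℝ, 0 ≤ y → 0 ≤ x → p t * x ≤ q → p t * (x * y) ≤ P * q * (p t * y) := by
        intro x y q hy hx hq
        calc p t * (x * y) = 1 * (p t * x) * y := by ring
          _ ≤ (P * p t) * (p t * x) * y := by gcongr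
          _ ≤ (P * p t) * q * y := by gcongr
          _ = P * q * (p t * y) := by ring
      have h3 := h2 _ (‖d‖ ^ 2) _ (by positivity) (by positivity) hv
      have h4 := h2 _ (‖v‖ ^ 2) _ (by positivity) (by positivity) hdQ
      have h5 := mul_le_mul_of_nonneg_left h1 hpt.le
      linarith
    have f6 : p t * ‖B (d₁ t) d‖ ^ 2
        ≤ Cb / 2 * (P * Qm * (p t * ‖d‖ ^ 2) + P * Q * (p t * ‖d₁ t‖ ^ 2)) := by
      have h1 := mul_le_mul_of_nonneg_left (hB.bound (d₁ t) d) hpt.le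
      have h2 := mul_le_mul_of_nonneg_left (f5 (d₁ t) (by rw [← he1]; exact a1 t htI)) hCb
      linarith
    have f7 : p t * ‖B d (d₂ t)‖ ^ 2
        ≤ Cb / 2 * (P * Qm * (p t * ‖d‖ ^ 2) + P * Q * (p t * ‖d₂ t‖ ^ 2)) := by
      have h1 := hB.bound d (d₂ t)
      rw [mul_comm (‖J d‖ * ‖d‖)] at h1
      have h1 := mul_le_mul_of_nonneg_left h1 hpt.le
      have h2 := mul_le_mul_of_nonneg_left (f5 (d₂ t) (by rw [← he2]; exact a2 t htI)) hCb
      linarith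
    have g1 := mul_le_mul_of_nonneg_left f1 hpt.le
    have g3 := mul_le_mul_of_nonneg_left f3 hpt.le
    have g4 := mul_le_mul_of_nonneg_left f4 hpt.le
    have g0 := mul_le_mul_of_nonneg_left f0 hpt.le
    rw [Pi.sub_apply, e0]
    simp only [he]
    have e9 : Cb / a = Cb * (1 / a) := by ring
    rw [e9]
    linarith) ⟨hT.le, le_rfl⟩
  rw [intervalIntegral.integral_add (((i1.const_mul _).add (i2.const_mul _)).add (i3.const_mul _))
    (i4.const_mul _), intervalIntegral.integral_add ((i1.const_mul _).add (i2.const_mul _))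
    (i3.const_mul _), intervalIntegral.integral_add (i1.const_mul _) (i2.const_mul _)] at hle
  simp only [intervalIntegral.integral_const_mul] at hle
  refine hle.trans ?_
  set I1 := ∫ s in (0:ℝ)..T, θ s * (p s * ‖e₁ s - e₂ s‖ ^ 2)
  set I2 := ∫ s in (0:ℝ)..T, p s * ‖d₁ s - d₂ s‖ ^ 2
  set I3 := ∫ s in (0:ℝ)..T, p s * ‖d₁ s‖ ^ 2
  set I4 := ∫ s in (0:ℝ)..T, p s * ‖d₂ s‖ ^ 2
  have hP0 : 0 < P := Real.exp_pos _
  have hQm0 : 0 ≤ Qm := (mul_nonneg (hp0 0).le (by positivity)).trans (a1 0 ⟨le_rfl, hT.le⟩)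
  have j1 : I1 ≤ Q / a ^ 2 := by rw [le_div_iff₀' (by positivity)]; exact b3
  have j2 : I2 ≤ Q / μ := by rw [le_div_iff₀' hμ]; exact c3
  have j3 : I3 ≤ Qm / μ := by rw [le_div_iff₀' hμ]; exact c1
  have j4 : I4 ≤ Qm / μ := by rw [le_div_iff₀' hμ]; exact c2
  have k1 : 5 * (k ^ 2 + Cb * a) * I1 ≤ 5 * (k ^ 2 + Cb * a) * (Q / a ^ 2) := by gcongr
  have k2 : 5 * (Cb / a + Cb * P * Qm) * I2 ≤ 5 * (Cb / a + Cb * P * Qm) * (Q / μ) := by gcongr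
  have k3 : 5 * (Cb / 2 * P * Q) * I3 ≤ 5 * (Cb / 2 * P * Q) * (Qm / μ) := by gcongr
  have k4 : 5 * (Cb / 2 * P * Q) * I4 ≤ 5 * (Cb / 2 * P * Q) * (Qm / μ) := by gcongr
  -- The two groups of coefficients are exactly those bounded by `μ/8` in `hca` and `hQm`.
  have e1 : 5 * (k ^ 2 + Cb * a) * (Q / a ^ 2) + 5 * (Cb / a + Cb * P * Qm) * (Q / μ)
      + 5 * (Cb / 2 * P * Q) * (Qm / μ) + 5 * (Cb / 2 * P * Q) * (Qm / μ)
      = (5 * (k ^ 2 / a ^ 2 + Cb * (1 + 1 / μ) / a) + 10 * Cb * P * Qm / μ) * Q := by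
    field_simp
    ring
  have e2 : (5 * (k ^ 2 / a ^ 2 + Cb * (1 + 1 / μ) / a) + 10 * Cb * P * Qm / μ) * Q
      ≤ (μ / 8 + μ / 8) * Q := by gcongr
  linarith

end Existence

/-! ### Existence for the abstract Navier–Stokes problem by continuation -/

section Existence

universe u v

variable {E : Type u} {X : Type v} [NormedAddCommGroup E] [InnerProductSpace ℝ E] [CompleteSpace E]
  [TopologicalSpace.SeparableSpace E] [NormedAddCommGroup X] [InnerProductSpace ℝ X]
  [CompleteSpace X] {J : E →L[ℝ] X} {T μ k Cb : ℝ} {K : E →L[ℝ] E} {B : E →L[ℝ] E →L[ℝ] E}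

lemma smul_mem_closure_range {x : X} (hx : x ∈ closure (range J)) (c : ℝ) :
    c • x ∈ closure (range J) :=
  map_mem_closure (continuous_const_smul c) hx (by
    rintro _ ⟨ψ, rfl⟩; exact ⟨c • ψ, by simp⟩)

/-- A solution of the abstract Navier–Stokes problem persists under small perturbations of the
data. -/
lemma exists_perturbed_traj (hT : 0 < T) (hJc : IsCompactOperator J) (hJ : Function.Injective J)
    (hμ : 0 < μ) (hB : IsConvective J B Cb) (hK : IsZerothOrder J K μ k) {u F : ℝ → E} {w : ℝ → X}
    (hu : IsTraj J T u F w) {a Θ Qm ρ : ℝ} (ha : 0 < a)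
    (hΘ : ∫ s in 0..T, weightRate u w s ≤ Θ)
    (hca : 5 * (k ^ 2 / a ^ 2 + Cb * (1 + 1 / μ) / a) ≤ μ / 8)
    (hQm : 10 * Cb * Real.exp (a ^ 2 * Θ) * Qm / μ ≤ μ / 8) (hρ : 0 < ρ) (hρQ : ρ ^ 2 = μ * Qm / 2)
    {x : X} (hx : x ∈ closure (range J)) (hxQ : ‖x‖ ^ 2 ≤ Qm / 2) {g : ℝ → E}
    (hg : MemLp g 2 (timeMeasure T)) (hgρ : ∫ t, ‖g t‖ ^ 2 ∂(timeMeasure T) ≤ (ρ / 4) ^ 2) :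
    ∃ d e, IsTraj J T d (fun t => g t - perturbation K B u d t - μ • d t) e ∧ e 0 = x := by
  -- Since `q² = p`, a forcing written as `q⁻¹ G` has as its `p`-weighted norm the plain `L²` norm
  -- of `G`. The fixed point argument can then run in an ordinary ball.
  set q := weight (a ^ 2 / 2) u w with hq
  set p := weight (a ^ 2) u w with hp
  have hqp : ∀ t, q t ^ 2 = p t := fun t => weight_sq _ _
  have hq0 : ∀ t, 0 < q t := fun t => weight_pos _ _ _ _
  have hqc : ContinuousOn q (Icc 0 T) := (hu.weight_primitive hT _).continuousOn hT.le
  have hqc' : ContinuousOn (fun t => (q t)⁻¹) (Icc 0 T) := hqc.inv₀ fun t _ => (hq0 t).ne'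
  have hGm : ∀ G : Lp E 2 (timeMeasure T), MemLp (fun t => (q t)⁻¹ • G t) 2 (timeMeasure T) :=
    fun G => memLp_smul_of_continuousOn hqc' (Lp.memLp G)
  choose d e hd he using fun G : Lp E 2 (timeMeasure T) =>
    exists_linear_traj hT hJc hJ hμ hx (hGm G)
  have hNm : ∀ G, MemLp (perturbation K B u (d G)) 2 (timeMeasure T) := fun G =>
    hB.memLp_perturbation hu (hd G)
  have hΦm : ∀ G, MemLp (fun t => q t • (g t - perturbation K B u (d G) t)) 2 (timeMeasure T) :=
    fun G => memLp_smul_of_continuousOn hqc (hg.sub (hNm G))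
  -- A fixed point `G` satisfies `q⁻¹ G = g - perturbation`, which says that the linear solution
  -- with forcing `q⁻¹ G` solves the nonlinear problem.
  let Φ : Lp E 2 (timeMeasure T) → Lp E 2 (timeMeasure T) := fun G => (hΦm G).toLp _
  have hp0 : ∀ t, 0 < p t := fun t => weight_pos _ _ _ _
  have hpG : ∀ G : Lp E 2 (timeMeasure T),
      ∫ s in (0:ℝ)..T, p s * ‖(q s)⁻¹ • G s‖ ^ 2 = ‖G‖ ^ 2 := fun G => by
    rw [Lp_norm_sq_eq_integral, intervalIntegral_eq_timeMeasure hT.le]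
    refine integral_congr_ae (Eventually.of_forall fun t => ?_)
    simp only [norm_smul, mul_pow, norm_inv, Real.norm_of_nonneg (hq0 t).le, ← hqp t]
    have := (hq0 t).ne'
    field_simp
  have hpGd : ∀ G G' : Lp E 2 (timeMeasure T),
      ∫ s in (0:ℝ)..T, p s * ‖(q s)⁻¹ • G s - (q s)⁻¹ • G' s‖ ^ 2 = ‖G - G'‖ ^ 2 := fun G G' => by
    rw [← hpG (G - G'), intervalIntegral_eq_timeMeasure hT.le, intervalIntegral_eq_timeMeasure hT.le]
    refine integral_congr_ae ?_
    filter_upwards [Lp.coeFn_sub G G'] with t ht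
    rw [ht, Pi.sub_apply, smul_sub]
  have hball : ∀ G : Lp E 2 (timeMeasure T), ‖G‖ ≤ ρ →
      ‖e G 0‖ ^ 2 + μ⁻¹ * ∫ s in (0:ℝ)..T, p s * ‖(q s)⁻¹ • G s‖ ^ 2 ≤ Qm := fun G hG => by
    rw [hpG, he]
    have h1 : ‖G‖ ^ 2 ≤ ρ ^ 2 := by gcongr
    have h2 : μ⁻¹ * ‖G‖ ^ 2 ≤ μ⁻¹ * (μ * Qm / 2) := by rw [← hρQ]; gcongr
    have h3 : μ⁻¹ * (μ * Qm / 2) = Qm / 2 := by field_simp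
    linarith
  have hQm0 : 0 < Qm := by
    have : 0 < μ * Qm / 2 := by rw [← hρQ]; positivity
    by_contra hcon
    push Not at hcon
    have := mul_nonpos_of_nonneg_of_nonpos hμ.le hcon
    linarith
  have hdiff : ∀ G G' : Lp E 2 (timeMeasure T), ‖Φ G - Φ G'‖ ^ 2
      = ∫ s in (0:ℝ)..T, p s * ‖perturbation K B u (d G) s - perturbation K B u (d G') s‖ ^ 2 := by
    intro G G'
    rw [Lp_norm_sq_eq_integral, intervalIntegral_eq_timeMeasure hT.le]
    refine integral_congr_ae ?_
    filter_upwards [Lp.coeFn_sub (Φ G) (Φ G'), (hΦm G).coeFn_toLp, (hΦm G').coeFn_toLp]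
      with t h1 h2 h3
    rw [h1, Pi.sub_apply, h2, h3, ← smul_sub, norm_smul, mul_pow, Real.norm_of_nonneg (hq0 t).le,
      hqp, sub_sub_sub_cancel_left, norm_sub_rev]
  have hlip : ∀ G G' : Lp E 2 (timeMeasure T), ‖G‖ ≤ ρ → ‖G'‖ ≤ ρ →
      ‖Φ G - Φ G'‖ ≤ 1 / 2 * ‖G - G'‖ := by
    intro G G' hG hG'
    have h1 := perturbation_lipschitz hT hJc hJ hμ hB hK hu ha hΘ hca hQm (hGm G) (hGm G')
      (hd G) (hd G') (hball G hG) (hball G' hG')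
    rw [← hdiff, hpGd, he, he, sub_self, norm_zero] at h1
    -- The initial values agree, and `(μ/4) μ⁻¹ = (1/2)²`.
    refine le_of_sq_le_sq (h1.trans (le_of_eq ?_)) (by positivity)
    field_simp
    ring
  have hself : ∀ G : Lp E 2 (timeMeasure T), ‖G‖ ≤ ρ → ‖Φ G‖ ≤ ρ := by
    intro G hG
    have hqg : MemLp (fun t => q t • g t) 2 (timeMeasure T) := memLp_smul_of_continuousOn hqc hg
    have hqN : MemLp (fun t => q t • perturbation K B u (d G) t) 2 (timeMeasure T) :=
      memLp_smul_of_continuousOn hqc (hNm G)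
    have hsplit : Φ G = hqg.toLp _ - hqN.toLp _ := by
      rw [← MemLp.toLp_sub]
      refine (MemLp.toLp_eq_toLp_iff _ _).2 (Eventually.of_forall fun t => ?_)
      simp [smul_sub]
    have h1 : ‖hqg.toLp _‖ ≤ ρ / 4 := by
      refine le_of_sq_le_sq ?_ (by positivity)
      rw [Lp_norm_sq_eq_integral]
      refine le_trans (integral_mono_ae (integrable_norm_sq_of_memLp (Lp.memLp _))
        (integrable_norm_sq_of_memLp hg) ?_) hgρ
      filter_upwards [hqg.coeFn_toLp, ae_restrict_mem measurableSet_Ioo] with t ht htI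
      rw [ht, norm_smul, mul_pow, Real.norm_of_nonneg (hq0 t).le]
      have h2 : q t ≤ 1 := weight_le_one (by positivity) htI.1.le
      have h3 : q t ^ 2 ≤ 1 := pow_le_one₀ (hq0 t).le h2
      nlinarith [sq_nonneg ‖g t‖]
    -- Comparison with the zero perturbation: the squared norm is at most `(μ/4) Qm = ρ²/2`, and
    -- `1/2 ≤ (3/4)²`. The remaining quarter of the radius is left for `g`.
    have h2 : ‖hqN.toLp _‖ ≤ 3 / 4 * ρ := by
      refine le_of_sq_le_sq ?_ (by positivity)
      have h0 : IsTraj J T (fun _ => (0 : E)) (fun t => (fun _ => (0 : E)) t - μ • (fun _ => (0 : E)) t)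
          (fun _ => (0 : X)) := by simpa using isTraj_zero J T
      have h3 := perturbation_lipschitz hT hJc hJ hμ hB hK hu ha hΘ hca hQm (hGm G) MemLp.zero
        (hd G) h0 (hball G hG) (by simpa using hQm0.le)
      have h4 := mul_le_mul_of_nonneg_left (hball G hG) (by positivity : 0 ≤ μ / 4)
      rw [Lp_norm_sq_eq_integral]
      have h5 : ∫ t, ‖hqN.toLp _ t‖ ^ 2 ∂(timeMeasure T) = ∫ s in (0:ℝ)..T, p s
          * ‖perturbation K B u (d G) s - perturbation K B u (fun _ => 0) s‖ ^ 2 := by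
        rw [intervalIntegral_eq_timeMeasure hT.le]
        refine integral_congr_ae ?_
        filter_upwards [hqN.coeFn_toLp] with t ht
        rw [ht, norm_smul, mul_pow, Real.norm_of_nonneg (hq0 t).le, hqp]
        simp [perturbation]
      rw [h5]
      simp only [sub_zero, Pi.zero_apply] at h3
      refine h3.trans (h4.trans ?_)
      nlinarith
    rw [hsplit]
    have := norm_sub_le (hqg.toLp _) (hqN.toLp _)
    linarith
  have hmaps : MapsTo Φ (Metric.closedBall 0 ρ) (Metric.closedBall 0 ρ) := fun G hG => by
    rw [mem_closedBall_zero_iff] at hG ⊢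
    exact hself G hG
  have hcontr : ContractingWith (1 / 2 : ℝ≥0) (hmaps.restrict Φ _ _) := by
    refine ⟨by rw [← NNReal.coe_lt_coe]; norm_num, LipschitzWith.of_dist_le_mul ?_⟩
    rintro ⟨G, hG⟩ ⟨G', hG'⟩
    rw [mem_closedBall_zero_iff] at hG hG'
    have := hlip G G' hG hG'
    rw [Subtype.dist_eq, Subtype.dist_eq, dist_eq_norm, dist_eq_norm]
    simpa using this
  obtain ⟨G, hG, hfix, -⟩ := hcontr.exists_fixedPoint' Metric.isClosed_closedBall.isComplete hmaps
    (Metric.mem_closedBall_self hρ.le) (edist_ne_top _ _)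
  refine ⟨d G, e G, (hd G).congr hT.le EventuallyEq.rfl ?_, he G⟩
  have hae : G =ᵐ[timeMeasure T] fun t => q t • (g t - perturbation K B u (d G) t) := by
    have := (hΦm G).coeFn_toLp
    rwa [show (hΦm G).toLp _ = G from hfix] at this
  filter_upwards [hae] with t ht
  rw [ht, smul_smul, inv_mul_cancel₀ (hq0 t).ne', one_smul]

lemma rhs_add_perturbation (μ : ℝ) (K : E →L[ℝ] E) (B : E →L[ℝ] E →L[ℝ] E) (u d g : ℝ → E)
    (σ δ t : ℝ) :
    (σ • g t - μ • u t - K (u t) - B (u t) (u t))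
        + (δ • g t - perturbation K B u d t - μ • d t)
      = (σ + δ) • g t - μ • (u t + d t) - K (u t + d t) - B (u t + d t) (u t + d t) := by
  simp only [perturbation, map_add, add_apply, smul_add, add_smul]
  abel

set_option maxHeartbeats 1000000 in
/-- Existence for the abstract Navier–Stokes problem, by continuation in the size of the data. -/
theorem exists_nsTraj (hT : 0 < T) (hJc : IsCompactOperator J) (hJ : Function.Injective J)
    (hμ : 0 < μ) (hB : IsConvective J B Cb) (hK : IsZerothOrder J K μ k) {x : X}
    (hx : x ∈ closure (range J)) {g : ℝ → E} (hg : MemLp g 2 (timeMeasure T)) :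
    ∃ u w, IsNSTraj J T μ K B g u w ∧ w 0 = x := by
  set N₀ := ∫ t, ‖g t‖ ^ 2 ∂(timeMeasure T) with hN₀
  have hN₀0 : 0 ≤ N₀ := integral_nonneg fun t => by positivity
  set c := ‖x‖ ^ 2 + 2 / μ * N₀ with hc
  have hc0 : 0 ≤ c := by positivity
  set Λ := 2 * ∫ _t, μ ∂(timeMeasure T) with hΛ
  have hΛ0 : 0 ≤ Λ := mul_nonneg two_pos.le (integral_nonneg fun t => hμ.le)
  set R := c * Real.exp Λ with hR
  set R₂ := 2 / μ * (c * (1 + Λ * Real.exp Λ)) with hR₂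
  set Θ := T + R * R₂ with hΘ
  have hzero : IsNSTraj J T μ K B (fun _ => 0) (fun _ => 0) (fun _ => 0) := by
    simpa [IsNSTraj] using isTraj_zero J T
  have hsmul : ∀ σ : ℝ, MemLp (fun t => σ • g t) 2 (timeMeasure T) := fun σ => hg.const_smul σ
  have hInt_smul : ∀ σ : ℝ, ∫ t, ‖σ • g t‖ ^ 2 ∂(timeMeasure T) = σ ^ 2 * N₀ := fun σ => by
    simp_rw [norm_smul, mul_pow, Real.norm_eq_abs, sq_abs, integral_const_mul, hN₀]
  -- Stability relative to the zero solution bounds every solution with data scaled by `σ ≤ 1`.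
  -- Hence `Θ`, and with it the admissible size of a step, does not depend on the stage of the
  -- continuation.
  have apriori : ∀ σ : ℝ, 0 ≤ σ → σ ≤ 1 → ∀ u w, IsNSTraj J T μ K B (fun t => σ • g t) u w →
      w 0 = σ • x → ∫ s in 0..T, weightRate u w s ≤ Θ := by
    intro σ hσ0 hσ1 u w h h0
    have hs2 : σ ^ 2 ≤ 1 := pow_le_one₀ hσ0 hσ1
    obtain ⟨h1, h2⟩ := h.stability hT hJc hJ hμ hB hK hzero (hsmul σ) MemLp.zero rfl rfl
    simp only [sub_zero, map_zero, norm_zero, h0, norm_smul, mul_pow, Real.norm_eq_abs,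
      sq_abs, ne_eq, OfNat.ofNat_ne_zero, not_false_eq_true, zero_pow, mul_zero, add_zero,
      integral_const_mul, ← hN₀] at h1 h2
    rw [← hΛ] at h1 h2
    have hcs : σ ^ 2 * ‖x‖ ^ 2 + 2 / μ * (σ ^ 2 * N₀) ≤ c := by
      rw [hc]
      have h3 : σ ^ 2 * ‖x‖ ^ 2 ≤ 1 * ‖x‖ ^ 2 := by gcongr
      have h4 : σ ^ 2 * N₀ ≤ 1 * N₀ := by gcongr
      have h5 : 2 / μ * (σ ^ 2 * N₀) ≤ 2 / μ * (1 * N₀) := by gcongr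
      linarith
    have b1 : ∀ t ∈ Icc 0 T, ‖w t‖ ^ 2 ≤ R := fun t ht =>
      (h1 t ht).trans (by rw [hR]; gcongr)
    have b2 : ∫ t, ‖u t‖ ^ 2 ∂(timeMeasure T) ≤ R₂ := by
      have h3 : μ / 2 * ∫ t, ‖u t‖ ^ 2 ∂(timeMeasure T) ≤ c * (1 + Λ * Real.exp Λ) :=
        h2.trans (by gcongr)
      rw [hR₂, div_mul_eq_mul_div, le_div_iff₀ hμ]
      linarith
    have hR0 : 0 ≤ R := by positivity
    rw [intervalIntegral_eq_timeMeasure hT.le]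
    have hui := integrable_norm_sq_of_memLp h.memLp
    calc ∫ s, weightRate u w s ∂(timeMeasure T)
        ≤ ∫ s, (1 + R * ‖u s‖ ^ 2) ∂(timeMeasure T) := by
          refine integral_mono_ae ((integrable_const _).add h.integrable_sq_mul_sq)
            ((integrable_const _).add (hui.const_mul R)) ?_
          filter_upwards [ae_restrict_mem measurableSet_Ioo] with t ht
          have := b1 t ⟨ht.1.le, ht.2.le⟩
          simp only [weightRate]
          gcongr
      _ = T + R * ∫ s, ‖u s‖ ^ 2 ∂(timeMeasure T) := by
          rw [integral_add (integrable_const _) (hui.const_mul R), integral_const_mul]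
          simp [hT.le]
      _ ≤ Θ := by rw [hΘ]; gcongr
  have hCb := hB.nonneg
  have hk := hK.nonneg
  -- `a` exceeds `1`, so `1/a² ≤ 1/a`, and `D` is chosen so that what remains is `(μ/40) D/(1 + D) ≤
  -- μ/40`.
  obtain ⟨a, ha1, ha⟩ : ∃ a : ℝ, 1 ≤ a ∧ 5 * (k ^ 2 / a ^ 2 + Cb * (1 + 1 / μ) / a) ≤ μ / 8 := by
    set D := 40 / μ * (k ^ 2 + Cb * (1 + 1 / μ)) with hD
    have hD0 : 0 ≤ D := by positivity
    refine ⟨1 + D, by linarith, ?_⟩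
    have h1 : (0:ℝ) < 1 + D := by linarith
    have h2 : k ^ 2 / (1 + D) ^ 2 ≤ k ^ 2 / (1 + D) := by
      gcongr
      nlinarith
    have h3 : k ^ 2 / (1 + D) + Cb * (1 + 1 / μ) / (1 + D)
        = μ / 40 * D / (1 + D) := by
      rw [hD]; field_simp
    have h4 : μ / 40 * D / (1 + D) ≤ μ / 40 := by
      rw [div_le_iff₀ h1]
      have : 0 < μ / 40 := by positivity
      nlinarith
    linarith
  have ha0 : 0 < a := by linarith
  set P := Real.exp (a ^ 2 * Θ) with hP
  have hP0 : 0 < P := Real.exp_pos _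
  -- The value that turns the quadratic condition into `Cb/(Cb + 1) ≤ 1`; the `+ 1` covers `Cb = 0`.
  set Qm := μ ^ 2 / (80 * (Cb + 1) * P) with hQm
  have hQm0 : 0 < Qm := by positivity
  have hQmle : 10 * Cb * P * Qm / μ ≤ μ / 8 := by
    have : 10 * Cb * P * Qm / μ = μ / 8 * (Cb / (Cb + 1)) := by
      rw [hQm]; field_simp; ring
    rw [this]
    have h2 : Cb / (Cb + 1) ≤ 1 := by rw [div_le_one (by positivity)]; linarith
    have : 0 < μ / 8 := by positivity
    nlinarith
  set ρ := Real.sqrt (μ * Qm / 2) with hρ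
  have hρ0 : 0 < ρ := by positivity
  have hρ2 : ρ ^ 2 = μ * Qm / 2 := Real.sq_sqrt (by positivity)
  -- One step adds `1/m` of the data, whose squared norms scale by `1/m² ≤ 1/m`. It is therefore
  -- enough that `m` exceed both quotients.
  obtain ⟨n, hn⟩ := exists_nat_gt (max (2 * ‖x‖ ^ 2 / Qm) (16 * N₀ / ρ ^ 2))
  set m : ℝ := (n : ℝ) + 1 with hm
  have hm1 : 1 ≤ m := by rw [hm]; linarith [n.cast_nonneg (α := ℝ)]
  have hm0 : 0 < m := by linarith
  have hmsq : m ≤ m ^ 2 := by nlinarith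
  have hx2 : ‖(1 / m) • x‖ ^ 2 ≤ Qm / 2 := by
    have h1 : 2 * ‖x‖ ^ 2 / Qm < m := by linarith [(le_max_left _ _).trans_lt hn]
    rw [div_lt_iff₀ hQm0] at h1
    rw [norm_smul, mul_pow, Real.norm_of_nonneg (by positivity), div_pow, one_pow, div_mul_eq_mul_div,
      div_le_iff₀ (by positivity)]
    nlinarith
  have hg2 : ∫ t, ‖(1 / m) • g t‖ ^ 2 ∂(timeMeasure T) ≤ (ρ / 4) ^ 2 := by
    have h1 : 16 * N₀ / ρ ^ 2 < m := by linarith [(le_max_right _ _).trans_lt hn]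
    rw [div_lt_iff₀ (by positivity)] at h1
    rw [hInt_smul, div_pow, one_pow, div_mul_eq_mul_div, div_le_iff₀ (by positivity)]
    nlinarith [sq_nonneg ρ]
  -- Each solution found is the reference trajectory for the next step; the data at step `j` are
  -- `j/m` times the full data.
  have hind : ∀ j : ℕ, (j : ℝ) ≤ m →
      ∃ u w, IsNSTraj J T μ K B (fun t => ((j : ℝ) / m) • g t) u w ∧ w 0 = ((j : ℝ) / m) • x := by
    intro j
    induction j with
    | zero => intro _; exact ⟨_, _, by simpa using hzero, by simp⟩
    | succ j ih =>
      intro hj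
      push_cast at hj
      obtain ⟨u, w, h, h0⟩ := ih (by linarith)
      have hΘu := apriori ((j : ℝ) / m) (by positivity) (by rw [div_le_one hm0]; linarith) u w h h0
      obtain ⟨d, e, hd, he⟩ := exists_perturbed_traj hT hJc hJ hμ hB hK h ha0 hΘu ha hQmle hρ0 hρ2
        (smul_mem_closure_range hx (1 / m)) hx2 (hsmul (1 / m)) hg2
      refine ⟨fun t => u t + d t, fun t => w t + e t,
        (IsTraj.add h hd).congr hT.le EventuallyEq.rfl (Eventually.of_forall fun t => ?_), ?_⟩
      · rw [Nat.cast_succ, add_div]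
        exact rhs_add_perturbation μ K B u d g _ _ t
      · simp only [h0, he, Nat.cast_succ, add_div, add_smul]
  obtain ⟨u, w, h, h0⟩ := hind (n + 1) (by push_cast; rfl)
  have e1 : ((n + 1 : ℕ) : ℝ) / m = 1 := by
    rw [hm]; push_cast; exact div_self (by positivity)
  rw [e1] at h h0
  exact ⟨u, w, by simpa using h, by simpa using h0⟩

end Existence

/-! ### The abstract stationary problem -/

section Stationary

universe u v w

variable {E : Type u} {X : Type v} {Y : Type w} [NormedAddCommGroup E] [InnerProductSpace ℝ E]
  [CompleteSpace E] [NormedAddCommGroup X] [InnerProductSpace ℝ X] [CompleteSpace X]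
  [NormedAddCommGroup Y] [InnerProductSpace ℝ Y] [CompleteSpace Y]
  {J : E →L[ℝ] X} {D : E →L[ℝ] Y} {M : X →L[ℝ] X} {B : E →L[ℝ] E →L[ℝ] E} {f : X} {μ c N : ℝ}

/-- The abstract stationary Navier–Stokes problem. -/
def IsNSStationary (J : E →L[ℝ] X) (D : E →L[ℝ] Y) (M : X →L[ℝ] X) (B : E →L[ℝ] E →L[ℝ] E)
    (f : X) (μ : ℝ) (v : E) : Prop :=
  ∀ ψ, μ * ⟪D v, D ψ⟫_ℝ + ⟪M (J v), J ψ⟫_ℝ + ⟪B v v, ψ⟫_ℝ = ⟪f, J ψ⟫_ℝ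

/-- The structural assumptions of the stationary problem: the Poincaré inequality and bounds for
the convective term in terms of the Dirichlet norm. -/
structure IsDirichletConvective (J : E →L[ℝ] X) (D : E →L[ℝ] Y) (B : E →L[ℝ] E →L[ℝ] E)
    (c N : ℝ) : Prop where
  const_nonneg : 0 ≤ c
  bound_nonneg : 0 ≤ N
  norm_sq : ∀ v, ‖v‖ ^ 2 = ‖J v‖ ^ 2 + ‖D v‖ ^ 2
  poincare : ∀ v, ‖J v‖ ≤ c * ‖D v‖
  bound : ∀ u v w, |⟪B u v, w⟫_ℝ| ≤ N * ‖D u‖ * ‖D v‖ * ‖D w‖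
  skew : ∀ u v, ⟪B u v, v⟫_ℝ = 0

lemma le_of_mul_sq_le {x y m : ℝ} (hx : 0 ≤ x) (hy : 0 ≤ y) (hm : 0 < m)
    (h : m * x ^ 2 ≤ y * x) : x ≤ y / m := by
  rw [le_div_iff₀ hm]
  rcases hx.eq_or_lt with rfl | hx
  · simpa using hy
  · nlinarith

lemma IsDirichletConvective.norm_sq_le (h : IsDirichletConvective J D B c N) (v : E) :
    ‖v‖ ^ 2 ≤ (1 + c ^ 2) * ‖D v‖ ^ 2 := by
  have h1 : ‖J v‖ ^ 2 ≤ (c * ‖D v‖) ^ 2 := by gcongr; exact h.poincare v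
  rw [h.norm_sq]
  nlinarith

/-- The Oseen-type linearisation of the stationary problem is uniquely solvable. -/
lemma IsDirichletConvective.exists_linearized (h : IsDirichletConvective J D B c N) (hμ : 0 < μ)
    (hM : ∀ x, 0 ≤ ⟪M x, x⟫_ℝ) (f : X) (w : E) :
    ∃ v, ∀ ψ, μ * ⟪D v, D ψ⟫_ℝ + ⟪M (J v), J ψ⟫_ℝ + ⟪B w v, ψ⟫_ℝ = ⟪f, J ψ⟫_ℝ := by
  set A : E →L[ℝ] E := μ • (D.adjoint ∘L D) + J.adjoint ∘L M ∘L J + B w with hA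
  have hAi : ∀ v ψ, ⟪A v, ψ⟫_ℝ = μ * ⟪D v, D ψ⟫_ℝ + ⟪M (J v), J ψ⟫_ℝ + ⟪B w v, ψ⟫_ℝ := by
    intro v ψ
    simp [hA, inner_add_left, inner_smul_left, ContinuousLinearMap.adjoint_inner_left]
  -- Lax–Milgram: on the diagonal the convective term drops out and `M` is nonnegative, so
  -- coercivity in the norm of `E` is Poincaré's inequality.
  have hc : IsCoercive ((innerSL ℝ) ∘L A) := by
    refine ⟨μ / (1 + c ^ 2), by positivity, fun v => ?_⟩
    have h1 := h.norm_sq_le v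
    have h2 : ((innerSL ℝ) ∘L A) v v = μ * ‖D v‖ ^ 2 + ⟪M (J v), J v⟫_ℝ := by
      rw [ContinuousLinearMap.comp_apply, innerSL_apply_apply, hAi, h.skew, add_zero,
        real_inner_self_eq_norm_sq]
    rw [h2, mul_assoc, ← sq, div_mul_eq_mul_div, div_le_iff₀ (by positivity)]
    have h3 := hM (J v)
    have h4 : 0 ≤ ⟪M (J v), J v⟫_ℝ * (1 + c ^ 2) := by positivity
    nlinarith
  obtain ⟨v, hv⟩ := hc.continuousLinearEquivOfBilin.surjective (J.adjoint f)
  refine ⟨v, fun ψ => ?_⟩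
  rw [← hAi, ← ContinuousLinearMap.adjoint_inner_left, ← hv, hc.continuousLinearEquivOfBilin_apply]
  rfl

/-- Testing with the solution itself kills the convective term, and Poincaré's inequality bounds the
forcing. -/
lemma IsDirichletConvective.norm_linearized_le (h : IsDirichletConvective J D B c N) (hμ : 0 < μ)
    (hM : ∀ x, 0 ≤ ⟪M x, x⟫_ℝ) {w v : E}
    (hv : ∀ ψ, μ * ⟪D v, D ψ⟫_ℝ + ⟪M (J v), J ψ⟫_ℝ + ⟪B w v, ψ⟫_ℝ = ⟪f, J ψ⟫_ℝ) :
    ‖D v‖ ≤ c * ‖f‖ / μ := by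
  refine le_of_mul_sq_le (norm_nonneg _) (mul_nonneg h.const_nonneg (norm_nonneg _)) hμ ?_
  have h1 := hv v
  rw [h.skew, add_zero, real_inner_self_eq_norm_sq] at h1
  have h2 := real_inner_le_norm f (J v)
  have h3 := mul_le_mul_of_nonneg_left (h.poincare v) (norm_nonneg f)
  linarith [hM (J v)]

/-- Testing the difference of the equations with `d = v₁ - v₂` removes `B(w₁, d)` by skewness; only
`B(w₁ - w₂, v₂)` and the change of the operator at `v₂` remain. With `M₁ = M₂` this is the
contraction estimate for the linearization, with `wᵢ = vᵢ` it is the source of stability for the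
nonlinear problem. -/
lemma IsDirichletConvective.norm_sub_linearized_le (h : IsDirichletConvective J D B c N)
    (hμ : 0 < μ) {M₁ M₂ : X →L[ℝ] X} (hM : ∀ x, 0 ≤ ⟪M₁ x, x⟫_ℝ) {w₁ w₂ v₁ v₂ : E}
    (h₁ : ∀ ψ, μ * ⟪D v₁, D ψ⟫_ℝ + ⟪M₁ (J v₁), J ψ⟫_ℝ + ⟪B w₁ v₁, ψ⟫_ℝ = ⟪f, J ψ⟫_ℝ)
    (h₂ : ∀ ψ, μ * ⟪D v₂, D ψ⟫_ℝ + ⟪M₂ (J v₂), J ψ⟫_ℝ + ⟪B w₂ v₂, ψ⟫_ℝ = ⟪f, J ψ⟫_ℝ) :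
    ‖D (v₁ - v₂)‖
      ≤ (N * ‖D v₂‖ * ‖D (w₁ - w₂)‖ + c * ‖M₁ (J v₂) - M₂ (J v₂)‖) / μ := by
  have hc := h.const_nonneg
  have hN := h.bound_nonneg
  refine le_of_mul_sq_le (norm_nonneg _) (by positivity) hμ ?_
  set d := v₁ - v₂ with hd
  have e1 := h₁ d
  have e2 := h₂ d
  have s1 := h.skew w₁ d
  have s2 := hM (J d)
  have s3 := h.bound (w₁ - w₂) v₂ d
  have s4 := real_inner_le_norm (M₂ (J v₂) - M₁ (J v₂)) (J d)
  rw [norm_sub_rev] at s4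
  have s5 := mul_le_mul_of_nonneg_left (h.poincare d) (norm_nonneg (M₁ (J v₂) - M₂ (J v₂)))
  have hv : v₁ = v₂ + d := by rw [hd]; abel
  have hw : B w₁ v₁ - B w₂ v₂ = B (w₁ - w₂) v₂ + B w₁ d := by
    simp only [hd, map_sub, sub_apply]; abel
  have e3 : ⟪B w₁ v₁, d⟫_ℝ - ⟪B w₂ v₂, d⟫_ℝ = ⟪B (w₁ - w₂) v₂, d⟫_ℝ := by
    rw [← inner_sub_left, hw, inner_add_left, s1, add_zero]
  have e4 : ⟪M₁ (J v₁), J d⟫_ℝ = ⟪M₁ (J v₂), J d⟫_ℝ + ⟪M₁ (J d), J d⟫_ℝ := by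
    rw [hv, map_add, map_add, inner_add_left]
  have e5 : ⟪D v₁, D d⟫_ℝ = ⟪D v₂, D d⟫_ℝ + ‖D d‖ ^ 2 := by
    rw [hv, map_add, inner_add_left, real_inner_self_eq_norm_sq]
  rw [inner_sub_left] at s4
  have s6 := (abs_le.1 s3).1
  rw [e5, mul_add] at e1
  nlinarith

/-- The smallness condition makes the stationary problem uniquely solvable. -/
theorem IsDirichletConvective.exists_stationary (h : IsDirichletConvective J D B c N) (hμ : 0 < μ)
    (hM : ∀ x, 0 ≤ ⟪M x, x⟫_ℝ) (hsmall : N * (c * ‖f‖ / μ) / μ < 1) :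
    ∃ v, IsNSStationary J D M B f μ v := by
  choose S hS using h.exists_linearized hμ hM f
  set κ := N * (c * ‖f‖ / μ) / μ with hκ
  have hc := h.const_nonneg
  have hN := h.bound_nonneg
  have hκ0 : 0 ≤ κ := by positivity
  -- The contraction is with respect to `‖D ·‖`, which Poincaré's inequality makes equivalent to the
  -- norm of `E`; the iteration therefore converges in `E`.
  have hlip : ∀ w₁ w₂, ‖D (S w₁ - S w₂)‖ ≤ κ * ‖D (w₁ - w₂)‖ := fun w₁ w₂ => by
    refine (h.norm_sub_linearized_le hμ hM (hS w₁) (hS w₂)).trans ?_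
    rw [sub_self, norm_zero, mul_zero, add_zero, hκ, div_mul_eq_mul_div]
    have := h.norm_linearized_le hμ hM (hS w₂)
    gcongr
  have hD : ∀ v, ‖D v‖ ≤ ‖v‖ := fun v => by
    refine le_of_sq_le_sq ?_ (norm_nonneg _)
    rw [h.norm_sq]; nlinarith [sq_nonneg ‖J v‖]
  set C := Real.sqrt (1 + c ^ 2) with hC
  have hE : ∀ v, ‖v‖ ≤ C * ‖D v‖ := fun v => by
    refine le_of_sq_le_sq ?_ (by positivity)
    rw [mul_pow, hC, Real.sq_sqrt (by positivity)]
    exact h.norm_sq_le v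
  have hcont : Continuous S := by
    have : LipschitzWith (Real.toNNReal (C * κ)) S := by
      refine LipschitzWith.of_dist_le_mul fun w₁ w₂ => ?_
      rw [dist_eq_norm, dist_eq_norm, Real.coe_toNNReal _ (by positivity), mul_assoc]
      refine (hE _).trans ?_
      have h1 := hlip w₁ w₂
      have h2 := hD (w₁ - w₂)
      gcongr
      exact h1.trans (by gcongr)
    exact this.continuous
  have hiter : ∀ n : ℕ, ‖D (S^[n] 0 - S^[n + 1] 0)‖ ≤ κ ^ n * ‖D (S 0)‖ := by
    intro n
    induction n with
    | zero => simp
    | succ n ih =>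
      rw [Function.iterate_succ_apply', Function.iterate_succ_apply' S (n + 1), pow_succ']
      refine (hlip _ _).trans ?_
      rw [mul_assoc]
      gcongr
  have hcauchy : CauchySeq fun n => S^[n] 0 := by
    refine cauchySeq_of_le_geometric κ (C * ‖D (S 0)‖) hsmall fun n => ?_
    rw [dist_eq_norm]
    refine (hE _).trans ?_
    rw [mul_assoc, mul_comm ‖D (S 0)‖]
    gcongr
    exact hiter n
  obtain ⟨v, hv⟩ := cauchySeq_tendsto_of_complete hcauchy
  have hfix : S v = v := isFixedPt_of_tendsto_iterate hv hcont.continuousAt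
  refine ⟨v, fun ψ => ?_⟩
  have := hS v ψ
  rwa [hfix] at this

/-- As the contraction constant is below `1/2`, the convective term takes up at most half of the
left side and can be absorbed; this doubles the constant. Taking `M₁ = M₂` gives uniqueness. -/
lemma IsDirichletConvective.stability (h : IsDirichletConvective J D B c N)
    (hμ : 0 < μ) {M₁ M₂ : X →L[ℝ] X} (hM₁ : ∀ x, 0 ≤ ⟪M₁ x, x⟫_ℝ) (hM₂ : ∀ x, 0 ≤ ⟪M₂ x, x⟫_ℝ)
    (hsmall : N * (c * ‖f‖ / μ) / μ < 1 / 2) {v₁ v₂ : E}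
    (h₁ : IsNSStationary J D M₁ B f μ v₁) (h₂ : IsNSStationary J D M₂ B f μ v₂) :
    ‖D (v₁ - v₂)‖ ≤ 2 * c / μ * ‖M₁ (J v₂) - M₂ (J v₂)‖ := by
  have h3 := h.norm_sub_linearized_le hμ hM₁ h₁ h₂
  have h4 := h.norm_linearized_le hμ hM₂ h₂
  have hN := h.bound_nonneg
  have h5 : N * ‖D v₂‖ * ‖D (v₁ - v₂)‖ / μ ≤ 1 / 2 * ‖D (v₁ - v₂)‖ := by
    rw [mul_div_right_comm]
    refine mul_le_mul_of_nonneg_right (le_trans ?_ hsmall.le) (norm_nonneg _)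
    gcongr
  have h6 : (N * ‖D v₂‖ * ‖D (v₁ - v₂)‖ + c * ‖M₁ (J v₂) - M₂ (J v₂)‖) / μ
    = N * ‖D v₂‖ * ‖D (v₁ - v₂)‖ / μ + c / μ * ‖M₁ (J v₂) - M₂ (J v₂)‖ := by ring
  have h7 : 2 * c / μ * ‖M₁ (J v₂) - M₂ (J v₂)‖ = 2 * (c / μ * ‖M₁ (J v₂) - M₂ (J v₂)‖) := by ring
  linarith

end Stationary

/-! ### Sobolev fields as elements of Hilbert spaces -/

section Basics

variable {Ω : Set Plane}

lemma norm_sq_eq_sval_sgrad (φ : H1 Ω) : ‖φ‖ ^ 2 = ‖sval φ‖ ^ 2 + ‖sgrad φ‖ ^ 2 :=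
  WithLp.prod_norm_sq_eq_of_L2 φ.1

lemma norm_sval_le (φ : H1 Ω) : ‖sval φ‖ ≤ ‖φ‖ :=
  le_of_sq_le_sq (by rw [norm_sq_eq_sval_sgrad]; nlinarith [sq_nonneg ‖sgrad φ‖]) (norm_nonneg _)

lemma norm_sgrad_le (φ : H1 Ω) : ‖sgrad φ‖ ≤ ‖φ‖ :=
  le_of_sq_le_sq (by rw [norm_sq_eq_sval_sgrad]; nlinarith [sq_nonneg ‖sval φ‖]) (norm_nonneg _)

/-- The underlying function as a continuous linear map. -/
def svalL (Ω : Set Plane) : H1 Ω →L[ℝ] L2 Ω ℝ :=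
  LinearMap.mkContinuous { toFun := sval, map_add' := fun _ _ => rfl, map_smul' := fun _ _ => rfl } 1
    fun φ => by rw [one_mul]; exact norm_sval_le φ

/-- The weak gradient as a continuous linear map. -/
def sgradL (Ω : Set Plane) : H1 Ω →L[ℝ] L2 Ω Plane :=
  LinearMap.mkContinuous { toFun := sgrad, map_add' := fun _ _ => rfl, map_smul' := fun _ _ => rfl } 1
    fun φ => by rw [one_mul]; exact norm_sgrad_le φ

@[simp] lemma svalL_apply (φ : H1 Ω) : svalL Ω φ = sval φ := rfl

@[simp] lemma sgradL_apply (φ : H1 Ω) : sgradL Ω φ = sgrad φ := rfl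

/-- The classical gradient in coordinates. -/
def pgrad (η : Plane → ℝ) (x : Plane) : Plane :=
  WithLp.toLp 2 fun i => fderiv ℝ η x (EuclideanSpace.single i 1)

@[simp] lemma pgrad_apply (η : Plane → ℝ) (x : Plane) (i : Fin 2) :
    pgrad η x i = fderiv ℝ η x (EuclideanSpace.single i 1) := rfl

lemma fderiv_eq_inner_pgrad (η : Plane → ℝ) (x v : Plane) :
    fderiv ℝ η x v = ⟪pgrad η x, v⟫_ℝ := by
  have hv : v = ∑ i, v i • EuclideanSpace.single i (1 : ℝ) := by
    ext j
    fin_cases j <;> simp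
  conv_lhs => rw [hv]
  rw [map_sum, PiLp.inner_apply]
  simp

/-- Membership in `H¹` as orthogonality. -/
lemma mem_H1Sub_iff (p : WithLp 2 (L2 Ω ℝ × L2 Ω Plane)) :
    p ∈ H1Sub Ω ↔ HasWeakGradient Ω p.fst p.snd := Iff.rfl

lemma continuous_integral_mul {h : Plane → ℝ} (hh : MemLp h 2 (volume.restrict Ω)) :
    Continuous fun u : L2 Ω ℝ => ∫ x in Ω, u x * h x := by
  have : (fun u : L2 Ω ℝ => ∫ x in Ω, u x * h x) = fun u => ⟪hh.toLp h, u⟫_ℝ := by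
    ext u
    rw [L2.inner_def]
    refine integral_congr_ae ?_
    filter_upwards [hh.coeFn_toLp] with x hx
    simp [hx]
  rw [this]
  fun_prop

lemma continuous_integral_inner {F : Type} [NormedAddCommGroup F] [InnerProductSpace ℝ F]
    {h : Plane → F} (hh : MemLp h 2 (volume.restrict Ω)) :
    Continuous fun u : L2 Ω F => ∫ x in Ω, ⟪h x, u x⟫_ℝ := by
  have : (fun u : L2 Ω F => ∫ x in Ω, ⟪h x, u x⟫_ℝ) = fun u => ⟪hh.toLp h, u⟫_ℝ := by
    ext u
    rw [L2.inner_def]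
    refine integral_congr_ae ?_
    filter_upwards [hh.coeFn_toLp] with x hx
    simp [hx]
  rw [this]
  fun_prop

lemma memLp_smul_const {h : Plane → ℝ} (hh : MemLp h 2 (volume.restrict Ω)) (e : Plane) :
    MemLp (fun x => h x • e) 2 (volume.restrict Ω) :=
  ((ContinuousLinearMap.id ℝ ℝ).smulRight e).comp_memLp' hh

/-- For each test function the defining identity compares `L²` pairings with fixed square-integrable
functions, so it is a closed condition on the pair. This is the completeness of `H¹(Ω)`. -/
lemma isClosed_H1Sub (Ω : Set Plane) : IsClosed (H1Sub Ω : Set (WithLp 2 (L2 Ω ℝ × L2 Ω Plane))) := by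
  have : (H1Sub Ω : Set (WithLp 2 (L2 Ω ℝ × L2 Ω Plane))) =
      ⋂ (η : Plane → ℝ) (_ : IsTestFunction Ω η) (i : Fin 2),
        {p | ∫ x in Ω, p.fst x * fderiv ℝ η x (EuclideanSpace.single i 1)
          = - ∫ x in Ω, ⟪η x • EuclideanSpace.single i (1:ℝ), p.snd x⟫_ℝ} := by
    ext p
    simp only [mem_iInter, mem_ofPred_eq, SetLike.mem_coe, mem_H1Sub_iff, HasWeakGradient]
    refine forall_congr' fun η => forall_congr' fun hη => forall_congr' fun i => ?_
    simp [inner_smul_left, EuclideanSpace.inner_single_left, mul_comm]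
  rw [this]
  refine isClosed_iInter fun η => isClosed_iInter fun hη => isClosed_iInter fun i => ?_
  refine isClosed_eq ?_ ?_
  · exact (continuous_integral_mul (test_deriv_memLp Ω hη i)).comp
      (WithLp.prod_continuous_ofLp 2 _ _).fst
  · exact ((continuous_integral_inner (memLp_smul_const (test_memLp Ω hη) _)).comp
      (WithLp.prod_continuous_ofLp 2 _ _).snd).neg

instance : CompleteSpace (H1 Ω) :=
  (isClosed_H1Sub Ω).completeSpace_coe

instance : SecondCountableTopology (H1 Ω) := by
  have : Fact ((2 : ℝ≥0∞) ≠ ⊤) := ⟨ENNReal.ofNat_ne_top⟩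
  have h1 : SecondCountableTopology (L2 Ω ℝ) := Lp.SecondCountableTopology
  have h2 : SecondCountableTopology (L2 Ω Plane) := Lp.SecondCountableTopology
  have h3 : SecondCountableTopology (L2 Ω ℝ × L2 Ω Plane) :=
    TopologicalSpace.instSecondCountableTopologyProd
  have : SecondCountableTopology (WithLp 2 (L2 Ω ℝ × L2 Ω Plane)) :=
    (WithLp.prodContinuousLinearEquiv 2 ℝ (L2 Ω ℝ) (L2 Ω Plane)).toHomeomorph.secondCountableTopology
  exact inferInstanceAs (SecondCountableTopology (H1Sub Ω))


instance : CompleteSpace (H1Vec Ω) := inferInstance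

instance : SecondCountableTopology (H1Vec Ω) :=
  (PiLp.homeomorph 2 (fun _ : Fin 2 => H1 Ω)).secondCountableTopology

/-- The values of a Sobolev vector field, as an element of `L²(Ω)²`. -/
def velL (Ω : Set Plane) : H1Vec Ω →L[ℝ] L2 Ω Plane :=
  ∑ i : Fin 2, ((ContinuousLinearMap.id ℝ ℝ).smulRight
    (EuclideanSpace.single i (1 : ℝ) : Plane)).compLpL 2 (volume.restrict Ω)
      ∘L svalL Ω ∘L PiLp.proj 2 (fun _ : Fin 2 => H1 Ω) i

/-- The inclusion of the `i`-th row into matrices. -/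
def rowSingle (i : Fin 2) : Plane →L[ℝ] PiLp 2 (fun _ : Fin 2 => Plane) :=
  (PiLp.continuousLinearEquiv 2 ℝ (fun _ : Fin 2 => Plane)).symm.toContinuousLinearMap ∘L
    ContinuousLinearMap.single ℝ (fun _ : Fin 2 => Plane) i

lemma rowSingle_apply (i j : Fin 2) (x : Plane) : rowSingle i x j = if j = i then x else 0 := by
  simp only [rowSingle, ContinuousLinearMap.comp_apply]
  change (Pi.single i x : Fin 2 → Plane) j = _
  rw [Pi.single_apply]

/-- The Jacobian of a Sobolev vector field, as an element of `L²`. -/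
def jacL (Ω : Set Plane) : H1Vec Ω →L[ℝ] L2 Ω (PiLp 2 (fun _ : Fin 2 => Plane)) :=
  ∑ i : Fin 2, (rowSingle i).compLpL 2 (volume.restrict Ω)
      ∘L sgradL Ω ∘L PiLp.proj 2 (fun _ : Fin 2 => H1 Ω) i

lemma velL_coe (v : H1Vec Ω) : velL Ω v =ᵐ[volume.restrict Ω] vel v := by
  have h : velL Ω v = ((ContinuousLinearMap.id ℝ ℝ).smulRight
      (EuclideanSpace.single 0 (1 : ℝ) : Plane)).compLpL 2 (volume.restrict Ω) (sval (v 0))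
    + ((ContinuousLinearMap.id ℝ ℝ).smulRight
      (EuclideanSpace.single 1 (1 : ℝ) : Plane)).compLpL 2 (volume.restrict Ω) (sval (v 1)) := by
    simp [velL, Fin.sum_univ_two]
  rw [h]
  filter_upwards [Lp.coeFn_add (((ContinuousLinearMap.id ℝ ℝ).smulRight
      (EuclideanSpace.single 0 (1 : ℝ) : Plane)).compLpL 2 (volume.restrict Ω) (sval (v 0)))
      (((ContinuousLinearMap.id ℝ ℝ).smulRight
      (EuclideanSpace.single 1 (1 : ℝ) : Plane)).compLpL 2 (volume.restrict Ω) (sval (v 1))),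
    ContinuousLinearMap.coeFn_compLpL ((ContinuousLinearMap.id ℝ ℝ).smulRight
      (EuclideanSpace.single 0 (1 : ℝ) : Plane)) (sval (v 0)),
    ContinuousLinearMap.coeFn_compLpL ((ContinuousLinearMap.id ℝ ℝ).smulRight
      (EuclideanSpace.single 1 (1 : ℝ) : Plane)) (sval (v 1))] with x h1 h2 h3
  rw [h1, Pi.add_apply, h2, h3]
  ext j
  fin_cases j <;> simp [vel]

lemma jacL_coe (v : H1Vec Ω) : jacL Ω v =ᵐ[volume.restrict Ω] jac v := by
  have h : jacL Ω v = (rowSingle 0).compLpL 2 (volume.restrict Ω) (sgrad (v 0))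
    + (rowSingle 1).compLpL 2 (volume.restrict Ω) (sgrad (v 1)) := by
    simp [jacL, Fin.sum_univ_two]
  rw [h]
  filter_upwards [Lp.coeFn_add ((rowSingle 0).compLpL 2 (volume.restrict Ω) (sgrad (v 0)))
      ((rowSingle 1).compLpL 2 (volume.restrict Ω) (sgrad (v 1))),
    ContinuousLinearMap.coeFn_compLpL (rowSingle 0) (sgrad (v 0)),
    ContinuousLinearMap.coeFn_compLpL (rowSingle 1) (sgrad (v 1))] with x h1 h2 h3
  rw [h1, Pi.add_apply, h2, h3]
  refine PiLp.ext fun j => ?_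
  rw [PiLp.add_apply, rowSingle_apply, rowSingle_apply]
  fin_cases j <;> simp [jac]

lemma memLp_vel (v : H1Vec Ω) : MemLp (vel v) 2 (volume.restrict Ω) :=
  (memLp_congr_ae (velL_coe v)).1 (Lp.memLp _)

lemma memLp_jac (v : H1Vec Ω) : MemLp (jac v) 2 (volume.restrict Ω) :=
  (memLp_congr_ae (jacL_coe v)).1 (Lp.memLp _)

lemma inner_velL (g : L2 Ω Plane) (v : H1Vec Ω) :
    ⟪g, velL Ω v⟫_ℝ = ∫ x in Ω, ⟪g x, vel v x⟫_ℝ := by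
  rw [L2.inner_def]
  refine integral_congr_ae ?_
  filter_upwards [velL_coe v] with x hx
  rw [hx]

lemma inner_velL_velL (u v : H1Vec Ω) :
    ⟪velL Ω u, velL Ω v⟫_ℝ = ∫ x in Ω, ⟪vel u x, vel v x⟫_ℝ := by
  rw [inner_velL]
  refine integral_congr_ae ?_
  filter_upwards [velL_coe u] with x hx
  rw [hx]

lemma inner_jacL_jacL (u v : H1Vec Ω) :
    ⟪jacL Ω u, jacL Ω v⟫_ℝ = ∫ x in Ω, ⟪jac u x, jac v x⟫_ℝ := by
  rw [L2.inner_def]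
  refine integral_congr_ae ?_
  filter_upwards [jacL_coe u, jacL_coe v] with x hx hy
  rw [hx, hy]

lemma inner_sval_add_inner_sgrad (p q : H1 Ω) :
    ⟪p, q⟫_ℝ = ⟪sval p, sval q⟫_ℝ + ⟪sgrad p, sgrad q⟫_ℝ :=
  WithLp.prod_inner_apply p.1 q.1

lemma inner_eq_velL_add_jacL (u v : H1Vec Ω) :
    ⟪u, v⟫_ℝ = ⟪velL Ω u, velL Ω v⟫_ℝ + ⟪jacL Ω u, jacL Ω v⟫_ℝ := by
  rw [inner_velL_velL, inner_jacL_jacL, PiLp.inner_apply]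
  simp only [inner_sval_add_inner_sgrad, Finset.sum_add_distrib, L2.inner_def]
  rw [← integral_finsetSum _ fun i _ => integrable_inner_of_memLp (Lp.memLp _) (Lp.memLp _),
    ← integral_finsetSum _ fun i _ => integrable_inner_of_memLp (Lp.memLp _) (Lp.memLp _)]
  simp only [PiLp.inner_apply (𝕜 := ℝ) (f := fun _ : Fin 2 => ℝ),
    PiLp.inner_apply (𝕜 := ℝ) (f := fun _ : Fin 2 => Plane)]
  rfl

lemma norm_sq_eq_velL_add_jacL (v : H1Vec Ω) : ‖v‖ ^ 2 = ‖velL Ω v‖ ^ 2 + ‖jacL Ω v‖ ^ 2 := by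
  simp only [← real_inner_self_eq_norm_sq, inner_eq_velL_add_jacL]

lemma isClosed_H10 (Ω : Set Plane) : IsClosed (H10 Ω : Set (H1 Ω)) :=
  Submodule.isClosed_topologicalClosure _

/-- The divergence as a continuous linear map. -/
def divL (Ω : Set Plane) : H1Vec Ω →L[ℝ] L2 Ω ℝ :=
  ∑ i : Fin 2, (EuclideanSpace.proj (𝕜 := ℝ) i : Plane →L[ℝ] ℝ).compLpL 2 (volume.restrict Ω)
      ∘L sgradL Ω ∘L PiLp.proj 2 (fun _ : Fin 2 => H1 Ω) i

lemma divL_coe (v : H1Vec Ω) :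
    divL Ω v =ᵐ[volume.restrict Ω] fun x => ∑ i, jac v x i i := by
  have h : divL Ω v =
      (EuclideanSpace.proj (𝕜 := ℝ) 0 : Plane →L[ℝ] ℝ).compLpL 2 (volume.restrict Ω) (sgrad (v 0))
    + (EuclideanSpace.proj (𝕜 := ℝ) 1 : Plane →L[ℝ] ℝ).compLpL 2 (volume.restrict Ω)
      (sgrad (v 1)) := by
    simp [divL, Fin.sum_univ_two]
  rw [h]
  filter_upwards [Lp.coeFn_add
      ((EuclideanSpace.proj (𝕜 := ℝ) 0 : Plane →L[ℝ] ℝ).compLpL 2 (volume.restrict Ω) (sgrad (v 0)))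
      ((EuclideanSpace.proj (𝕜 := ℝ) 1 : Plane →L[ℝ] ℝ).compLpL 2 (volume.restrict Ω)
        (sgrad (v 1))),
    ContinuousLinearMap.coeFn_compLpL (EuclideanSpace.proj (𝕜 := ℝ) 0 : Plane →L[ℝ] ℝ)
      (sgrad (v 0)),
    ContinuousLinearMap.coeFn_compLpL (EuclideanSpace.proj (𝕜 := ℝ) 1 : Plane →L[ℝ] ℝ)
      (sgrad (v 1))] with x h1 h2 h3
  rw [h1, Pi.add_apply, h2, h3, Fin.sum_univ_two]
  rfl

/-- The divergence is a continuous map into `L²(Ω)`, and membership in `H¹₀(Ω)` is closed by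
definition. -/
lemma isClosed_VSub (Ω : Set Plane) : IsClosed (VSub Ω : Set (H1Vec Ω)) := by
  have : (VSub Ω : Set (H1Vec Ω)) =
      (⋂ i : Fin 2, {v : H1Vec Ω | v i ∈ (H10 Ω : Set (H1 Ω))}) ∩ {v | divL Ω v = 0} := by
    ext v
    simp only [mem_inter_iff, mem_iInter, mem_ofPred_eq]
    refine and_congr Iff.rfl ?_
    rw [Lp.eq_zero_iff_ae_eq_zero]
    exact ⟨fun h => (divL_coe v).trans h, fun h => (divL_coe v).symm.trans h⟩
  rw [this]
  refine (isClosed_iInter fun i => ?_).inter ?_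
  · exact (isClosed_H10 Ω).preimage (PiLp.continuous_apply 2 (fun _ : Fin 2 => H1 Ω) i)
  · exact isClosed_eq (divL Ω).continuous continuous_const

instance : CompleteSpace (V Ω) := (isClosed_VSub Ω).completeSpace_coe

instance : SecondCountableTopology (V Ω) := inferInstanceAs (SecondCountableTopology (VSub Ω))

/-- The inclusion of `V` into `H¹(Ω)²`. -/
def vInc (Ω : Set Plane) : V Ω →L[ℝ] H1Vec Ω := (VSub Ω).subtypeL

/-- The embedding of `V` into `L²(Ω)²`. -/
def vJ (Ω : Set Plane) : V Ω →L[ℝ] L2 Ω Plane := velL Ω ∘L vInc Ω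

/-- The gradient on `V`. -/
def vD (Ω : Set Plane) : V Ω →L[ℝ] L2 Ω (PiLp 2 (fun _ : Fin 2 => Plane)) := jacL Ω ∘L vInc Ω

lemma vJ_apply (v : V Ω) : vJ Ω v = velL Ω v.1 := rfl

lemma vD_apply (v : V Ω) : vD Ω v = jacL Ω v.1 := rfl

lemma V.inner_eq (u v : V Ω) : ⟪u, v⟫_ℝ = ⟪vJ Ω u, vJ Ω v⟫_ℝ + ⟪vD Ω u, vD Ω v⟫_ℝ :=
  inner_eq_velL_add_jacL u.1 v.1

lemma V.norm_sq_eq (v : V Ω) : ‖v‖ ^ 2 = ‖vJ Ω v‖ ^ 2 + ‖vD Ω v‖ ^ 2 :=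
  norm_sq_eq_velL_add_jacL v.1

end Basics

/-! ### Smooth functions in `H¹(Ω)` and approximation in `H¹₀(Ω)` -/

section TestFunctions

variable {Ω : Set Plane}

/-- An element of `H¹(Ω)` from representatives. -/
def mkH1 {u : Plane → ℝ} {g : Plane → Plane} (hu : MemLp u 2 (volume.restrict Ω))
    (hg : MemLp g 2 (volume.restrict Ω)) (h : HasWeakGradient Ω u g) : H1 Ω :=
  ⟨WithLp.toLp 2 (hu.toLp u, hg.toLp g), fun η hη i => by
    have h1 : ∫ x in Ω, hu.toLp u x * fderiv ℝ η x (EuclideanSpace.single i 1)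
        = ∫ x in Ω, u x * fderiv ℝ η x (EuclideanSpace.single i 1) := by
      refine integral_congr_ae ?_
      filter_upwards [hu.coeFn_toLp] with x hx
      rw [hx]
    have h2 : ∫ x in Ω, hg.toLp g x i * η x = ∫ x in Ω, g x i * η x := by
      refine integral_congr_ae ?_
      filter_upwards [hg.coeFn_toLp] with x hx
      rw [hx]
    exact (h1.trans (h η hη i)).trans (congrArg Neg.neg h2.symm)⟩

lemma sval_mkH1 {u : Plane → ℝ} {g : Plane → Plane} (hu : MemLp u 2 (volume.restrict Ω))
    (hg : MemLp g 2 (volume.restrict Ω)) (h : HasWeakGradient Ω u g) :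
    sval (mkH1 hu hg h) =ᵐ[volume.restrict Ω] u := hu.coeFn_toLp

lemma sgrad_mkH1 {u : Plane → ℝ} {g : Plane → Plane} (hu : MemLp u 2 (volume.restrict Ω))
    (hg : MemLp g 2 (volume.restrict Ω)) (h : HasWeakGradient Ω u g) :
    sgrad (mkH1 hu hg h) =ᵐ[volume.restrict Ω] g := hg.coeFn_toLp

lemma hasWeakGradient_sgrad (p : H1 Ω) : HasWeakGradient Ω (sval p) (sgrad p) := p.2

/-- Outside the closed support of `g` the product vanishes in a neighbourhood, so the behaviour of
`f` off `Ω` is irrelevant. -/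
lemma continuous_mul_of_continuousOn {f g : Plane → ℝ} (hΩ : IsOpen Ω) (hf : ContinuousOn f Ω)
    (hg : Continuous g) (hs : tsupport g ⊆ Ω) : Continuous fun x => f x * g x := by
  refine continuous_iff_continuousAt.2 fun x => ?_
  by_cases hx : x ∈ tsupport g
  · exact (hf.continuousAt (hΩ.mem_nhds (hs hx))).mul hg.continuousAt
  · have : (fun x => f x * g x) =ᶠ[𝓝 x] fun _ => 0 := by
      filter_upwards [(isClosed_tsupport g).isOpen_compl.mem_nhds hx] with y hy
      rw [image_eq_zero_of_notMem_tsupport hy, mul_zero]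
    exact this.continuousAt

lemma integrable_mul_of_continuousOn {f g : Plane → ℝ} (hΩ : IsOpen Ω) (hf : ContinuousOn f Ω)
    (hg : Continuous g) (hc : HasCompactSupport g) (hs : tsupport g ⊆ Ω) :
    Integrable fun x => f x * g x :=
  (continuous_mul_of_continuousOn hΩ hf hg hs).integrable_of_hasCompactSupport hc.mul_left

lemma tsupport_fderiv_apply_subset (η : Plane → ℝ) (v : Plane) :
    tsupport (fun x => fderiv ℝ η x v) ⊆ tsupport η := by
  refine closure_minimal (fun x hx => ?_) (isClosed_tsupport η)
  refine support_fderiv_subset ℝ (f := η) ?_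
  intro h0
  exact hx (by simp [h0])

lemma setIntegral_mul_of_tsupport {f g : Plane → ℝ} (hs : tsupport g ⊆ Ω) :
    ∫ x in Ω, f x * g x = ∫ x, f x * g x :=
  setIntegral_eq_integral_of_forall_compl_eq_zero fun x hx => by
    rw [image_eq_zero_of_notMem_tsupport fun h => hx (hs h), mul_zero]

/-- Continuously differentiable functions have their gradient as weak gradient. -/
lemma hasWeakGradient_of_contDiffOn {u : Plane → ℝ} (hΩ : IsOpen Ω) (hu : ContDiffOn ℝ 1 u Ω) :
    HasWeakGradient Ω u (pgrad u) := by
  intro η hη i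
  have hd : Continuous fun x => fderiv ℝ η x (EuclideanSpace.single i 1) :=
    (hη.1.continuous_fderiv (by simp)).clm_apply continuous_const
  have hds := (tsupport_fderiv_apply_subset η (EuclideanSpace.single i 1)).trans hη.2.2
  have hdu : ContinuousOn (fun x => fderiv ℝ u x (EuclideanSpace.single i 1)) Ω :=
    (hu.continuousOn_fderiv_of_isOpen hΩ le_rfl).clm_apply continuousOn_const
  rw [setIntegral_mul_of_tsupport hds, setIntegral_mul_of_tsupport hη.2.2]
  refine integral_mul_fderiv_eq_neg_fderiv_mul_of_integrable ?_ ?_ ?_ ?_ ?_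
  · exact integrable_mul_of_continuousOn hΩ hdu hη.1.continuous hη.2.1 hη.2.2
  · exact integrable_mul_of_continuousOn hΩ hu.continuousOn hd
      (hη.2.1.fderiv_apply (𝕜 := ℝ) _) hds
  · exact integrable_mul_of_continuousOn hΩ hu.continuousOn hη.1.continuous hη.2.1 hη.2.2
  · intro x hx
    exact (hu.differentiableOn one_ne_zero).differentiableAt (hΩ.mem_nhds (hη.2.2 hx))
  · exact fun x _ => (hη.1.differentiable (by simp)) x

lemma memLp_pgrad {η : Plane → ℝ} (h1 : ContDiff ℝ ∞ η) (h2 : HasCompactSupport η) :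
    MemLp (pgrad η) 2 (volume.restrict Ω) := by
  have hc : Continuous (pgrad η) := by
    refine (PiLp.continuous_toLp 2 _).comp (continuous_pi fun i => ?_)
    exact (h1.continuous_fderiv (by simp)).clm_apply continuous_const
  have hs : HasCompactSupport (pgrad η) := by
    refine HasCompactSupport.of_support_subset_isCompact h2.isCompact fun x hx => ?_
    by_contra hcon
    refine hx ?_
    have : fderiv ℝ η x = 0 := by
      by_contra h0
      exact hcon (support_fderiv_subset ℝ h0)
    ext i
    simp [this]
  exact (hc.memLp_of_hasCompactSupport (μ := volume) hs).mono_measure Measure.restrict_le_self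

/-- A smooth compactly supported function as an element of `H¹(Ω)`. -/
def smoothH1 (hΩ : IsOpen Ω) {η : Plane → ℝ} (h1 : ContDiff ℝ ∞ η) (h2 : HasCompactSupport η) :
    H1 Ω :=
  mkH1 (memLp_of_continuous_compact Ω h1.continuous h2) (memLp_pgrad h1 h2)
    (hasWeakGradient_of_contDiffOn hΩ (h1.of_le (by simp)).contDiffOn)

lemma sval_smoothH1 (hΩ : IsOpen Ω) {η : Plane → ℝ} (h1 : ContDiff ℝ ∞ η)
    (h2 : HasCompactSupport η) : sval (smoothH1 hΩ h1 h2) =ᵐ[volume.restrict Ω] η :=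
  sval_mkH1 _ _ _

lemma sgrad_smoothH1 (hΩ : IsOpen Ω) {η : Plane → ℝ} (h1 : ContDiff ℝ ∞ η)
    (h2 : HasCompactSupport η) : sgrad (smoothH1 hΩ h1 h2) =ᵐ[volume.restrict Ω] pgrad η :=
  sgrad_mkH1 _ _ _

lemma smoothH1_mem_H10 (hΩ : IsOpen Ω) {η : Plane → ℝ} (h : IsTestFunction Ω η) :
    smoothH1 hΩ h.1 h.2.1 ∈ H10 Ω :=
  subset_closure (Submodule.subset_span ⟨η, h, sval_smoothH1 hΩ h.1 h.2.1⟩)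

/-- Fundamental lemma of the calculus of variations in `L²(Ω)`. -/
lemma ae_eq_zero_of_integral_test {f : Plane → ℝ} (hΩ : IsOpen Ω)
    (hf : MemLp f 2 (volume.restrict Ω))
    (h : ∀ η, IsTestFunction Ω η → ∫ x in Ω, f x * η x = 0) : f =ᵐ[volume.restrict Ω] 0 := by
  have hloc : LocallyIntegrableOn f Ω := by
    refine (locallyIntegrableOn_iff hΩ.isLocallyClosed).2 fun k hk hkc => ?_
    have : IsFiniteMeasure (volume.restrict k) := ⟨by simpa using hkc.measure_lt_top⟩
    exact (hf.mono_measure (Measure.restrict_mono hk le_rfl)).integrable (by norm_num)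
  have := hΩ.ae_eq_zero_of_integral_contDiff_smul_eq_zero (μ := volume) hloc fun g hg hgc hgs => by
    have := h g ⟨hg, hgc, hgs⟩
    rw [setIntegral_mul_of_tsupport hgs] at this
    simpa [mul_comm] using this
  exact (ae_restrict_iff' hΩ.measurableSet).2 this

lemma HasWeakGradient.ae_eq_zero {u : Plane → ℝ} {g : Plane → Plane} (hΩ : IsOpen Ω)
    (hg : MemLp g 2 (volume.restrict Ω)) (h : HasWeakGradient Ω u g)
    (hu : u =ᵐ[volume.restrict Ω] 0) : g =ᵐ[volume.restrict Ω] 0 := by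
  have hi : ∀ i : Fin 2, (fun x => g x i) =ᵐ[volume.restrict Ω] 0 := fun i => by
    refine ae_eq_zero_of_integral_test hΩ (coord_memLp hg i) fun η hη => ?_
    have h1 := h η hη i
    rw [integral_eq_zero_of_ae] at h1
    · linarith
    · filter_upwards [hu] with x hx
      simp [hx]
  filter_upwards [hi 0, hi 1] with x h0 h1
  ext j
  fin_cases j
  · exact h0
  · exact h1

/-- By the fundamental lemma of the calculus of variations, a function that vanishes almost
everywhere has vanishing weak gradient. -/
lemma sval_injective (hΩ : IsOpen Ω) : Function.Injective (sval : H1 Ω → L2 Ω ℝ) := by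
  intro p q h
  have h0 : sval (p - q) = 0 := by
    change sval p - sval q = 0
    rw [h, sub_self]
  have h1 : sgrad (p - q) = 0 := by
    rw [Lp.eq_zero_iff_ae_eq_zero]
    refine (hasWeakGradient_sgrad (p - q)).ae_eq_zero hΩ (Lp.memLp _) ?_
    rw [h0]
    exact Lp.coeFn_zero _ _ _
  have h2 := norm_sq_eq_sval_sgrad (p - q)
  rw [h0, h1] at h2
  simp only [norm_zero, ne_eq, OfNat.ofNat_ne_zero, not_false_eq_true, zero_pow, add_zero,
    pow_eq_zero_iff, norm_eq_zero] at h2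
  exact sub_eq_zero.1 h2

lemma IsTestFunction.add {η ζ : Plane → ℝ} (h : IsTestFunction Ω η) (h' : IsTestFunction Ω ζ) :
    IsTestFunction Ω (fun x => η x + ζ x) :=
  ⟨h.1.add h'.1, h.2.1.add h'.2.1, (tsupport_add η ζ).trans (union_subset h.2.2 h'.2.2)⟩

lemma IsTestFunction.const_mul {η : Plane → ℝ} (h : IsTestFunction Ω η) (c : ℝ) :
    IsTestFunction Ω (fun x => c * η x) :=
  ⟨contDiff_const.mul h.1, h.2.1.mul_left, (tsupport_mul_subset_right).trans h.2.2⟩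

lemma IsTestFunction.mul {η ζ : Plane → ℝ} (h : IsTestFunction Ω η) (hζ : IsTestFunction Ω ζ) :
    IsTestFunction Ω (fun x => η x * ζ x) :=
  ⟨h.1.mul hζ.1, hζ.2.1.mul_left, (tsupport_mul_subset_right).trans hζ.2.2⟩

/-- Elements of `H¹₀(Ω)` are limits of test functions. -/
lemma exists_seq_test_of_mem_H10 (hΩ : IsOpen Ω) {p : H1 Ω} (hp : p ∈ H10 Ω) :
    ∃ (η : ℕ → Plane → ℝ) (hη : ∀ n, IsTestFunction Ω (η n)),
      Tendsto (fun n => smoothH1 hΩ (hη n).1 (hη n).2.1) atTop (𝓝 p) := by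
  obtain ⟨q, hq, hqp⟩ := mem_closure_iff_seq_limit.1 hp
  -- Test functions already form a subspace, so taking the span adds nothing.
  have hspan : ∀ q ∈ Submodule.span ℝ {p : H1 Ω | ∃ η : Plane → ℝ, IsTestFunction Ω η ∧
      sval p =ᵐ[volume.restrict Ω] η}, ∃ η, ∃ hη : IsTestFunction Ω η,
      smoothH1 hΩ hη.1 hη.2.1 = q := by
    intro q hq
    suffices h : ∃ η, IsTestFunction Ω η ∧ sval q =ᵐ[volume.restrict Ω] η by
      obtain ⟨η, hη, h⟩ := h
      refine ⟨η, hη, sval_injective hΩ (Lp.ext ?_)⟩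
      exact (sval_smoothH1 hΩ hη.1 hη.2.1).trans h.symm
    induction hq using Submodule.span_induction with
    | mem q h => exact h
    | zero => exact ⟨fun _ => 0, ⟨contDiff_const, HasCompactSupport.zero, by simp [tsupport]⟩,
        Lp.coeFn_zero _ _ _⟩
    | add q r _ _ h1 h2 =>
      obtain ⟨η, hη, h1⟩ := h1
      obtain ⟨ζ, hζ, h2⟩ := h2
      refine ⟨_, hη.add hζ, (Lp.coeFn_add (sval q) (sval r)).trans ?_⟩
      filter_upwards [h1, h2] with x h1 h2
      simp [h1, h2]
    | smul c q _ h1 =>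
      obtain ⟨η, hη, h1⟩ := h1
      refine ⟨_, hη.const_mul c, (Lp.coeFn_smul c (sval q)).trans ?_⟩
      filter_upwards [h1] with x h1
      simp [h1]
  choose η hη h using fun n => hspan (q n) (hq n)
  exact ⟨η, hη, by simpa only [h] using hqp⟩

lemma vJ_injective (hΩ : IsOpen Ω) : Function.Injective (vJ Ω) := by
  intro u v h
  refine Subtype.ext (PiLp.ext fun i => sval_injective hΩ (Lp.ext ?_))
  filter_upwards [velL_coe u.1, velL_coe v.1] with x h1 h2
  have h3 : vel u.1 x = vel v.1 x := by
    rw [← h1, ← h2, ← vJ_apply, ← vJ_apply, h]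
  exact congrArg (fun y : Plane => y i) h3

end TestFunctions

/-! ### Ladyzhenskaya's inequality -/

section Ladyzhenskaya

variable {Ω : Set Plane}

lemma norm_fderiv_le_norm_pgrad (η : Plane → ℝ) (x : Plane) : ‖fderiv ℝ η x‖ ≤ ‖pgrad η x‖ :=
  ContinuousLinearMap.opNorm_le_bound _ (norm_nonneg _) fun v => by
    rw [fderiv_eq_inner_pgrad]
    exact norm_inner_le_norm _ _

lemma eLpNorm_sq_two (η : Plane → ℝ) (ν : Measure Plane) :
    eLpNorm (fun x => η x ^ 2) 2 ν = eLpNorm η 4 ν ^ 2 := by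
  have h := eLpNorm_norm_rpow (p := 2) (μ := ν) η (q := 2) two_pos
  rw [show (2 : ℝ≥0∞) * ENNReal.ofReal 2 = 4 by norm_num] at h
  simp only [ENNReal.rpow_ofNat] at h
  rw [← h]
  congr 1
  ext x
  simp

/-- Ladyzhenskaya's inequality for smooth functions of compact support. -/
lemma exists_ladyzhenskaya_smooth : ∃ C : ℝ≥0, ∀ η : Plane → ℝ, ContDiff ℝ ∞ η →
    HasCompactSupport η →
    eLpNorm η 4 volume ^ 2 ≤ C * (eLpNorm η 2 volume * eLpNorm (pgrad η) 2 volume) := by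
  refine ⟨eLpNormLESNormFDerivOneConst (volume : Measure Plane) ((2 : ℝ≥0) : ℝ) * 2, fun η h1 h2 => ?_⟩
  have hconj : NNReal.HolderConjugate (Module.finrank ℝ Plane) 2 := by
    rw [finrank_euclideanSpace_fin]
    rw [NNReal.holderConjugate_iff]
    norm_num
  have hs : ContDiff ℝ 1 fun x => η x ^ 2 := (h1.pow 2).of_le (by simp)
  -- The Gagliardo–Nirenberg–Sobolev inequality from `W^{1,1}` to `L²` in dimension two, applied to
  -- `η²`. Then `∇(η²) = 2 η ∇η` and the Cauchy–Schwarz inequality give the product of norms.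
  have h3 := eLpNorm_le_eLpNorm_fderiv_one (volume : Measure Plane) hs
    (h2.comp_left (g := fun s => s ^ 2) (by simp)) hconj
  rw [← eLpNorm_sq_two]
  refine h3.trans ?_
  rw [ENNReal.coe_mul, mul_assoc]
  gcongr
  have hdη : Differentiable ℝ η := h1.differentiable (by simp)
  have hc : Continuous (fderiv ℝ η) := h1.continuous_fderiv (by simp)
  have e : fderiv ℝ (fun x => η x ^ 2) = (2 : ℝ) • (η • fderiv ℝ η) := by
    ext x v
    rw [fderiv_fun_pow 2 (hdη x)]
    simp
    ring
  have h7 : eLpNorm (fderiv ℝ fun x => η x ^ 2) 1 volume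
      = ‖(2 : ℝ)‖ₑ * eLpNorm (η • fderiv ℝ η) 1 volume := by
    rw [e]
    exact eLpNorm_const_smul (2 : ℝ) (η • fderiv ℝ η) 1 volume
  rw [h7]
  have h4 : eLpNorm (η • fderiv ℝ η) 1 volume ≤ eLpNorm η 2 volume * eLpNorm (fderiv ℝ η) 2 volume :=
    eLpNorm_smul_le_mul_eLpNorm (p := 2) (q := 2) hc.aestronglyMeasurable
      h1.continuous.aestronglyMeasurable
  have h5 : eLpNorm (fderiv ℝ η) 2 volume ≤ eLpNorm (pgrad η) 2 volume :=
    eLpNorm_mono fun x => norm_fderiv_le_norm_pgrad η x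
  have h6 : ‖(2 : ℝ)‖ₑ = ((2 : ℝ≥0) : ℝ≥0∞) := by
    rw [enorm_eq_nnnorm]; norm_num
  rw [h6]
  gcongr
  exact h4.trans (by gcongr)


lemma eLpNorm_sval (p : H1 Ω) : eLpNorm (sval p) 2 (volume.restrict Ω) = ENNReal.ofReal ‖sval p‖ := by
  rw [ofReal_norm, Lp.enorm_def]

lemma eLpNorm_sgrad (p : H1 Ω) :
    eLpNorm (sgrad p) 2 (volume.restrict Ω) = ENNReal.ofReal ‖sgrad p‖ := by
  rw [ofReal_norm, Lp.enorm_def]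

lemma eLpNorm_vel (v : H1Vec Ω) :
    eLpNorm (vel v) 2 (volume.restrict Ω) = ENNReal.ofReal ‖velL Ω v‖ := by
  rw [ofReal_norm, Lp.enorm_def, eLpNorm_congr_ae (velL_coe v)]

lemma eLpNorm_jac (v : H1Vec Ω) :
    eLpNorm (jac v) 2 (volume.restrict Ω) = ENNReal.ofReal ‖jacL Ω v‖ := by
  rw [ofReal_norm, Lp.enorm_def, eLpNorm_congr_ae (jacL_coe v)]

lemma isPoincareConstant_iff {c : ℝ} : IsPoincareConstant Ω c ↔
    0 < c ∧ ∀ v : H1Vec Ω, (∀ i, v i ∈ H10 Ω) → ‖velL Ω v‖ ≤ c * ‖jacL Ω v‖ := by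
  refine and_congr_right fun hc => forall_congr' fun v => forall_congr' fun _ => ?_
  rw [eLpNorm_vel, eLpNorm_jac, ← ENNReal.ofReal_mul hc.le,
    ENNReal.ofReal_le_ofReal_iff (by positivity)]

lemma isLadyzhenskayaConstant_iff {c : ℝ} : IsLadyzhenskayaConstant Ω c ↔
    0 < c ∧ ∀ v : H1Vec Ω, (∀ i, v i ∈ H10 Ω) → eLpNorm (vel v) 4 (volume.restrict Ω)
      ≤ ENNReal.ofReal (√(c * ‖velL Ω v‖ * ‖jacL Ω v‖)) := by
  refine and_congr_right fun hc => forall_congr' fun v => forall_congr' fun _ => ?_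
  rw [eLpNorm_vel, eLpNorm_jac, ENNReal.ofReal_rpow_of_nonneg (norm_nonneg _) (by positivity),
    ENNReal.ofReal_rpow_of_nonneg (norm_nonneg _) (by positivity), ← Real.sqrt_eq_rpow,
    ← Real.sqrt_eq_rpow, ← ENNReal.ofReal_mul (Real.sqrt_nonneg _),
    ← ENNReal.ofReal_mul (by positivity), ← Real.sqrt_mul hc.le, ← Real.sqrt_mul (by positivity)]

/-- Test functions approximate in `H¹`, so the right side converges. On the left a subsequence
converges almost everywhere, and Fatou's lemma bounds the `L⁴` norm of the limit. -/
lemma exists_ladyzhenskaya_H10 (hΩ : IsOpen Ω) : ∃ C : ℝ, 0 < C ∧ ∀ p ∈ H10 Ω,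
    eLpNorm (sval p) 4 (volume.restrict Ω) ≤ ENNReal.ofReal (√(C * ‖sval p‖ * ‖sgrad p‖)) := by
  obtain ⟨C, hC⟩ := exists_ladyzhenskaya_smooth
  have htest : ∀ η (hη : IsTestFunction Ω η), eLpNorm (sval (smoothH1 hΩ hη.1 hη.2.1)) 4
      (volume.restrict Ω) ≤ ENNReal.ofReal (√((C + 1) * ‖sval (smoothH1 hΩ hη.1 hη.2.1)‖
        * ‖sgrad (smoothH1 hΩ hη.1 hη.2.1)‖)) := by
    intro η hη
    set q := smoothH1 hΩ hη.1 hη.2.1 with hq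
    have h1 := hC η hη.1 hη.2.1
    have hsupp : Function.support η ⊆ Ω := (subset_tsupport η).trans hη.2.2
    have hsupp' : Function.support (pgrad η) ⊆ Ω := by
      intro x hx
      by_contra hcon
      refine hx ?_
      ext i
      rw [pgrad_apply, image_eq_zero_of_notMem_tsupport fun h =>
        hcon (hη.2.2 (tsupport_fderiv_apply_subset η _ h))]
      rfl
    rw [← eLpNorm_restrict_eq_of_support_subset (p := 4) hsupp, ← eLpNorm_restrict_eq_of_support_subset
      (f := pgrad η) hsupp', ← eLpNorm_restrict_eq_of_support_subset (p := 2) hsupp,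
      ← eLpNorm_congr_ae (sval_smoothH1 hΩ hη.1 hη.2.1),
      ← eLpNorm_congr_ae (sval_smoothH1 hΩ hη.1 hη.2.1),
      ← eLpNorm_congr_ae (sgrad_smoothH1 hΩ hη.1 hη.2.1), ← hq, eLpNorm_sval, eLpNorm_sgrad,
      ← ENNReal.ofReal_mul (norm_nonneg _), ← ENNReal.ofReal_coe_nnreal,
      ← ENNReal.ofReal_mul C.coe_nonneg] at h1
    rw [← ENNReal.rpow_le_rpow_iff (z := 2) two_pos,
      ENNReal.ofReal_rpow_of_nonneg (Real.sqrt_nonneg _) two_pos.le, ENNReal.rpow_ofNat,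
      Real.rpow_ofNat, Real.sq_sqrt (by positivity)]
    refine h1.trans (ENNReal.ofReal_le_ofReal ?_)
    rw [mul_assoc]
    gcongr
    linarith
  -- The smooth inequality may hold with `C = 0` as far as its statement tells, whereas a positive
  -- constant is wanted.
  refine ⟨C + 1, by positivity, fun p hp => ?_⟩
  obtain ⟨η, hη, hlim⟩ := exists_seq_test_of_mem_H10 hΩ hp
  set q := fun n => smoothH1 hΩ (hη n).1 (hη n).2.1 with hq
  have hv : Tendsto (fun n => sval (q n)) atTop (𝓝 (sval p)) := ((svalL Ω).continuous.tendsto p).comp hlim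
  have hg : Tendsto (fun n => sgrad (q n)) atTop (𝓝 (sgrad p)) :=
    ((sgradL Ω).continuous.tendsto p).comp hlim
  obtain ⟨ns, hns, hae⟩ := (tendstoInMeasure_of_tendsto_Lp hv).exists_seq_tendsto_ae
  refine (Lp.eLpNorm_lim_le_liminf_eLpNorm (fun n => Lp.aestronglyMeasurable (sval (q (ns n)))) _
    hae).trans ?_
  have hR : Tendsto (fun n => ENNReal.ofReal (√((C + 1) * ‖sval (q (ns n))‖ * ‖sgrad (q (ns n))‖)))
      atTop (𝓝 (ENNReal.ofReal (√((C + 1) * ‖sval p‖ * ‖sgrad p‖)))) := by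
    refine ENNReal.tendsto_ofReal ((Real.continuous_sqrt.tendsto _).comp ?_)
    exact ((hv.comp hns.tendsto_atTop).norm.const_mul _).mul (hg.comp hns.tendsto_atTop).norm
  rw [← hR.liminf_eq]
  exact liminf_le_liminf (Eventually.of_forall fun n => htest _ (hη (ns n)))

lemma norm_sval_le_norm_velL (v : H1Vec Ω) (i : Fin 2) : ‖sval (v i)‖ ≤ ‖velL Ω v‖ := by
  have h : eLpNorm (sval (v i)) 2 (volume.restrict Ω) ≤ eLpNorm (vel v) 2 (volume.restrict Ω) :=
    eLpNorm_mono fun x => PiLp.norm_apply_le (vel v x) i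
  rw [eLpNorm_sval, eLpNorm_vel] at h
  exact (ENNReal.ofReal_le_ofReal_iff (norm_nonneg _)).1 h

lemma norm_sgrad_le_norm_jacL (v : H1Vec Ω) (i : Fin 2) : ‖sgrad (v i)‖ ≤ ‖jacL Ω v‖ := by
  have h : eLpNorm (sgrad (v i)) 2 (volume.restrict Ω) ≤ eLpNorm (jac v) 2 (volume.restrict Ω) :=
    eLpNorm_mono fun x => PiLp.norm_apply_le (jac v x) i
  rw [eLpNorm_sgrad, eLpNorm_jac] at h
  exact (ENNReal.ofReal_le_ofReal_iff (norm_nonneg _)).1 h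

lemma Plane.norm_le_abs_add_abs (x : Plane) : ‖x‖ ≤ |x 0| + |x 1| := by
  refine le_of_sq_le_sq ?_ (by positivity)
  rw [EuclideanSpace.norm_sq_eq, Fin.sum_univ_two]
  simp only [Real.norm_eq_abs]
  nlinarith [abs_nonneg (x 0), abs_nonneg (x 1)]

/-- The two components are estimated separately and added. This doubles the bound, and since the
constant stands under a square root it is multiplied by `4`. -/
lemma exists_isLadyzhenskayaConstant (hΩ : IsOpen Ω) : ∃ c, IsLadyzhenskayaConstant Ω c := by
  obtain ⟨C, hC, h⟩ := exists_ladyzhenskaya_H10 hΩ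
  refine ⟨4 * C, isLadyzhenskayaConstant_iff.2 ⟨by positivity, fun v hv => ?_⟩⟩
  have h1 : eLpNorm (vel v) 4 (volume.restrict Ω)
      ≤ eLpNorm ((fun x => |sval (v 0) x|) + fun x => |sval (v 1) x|) 4 (volume.restrict Ω) :=
    eLpNorm_mono_real fun x => Plane.norm_le_abs_add_abs (vel v x)
  have h2 : eLpNorm ((fun x => |sval (v 0) x|) + fun x => |sval (v 1) x|) 4 (volume.restrict Ω)
      ≤ eLpNorm (sval (v 0)) 4 (volume.restrict Ω) + eLpNorm (sval (v 1)) 4 (volume.restrict Ω) := by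
    refine (eLpNorm_add_le (Lp.aestronglyMeasurable (sval (v 0))).norm
      (Lp.aestronglyMeasurable (sval (v 1))).norm (by norm_num)).trans ?_
    rw [← eLpNorm_norm (sval (v 0)), ← eLpNorm_norm (sval (v 1))]
  have h3 : ∀ i, eLpNorm (sval (v i)) 4 (volume.restrict Ω)
      ≤ ENNReal.ofReal (√(C * ‖velL Ω v‖ * ‖jacL Ω v‖)) := fun i => by
    refine (h _ (hv i)).trans (ENNReal.ofReal_le_ofReal (Real.sqrt_le_sqrt ?_))
    have h4 := norm_sval_le_norm_velL v i
    have h5 := norm_sgrad_le_norm_jacL v i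
    gcongr
  refine (h1.trans h2).trans ((add_le_add (h3 0) (h3 1)).trans (le_of_eq ?_))
  rw [← ENNReal.ofReal_add (Real.sqrt_nonneg _) (Real.sqrt_nonneg _), ← two_mul,
    mul_assoc, mul_assoc 4, mul_assoc 4, Real.sqrt_mul (by norm_num : (0:ℝ) ≤ 4),
    show √(4:ℝ) = 2 by rw [show (4:ℝ) = 2 ^ 2 by norm_num]; exact Real.sqrt_sq (by norm_num),
    mul_assoc]

end Ladyzhenskaya

/-! ### The convective term -/

section Convection

variable {Ω : Set Plane}

lemma le_of_sq_le_mul {x y : ℝ} (hx : 0 ≤ x) (hy : 0 ≤ y) (h : x ^ 2 ≤ y * x) : x ≤ y := by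
  rcases hx.eq_or_lt with rfl | hx
  · exact hy
  · nlinarith

/-- Vector fields in `H¹₀(Ω)²`. -/
def WSub (Ω : Set Plane) : Submodule ℝ (H1Vec Ω) where
  carrier := {v | ∀ i, v i ∈ H10 Ω}
  zero_mem' := fun _ => (H10 Ω).zero_mem
  add_mem' := fun hu hv i => (H10 Ω).add_mem (hu i) (hv i)
  smul_mem' := fun c _ hv i => (H10 Ω).smul_mem c (hv i)

lemma isClosed_WSub (Ω : Set Plane) : IsClosed (WSub Ω : Set (H1Vec Ω)) := by
  have : (WSub Ω : Set (H1Vec Ω)) = ⋂ i : Fin 2, {v : H1Vec Ω | v i ∈ (H10 Ω : Set (H1 Ω))} := by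
    ext v
    simp only [mem_iInter]
    rfl
  rw [this]
  exact isClosed_iInter fun i =>
    (isClosed_H10 Ω).preimage (PiLp.continuous_apply 2 (fun _ : Fin 2 => H1 Ω) i)

instance : CompleteSpace (WSub Ω) := (isClosed_WSub Ω).completeSpace_coe

lemma convection_apply (u v : H1Vec Ω) (x : Plane) (i : Fin 2) :
    convection u v x i = ⟪jac v x i, vel u x⟫_ℝ := by
  simp [convection, PiLp.inner_apply]

lemma norm_convection_le (u v : H1Vec Ω) (x : Plane) :
    ‖convection u v x‖ ≤ ‖vel u x‖ * ‖jac v x‖ := by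
  refine le_of_sq_le_sq ?_ (by positivity)
  have h1 : ‖jac v x‖ ^ 2 = ‖jac v x 0‖ ^ 2 + ‖jac v x 1‖ ^ 2 := by
    rw [PiLp.norm_sq_eq_of_L2, Fin.sum_univ_two]
  rw [EuclideanSpace.norm_sq_eq, Fin.sum_univ_two, convection_apply, convection_apply, mul_pow, h1,
    mul_add]
  refine add_le_add ?_ ?_
  · rw [mul_comm, ← mul_pow]
    gcongr
    exact norm_inner_le_norm _ _
  · rw [mul_comm (‖vel u x‖ ^ 2), ← mul_pow]
    gcongr
    exact norm_inner_le_norm _ _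

lemma vel_add_ae (u v : H1Vec Ω) :
    vel (u + v) =ᵐ[volume.restrict Ω] fun x => vel u x + vel v x := by
  filter_upwards [Lp.coeFn_add (sval (u 0)) (sval (v 0)), Lp.coeFn_add (sval (u 1)) (sval (v 1))]
    with x h0 h1
  refine PiLp.ext fun j => ?_
  fin_cases j
  · exact h0
  · exact h1

lemma vel_smul_ae (c : ℝ) (v : H1Vec Ω) :
    vel (c • v) =ᵐ[volume.restrict Ω] fun x => c • vel v x := by
  filter_upwards [Lp.coeFn_smul c (sval (v 0)), Lp.coeFn_smul c (sval (v 1))] with x h0 h1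
  refine PiLp.ext fun j => ?_
  fin_cases j
  · exact h0
  · exact h1

lemma jac_add_ae (u v : H1Vec Ω) :
    jac (u + v) =ᵐ[volume.restrict Ω] fun x => jac u x + jac v x := by
  filter_upwards [Lp.coeFn_add (sgrad (u 0)) (sgrad (v 0)),
    Lp.coeFn_add (sgrad (u 1)) (sgrad (v 1))] with x h0 h1
  refine PiLp.ext fun j => ?_
  fin_cases j
  · exact h0
  · exact h1

lemma jac_smul_ae (c : ℝ) (v : H1Vec Ω) :
    jac (c • v) =ᵐ[volume.restrict Ω] fun x => c • jac v x := by
  filter_upwards [Lp.coeFn_smul c (sgrad (v 0)), Lp.coeFn_smul c (sgrad (v 1))] with x h0 h1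
  refine PiLp.ext fun j => ?_
  fin_cases j
  · exact h0
  · exact h1

lemma aestronglyMeasurable_convection (u v : H1Vec Ω) :
    AEStronglyMeasurable (convection u v) (volume.restrict Ω) := by
  refine (PiLp.continuous_toLp 2 (fun _ : Fin 2 => ℝ)).comp_aestronglyMeasurable
    (AEMeasurable.aestronglyMeasurable (aemeasurable_pi_lambda _ fun i => ?_))
  have hu := (memLp_vel u).1
  have hv := (memLp_jac v).1
  have hvi : AEStronglyMeasurable (fun x => jac v x i) (volume.restrict Ω) :=
    (PiLp.continuous_apply 2 (fun _ : Fin 2 => Plane) i).comp_aestronglyMeasurable hv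
  refine Finset.aemeasurable_fun_sum _ fun j _ => ?_
  exact (((PiLp.continuous_apply 2 (fun _ : Fin 2 => ℝ) j).comp_aestronglyMeasurable hu).mul
    ((PiLp.continuous_apply 2 (fun _ : Fin 2 => ℝ) j).comp_aestronglyMeasurable hvi)).aemeasurable

instance : ENNReal.HolderTriple 4 4 2 := ⟨by
  rw [← ENNReal.toReal_eq_toReal_iff' (by simp) (by simp), ENNReal.toReal_add (by simp) (by simp)]
  norm_num⟩

/-- Hölder's inequality with `1/4 + 1/4 + 1/2 = 1`. -/
lemma eLpNorm_convection_le (u v w : H1Vec Ω) :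
    eLpNorm (fun x => ⟪convection u v x, vel w x⟫_ℝ) 1 (volume.restrict Ω)
      ≤ eLpNorm (vel u) 4 (volume.restrict Ω) * eLpNorm (vel w) 4 (volume.restrict Ω)
        * eLpNorm (jac v) 2 (volume.restrict Ω) := by
  have hu := (memLp_vel u).1
  have hw := (memLp_vel w).1
  have hv := (memLp_jac v).1
  have h1 : eLpNorm ((fun x => ‖vel u x‖) • fun x => ‖vel w x‖) 2 (volume.restrict Ω)
      ≤ eLpNorm (vel u) 4 (volume.restrict Ω) * eLpNorm (vel w) 4 (volume.restrict Ω) := by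
    refine (eLpNorm_smul_le_mul_eLpNorm (p := 4) (q := 4) hw.norm hu.norm).trans (le_of_eq ?_)
    rw [eLpNorm_norm, eLpNorm_norm]
  have h2 : eLpNorm (((fun x => ‖vel u x‖) • fun x => ‖vel w x‖) • fun x => ‖jac v x‖) 1
      (volume.restrict Ω) ≤ eLpNorm ((fun x => ‖vel u x‖) • fun x => ‖vel w x‖) 2
        (volume.restrict Ω) * eLpNorm (jac v) 2 (volume.restrict Ω) := by
    refine (eLpNorm_smul_le_mul_eLpNorm (p := 2) (q := 2) hv.norm (hu.norm.smul hw.norm)).trans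
      (le_of_eq ?_)
    rw [eLpNorm_norm (jac v)]
  have h3 : eLpNorm (fun x => ⟪convection u v x, vel w x⟫_ℝ) 1 (volume.restrict Ω)
      ≤ eLpNorm (((fun x => ‖vel u x‖) • fun x => ‖vel w x‖) • fun x => ‖jac v x‖) 1
        (volume.restrict Ω) := by
    refine eLpNorm_mono_real fun x => ?_
    refine (norm_inner_le_norm _ _).trans ?_
    have := mul_le_mul_of_nonneg_right (norm_convection_le u v x) (norm_nonneg (vel w x))
    have e : (((fun x => ‖vel u x‖) • fun x => ‖vel w x‖) • fun x => ‖jac v x‖) x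
        = ‖vel u x‖ * ‖vel w x‖ * ‖jac v x‖ := rfl
    rw [e]
    linarith
  exact (h3.trans h2).trans (by gcongr)

lemma memLp_four_vel (hΩ : IsOpen Ω) {v : H1Vec Ω} (hv : v ∈ WSub Ω) :
    MemLp (vel v) 4 (volume.restrict Ω) := by
  obtain ⟨c, hc⟩ := exists_isLadyzhenskayaConstant hΩ
  exact ⟨(memLp_vel v).1, ((isLadyzhenskayaConstant_iff.1 hc).2 v hv).trans_lt ENNReal.ofReal_lt_top⟩

lemma integrable_convection (hΩ : IsOpen Ω) {u w : H1Vec Ω} (hu : u ∈ WSub Ω) (v : H1Vec Ω)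
    (hw : w ∈ WSub Ω) :
    Integrable (fun x => ⟪convection u v x, vel w x⟫_ℝ) (volume.restrict Ω) := by
  rw [← memLp_one_iff_integrable]
  refine ⟨(aestronglyMeasurable_convection u v).inner (memLp_vel w).1,
    (eLpNorm_convection_le u v w).trans_lt ?_⟩
  exact ENNReal.mul_lt_top (ENNReal.mul_lt_top (memLp_four_vel hΩ hu).2 (memLp_four_vel hΩ hw).2)
    (memLp_jac v).2

/-- Hölder's inequality followed by Ladyzhenskaya's for `u` and `w`, each contributing a factor
`√c`. No `L⁴` bound is required of `v`, which enters only through its gradient. -/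
lemma abs_bForm_le {c : ℝ} (hc : IsLadyzhenskayaConstant Ω c) {u w : H1Vec Ω} (hu : u ∈ WSub Ω)
    (v : H1Vec Ω) (hw : w ∈ WSub Ω) :
    |bForm u v w| ≤ c * (√(‖velL Ω u‖ * ‖jacL Ω u‖) * √(‖velL Ω w‖ * ‖jacL Ω w‖) * ‖jacL Ω v‖) := by
  have hc' := isLadyzhenskayaConstant_iff.1 hc
  have hc0 := hc'.1.le
  have h1 : ‖bForm u v w‖ₑ ≤ ENNReal.ofReal (√(c * ‖velL Ω u‖ * ‖jacL Ω u‖)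
      * √(c * ‖velL Ω w‖ * ‖jacL Ω w‖) * ‖jacL Ω v‖) := by
    refine (enorm_integral_le_lintegral_enorm _).trans ?_
    rw [← eLpNorm_one_eq_lintegral_enorm, ENNReal.ofReal_mul (by positivity),
      ENNReal.ofReal_mul (by positivity), ← eLpNorm_jac]
    refine (eLpNorm_convection_le u v w).trans ?_
    gcongr
    · exact hc'.2 u hu
    · exact hc'.2 w hw
  rw [← ofReal_norm, ENNReal.ofReal_le_ofReal_iff (by positivity), Real.norm_eq_abs] at h1
  refine h1.trans (le_of_eq ?_)
  rw [mul_assoc c, mul_assoc c, Real.sqrt_mul hc0, Real.sqrt_mul hc0]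
  have := Real.mul_self_sqrt hc0
  linear_combination (√(‖velL Ω u‖ * ‖jacL Ω u‖) * √(‖velL Ω w‖ * ‖jacL Ω w‖) * ‖jacL Ω v‖) * this

lemma bForm_add_left (hΩ : IsOpen Ω) {u u' w : H1Vec Ω} (hu : u ∈ WSub Ω) (hu' : u' ∈ WSub Ω)
    (v : H1Vec Ω) (hw : w ∈ WSub Ω) : bForm (u + u') v w = bForm u v w + bForm u' v w := by
  rw [bForm, bForm, bForm, ← integral_add (integrable_convection hΩ hu v hw)
    (integrable_convection hΩ hu' v hw)]
  refine integral_congr_ae ?_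
  filter_upwards [vel_add_ae u u'] with x hx
  simp only [PiLp.inner_apply, convection_apply, hx, PiLp.add_apply, RCLike.inner_apply, map_add,
    add_mul, mul_add, Finset.sum_add_distrib]

lemma bForm_smul_left (c : ℝ) (u v w : H1Vec Ω) : bForm (c • u) v w = c * bForm u v w := by
  rw [bForm, bForm, ← integral_const_mul]
  refine integral_congr_ae ?_
  filter_upwards [vel_smul_ae c u] with x hx
  simp only [PiLp.inner_apply (𝕜 := ℝ) (f := fun _ : Fin 2 => ℝ) (convection _ _ _),
    convection_apply, hx, inner_smul_right]
  simp
  ring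

lemma bForm_add_mid (hΩ : IsOpen Ω) {u w : H1Vec Ω} (hu : u ∈ WSub Ω)
    (v v' : H1Vec Ω) (hw : w ∈ WSub Ω) : bForm u (v + v') w = bForm u v w + bForm u v' w := by
  rw [bForm, bForm, bForm, ← integral_add (integrable_convection hΩ hu v hw)
    (integrable_convection hΩ hu v' hw)]
  refine integral_congr_ae ?_
  filter_upwards [jac_add_ae v v'] with x hx
  simp only [PiLp.inner_apply, convection_apply, hx, PiLp.add_apply, RCLike.inner_apply, map_add,
    mul_add, Finset.sum_add_distrib]

lemma bForm_smul_mid (c : ℝ) (u v w : H1Vec Ω) : bForm u (c • v) w = c * bForm u v w := by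
  rw [bForm, bForm, ← integral_const_mul]
  refine integral_congr_ae ?_
  filter_upwards [jac_smul_ae c v] with x hx
  simp only [PiLp.inner_apply (𝕜 := ℝ) (f := fun _ : Fin 2 => ℝ) (convection _ _ _),
    convection_apply, hx, PiLp.smul_apply, inner_smul_left]
  simp
  ring

lemma bForm_add_right (hΩ : IsOpen Ω) {u w w' : H1Vec Ω} (hu : u ∈ WSub Ω)
    (v : H1Vec Ω) (hw : w ∈ WSub Ω) (hw' : w' ∈ WSub Ω) :
    bForm u v (w + w') = bForm u v w + bForm u v w' := by
  rw [bForm, bForm, bForm, ← integral_add (integrable_convection hΩ hu v hw)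
    (integrable_convection hΩ hu v hw')]
  refine integral_congr_ae ?_
  filter_upwards [vel_add_ae w w'] with x hx
  rw [hx, inner_add_right]

lemma bForm_smul_right (c : ℝ) (u v w : H1Vec Ω) : bForm u v (c • w) = c * bForm u v w := by
  rw [bForm, bForm, ← integral_const_mul]
  refine integral_congr_ae ?_
  filter_upwards [vel_smul_ae c w] with x hx
  rw [hx, inner_smul_right]

lemma norm_velL_le (v : H1Vec Ω) : ‖velL Ω v‖ ≤ ‖v‖ :=
  le_of_sq_le_sq (by rw [norm_sq_eq_velL_add_jacL]; nlinarith [sq_nonneg ‖jacL Ω v‖]) (norm_nonneg _)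

lemma norm_jacL_le (v : H1Vec Ω) : ‖jacL Ω v‖ ≤ ‖v‖ :=
  le_of_sq_le_sq (by rw [norm_sq_eq_velL_add_jacL]; nlinarith [sq_nonneg ‖velL Ω v‖]) (norm_nonneg _)

lemma sqrt_norm_mul_norm_le (v : H1Vec Ω) : √(‖velL Ω v‖ * ‖jacL Ω v‖) ≤ ‖v‖ := by
  rw [Real.sqrt_le_left (norm_nonneg _), sq]
  exact mul_le_mul (norm_velL_le v) (norm_jacL_le v) (norm_nonneg _) (norm_nonneg _)

lemma abs_bForm_le_norm {c : ℝ} (hc : IsLadyzhenskayaConstant Ω c) {u w : H1Vec Ω}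
    (hu : u ∈ WSub Ω) (v : H1Vec Ω) (hw : w ∈ WSub Ω) :
    |bForm u v w| ≤ c * ‖u‖ * ‖v‖ * ‖w‖ := by
  refine (abs_bForm_le hc hu v hw).trans ?_
  have h1 := sqrt_norm_mul_norm_le u
  have h2 := sqrt_norm_mul_norm_le w
  have h3 := norm_jacL_le v
  have h4 : √(‖velL Ω u‖ * ‖jacL Ω u‖) * √(‖velL Ω w‖ * ‖jacL Ω w‖) * ‖jacL Ω v‖
      ≤ ‖u‖ * ‖w‖ * ‖v‖ := by gcongr
  calc _ ≤ c * (‖u‖ * ‖w‖ * ‖v‖) := mul_le_mul_of_nonneg_left h4 hc.1.le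
    _ = _ := by ring

/-- The convective term as an element of `H¹₀(Ω)²`, by the Riesz representation theorem. -/
def convRep {c : ℝ} (hΩ : IsOpen Ω) (hc : IsLadyzhenskayaConstant Ω c) (u v : WSub Ω) : WSub Ω :=
  (InnerProductSpace.toDual ℝ (WSub Ω)).symm (LinearMap.mkContinuous
    { toFun := fun w => bForm u.1 v.1 w.1
      map_add' := fun w w' => bForm_add_right hΩ u.2 v.1 w.2 w'.2
      map_smul' := fun a w => bForm_smul_right a u.1 v.1 w.1 } (c * ‖u‖ * ‖v‖)
    fun w => abs_bForm_le_norm hc u.2 v.1 w.2)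

lemma inner_convRep {c : ℝ} (hΩ : IsOpen Ω) (hc : IsLadyzhenskayaConstant Ω c) (u v w : WSub Ω) :
    ⟪convRep hΩ hc u v, w⟫_ℝ = bForm u.1 v.1 w.1 := by
  rw [convRep, InnerProductSpace.toDual_symm_apply]
  rfl

/-- The convective term as a bounded bilinear map. -/
def convW {c : ℝ} (hΩ : IsOpen Ω) (hc : IsLadyzhenskayaConstant Ω c) :
    WSub Ω →L[ℝ] WSub Ω →L[ℝ] WSub Ω :=
  LinearMap.mkContinuous₂ (LinearMap.mk₂ ℝ (convRep hΩ hc)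
    (fun u u' v => ext_inner_right ℝ fun w => by
      rw [inner_add_left, inner_convRep, inner_convRep, inner_convRep]
      exact bForm_add_left hΩ u.2 u'.2 v.1 w.2)
    (fun a u v => ext_inner_right ℝ fun w => by
      rw [inner_smul_left, inner_convRep, inner_convRep]
      exact bForm_smul_left a u.1 v.1 w.1)
    (fun u v v' => ext_inner_right ℝ fun w => by
      rw [inner_add_left, inner_convRep, inner_convRep, inner_convRep]
      exact bForm_add_mid hΩ u.2 v.1 v'.1 w.2)
    (fun a u v => ext_inner_right ℝ fun w => by
      rw [inner_smul_left, inner_convRep, inner_convRep]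
      exact bForm_smul_mid a u.1 v.1 w.1)) c
    fun u v => by
      change ‖convRep hΩ hc u v‖ ≤ _
      have h : ‖convRep hΩ hc u v‖ ^ 2 ≤ c * ‖u‖ * ‖v‖ * ‖convRep hΩ hc u v‖ := by
        rw [← real_inner_self_eq_norm_sq, inner_convRep]
        exact (le_abs_self _).trans (abs_bForm_le_norm hc u.2 v.1 (convRep hΩ hc u v).2)
      have := hc.1
      exact le_of_sq_le_mul (norm_nonneg _) (by positivity) h

lemma inner_convW {c : ℝ} (hΩ : IsOpen Ω) (hc : IsLadyzhenskayaConstant Ω c) (u v w : WSub Ω) :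
    ⟪convW hΩ hc u v, w⟫_ℝ = bForm u.1 v.1 w.1 := inner_convRep hΩ hc u v w

/-- The defining identities of the weak gradients of the components of `u`, all tested with the same
`ζ`, add up to the integral of `-ζ div u`. -/
lemma integral_inner_vel_pgrad_eq_zero {u : H1Vec Ω}
    (hdiv : ∀ᵐ x ∂(volume.restrict Ω), ∑ i, jac u x i i = 0) {ζ : Plane → ℝ}
    (hζ : IsTestFunction Ω ζ) : ∫ x in Ω, ⟪vel u x, pgrad ζ x⟫_ℝ = 0 := by
  have h : ∀ i, ∫ x in Ω, sval (u i) x * fderiv ℝ ζ x (EuclideanSpace.single i 1)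
      = - ∫ x in Ω, sgrad (u i) x i * ζ x := fun i => hasWeakGradient_sgrad (u i) ζ hζ i
  have h1 : ∫ x in Ω, ⟪vel u x, pgrad ζ x⟫_ℝ
      = ∑ i, ∫ x in Ω, sval (u i) x * fderiv ℝ ζ x (EuclideanSpace.single i 1) := by
    have hi : ∀ i ∈ Finset.univ, Integrable (fun x => sval (u i) x
        * fderiv ℝ ζ x (EuclideanSpace.single i 1)) (volume.restrict Ω) := fun i _ =>
      (Lp.memLp (sval (u i))).integrable_mul (test_deriv_memLp Ω hζ i)
    rw [← integral_finsetSum _ hi]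
    refine integral_congr_ae (Eventually.of_forall fun x => ?_)
    simp [PiLp.inner_apply, vel, mul_comm]
  have hi : ∀ i ∈ Finset.univ, Integrable (fun x => sgrad (u i) x i * ζ x) (volume.restrict Ω) :=
    fun i _ => (coord_memLp (Lp.memLp (sgrad (u i))) i).integrable_mul (test_memLp Ω hζ)
  rw [h1, Finset.sum_congr rfl fun i _ => h i, Finset.sum_neg_distrib,
    ← integral_finsetSum _ hi, integral_eq_zero_of_ae, neg_zero]
  filter_upwards [hdiv] with x hx
  rw [← Finset.sum_mul]
  change (∑ i, jac u x i i) * ζ x = 0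
  rw [hx, zero_mul]

lemma pgrad_mul_self {η : Plane → ℝ} (h : Differentiable ℝ η) (x : Plane) :
    pgrad (fun x => η x * η x) x = (2 * η x) • pgrad η x := by
  refine PiLp.ext fun i => ?_
  rw [pgrad_apply, fderiv_fun_mul (h x) (h x)]
  simp
  ring

lemma pgrad_add {η ζ : Plane → ℝ} (h : Differentiable ℝ η) (h' : Differentiable ℝ ζ) (x : Plane) :
    pgrad (fun x => η x + ζ x) x = pgrad η x + pgrad ζ x := by
  refine PiLp.ext fun i => ?_
  rw [pgrad_apply, fderiv_fun_add (h x) (h' x)]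
  simp

/-- For smooth `v` one has `2 [(u · ∇)v] · v = u · ∇|v|²`, and `|v|²` is again a test function. -/
lemma bForm_self_eq_zero_of_test {u v : H1Vec Ω}
    (hdiv : ∀ᵐ x ∂(volume.restrict Ω), ∑ i, jac u x i i = 0) {η : Fin 2 → Plane → ℝ}
    (hη : ∀ i, IsTestFunction Ω (η i)) (hv : ∀ i, sval (v i) =ᵐ[volume.restrict Ω] η i)
    (hv' : ∀ i, sgrad (v i) =ᵐ[volume.restrict Ω] pgrad (η i)) : bForm u v v = 0 := by
  have hd : ∀ i, Differentiable ℝ (η i) := fun i => (hη i).1.differentiable (by simp)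
  have hζ := ((hη 0).mul (hη 0)).add ((hη 1).mul (hη 1))
  have h := integral_inner_vel_pgrad_eq_zero hdiv hζ
  have h2 : 2 * bForm u v v = 0 := by
    rw [← h, bForm, ← integral_const_mul]
    refine integral_congr_ae ?_
    filter_upwards [hv 0, hv 1, hv' 0, hv' 1] with x h0 h1 h0' h1'
    rw [pgrad_add (η := fun x => η 0 x * η 0 x) (ζ := fun x => η 1 x * η 1 x)
      ((hd 0).mul (hd 0)) ((hd 1).mul (hd 1)), pgrad_mul_self (hd 0),
      pgrad_mul_self (hd 1), inner_add_right, inner_smul_right, inner_smul_right, PiLp.inner_apply,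
      Fin.sum_univ_two, convection_apply, convection_apply]
    have e0 : vel v x 0 = η 0 x := h0
    have e1 : vel v x 1 = η 1 x := h1
    have e2 : jac v x 0 = pgrad (η 0) x := h0'
    have e3 : jac v x 1 = pgrad (η 1) x := h1'
    rw [e0, e1, e2, e3, real_inner_comm (vel u x), real_inner_comm (vel u x)]
    simp
    ring
  linarith

/-- Test fields approximate `v` in `H¹₀(Ω)²`, and the form is continuous there by Ladyzhenskaya's
inequality. The approximations of `v` need not be solenoidal; only `u` must be. -/
lemma bForm_self_eq_zero (hΩ : IsOpen Ω) {u v : H1Vec Ω} (hu : u ∈ VSub Ω) (hv : v ∈ WSub Ω) :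
    bForm u v v = 0 := by
  obtain ⟨c, hc⟩ := exists_isLadyzhenskayaConstant hΩ
  choose η hη hlim using fun i => exists_seq_test_of_mem_H10 hΩ (hv i)
  let v' : ℕ → WSub Ω := fun n => ⟨WithLp.toLp 2 fun i => smoothH1 hΩ (hη i n).1 (hη i n).2.1,
    fun i => smoothH1_mem_H10 hΩ (hη i n)⟩
  have hlim' : Tendsto v' atTop (𝓝 ⟨v, hv⟩) := by
    refine tendsto_subtype_rng.2 ?_
    exact ((PiLp.continuous_toLp 2 (fun _ : Fin 2 => H1 Ω)).tendsto _).comp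
      (tendsto_pi_nhds.2 fun i => hlim i)
  have h1 : Tendsto (fun n => ⟪convW hΩ hc ⟨u, hu.1⟩ (v' n), v' n⟫_ℝ) atTop
      (𝓝 ⟪convW hΩ hc ⟨u, hu.1⟩ ⟨v, hv⟩, ⟨v, hv⟩⟫_ℝ) :=
    (((convW hΩ hc ⟨u, hu.1⟩).continuous.tendsto _).comp hlim').inner hlim'
  have h2 : ∀ n, ⟪convW hΩ hc ⟨u, hu.1⟩ (v' n), v' n⟫_ℝ = 0 := fun n => by
    rw [inner_convW]
    exact bForm_self_eq_zero_of_test hu.2 (fun i => hη i n)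
      (fun i => sval_smoothH1 hΩ (hη i n).1 (hη i n).2.1)
      (fun i => sgrad_smoothH1 hΩ (hη i n).1 (hη i n).2.1)
  simp only [h2] at h1
  rw [← inner_convW hΩ hc ⟨u, hu.1⟩ ⟨v, hv⟩ ⟨v, hv⟩]
  exact (tendsto_nhds_unique h1 tendsto_const_nhds)

/-- Polarization of `bForm_self_eq_zero`. -/
lemma bForm_antisymm (hΩ : IsOpen Ω) {u v w : H1Vec Ω} (hu : u ∈ VSub Ω) (hv : v ∈ WSub Ω)
    (hw : w ∈ WSub Ω) : bForm u v w = - bForm u w v := by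
  have h := bForm_self_eq_zero hΩ hu ((WSub Ω).add_mem hv hw)
  rw [bForm_add_mid hΩ hu.1 _ _ ((WSub Ω).add_mem hv hw), bForm_add_right hΩ hu.1 _ hv hw,
    bForm_add_right hΩ hu.1 _ hv hw, bForm_self_eq_zero hΩ hu hv, bForm_self_eq_zero hΩ hu hw] at h
  linarith

/-- The inclusion of `V` into `H¹₀(Ω)²`. -/
def vW (Ω : Set Plane) : V Ω →L[ℝ] WSub Ω := (vInc Ω).codRestrict (WSub Ω) fun v => v.2.1

/-- The convective term on `V`. -/
def vB {c : ℝ} (hΩ : IsOpen Ω) (hc : IsLadyzhenskayaConstant Ω c) : V Ω →L[ℝ] V Ω →L[ℝ] V Ω :=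
  (ContinuousLinearMap.compL ℝ (V Ω) (WSub Ω) (V Ω) (vW Ω).adjoint) ∘L
    (convW hΩ hc).bilinearComp (vW Ω) (vW Ω)

lemma inner_vB {c : ℝ} (hΩ : IsOpen Ω) (hc : IsLadyzhenskayaConstant Ω c) (u v w : V Ω) :
    ⟪vB hΩ hc u v, w⟫_ℝ = bForm u.1 v.1 w.1 := by
  have h : vB hΩ hc u v = (vW Ω).adjoint (convW hΩ hc (vW Ω u) (vW Ω v)) := rfl
  rw [h, ContinuousLinearMap.adjoint_inner_left, inner_convW]
  rfl

/-- Antisymmetry moves the derivative onto the test field. Ladyzhenskaya's inequality then falls on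
`u` and `v`, and the test field is measured by its gradient alone, as the dual norm requires. -/
lemma isConvective_vB {c : ℝ} (hΩ : IsOpen Ω) (hc : IsLadyzhenskayaConstant Ω c) :
    IsConvective (vJ Ω) (vB hΩ hc) (c ^ 2) := by
  refine ⟨sq_nonneg _, fun u v => ?_, fun u v => ?_⟩
  · set w := vB hΩ hc u v with hw
    have hc0 := hc.1
    have h1 : ‖w‖ ^ 2 ≤ c * (√(‖vJ Ω u‖ * ‖u‖) * √(‖vJ Ω v‖ * ‖v‖)) * ‖w‖ := by
      rw [← real_inner_self_eq_norm_sq]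
      conv_lhs => rw [hw]
      rw [inner_vB, bForm_antisymm hΩ u.2 v.2.1 (vB hΩ hc u v).2.1, ← hw]
      refine (neg_le_abs _).trans ((abs_bForm_le hc u.2.1 w.1 v.2.1).trans ?_)
      rw [mul_assoc c]
      have h2 := norm_jacL_le u.1
      have h3 := norm_jacL_le v.1
      have h4 := norm_jacL_le w.1
      refine mul_le_mul_of_nonneg_left ?_ hc0.le
      refine mul_le_mul (mul_le_mul ?_ ?_ (by positivity) (by positivity)) h4 (by positivity)
        (by positivity)
      · exact Real.sqrt_le_sqrt (mul_le_mul_of_nonneg_left h2 (norm_nonneg _))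
      · exact Real.sqrt_le_sqrt (mul_le_mul_of_nonneg_left h3 (norm_nonneg _))
    have h2 := le_of_sq_le_mul (norm_nonneg w) (by positivity) h1
    calc ‖w‖ ^ 2 ≤ (c * (√(‖vJ Ω u‖ * ‖u‖) * √(‖vJ Ω v‖ * ‖v‖))) ^ 2 := by gcongr
      _ = _ := by
        rw [mul_pow, mul_pow, Real.sq_sqrt (by positivity), Real.sq_sqrt (by positivity)]
  · rw [inner_vB]
    exact bForm_self_eq_zero hΩ u.2 v.2.1

/-- Poincaré's inequality turns each square root in Ladyzhenskaya's bound into `√cP` times the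
Dirichlet norm; two such factors make up the constant `c cP`. -/
lemma isDirichletConvective_vB {c cP : ℝ} (hΩ : IsOpen Ω) (hP : IsPoincareConstant Ω cP)
    (hc : IsLadyzhenskayaConstant Ω c) :
    IsDirichletConvective (vJ Ω) (vD Ω) (vB hΩ hc) cP (c * cP) := by
  have hP' := isPoincareConstant_iff.1 hP
  have hcP := hP'.1
  have hc0 := hc.1
  refine ⟨hcP.le, by positivity, V.norm_sq_eq, fun v => hP'.2 v.1 v.2.1, fun u v w => ?_,
    fun u v => ?_⟩
  · rw [inner_vB]
    refine (abs_bForm_le hc u.2.1 v.1 w.2.1).trans ?_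
    have hs : ∀ v : V Ω, √(‖velL Ω v.1‖ * ‖jacL Ω v.1‖) ≤ √cP * ‖vD Ω v‖ := fun v => by
      rw [Real.sqrt_le_left (by positivity), mul_pow, Real.sq_sqrt hcP.le, sq, ← mul_assoc]
      exact mul_le_mul_of_nonneg_right (hP'.2 v.1 v.2.1) (norm_nonneg _)
    calc c * (√(‖velL Ω u.1‖ * ‖jacL Ω u.1‖) * √(‖velL Ω w.1‖ * ‖jacL Ω w.1‖) * ‖jacL Ω v.1‖)
        ≤ c * ((√cP * ‖vD Ω u‖) * (√cP * ‖vD Ω w‖) * ‖vD Ω v‖) := by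
          refine mul_le_mul_of_nonneg_left (mul_le_mul_of_nonneg_right
            (mul_le_mul (hs u) (hs w) (by positivity) (by positivity)) (norm_nonneg _)) hc0.le
      _ = c * cP * ‖vD Ω u‖ * ‖vD Ω v‖ * ‖vD Ω w‖ := by
          have := Real.mul_self_sqrt hcP.le
          linear_combination c * ‖vD Ω u‖ * ‖vD Ω v‖ * ‖vD Ω w‖ * this
  · rw [inner_vB]
    exact bForm_self_eq_zero hΩ u.2 v.2.1

end Convection

/-! ### Mollification and Rellich's theorem in the plane -/

section Mollification

/-- Mollification `∫ p(x) ζ(y - x) dx`. -/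
def mollify (p ζ : Plane → ℝ) (y : Plane) : ℝ := ∫ x, p x * ζ (y - x)

lemma mollify_eq_convolution (p ζ : Plane → ℝ) :
    mollify p ζ = convolution p ζ (ContinuousLinearMap.mul ℝ ℝ) volume := rfl

lemma contDiff_mollify {p ζ : Plane → ℝ} (hp : LocallyIntegrable p) (hζ : ContDiff ℝ ∞ ζ)
    (hc : HasCompactSupport ζ) : ContDiff ℝ ∞ (mollify p ζ) :=
  hc.contDiff_convolution_right (ContinuousLinearMap.mul ℝ ℝ) hp hζ

lemma fderiv_mollify {p ζ : Plane → ℝ} (hp : LocallyIntegrable p) (hζ : ContDiff ℝ ∞ ζ)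
    (hc : HasCompactSupport ζ) (y v : Plane) :
    fderiv ℝ (mollify p ζ) y v = ∫ x, p x * fderiv ℝ ζ (y - x) v := by
  have hζ1 : ContDiff ℝ 1 ζ := hζ.of_le (by simp)
  rw [mollify_eq_convolution, (hc.hasFDerivAt_convolution_right _ hp hζ1 y).fderiv,
    convolution_precompR_apply _ hp (hc.fderiv ℝ) (hζ1.continuous_fderiv one_ne_zero)]
  rfl

lemma hasCompactSupport_comp_sub {ζ : Plane → ℝ} (hc : HasCompactSupport ζ) (y : Plane) :
    HasCompactSupport fun x => ζ (y - x) :=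
  hc.comp_homeomorph (Homeomorph.subLeft y)

lemma contDiff_comp_sub {ζ : Plane → ℝ} (hζ : ContDiff ℝ ∞ ζ) (y : Plane) :
    ContDiff ℝ ∞ fun x => ζ (y - x) :=
  hζ.comp (contDiff_const.sub contDiff_id)

lemma fderiv_comp_sub {ζ : Plane → ℝ} (hζ : ContDiff ℝ ∞ ζ) (x y v : Plane) :
    fderiv ℝ (fun x => ζ (y - x)) x v = - fderiv ℝ ζ (y - x) v := by
  have h1 : HasFDerivAt (fun x => y - x) (-(ContinuousLinearMap.id ℝ Plane)) x :=
    (hasFDerivAt_id x).const_sub y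
  have h2 : HasFDerivAt ζ (fderiv ℝ ζ (y - x)) (y - x) :=
    (hζ.differentiable (by simp) _).hasFDerivAt
  have := (h2.comp x h1).fderiv
  simp only [Function.comp_def] at this
  rw [this]
  simp

lemma isTestFunction_univ {η : Plane → ℝ} (h1 : ContDiff ℝ ∞ η) (h2 : HasCompactSupport η) :
    IsTestFunction univ η := ⟨h1, h2, subset_univ _⟩

/-- The gradient of a mollification is the mollification of the weak gradient. -/
lemma fderiv_mollify_of_hasWeakGradient {p ζ : Plane → ℝ} {g : Plane → Plane}
    (hp : MemLp p 2 volume) (hg : MemLp g 2 volume) (h : HasWeakGradient univ p g)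
    (hζ : ContDiff ℝ ∞ ζ) (hc : HasCompactSupport ζ) (y v : Plane) :
    fderiv ℝ (mollify p ζ) y v = ∫ x, ⟪g x, v⟫_ℝ * ζ (y - x) := by
  have hloc : LocallyIntegrable p := hp.locallyIntegrable (by norm_num)
  have ht : IsTestFunction univ fun x => ζ (y - x) :=
    isTestFunction_univ (contDiff_comp_sub hζ y) (hasCompactSupport_comp_sub hc y)
  have hi : ∀ i : Fin 2, fderiv ℝ (mollify p ζ) y (EuclideanSpace.single i 1)
      = ∫ x, g x i * ζ (y - x) := fun i => by
    have h1 := h _ ht i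
    simp only [Measure.restrict_univ, fderiv_comp_sub hζ, mul_neg, integral_neg, neg_inj] at h1
    rw [fderiv_mollify hloc hζ hc, h1]
  have hInt : ∀ i : Fin 2, Integrable fun x => g x i * ζ (y - x) := fun i => by
    have h1 : MemLp (fun x => g x i) 2 volume :=
      (EuclideanSpace.proj (𝕜 := ℝ) i : Plane →L[ℝ] ℝ).comp_memLp' hg
    exact h1.integrable_mul (q := 2) (ht.1.continuous.memLp_of_hasCompactSupport ht.2.1)
  rw [fderiv_eq_inner_pgrad, PiLp.inner_apply, Fin.sum_univ_two, pgrad_apply, pgrad_apply, hi, hi]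
  simp only [RCLike.inner_apply, conj_trivial]
  rw [← integral_const_mul, ← integral_const_mul,
    ← integral_add ((hInt 0).const_mul _) ((hInt 1).const_mul _)]
  refine integral_congr_ae (Eventually.of_forall fun x => ?_)
  simp only [PiLp.inner_apply, Fin.sum_univ_two, RCLike.inner_apply, conj_trivial]
  ring

lemma abs_integral_inner_le {α F : Type*} [MeasurableSpace α] {ν : Measure α}
    [NormedAddCommGroup F] [InnerProductSpace ℝ F] {f g : α → F} (hf : MemLp f 2 ν)
    (hg : MemLp g 2 ν) :
    |∫ x, ⟪f x, g x⟫_ℝ ∂ν| ≤ √(∫ x, ‖f x‖ ^ 2 ∂ν) * √(∫ x, ‖g x‖ ^ 2 ∂ν) := by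
  have h1 : ∀ {h : α → F} (hh : MemLp h 2 ν), √(∫ x, ‖h x‖ ^ 2 ∂ν) = ‖hh.toLp h‖ := by
    intro h hh
    rw [← Real.sqrt_sq (norm_nonneg (hh.toLp h)), Lp_norm_sq_eq_integral]
    congr 1
    refine integral_congr_ae ?_
    filter_upwards [hh.coeFn_toLp] with x hx
    rw [hx]
  have h2 : ∫ x, ⟪f x, g x⟫_ℝ ∂ν = ⟪hf.toLp f, hg.toLp g⟫_ℝ := by
    rw [L2.inner_def]
    refine integral_congr_ae ?_
    filter_upwards [hf.coeFn_toLp, hg.coeFn_toLp] with x h1 h2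
    rw [h1, h2]
  rw [h1 hf, h1 hg, h2]
  exact abs_real_inner_le_norm _ _

lemma abs_integral_mul_le {α : Type*} [MeasurableSpace α] {ν : Measure α} {f g : α → ℝ}
    (hf : MemLp f 2 ν) (hg : MemLp g 2 ν) :
    |∫ x, f x * g x ∂ν| ≤ √(∫ x, f x ^ 2 ∂ν) * √(∫ x, g x ^ 2 ∂ν) := by
  have := abs_integral_inner_le hf hg
  simpa [mul_comm] using this

lemma integral_sq_comp_sub (ζ : Plane → ℝ) (y : Plane) :
    ∫ x, ζ (y - x) ^ 2 = ∫ x, ζ x ^ 2 :=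
  integral_sub_left_eq_self (fun x => ζ x ^ 2) volume y

/-- Mollifications of a function with square-integrable gradient are Lipschitz. -/
lemma abs_mollify_sub_le {p ζ : Plane → ℝ} {g : Plane → Plane}
    (hp : MemLp p 2 volume) (hg : MemLp g 2 volume) (h : HasWeakGradient univ p g)
    (hζ : ContDiff ℝ ∞ ζ) (hc : HasCompactSupport ζ) (y z : Plane) :
    |mollify p ζ z - mollify p ζ y| ≤ √(∫ x, ‖g x‖ ^ 2) * √(∫ x, ζ x ^ 2) * ‖z - y‖ := by
  have hloc : LocallyIntegrable p := hp.locallyIntegrable (by norm_num)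
  have hd : Differentiable ℝ (mollify p ζ) := (contDiff_mollify hloc hζ hc).differentiable (by simp)
  refine Convex.norm_image_sub_le_of_norm_fderiv_le (𝕜 := ℝ) (fun x _ => hd x) (fun x _ => ?_)
    convex_univ (mem_univ y) (mem_univ z)
  refine ContinuousLinearMap.opNorm_le_bound _ (by positivity) fun v => ?_
  rw [fderiv_mollify_of_hasWeakGradient hp hg h hζ hc]
  have hζm : MemLp (fun w => ζ (x - w)) 2 volume :=
    (contDiff_comp_sub hζ x).continuous.memLp_of_hasCompactSupport (hasCompactSupport_comp_sub hc x)
  have hgv : MemLp (fun w => ⟪g w, v⟫_ℝ) 2 volume := by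
    have := (innerSL ℝ v).comp_memLp' hg
    simpa [real_inner_comm, Function.comp_def] using this
  refine (abs_integral_mul_le hgv hζm).trans ?_
  rw [integral_sq_comp_sub, mul_right_comm]
  gcongr
  rw [Real.sqrt_le_left (by positivity), mul_pow, Real.sq_sqrt (integral_nonneg fun _ => by positivity),
    ← integral_mul_const]
  refine integral_mono hgv.integrable_sq ((integrable_norm_sq_of_memLp hg).mul_const _) fun w => ?_
  have h1 := abs_real_inner_le_norm (g w) v
  have h2 : ⟪g w, v⟫_ℝ ^ 2 ≤ (‖g w‖ * ‖v‖) ^ 2 := by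
    rw [← sq_abs]; gcongr
  simpa [mul_pow] using h2


open scoped Pointwise in
-- The integrand vanishes unless `x` lies in the sum of the two supports, a compact set on which `p`
-- is integrable. This justifies Fubini's theorem in `integral_mul_mollify_comm`.
lemma integrable_mul_mul_comp_sub {p a b : Plane → ℝ} (hp : LocallyIntegrable p)
    (ha : Continuous a) (hac : HasCompactSupport a) (hb : Continuous b) (hbc : HasCompactSupport b) :
    Integrable (Function.uncurry fun x y => p x * a y * b (x - y))
      ((volume : Measure Plane).prod (volume : Measure Plane)) := by
  set K : Set Plane := tsupport a + tsupport b with hK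
  have hKc : IsCompact K := hac.isCompact.add hbc.isCompact
  have hpK : Integrable (K.indicator p) :=
    (hp.integrableOn_isCompact hKc).integrable_indicator hKc.measurableSet
  have h1 : Integrable (fun z : Plane × Plane => K.indicator p z.1 * a z.2)
      ((volume : Measure Plane).prod (volume : Measure Plane)) :=
    hpK.mul_prod (ha.integrable_of_hasCompactSupport hac)
  obtain ⟨C, hC⟩ := hb.bounded_above_of_compact_support hbc
  have h2 := h1.bdd_mul (c := C) (f := fun z : Plane × Plane => b (z.1 - z.2))
    (hb.comp (continuous_fst.sub continuous_snd)).aestronglyMeasurable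
    (Eventually.of_forall fun z => hC _)
  refine h2.congr (Eventually.of_forall fun ⟨x, y⟩ => ?_)
  simp only [Function.uncurry]
  by_cases hx : x ∈ K
  · rw [indicator_of_mem hx]; ring
  · rw [indicator_of_notMem hx]
    by_cases hy : y ∈ tsupport a
    · have : x - y ∉ tsupport b := fun hcon => hx ⟨y, hy, x - y, hcon, by simp⟩
      rw [image_eq_zero_of_notMem_tsupport this]; ring
    · rw [image_eq_zero_of_notMem_tsupport hy]; ring

/-- Both sides are the double integral of `p(x) a(y) b(x - y)`, up to the substitution that
exchanges `y` and `x - y`. -/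
lemma integral_mul_mollify_comm {p a b : Plane → ℝ} (hp : LocallyIntegrable p)
    (ha : Continuous a) (hac : HasCompactSupport a) (hb : Continuous b) (hbc : HasCompactSupport b) :
    ∫ z, a z * mollify p (fun y => b (-y)) z = ∫ y, b y * mollify p (fun y => a (-y)) y := by
  have e1 : ∀ c d : Plane → ℝ, (∫ z, c z * mollify p (fun y => d (-y)) z)
      = ∫ z, ∫ x, p x * c z * d (x - z) := fun c d => by
    refine integral_congr_ae (Eventually.of_forall fun z => ?_)
    simp only [mollify, neg_sub]
    rw [← integral_const_mul]
    exact integral_congr_ae (Eventually.of_forall fun x => by simp only; ring)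
  rw [e1, e1, ← integral_integral_swap (integrable_mul_mul_comp_sub hp ha hac hb hbc),
    ← integral_integral_swap (integrable_mul_mul_comp_sub hp hb hbc ha hac)]
  refine integral_congr_ae (Eventually.of_forall fun x => ?_)
  simp only
  rw [← integral_sub_left_eq_self (fun y => p x * b y * a (x - y)) volume x]
  refine integral_congr_ae (Eventually.of_forall fun y => ?_)
  simp only [sub_sub_cancel]
  ring

/-- Test functions are dense in `L²(U)`. -/
lemma sqrt_integral_sq_le_of_test {U : Set Plane} (hU : IsOpen U) {f : Plane → ℝ}
    (hf : MemLp f 2 (volume.restrict U)) {M : ℝ} (hM : 0 ≤ M)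
    (h : ∀ η, IsTestFunction U η → |∫ x in U, f x * η x| ≤ M * √(∫ x in U, η x ^ 2)) :
    √(∫ x in U, f x ^ 2) ≤ M := by
  let S : Submodule ℝ (L2 U ℝ) :=
    { carrier := {q | ∃ η, IsTestFunction U η ∧ q =ᵐ[volume.restrict U] η}
      zero_mem' := ⟨fun _ => 0, ⟨contDiff_const, HasCompactSupport.zero, by simp [tsupport]⟩,
        Lp.coeFn_zero _ _ _⟩
      add_mem' := by
        rintro q r ⟨η, hη, h1⟩ ⟨ζ, hζ, h2⟩
        refine ⟨_, hη.add hζ, (Lp.coeFn_add q r).trans ?_⟩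
        filter_upwards [h1, h2] with x h1 h2
        simp [h1, h2]
      smul_mem' := by
        rintro c q ⟨η, hη, h1⟩
        refine ⟨_, hη.const_mul c, (Lp.coeFn_smul c q).trans ?_⟩
        filter_upwards [h1] with x h1
        simp [h1] }
  have hS : S.topologicalClosure = ⊤ := by
    rw [Submodule.topologicalClosure_eq_top_iff, Submodule.eq_bot_iff]
    intro q hq
    rw [Lp.eq_zero_iff_ae_eq_zero]
    refine ae_eq_zero_of_integral_test hU (Lp.memLp q) fun η hη => ?_
    have h1 := (Submodule.mem_orthogonal' S q).1 hq ((test_memLp U hη).toLp η)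
      ⟨η, hη, (test_memLp U hη).coeFn_toLp⟩
    rw [L2.inner_def] at h1
    rw [← h1]
    refine integral_congr_ae ?_
    filter_upwards [(test_memLp U hη).coeFn_toLp] with x hx
    rw [hx]
    simp [mul_comm]
  set F := hf.toLp f with hF
  have hb : ∀ q : L2 U ℝ, |⟪F, q⟫_ℝ| ≤ M * ‖q‖ := by
    intro q
    have hq : q ∈ closure (S : Set (L2 U ℝ)) := by
      rw [← Submodule.topologicalClosure_coe, hS]; trivial
    refine closure_minimal (t := {q : L2 U ℝ | |⟪F, q⟫_ℝ| ≤ M * ‖q‖}) ?_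
      (isClosed_le (by fun_prop) (by fun_prop)) hq
    rintro q ⟨η, hη, hqη⟩
    have h1 := h η hη
    have e1 : ⟪F, q⟫_ℝ = ∫ x in U, f x * η x := by
      rw [L2.inner_def]
      refine integral_congr_ae ?_
      filter_upwards [hqη, hf.coeFn_toLp] with x h1 h2
      rw [h1, h2]
      simp [mul_comm]
    have e2 : ‖q‖ = √(∫ x in U, η x ^ 2) := by
      rw [← Real.sqrt_sq (norm_nonneg q), Lp_norm_sq_eq_integral]
      congr 1
      refine integral_congr_ae ?_
      filter_upwards [hqη] with x h1
      rw [h1]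
      simp
    simp only [mem_ofPred_eq]
    rwa [e1, e2]
  have e3 : √(∫ x in U, f x ^ 2) = ‖F‖ := by
    rw [← Real.sqrt_sq (norm_nonneg F), Lp_norm_sq_eq_integral]
    congr 1
    refine integral_congr_ae ?_
    filter_upwards [hf.coeFn_toLp] with x h1
    rw [h1]
    simp
  rw [e3]
  have h1 := hb F
  rw [real_inner_self_eq_norm_sq, abs_of_nonneg (by positivity)] at h1
  rcases (norm_nonneg F).eq_or_lt with h0 | h0
  · rwa [← h0]
  · nlinarith

/-- Rellich's theorem for functions supported in a fixed ball. -/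
theorem tendsto_integral_sq_of_weak {p : ℕ → Plane → ℝ} {g : ℕ → Plane → Plane} {R C : ℝ}
    (hp : ∀ n, MemLp (p n) 2 volume) (hg : ∀ n, MemLp (g n) 2 volume)
    (hw : ∀ n, HasWeakGradient univ (p n) (g n))
    (hs : ∀ n, ∀ᵐ x, x ∉ Metric.ball (0 : Plane) R → p n x = 0)
    (hpC : ∀ n, √(∫ x, p n x ^ 2) ≤ C) (hgC : ∀ n, √(∫ x, ‖g n x‖ ^ 2) ≤ C)
    (hweak : ∀ ρ : Plane → ℝ, ContDiff ℝ ∞ ρ → HasCompactSupport ρ →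
      Tendsto (fun n => ∫ x, p n x * ρ x) atTop (𝓝 0)) :
    Tendsto (fun n => √(∫ x, p n x ^ 2)) atTop (𝓝 0) := by
  set B := Metric.ball (0 : Plane) R with hB
  have hC : 0 ≤ C := (Real.sqrt_nonneg _).trans (hpC 0)
  have hBfin : IsFiniteMeasure (volume.restrict B) := ⟨by simpa using measure_ball_lt_top⟩
  have hpB : ∀ n (ζ : Plane → ℝ), ∫ x, p n x * ζ x = ∫ x in B, p n x * ζ x := fun n ζ => by
    refine (setIntegral_eq_integral_of_ae_compl_eq_zero ?_).symm
    filter_upwards [hs n] with x hx h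
    rw [hx h, zero_mul]
  have hpB2 : ∀ n, ∫ x, p n x ^ 2 = ∫ x in B, p n x ^ 2 := fun n => by
    simpa [sq] using hpB n (p n)
  have hloc : ∀ n, LocallyIntegrable (p n) := fun n => (hp n).locallyIntegrable (by norm_num)
  refine Metric.tendsto_atTop.2 fun ε hε => ?_
  -- Replacing `p n` by its mollification at scale `δ` will cost at most `δ C < ε/2`.
  set δ := ε / (2 * (C + 1)) with hδ
  have hδ0 : 0 < δ := by positivity
  let b : ContDiffBump (0 : Plane) := ⟨δ / 2, δ, by positivity, by linarith⟩
  set ρ : Plane → ℝ := b.normed volume with hρ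
  have hρd : ContDiff ℝ ∞ ρ := b.contDiff_normed
  have hρc : HasCompactSupport ρ := b.hasCompactSupport_normed
  have hρi : ∫ x, ρ x = 1 := b.integral_normed
  set Q : ℕ → Plane → ℝ := fun n => mollify (p n) fun y => ρ (-y) with hQ
  have hρd' : ContDiff ℝ ∞ fun y => ρ (-y) := by simpa using contDiff_comp_sub hρd 0
  have hρc' : HasCompactSupport fun y => ρ (-y) := by simpa using hasCompactSupport_comp_sub hρc 0
  have hQc : ∀ n, Continuous (Q n) := fun n => (contDiff_mollify (hloc n) hρd' hρc').continuous
  have hQb : ∀ n y, |Q n y| ≤ C * √(∫ x, ρ x ^ 2) := fun n y => by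
    have hm : MemLp (fun x => ρ (-(y - x))) 2 volume :=
      (contDiff_comp_sub hρd' y).continuous.memLp_of_hasCompactSupport
        (hasCompactSupport_comp_sub hρc' y)
    refine (abs_integral_mul_le (hp n) hm).trans ?_
    rw [integral_sq_comp_sub (fun y => ρ (-y)), integral_neg_eq_self (fun x => ρ x ^ 2)]
    gcongr
    exact hpC n
  have hQlim : ∀ y, Tendsto (fun n => Q n y) atTop (𝓝 0) := fun y =>
    hweak _ (contDiff_comp_sub hρd' y) (hasCompactSupport_comp_sub hρc' y)
  -- At a fixed scale the mollifications tend to zero at every point by weak convergence and are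
  -- uniformly bounded; dominated convergence on the ball applies.
  have hQint : Tendsto (fun n => √(∫ x in B, Q n x ^ 2)) atTop (𝓝 0) := by
    have h1 : Tendsto (fun n => ∫ x in B, Q n x ^ 2) atTop (𝓝 (∫ x in B, (0:ℝ))) := by
      refine tendsto_integral_of_dominated_convergence (fun _ => (C * √(∫ x, ρ x ^ 2)) ^ 2)
        (fun n => ((hQc n).pow 2).aestronglyMeasurable) (integrable_const _)
        (fun n => Eventually.of_forall fun y => ?_) (Eventually.of_forall fun y => ?_)
      · rw [Real.norm_eq_abs, abs_pow]
        gcongr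
        exact hQb n y
      · simpa using (hQlim y).pow 2
    rw [integral_zero] at h1
    simpa [Function.comp_def] using (Real.continuous_sqrt.tendsto 0).comp h1
  -- Duality: `∫ p η` is the value at `0` of a function `P` whose Lipschitz constant is at most `C`
  -- times the norm of `η`. Its average against the bump `ρ`, supported within distance `δ`, equals
  -- the pairing of `η` with the mollification `Q n`.
  have hmain : ∀ n, √(∫ x, p n x ^ 2) ≤ √(∫ x in B, Q n x ^ 2) + δ * C := fun n => by
    rw [hpB2]
    refine sqrt_integral_sq_le_of_test Metric.isOpen_ball ((hp n).restrict B)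
      (by positivity) fun η hη => ?_
    have hη2 : ∫ x in B, η x ^ 2 = ∫ x, η x ^ 2 := by
      simpa [sq] using setIntegral_mul_of_tsupport (f := η) hη.2.2
    have hηd' : ContDiff ℝ ∞ fun y => η (-y) := by simpa using contDiff_comp_sub hη.1 0
    have hηc' : HasCompactSupport fun y => η (-y) := by
      simpa using hasCompactSupport_comp_sub hη.2.1 0
    set P := mollify (p n) fun y => η (-y) with hP
    have hPc : Continuous P := (contDiff_mollify (hloc n) hηd' hηc').continuous
    have hP0 : P 0 = ∫ x in B, p n x * η x := by
      rw [← hpB, hP]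
      simp [mollify]
    have hPl : ∀ z, |P z - P 0| ≤ C * √(∫ x in B, η x ^ 2) * ‖z‖ := fun z => by
      have h1 := abs_mollify_sub_le (hp n) (hg n) (hw n) hηd' hηc' 0 z
      rw [integral_neg_eq_self (fun x => η x ^ 2), ← hη2, sub_zero] at h1
      refine h1.trans ?_
      gcongr
      exact hgC n
    have hswap : ∫ z, ρ z * P z = ∫ y in B, η y * Q n y := by
      rw [integral_mul_mollify_comm (hloc n) hρd.continuous hρc hη.1.continuous hη.2.1]
      simp only [mul_comm (η _)]
      exact (setIntegral_mul_of_tsupport hη.2.2).symm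
    have hρPi : Integrable fun z => ρ z * P z :=
      (hρd.continuous.mul hPc).integrable_of_hasCompactSupport hρc.mul_right
    have hρi' : Integrable ρ := hρd.continuous.integrable_of_hasCompactSupport hρc
    have hdiff : |∫ z, ρ z * (P z - P 0)| ≤ δ * C * √(∫ x in B, η x ^ 2) := by
      have h1 : ∀ z, ‖ρ z * (P z - P 0)‖ ≤ ρ z * (δ * C * √(∫ x in B, η x ^ 2)) := fun z => by
        have hρ0 : 0 ≤ ρ z := b.nonneg_normed z
        rw [norm_mul, Real.norm_of_nonneg hρ0, Real.norm_eq_abs]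
        by_cases hz : ‖z‖ < δ
        · refine mul_le_mul_of_nonneg_left ((hPl z).trans ?_) hρ0
          have : C * √(∫ x in B, η x ^ 2) * ‖z‖ ≤ C * √(∫ x in B, η x ^ 2) * δ := by gcongr
          linarith
        · have : ρ z = 0 := by
            have h2 : z ∉ Function.support ρ := by
              rw [hρ, b.support_normed_eq, mem_ball_zero_iff]
              exact hz
            simpa using h2
          simp [this]
      have h2 := norm_integral_le_of_norm_le (hρi'.mul_const _) (Eventually.of_forall h1)
      rwa [integral_mul_const, hρi, one_mul] at h2
    have hsplit : ∫ z, ρ z * (P z - P 0) = (∫ y in B, η y * Q n y) - ∫ x in B, p n x * η x := by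
      simp only [mul_sub]
      rw [integral_sub hρPi (hρi'.mul_const _), integral_mul_const, hρi, one_mul, hswap, hP0]
    have hQη : |∫ y in B, η y * Q n y| ≤ √(∫ x in B, η x ^ 2) * √(∫ x in B, Q n x ^ 2) := by
      refine abs_integral_mul_le (test_memLp B hη) ?_
      exact MemLp.of_bound (hQc n).aestronglyMeasurable _ (Eventually.of_forall (hQb n))
    rw [hsplit] at hdiff
    have h3 := abs_le.1 hdiff
    have h4 := abs_le.1 hQη
    rw [abs_le]
    constructor <;> nlinarith [h3.1, h3.2, h4.1, h4.2]
  obtain ⟨N, hN⟩ := Metric.tendsto_atTop.1 hQint (ε / 2) (by positivity)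
  refine ⟨N, fun n hn => ?_⟩
  have h1 := hN n hn
  rw [Real.dist_eq, sub_zero, abs_of_nonneg (Real.sqrt_nonneg _)] at h1 ⊢
  have h2 : δ * C < ε / 2 := by
    rw [hδ, div_mul_eq_mul_div, div_lt_div_iff₀ (by positivity) two_pos]
    nlinarith
  linarith [hmain n]

end Mollification

/-! ### Compact embeddings and limits of designs -/

section Compactness

universe u

/-- Sequential Banach–Alaoglu for the dual of a separable space, transported by the Riesz
isomorphism. -/
lemma exists_weak_subseq {E : Type u} [NormedAddCommGroup E] [InnerProductSpace ℝ E]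
    [CompleteSpace E] [TopologicalSpace.SeparableSpace E] {x : ℕ → E} {C : ℝ}
    (hx : ∀ n, ‖x n‖ ≤ C) :
    ∃ y, ‖y‖ ≤ C ∧ ∃ ns : ℕ → ℕ, StrictMono ns ∧
      ∀ h, Tendsto (fun n => ⟪x (ns n), h⟫_ℝ) atTop (𝓝 ⟪y, h⟫_ℝ) := by
  let F : ℕ → WeakDual ℝ E := fun n =>
    StrongDual.toWeakDual (InnerProductSpace.toDual ℝ E (x n))
  have hF : ∀ n, F n ∈ WeakDual.toStrongDual ⁻¹' Metric.closedBall (0 : StrongDual ℝ E) C := by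
    intro n
    rw [mem_preimage, mem_closedBall_zero_iff]
    change ‖InnerProductSpace.toDual ℝ E (x n)‖ ≤ C
    rw [LinearIsometryEquiv.norm_map]
    exact hx n
  obtain ⟨G, hG, ns, hns, hlim⟩ := WeakDual.isSeqCompact_closedBall (𝕜 := ℝ) (E := E) 0 C hF
  refine ⟨(InnerProductSpace.toDual ℝ E).symm (WeakDual.toStrongDual G), ?_, ns, hns, fun h => ?_⟩
  · rw [LinearIsometryEquiv.norm_map]
    exact mem_closedBall_zero_iff.1 hG
  · rw [InnerProductSpace.toDual_symm_apply]
    have := ((WeakDual.eval_continuous h).tendsto G).comp hlim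
    exact this

variable {Ω : Set Plane}

lemma memLp_indicator {F : Type} [NormedAddCommGroup F] (hΩ : IsOpen Ω) {f : Plane → F}
    (hf : MemLp f 2 (volume.restrict Ω)) : MemLp (Ω.indicator f) 2 volume :=
  (memLp_indicator_iff_restrict hΩ.measurableSet).2 hf

/-- The hypothesis tests with functions that need not vanish near the boundary of `Ω`; this is what
makes extension by zero compatible with the gradient. -/
lemma hasWeakGradient_indicator (hΩ : IsOpen Ω) {u : Plane → ℝ} {g : Plane → Plane}
    (h : ∀ η, ContDiff ℝ ∞ η → HasCompactSupport η → ∀ i : Fin 2,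
      ∫ x in Ω, u x * fderiv ℝ η x (EuclideanSpace.single i 1) = - ∫ x in Ω, g x i * η x) :
    HasWeakGradient univ (Ω.indicator u) (Ω.indicator g) := by
  intro η hη i
  have h1 := h η hη.1 hη.2.1 i
  rw [← integral_indicator hΩ.measurableSet, ← integral_indicator hΩ.measurableSet] at h1
  rw [Measure.restrict_univ]
  have e1 : ∫ x, Ω.indicator u x * fderiv ℝ η x (EuclideanSpace.single i 1)
      = ∫ x, Ω.indicator (fun x => u x * fderiv ℝ η x (EuclideanSpace.single i 1)) x :=
    integral_congr_ae (Eventually.of_forall fun x => by by_cases hx : x ∈ Ω <;> simp [hx])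
  have e2 : ∫ x, Ω.indicator g x i * η x = ∫ x, Ω.indicator (fun x => g x i * η x) x :=
    integral_congr_ae (Eventually.of_forall fun x => by by_cases hx : x ∈ Ω <;> simp [hx])
  rw [e1, e2, h1]

/-- The identity is closed in `H¹(Ω)` and is classical integration by parts when `p` is a test
function; the support of `η` is then immaterial. -/
lemma integral_mul_fderiv_of_mem_H10 (hΩ : IsOpen Ω) {p : H1 Ω} (hp : p ∈ H10 Ω) {η : Plane → ℝ}
    (h1 : ContDiff ℝ ∞ η) (h2 : HasCompactSupport η) (i : Fin 2) :
    ∫ x in Ω, sval p x * fderiv ℝ η x (EuclideanSpace.single i 1)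
      = - ∫ x in Ω, sgrad p x i * η x := by
  have hm1 : MemLp (fun x => fderiv ℝ η x (EuclideanSpace.single i 1)) 2 (volume.restrict Ω) :=
    memLp_of_continuous_compact Ω ((h1.continuous_fderiv (by simp)).clm_apply continuous_const)
      (h2.fderiv_apply (𝕜 := ℝ) _)
  have hm2 : MemLp (fun x => η x • (EuclideanSpace.single i (1:ℝ) : Plane)) 2 (volume.restrict Ω) :=
    memLp_smul_const (memLp_of_continuous_compact Ω h1.continuous h2) _
  have e : ∀ q : H1 Ω, ∫ x in Ω, sgrad q x i * η x
      = ∫ x in Ω, ⟪η x • (EuclideanSpace.single i (1:ℝ) : Plane), sgrad q x⟫_ℝ := fun q => by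
    simp [inner_smul_left, EuclideanSpace.inner_single_left, mul_comm]
  obtain ⟨ζ, hζ, hlim⟩ := exists_seq_test_of_mem_H10 hΩ hp
  have hcl : IsClosed {q : H1 Ω | ∫ x in Ω, sval q x * fderiv ℝ η x (EuclideanSpace.single i 1)
      = - ∫ x in Ω, sgrad q x i * η x} := by
    simp only [e]
    exact isClosed_eq ((continuous_integral_mul hm1).comp (svalL Ω).continuous)
      ((continuous_integral_inner hm2).comp (sgradL Ω).continuous).neg
  refine hcl.mem_of_tendsto hlim (Eventually.of_forall fun n => ?_)
  simp only [mem_ofPred_eq]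
  have hz := hζ n
  have e1 : ∫ x in Ω, sval (smoothH1 hΩ hz.1 hz.2.1) x * fderiv ℝ η x (EuclideanSpace.single i 1)
      = ∫ x, fderiv ℝ η x (EuclideanSpace.single i 1) * ζ n x := by
    rw [← setIntegral_mul_of_tsupport hz.2.2]
    refine integral_congr_ae ?_
    filter_upwards [sval_smoothH1 hΩ hz.1 hz.2.1] with x hx
    rw [hx, mul_comm]
  have e2 : ∫ x in Ω, sgrad (smoothH1 hΩ hz.1 hz.2.1) x i * η x
      = ∫ x, η x * fderiv ℝ (ζ n) x (EuclideanSpace.single i 1) := by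
    rw [← setIntegral_mul_of_tsupport ((tsupport_fderiv_apply_subset _ _).trans hz.2.2)]
    refine integral_congr_ae ?_
    filter_upwards [sgrad_smoothH1 hΩ hz.1 hz.2.1] with x hx
    rw [hx, mul_comm, pgrad_apply]
  rw [e1, e2]
  have hc1 : Continuous fun x => fderiv ℝ η x (EuclideanSpace.single i 1) :=
    (h1.continuous_fderiv (by simp)).clm_apply continuous_const
  have hc2 : Continuous fun x => fderiv ℝ (ζ n) x (EuclideanSpace.single i 1) :=
    (hz.1.continuous_fderiv (by simp)).clm_apply continuous_const
  rw [integral_mul_fderiv_eq_neg_fderiv_mul_of_integrable, neg_neg]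
  · exact (hc1.mul hz.1.continuous).integrable_of_hasCompactSupport hz.2.1.mul_left
  · exact (h1.continuous.mul hc2).integrable_of_hasCompactSupport h2.mul_right
  · exact (h1.continuous.mul hz.1.continuous).integrable_of_hasCompactSupport h2.mul_right
  · exact fun x _ => h1.differentiable (by simp) x
  · exact fun x _ => hz.1.differentiable (by simp) x

lemma integral_indicator_sq (hΩ : IsOpen Ω) (f : Plane → ℝ) :
    ∫ x, Ω.indicator f x ^ 2 = ∫ x in Ω, f x ^ 2 := by
  rw [← integral_indicator hΩ.measurableSet]
  refine integral_congr_ae (Eventually.of_forall fun x => ?_)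
  by_cases hx : x ∈ Ω <;> simp [hx]

lemma integral_indicator_norm_sq (hΩ : IsOpen Ω) (f : Plane → Plane) :
    ∫ x, ‖Ω.indicator f x‖ ^ 2 = ∫ x in Ω, ‖f x‖ ^ 2 := by
  rw [← integral_indicator hΩ.measurableSet]
  refine integral_congr_ae (Eventually.of_forall fun x => ?_)
  by_cases hx : x ∈ Ω <;> simp [hx]

lemma integral_indicator_mul (hΩ : IsOpen Ω) (f ρ : Plane → ℝ) :
    ∫ x, Ω.indicator f x * ρ x = ∫ x in Ω, f x * ρ x := by
  rw [← integral_indicator hΩ.measurableSet]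
  refine integral_congr_ae (Eventually.of_forall fun x => ?_)
  by_cases hx : x ∈ Ω <;> simp [hx]

/-- Rellich's theorem in `Ω` for functions with a gradient on the whole plane. -/
lemma tendsto_integral_sq_of_weak_on (hΩ : IsOpen Ω) (hb : Bornology.IsBounded Ω)
    {p : ℕ → Plane → ℝ} {g : ℕ → Plane → Plane} {C : ℝ}
    (hp : ∀ n, MemLp (p n) 2 (volume.restrict Ω)) (hg : ∀ n, MemLp (g n) 2 (volume.restrict Ω))
    (hw : ∀ n, ∀ η, ContDiff ℝ ∞ η → HasCompactSupport η → ∀ i : Fin 2,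
      ∫ x in Ω, p n x * fderiv ℝ η x (EuclideanSpace.single i 1) = - ∫ x in Ω, g n x i * η x)
    (hpC : ∀ n, √(∫ x in Ω, p n x ^ 2) ≤ C) (hgC : ∀ n, √(∫ x in Ω, ‖g n x‖ ^ 2) ≤ C)
    (hweak : ∀ ρ : Plane → ℝ, ContDiff ℝ ∞ ρ → HasCompactSupport ρ →
      Tendsto (fun n => ∫ x in Ω, p n x * ρ x) atTop (𝓝 0)) :
    Tendsto (fun n => √(∫ x in Ω, p n x ^ 2)) atTop (𝓝 0) := by
  obtain ⟨R, hR⟩ := hb.subset_ball (0 : Plane)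
  have := tendsto_integral_sq_of_weak (p := fun n => Ω.indicator (p n))
    (g := fun n => Ω.indicator (g n)) (R := R) (C := C) (fun n => memLp_indicator hΩ (hp n))
    (fun n => memLp_indicator hΩ (hg n)) (fun n => hasWeakGradient_indicator hΩ (hw n))
    (fun n => Eventually.of_forall fun x hx => indicator_of_notMem (fun h => hx (hR h)) _)
    (fun n => by rw [integral_indicator_sq hΩ]; exact hpC n)
    (fun n => by rw [integral_indicator_norm_sq hΩ]; exact hgC n)
    (fun ρ h1 h2 => by simpa only [integral_indicator_mul hΩ] using hweak ρ h1 h2)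
  simpa only [integral_indicator_sq hΩ] using this

lemma sqrt_integral_sval_sq (q : H1 Ω) : √(∫ x in Ω, sval q x ^ 2) = ‖sval q‖ := by
  rw [← Real.sqrt_sq (norm_nonneg (sval q)), Lp_norm_sq_eq_integral]
  simp

lemma sqrt_integral_sgrad_sq (q : H1 Ω) : √(∫ x in Ω, ‖sgrad q x‖ ^ 2) = ‖sgrad q‖ := by
  rw [← Real.sqrt_sq (norm_nonneg (sgrad q)), Lp_norm_sq_eq_integral]

lemma integral_sval_mul_eq_inner (q : H1 Ω) {ρ : Plane → ℝ} (hρ : MemLp ρ 2 (volume.restrict Ω)) :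
    ∫ x in Ω, sval q x * ρ x = ⟪q, (svalL Ω).adjoint (hρ.toLp ρ)⟫_ℝ := by
  rw [ContinuousLinearMap.adjoint_inner_right, svalL_apply, L2.inner_def]
  refine integral_congr_ae ?_
  filter_upwards [hρ.coeFn_toLp] with x hx
  rw [hx]
  simp [mul_comm]

/-- Elements of `H¹₀(Ω)` extend by zero together with their gradients, so Rellich's theorem needs no
regularity of the boundary here. -/
lemma tendsto_norm_sval_of_weak (hΩ : IsOpen Ω) (hb : Bornology.IsBounded Ω) {q : ℕ → H1 Ω}
    (hq : ∀ n, q n ∈ H10 Ω) {C : ℝ} (hC : ∀ n, ‖q n‖ ≤ C)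
    (hweak : ∀ h, Tendsto (fun n => ⟪q n, h⟫_ℝ) atTop (𝓝 0)) :
    Tendsto (fun n => ‖sval (q n)‖) atTop (𝓝 0) := by
  have := tendsto_integral_sq_of_weak_on hΩ hb (p := fun n => sval (q n))
    (g := fun n => sgrad (q n)) (C := C) (fun n => Lp.memLp _) (fun n => Lp.memLp _)
    (fun n η h1 h2 i => integral_mul_fderiv_of_mem_H10 hΩ (hq n) h1 h2 i)
    (fun n => by rw [sqrt_integral_sval_sq]; exact (norm_sval_le _).trans (hC n))
    (fun n => by rw [sqrt_integral_sgrad_sq]; exact (norm_sgrad_le _).trans (hC n))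
    (fun ρ h1 h2 => by
      simp only [integral_sval_mul_eq_inner _ (memLp_of_continuous_compact Ω h1.continuous h2)]
      exact hweak _)
  simpa only [sqrt_integral_sval_sq] using this

lemma norm_velL_sq (v : H1Vec Ω) : ‖velL Ω v‖ ^ 2 = ‖sval (v 0)‖ ^ 2 + ‖sval (v 1)‖ ^ 2 := by
  rw [← real_inner_self_eq_norm_sq, inner_velL_velL, Lp_norm_sq_eq_integral,
    Lp_norm_sq_eq_integral, ← integral_add (integrable_norm_sq_of_memLp (Lp.memLp _))
    (integrable_norm_sq_of_memLp (Lp.memLp _))]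
  refine integral_congr_ae (Eventually.of_forall fun x => ?_)
  simp only [real_inner_self_eq_norm_sq, EuclideanSpace.norm_sq_eq, Fin.sum_univ_two]
  rfl

lemma tendsto_vJ_of_weak (hΩ : IsOpen Ω) (hb : Bornology.IsBounded Ω) {v : ℕ → V Ω} {C : ℝ}
    (hC : ∀ n, ‖v n‖ ≤ C) (hweak : ∀ h, Tendsto (fun n => ⟪v n, h⟫_ℝ) atTop (𝓝 0)) :
    Tendsto (fun n => vJ Ω (v n)) atTop (𝓝 0) := by
  have hi : ∀ i : Fin 2, Tendsto (fun n => ‖sval ((v n).1 i)‖) atTop (𝓝 0) := fun i => by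
    refine tendsto_norm_sval_of_weak hΩ hb (fun n => (v n).2.1 i) (C := C) (fun n => ?_) fun h => ?_
    · exact (PiLp.norm_apply_le (v n).1 i).trans (hC n)
    · have h1 := hweak (((PiLp.proj 2 (fun _ : Fin 2 => H1 Ω) i : H1Vec Ω →L[ℝ] H1 Ω) ∘L
        vInc Ω).adjoint h)
      simp only [ContinuousLinearMap.adjoint_inner_right] at h1
      exact h1
  rw [tendsto_zero_iff_norm_tendsto_zero]
  have h2 : Tendsto (fun n => ‖vJ Ω (v n)‖ ^ 2) atTop (𝓝 0) := by
    simp only [vJ_apply, norm_velL_sq]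
    simpa using ((hi 0).pow 2).add ((hi 1).pow 2)
  have h3 := (Real.continuous_sqrt.tendsto 0).comp h2
  simpa [Function.comp_def] using h3

/-- A sequence in the unit ball has a weakly convergent subsequence; Rellich's theorem applied to
the difference from its limit makes the images converge strongly. -/
theorem isCompactOperator_vJ (hΩ : IsOpen Ω) (hb : Bornology.IsBounded Ω) :
    IsCompactOperator (vJ Ω) := by
  rw [isCompactOperator_iff_exists_mem_nhds_image_subset_compact]
  refine ⟨Metric.closedBall 0 1, Metric.closedBall_mem_nhds 0 one_pos, vJ Ω '' Metric.closedBall 0 1,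
    ?_, subset_rfl⟩
  refine IsSeqCompact.isCompact fun y hy => ?_
  choose v hv hvy using hy
  obtain ⟨w, hw, ns, hns, hlim⟩ := exists_weak_subseq (x := v) (C := 1)
    fun n => mem_closedBall_zero_iff.1 (hv n)
  refine ⟨vJ Ω w, ⟨w, mem_closedBall_zero_iff.2 hw, rfl⟩, ns, hns, ?_⟩
  have h1 := tendsto_vJ_of_weak hΩ hb (v := fun n => v (ns n) - w) (C := 2) (fun n => ?_)
    fun h => ?_
  · have h2 := h1.add_const (vJ Ω w)
    simpa [hvy, Function.comp_def] using h2
  · have := norm_sub_le (v (ns n)) w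
    have := mem_closedBall_zero_iff.1 (hv (ns n))
    linarith
  · simpa [inner_sub_left] using (hlim h).sub_const ⟪w, h⟫_ℝ


open scoped Manifold in
lemma exists_cutoff (hΩ : IsOpen Ω) {K : Set Plane} (hK : IsCompact K) (hKΩ : K ⊆ Ω) :
    ∃ χ, IsTestFunction Ω χ ∧ (∀ x, χ x ∈ Icc (0 : ℝ) 1) ∧ ∀ x ∈ K, χ x = 1 := by
  obtain ⟨L, hL, hKL, hLΩ⟩ := exists_compact_between hK hΩ hKΩ
  obtain ⟨f, h0, h1, h⟩ := exists_contMDiffMap_zero_one_of_isClosed (n := ⊤) 𝓘(ℝ, Plane)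
    (isOpen_interior (s := L)).isClosed_compl hK.isClosed
    (disjoint_compl_left_iff_subset.2 hKL)
  have hs : Function.support f ⊆ L := fun x hx => by
    by_contra hcon
    exact hx (h0 fun h => hcon (interior_subset h))
  have hts : tsupport f ⊆ L := closure_minimal hs hL.isClosed
  exact ⟨f, ⟨f.contMDiff.contDiff, HasCompactSupport.of_support_subset_isCompact hL hs,
    hts.trans hLΩ⟩, h, fun x hx => h1 hx⟩

lemma continuous_pgrad {η : Plane → ℝ} (h : ContDiff ℝ ∞ η) : Continuous (pgrad η) :=
  (PiLp.continuous_toLp 2 _).comp (continuous_pi fun _ =>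
    (h.continuous_fderiv (by simp)).clm_apply continuous_const)

lemma hasCompactSupport_pgrad {η : Plane → ℝ} (h : HasCompactSupport η) :
    HasCompactSupport (pgrad η) := by
  refine HasCompactSupport.of_support_subset_isCompact h.isCompact fun x hx => ?_
  by_contra hcon
  refine hx (PiLp.ext fun i => ?_)
  rw [pgrad_apply, image_eq_zero_of_notMem_tsupport fun h =>
    hcon (tsupport_fderiv_apply_subset η _ h)]
  rfl

/-- Local Rellich theorem. -/
lemma tendsto_cutoff_mul_of_weak (hΩ : IsOpen Ω) (hb : Bornology.IsBounded Ω) {q : ℕ → H1 Ω}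
    {C : ℝ} (hC : ∀ n, ‖q n‖ ≤ C) (hweak : ∀ h, Tendsto (fun n => ⟪q n, h⟫_ℝ) atTop (𝓝 0))
    {χ : Plane → ℝ} (hχ : IsTestFunction Ω χ) :
    Tendsto (fun n => √(∫ x in Ω, (χ x * sval (q n) x) ^ 2)) atTop (𝓝 0) := by
  have hC0 : 0 ≤ C := (norm_nonneg _).trans (hC 0)
  have hχd : Differentiable ℝ χ := hχ.1.differentiable (by simp)
  obtain ⟨c₁, hc₁⟩ := hχ.1.continuous.bounded_above_of_compact_support hχ.2.1
  obtain ⟨c₂, hc₂⟩ := (continuous_pgrad hχ.1).bounded_above_of_compact_support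
    (hasCompactSupport_pgrad hχ.2.1)
  have hm1 : ∀ n, MemLp (fun x => χ x * sval (q n) x) 2 (volume.restrict Ω) := fun n =>
    MemLp.of_le_mul (c := c₁) (Lp.memLp (sval (q n)))
      (hχ.1.continuous.aestronglyMeasurable.mul (Lp.aestronglyMeasurable _))
      (Eventually.of_forall fun x => by rw [norm_mul]; gcongr; exact hc₁ x)
  have hm2 : ∀ n, MemLp (fun x => χ x • sgrad (q n) x) 2 (volume.restrict Ω) := fun n =>
    MemLp.of_le_mul (c := c₁) (Lp.memLp (sgrad (q n)))
      (hχ.1.continuous.aestronglyMeasurable.smul (Lp.aestronglyMeasurable _))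
      (Eventually.of_forall fun x => by rw [norm_smul]; gcongr; exact hc₁ x)
  have hm3 : ∀ n, MemLp (fun x => sval (q n) x • pgrad χ x) 2 (volume.restrict Ω) := fun n =>
    MemLp.of_le_mul (c := c₂) (Lp.memLp (sval (q n)))
      ((Lp.aestronglyMeasurable (sval (q n))).smul (continuous_pgrad hχ.1).aestronglyMeasurable)
      (Eventually.of_forall fun x => by rw [norm_smul, mul_comm]; gcongr; exact hc₂ x)
  have hnv : ∀ n, ∫ x in Ω, ‖sval (q n) x‖ ^ 2 ≤ C ^ 2 := fun n => by
    rw [← Lp_norm_sq_eq_integral]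
    have := (norm_sval_le (q n)).trans (hC n)
    gcongr
  have hng : ∀ n, ∫ x in Ω, ‖sgrad (q n) x‖ ^ 2 ≤ C ^ 2 := fun n => by
    rw [← Lp_norm_sq_eq_integral]
    have := (norm_sgrad_le (q n)).trans (hC n)
    gcongr
  have hiv : ∀ n, Integrable (fun x => ‖sval (q n) x‖ ^ 2) (volume.restrict Ω) := fun n =>
    integrable_norm_sq_of_memLp (Lp.memLp _)
  have hig : ∀ n, Integrable (fun x => ‖sgrad (q n) x‖ ^ 2) (volume.restrict Ω) := fun n =>
    integrable_norm_sq_of_memLp (Lp.memLp _)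
  set D := 2 * c₁ ^ 2 * C ^ 2 + 2 * c₂ ^ 2 * C ^ 2 with hD
  -- The cut-off makes `χ q` extendable by zero without any boundary condition on `q`. By Leibniz'
  -- rule its gradient is `χ ∇q + q ∇χ`, bounded in `L²` by `√D`.
  refine tendsto_integral_sq_of_weak_on hΩ hb
    (g := fun n x => χ x • sgrad (q n) x + sval (q n) x • pgrad χ x) (C := √D)
    hm1 (fun n => (hm2 n).add (hm3 n)) ?_ ?_ ?_ ?_
  · intro n η h1 h2 i
    have hηd : Differentiable ℝ η := h1.differentiable (by simp)
    have ht : IsTestFunction Ω fun x => χ x * η x :=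
      ⟨hχ.1.mul h1, hχ.2.1.mul_right, (tsupport_mul_subset_left).trans hχ.2.2⟩
    have h3 := hasWeakGradient_sgrad (q n) _ ht i
    have hcd : Continuous fun x => fderiv ℝ η x (EuclideanSpace.single i 1) :=
      (h1.continuous_fderiv (by simp)).clm_apply continuous_const
    have hcχ : Continuous fun x => fderiv ℝ χ x (EuclideanSpace.single i 1) :=
      (hχ.1.continuous_fderiv (by simp)).clm_apply continuous_const
    have i1 : Integrable (fun x => χ x * sval (q n) x * fderiv ℝ η x (EuclideanSpace.single i 1))
        (volume.restrict Ω) := by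
      refine (MemLp.integrable_mul (p := 2) (q := 2) (hm1 n) (memLp_of_continuous_compact Ω hcd ?_))
      exact h2.fderiv_apply (𝕜 := ℝ) _
    have i2 : Integrable (fun x => sval (q n) x * (η x * fderiv ℝ χ x (EuclideanSpace.single i 1)))
        (volume.restrict Ω) :=
      MemLp.integrable_mul (p := 2) (q := 2) (Lp.memLp (sval (q n)))
        (memLp_of_continuous_compact Ω (h1.continuous.mul hcχ) h2.mul_right)
    have i3 : Integrable (fun x => sgrad (q n) x i * (χ x * η x)) (volume.restrict Ω) :=
      MemLp.integrable_mul (p := 2) (q := 2) (coord_memLp (Lp.memLp (sgrad (q n))) i)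
        (test_memLp Ω ht)
    have e1 : ∫ x in Ω, sval (q n) x * fderiv ℝ (fun x => χ x * η x) x (EuclideanSpace.single i 1)
        = (∫ x in Ω, χ x * sval (q n) x * fderiv ℝ η x (EuclideanSpace.single i 1))
          + ∫ x in Ω, sval (q n) x * (η x * fderiv ℝ χ x (EuclideanSpace.single i 1)) := by
      rw [← integral_add i1 i2]
      refine integral_congr_ae (Eventually.of_forall fun x => ?_)
      simp only [fderiv_fun_mul (hχd x) (hηd x), add_apply, smul_apply, smul_eq_mul]
      ring
    have e2 : ∫ x in Ω, (χ x • sgrad (q n) x + sval (q n) x • pgrad χ x) i * η x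
        = (∫ x in Ω, sgrad (q n) x i * (χ x * η x))
          + ∫ x in Ω, sval (q n) x * (η x * fderiv ℝ χ x (EuclideanSpace.single i 1)) := by
      rw [← integral_add i3 i2]
      refine integral_congr_ae (Eventually.of_forall fun x => ?_)
      simp only [PiLp.add_apply, PiLp.smul_apply, pgrad_apply, smul_eq_mul]
      ring
    rw [e1] at h3
    rw [e2]
    linarith
  · intro n
    refine Real.sqrt_le_sqrt ?_
    calc ∫ x in Ω, (χ x * sval (q n) x) ^ 2 ≤ ∫ x in Ω, c₁ ^ 2 * ‖sval (q n) x‖ ^ 2 := by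
          refine integral_mono (hm1 n).integrable_sq ((hiv n).const_mul _) fun x => ?_
          simp only
          rw [mul_pow, ← sq_abs (χ x), ← sq_abs (sval (q n) x), ← Real.norm_eq_abs, ← Real.norm_eq_abs]
          gcongr
          exact hc₁ x
      _ ≤ c₁ ^ 2 * C ^ 2 := by
          rw [integral_const_mul]
          exact mul_le_mul_of_nonneg_left (hnv n) (by positivity)
      _ ≤ D := by rw [hD]; nlinarith [mul_nonneg (sq_nonneg c₁) (sq_nonneg C),
                    mul_nonneg (sq_nonneg c₂) (sq_nonneg C)]
  · intro n
    refine Real.sqrt_le_sqrt ?_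
    calc ∫ x in Ω, ‖χ x • sgrad (q n) x + sval (q n) x • pgrad χ x‖ ^ 2
        ≤ ∫ x in Ω, (2 * c₁ ^ 2 * ‖sgrad (q n) x‖ ^ 2 + 2 * c₂ ^ 2 * ‖sval (q n) x‖ ^ 2) := by
          refine integral_mono (integrable_norm_sq_of_memLp ((hm2 n).add (hm3 n)))
            (((hig n).const_mul _).add ((hiv n).const_mul _)) fun x => ?_
          have k1 := norm_add_le (χ x • sgrad (q n) x) (sval (q n) x • pgrad χ x)
          rw [norm_smul, norm_smul] at k1
          have k2 : ‖χ x‖ * ‖sgrad (q n) x‖ ≤ c₁ * ‖sgrad (q n) x‖ := by gcongr; exact hc₁ x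
          have k3 : ‖sval (q n) x‖ * ‖pgrad χ x‖ ≤ ‖sval (q n) x‖ * c₂ := by gcongr; exact hc₂ x
          have k4 := k1.trans (add_le_add k2 k3)
          have k5 : ‖χ x • sgrad (q n) x + sval (q n) x • pgrad χ x‖ ^ 2
              ≤ (c₁ * ‖sgrad (q n) x‖ + ‖sval (q n) x‖ * c₂) ^ 2 := by gcongr
          simp only
          nlinarith [sq_nonneg (c₁ * ‖sgrad (q n) x‖ - ‖sval (q n) x‖ * c₂)]
      _ ≤ D := by
          rw [integral_add ((hig n).const_mul _) ((hiv n).const_mul _), integral_const_mul,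
            integral_const_mul, hD]
          exact add_le_add (mul_le_mul_of_nonneg_left (hng n) (by positivity))
            (mul_le_mul_of_nonneg_left (hnv n) (by positivity))
  · intro ρ h1 h2
    have hm : MemLp (fun x => χ x * ρ x) 2 (volume.restrict Ω) :=
      memLp_of_continuous_compact Ω (hχ.1.continuous.mul h1.continuous) hχ.2.1.mul_right
    have : ∀ n, ∫ x in Ω, χ x * sval (q n) x * ρ x
        = ⟪q n, (svalL Ω).adjoint (hm.toLp _)⟫_ℝ := fun n => by
      rw [← integral_sval_mul_eq_inner]
      exact integral_congr_ae (Eventually.of_forall fun x => by simp only; ring)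
    simp only [this]
    exact hweak _

/-- Bounded sequences of admissible designs have subsequences that converge weakly in `H¹` and
almost everywhere. -/
theorem exists_admissible_limit (hΩ : IsOpen Ω) (hb : Bornology.IsBounded Ω) {φ : ℕ → H1 Ω}
    (hφ : ∀ n, φ n ∈ admissible Ω) {C : ℝ} (hC : ∀ n, ‖sgrad (φ n)‖ ≤ C) :
    ∃ φ' ∈ admissible Ω, ∃ ns : ℕ → ℕ, StrictMono ns ∧
      (∀ᵐ x ∂(volume.restrict Ω), Tendsto (fun n => sval (φ (ns n)) x) atTop (𝓝 (sval φ' x))) ∧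
      ∀ h, Tendsto (fun n => ⟪sgrad (φ (ns n)), h⟫_ℝ) atTop (𝓝 ⟪sgrad φ', h⟫_ℝ) := by
  have hfin : IsFiniteMeasure (volume.restrict Ω) := ⟨by simpa using hb.measure_lt_top⟩
  have hC0 : 0 ≤ C := (norm_nonneg _).trans (hC 0)
  set C' := √((volume.restrict Ω).real univ + C ^ 2) with hC'
  have hbd : ∀ n, ‖φ n‖ ≤ C' := fun n => by
    refine le_of_sq_le_sq ?_ (Real.sqrt_nonneg _)
    rw [hC', Real.sq_sqrt (by positivity), norm_sq_eq_sval_sgrad]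
    refine add_le_add ?_ (by gcongr; exact hC n)
    rw [Lp_norm_sq_eq_integral]
    calc ∫ x in Ω, ‖sval (φ n) x‖ ^ 2 ≤ ∫ x in Ω, (1 : ℝ) := by
          refine integral_mono_ae (integrable_norm_sq_of_memLp (Lp.memLp _)) (integrable_const _) ?_
          filter_upwards [hφ n] with x hx
          rw [Real.norm_eq_abs]
          exact pow_le_one₀ (abs_nonneg _) hx
      _ = _ := by simp
  obtain ⟨φ', hφ'C, ns, hns, hlim⟩ := exists_weak_subseq hbd
  set q : ℕ → H1 Ω := fun n => φ (ns n) - φ' with hq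
  have hqC : ∀ n, ‖q n‖ ≤ 2 * C' := fun n => by
    have h1 := norm_sub_le (φ (ns n)) φ'
    have h2 := hbd (ns n)
    rw [hq]; simp only; linarith
  have hqw : ∀ h, Tendsto (fun n => ⟪q n, h⟫_ℝ) atTop (𝓝 0) := fun h => by
    simpa [hq, inner_sub_left] using (hlim h).sub_const ⟪φ', h⟫_ℝ
  -- A majorant of `(φₙ - φ')²` independent of `n`. The bound `|φ'| ≤ 1` is not yet available, hence
  -- the term `‖φ'‖²`.
  set F : Plane → ℝ := fun x => 2 * (1 + ‖sval φ' x‖ ^ 2) with hF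
  have hFi : Integrable F (volume.restrict Ω) :=
    ((integrable_const _).add (integrable_norm_sq_of_memLp (Lp.memLp _))).const_mul _
  have hqF : ∀ n, ∀ᵐ x ∂(volume.restrict Ω), sval (q n) x ^ 2 ≤ F x := fun n => by
    filter_upwards [hφ (ns n), Lp.coeFn_sub (sval (φ (ns n))) (sval φ')] with x h1 h2
    have h3 : sval (q n) x = sval (φ (ns n)) x - sval φ' x := h2
    have h4 := abs_le.1 h1
    rw [h3, hF]
    simp only [Real.norm_eq_abs, sq_abs]
    nlinarith [sq_nonneg (sval (φ (ns n)) x + sval φ' x)]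
  have hstrong : Tendsto (fun n => ∫ x in Ω, sval (q n) x ^ 2) atTop (𝓝 0) := by
    refine Metric.tendsto_atTop.2 fun ε hε => ?_
    -- The boundary is arbitrary, so compactness holds only in the interior. `Ω` is exhausted by
    -- sets that are compact because `Ω` is bounded. The local theorem handles one of them, and the
    -- integral of `F` over the rest is small.
    obtain ⟨A, hAc, hAΩ, hAU, hAm⟩ := hΩ.exists_iUnion_isClosed
    have h1 : Tendsto (fun n => ∫ x in A n, F x ∂(volume.restrict Ω)) atTop
        (𝓝 (∫ x in ⋃ n, A n, F x ∂(volume.restrict Ω))) :=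
      tendsto_setIntegral_of_monotone (fun n => (hAc n).measurableSet) hAm hFi.integrableOn
    rw [hAU, Measure.restrict_restrict hΩ.measurableSet, inter_self] at h1
    obtain ⟨N, hN⟩ := Metric.tendsto_atTop.1 h1 (ε / 2) (by positivity)
    have hNA := hN N le_rfl
    have hKc : IsCompact (A N) := Metric.isCompact_of_isClosed_isBounded (hAc N) (hb.subset (hAΩ N))
    obtain ⟨χ, hχ, hχ01, hχ1⟩ := exists_cutoff hΩ hKc (hAΩ N)
    have h2 := tendsto_cutoff_mul_of_weak hΩ hb hqC hqw hχ
    have h3 : Tendsto (fun n => ∫ x in Ω, (χ x * sval (q n) x) ^ 2) atTop (𝓝 0) := by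
      have := h2.pow 2
      simpa [Real.sq_sqrt (integral_nonneg fun x => sq_nonneg _)] using this
    obtain ⟨N', hN'⟩ := Metric.tendsto_atTop.1 h3 (ε / 2) (by positivity)
    refine ⟨N', fun n hn => ?_⟩
    have h4 := hN' n hn
    have hnn : ∀ f : Plane → ℝ, 0 ≤ ∫ x in Ω, f x ^ 2 := fun f => integral_nonneg fun x => sq_nonneg _
    rw [Real.dist_eq, sub_zero, abs_of_nonneg (hnn _)] at h4 ⊢
    have hAint : ∫ x in (A N)ᶜ, F x ∂(volume.restrict Ω) < ε / 2 := by
      have h5 := integral_add_compl (hAc N).measurableSet hFi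
      rw [Real.dist_eq] at hNA
      have := (abs_lt.1 hNA).1
      linarith
    have hχm : MemLp (fun x => χ x * sval (q n) x) 2 (volume.restrict Ω) :=
      MemLp.of_le (Lp.memLp (sval (q n)))
        (hχ.1.continuous.aestronglyMeasurable.mul (Lp.aestronglyMeasurable _))
        (Eventually.of_forall fun x => by
          rw [norm_mul, Real.norm_of_nonneg (hχ01 x).1]
          exact mul_le_of_le_one_left (norm_nonneg _) (hχ01 x).2)
    have h6 : ∫ x in Ω, sval (q n) x ^ 2
        ≤ ∫ x in Ω, ((χ x * sval (q n) x) ^ 2 + (A N)ᶜ.indicator F x) := by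
      refine integral_mono_ae (Lp.memLp (sval (q n))).integrable_sq
        (hχm.integrable_sq.add (hFi.indicator (hAc N).measurableSet.compl)) ?_
      filter_upwards [hqF n] with x hx
      by_cases hxA : x ∈ A N
      · rw [hχ1 x hxA]; simp [hxA]
      · rw [indicator_of_mem (by exact hxA)]
        nlinarith [sq_nonneg (χ x * sval (q n) x)]
    rw [integral_add hχm.integrable_sq (hFi.indicator (hAc N).measurableSet.compl),
      integral_indicator (hAc N).measurableSet.compl] at h6
    linarith
  have hconv : Tendsto (fun n => sval (φ (ns n))) atTop (𝓝 (sval φ')) := by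
    rw [tendsto_iff_norm_sub_tendsto_zero]
    have h1 : ∀ n, ‖sval (φ (ns n)) - sval φ'‖ = √(∫ x in Ω, sval (q n) x ^ 2) := fun n =>
      (sqrt_integral_sval_sq (q n)).symm
    simp only [h1]
    simpa [Function.comp_def] using (Real.continuous_sqrt.tendsto 0).comp hstrong
  -- A second extraction turns strong `L²` convergence into convergence almost everywhere.
  obtain ⟨ms, hms, hae⟩ := (tendstoInMeasure_of_tendsto_Lp hconv).exists_seq_tendsto_ae
  refine ⟨φ', ?_, fun n => ns (ms n), hns.comp hms, hae, fun h => ?_⟩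
  · have hall : ∀ᵐ x ∂(volume.restrict Ω), ∀ n, |sval (φ n) x| ≤ 1 := ae_all_iff.2 hφ
    change ∀ᵐ x ∂(volume.restrict Ω), |sval φ' x| ≤ 1
    filter_upwards [hae, hall] with x h1 h2
    exact le_of_tendsto h1.abs (Eventually.of_forall fun n => h2 _)
  · have h1 := (hlim ((sgradL Ω).adjoint h)).comp hms.tendsto_atTop
    simpa only [ContinuousLinearMap.adjoint_inner_right, sgradL_apply, Function.comp_def] using h1

end Compactness

/-! ### A mean value kernel from the regularized logarithm -/

section Kernel

/-- A smooth function that is `log s` for `s ≥ 3/4` and vanishes for `s ≤ 1/2`. -/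
def logCut (s : ℝ) : ℝ := Real.smoothTransition (4 * s - 2) * Real.log s

lemma logCut_of_le {s : ℝ} (h : s ≤ 1 / 2) : logCut s = 0 := by
  rw [logCut, Real.smoothTransition.zero_of_nonpos (by linarith), zero_mul]

lemma logCut_of_ge {s : ℝ} (h : 3 / 4 ≤ s) : logCut s = Real.log s := by
  rw [logCut, Real.smoothTransition.one_of_one_le (by linarith), one_mul]

lemma contDiff_logCut : ContDiff ℝ ∞ logCut := by
  refine contDiff_iff_contDiffAt.2 fun s => ?_
  by_cases hs : s < 1 / 2
  · have : logCut =ᶠ[𝓝 s] fun _ => 0 := by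
      filter_upwards [Iio_mem_nhds hs] with t ht
      exact logCut_of_le (le_of_lt ht)
    exact contDiffAt_const.congr_of_eventuallyEq this
  · have hs0 : s ≠ 0 := by rintro rfl; norm_num at hs
    refine ContDiffAt.mul ?_ (Real.contDiffAt_log.2 hs0)
    exact (Real.smoothTransition.contDiff.comp
      ((contDiff_const.mul contDiff_id).sub contDiff_const)).contDiffAt

/-- The radial profile of the Laplacian of `logCut (‖z‖²)`. -/
def kernProfile (s : ℝ) : ℝ := 4 * deriv logCut s + 4 * s * deriv (deriv logCut) s

lemma contDiff_deriv_logCut : ContDiff ℝ ∞ (deriv logCut) :=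
  (contDiff_infty_iff_deriv.1 contDiff_logCut).2

lemma contDiff_deriv_deriv_logCut : ContDiff ℝ ∞ (deriv (deriv logCut)) :=
  (contDiff_infty_iff_deriv.1 contDiff_deriv_logCut).2

lemma contDiff_kernProfile : ContDiff ℝ ∞ kernProfile :=
  (contDiff_const.mul contDiff_deriv_logCut).add
    ((contDiff_const.mul contDiff_id).mul contDiff_deriv_deriv_logCut)

lemma deriv_logCut_eventuallyEq {s : ℝ} (hs : 3 / 4 < s) : deriv logCut =ᶠ[𝓝 s] fun t => t⁻¹ := by
  filter_upwards [Ioi_mem_nhds hs] with t ht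
  have : logCut =ᶠ[𝓝 t] Real.log := by
    filter_upwards [Ioi_mem_nhds ht] with r hr
    exact logCut_of_ge (le_of_lt hr)
  rw [this.deriv_eq, Real.deriv_log]

lemma deriv_logCut_of_gt {s : ℝ} (hs : 3 / 4 < s) : deriv logCut s = s⁻¹ :=
  (deriv_logCut_eventuallyEq hs).self_of_nhds

/-- The logarithm of `‖z‖²` is harmonic away from the origin: `4 s⁻¹ - 4 s · s⁻² = 0`. -/
lemma kernProfile_of_gt {s : ℝ} (hs : 3 / 4 < s) : kernProfile s = 0 := by
  have hs0 : s ≠ 0 := by linarith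
  rw [kernProfile, deriv_logCut_of_gt hs, (deriv_logCut_eventuallyEq hs).deriv_eq, deriv_inv]
  field_simp
  ring

/-- The family of mean value kernels. -/
def kern (δ : ℝ) (z : Plane) : ℝ := (δ ^ 2)⁻¹ * kernProfile (‖z‖ ^ 2 / δ ^ 2)

lemma contDiff_kern (δ : ℝ) : ContDiff ℝ ∞ (kern δ) :=
  contDiff_const.mul (contDiff_kernProfile.comp ((contDiff_norm_sq ℝ).div_const _))

lemma kern_eq_zero {δ : ℝ} (hδ : 0 < δ) {z : Plane} (hz : δ ≤ ‖z‖) : kern δ z = 0 := by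
  rw [kern, kernProfile_of_gt, mul_zero]
  have : 1 ≤ ‖z‖ ^ 2 / δ ^ 2 := by
    rw [one_le_div (by positivity)]
    gcongr
  linarith

lemma tsupport_kern_subset {δ : ℝ} (hδ : 0 < δ) : tsupport (kern δ) ⊆ Metric.closedBall 0 δ := by
  refine closure_minimal (fun z hz => ?_) Metric.isClosed_closedBall
  by_contra hcon
  rw [mem_closedBall_zero_iff, not_le] at hcon
  exact hz (kern_eq_zero hδ hcon.le)

lemma hasCompactSupport_kern {δ : ℝ} (hδ : 0 < δ) : HasCompactSupport (kern δ) :=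
  HasCompactSupport.of_support_subset_isCompact (isCompact_closedBall 0 δ)
    ((subset_tsupport _).trans (tsupport_kern_subset hδ))

lemma kern_neg (δ : ℝ) (z : Plane) : kern δ (-z) = kern δ z := by
  rw [kern, kern, norm_neg]

lemma kern_eq_comp_smul (δ : ℝ) (z : Plane) :
    kern δ z = (δ ^ 2)⁻¹ * kern 1 (δ⁻¹ • z) := by
  rw [kern, kern, norm_smul, mul_pow, norm_inv, inv_pow, Real.norm_eq_abs, sq_abs]
  simp only [one_pow, inv_one, one_mul, div_one]
  rw [div_eq_inv_mul]

lemma integral_kern_comp {δ : ℝ} (hδ : 0 < δ) (F : ℝ → ℝ) :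
    ∫ z : Plane, F (kern 1 (δ⁻¹ • z)) = δ ^ 2 * ∫ z : Plane, F (kern 1 z) := by
  have h := Measure.integral_comp_inv_smul (volume : Measure Plane) (fun z => F (kern 1 z)) δ
  rw [finrank_euclideanSpace_fin, abs_of_nonneg (by positivity), smul_eq_mul] at h
  exact h

lemma integral_kern {δ : ℝ} (hδ : 0 < δ) : ∫ z, kern δ z = ∫ z, kern 1 z := by
  simp only [kern_eq_comp_smul δ]
  rw [integral_const_mul, integral_kern_comp hδ (fun s => s)]
  field_simp

/-- Positivity of the kernel is not asserted. This scale-invariant `L¹` norm replaces it when the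
kernels are used as an approximate identity. -/
lemma integral_abs_kern {δ : ℝ} (hδ : 0 < δ) : ∫ z, |kern δ z| = ∫ z, |kern 1 z| := by
  simp only [kern_eq_comp_smul δ, abs_mul]
  rw [integral_const_mul, integral_kern_comp hδ (fun s => |s|),
    abs_of_nonneg (by positivity : 0 ≤ (δ ^ 2)⁻¹)]
  field_simp

/-- In polar coordinates the integrand is an exact derivative, and only its value at radius `1`,
where the profile is already the logarithm, contributes: the flux of `∇ log ‖z‖²` through a circle.
-/
lemma integral_kern_one_ne_zero : ∫ z, kern 1 z ≠ 0 := by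
  have h1 : ∫ z, kern 1 z = ∫ z : Plane, (fun r => kernProfile (r ^ 2)) ‖z‖ := by
    refine integral_congr_ae (Eventually.of_forall fun z => ?_)
    simp [kern]
  rw [h1, integral_fun_norm_addHaar (volume : Measure Plane) (fun r => kernProfile (r ^ 2)),
    finrank_euclideanSpace_fin]
  have h2 : ∫ y in Ioi (0 : ℝ), y ^ (2 - 1) • kernProfile (y ^ 2) = 2 := by
    have h3 : ∫ y in Ioi (0 : ℝ), y ^ (2 - 1) • kernProfile (y ^ 2)
        = ∫ y in Ioc (0 : ℝ) 1, y ^ (2 - 1) • kernProfile (y ^ 2) := by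
      refine (setIntegral_eq_of_subset_of_forall_sdiff_eq_zero measurableSet_Ioi
        Ioc_subset_Ioi_self fun y hy => ?_)
      have hy1 : 1 < y := by
        by_contra hcon
        exact hy.2 ⟨hy.1, not_lt.1 hcon⟩
      rw [kernProfile_of_gt (by nlinarith), smul_zero]
    rw [h3, ← intervalIntegral.integral_of_le zero_le_one]
    have hder : ∀ y : ℝ, HasDerivAt (fun y => 2 * y ^ 2 * deriv logCut (y ^ 2))
        (y ^ (2 - 1) • kernProfile (y ^ 2)) y := fun y => by
      have d1 : HasDerivAt (fun y : ℝ => y ^ 2) (2 * y) y := by simpa using hasDerivAt_pow 2 y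
      have d2 : HasDerivAt (deriv logCut) (deriv (deriv logCut) (y ^ 2)) (y ^ 2) :=
        (contDiff_deriv_logCut.differentiable (by simp) _).hasDerivAt
      have d3 := (d1.const_mul 2).mul (HasDerivAt.comp (h := fun y : ℝ => y ^ 2) y d2 d1)
      refine d3.congr_deriv ?_
      simp only [kernProfile, Function.comp_apply, smul_eq_mul]
      ring
    rw [intervalIntegral.integral_eq_sub_of_hasDerivAt (fun y _ => hder y)]
    · norm_num
      rw [deriv_logCut_of_gt (by norm_num)]
      norm_num
    · refine Continuous.intervalIntegrable ?_ _ _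
      exact (continuous_pow _).smul (contDiff_kernProfile.continuous.comp (continuous_pow 2))
  rw [h2]
  have h4 : (volume : Measure Plane).real (Metric.ball 0 1) ≠ 0 := by
    have := Metric.measure_ball_pos (volume : Measure Plane) 0 one_pos
    exact (ENNReal.toReal_pos this.ne' measure_ball_lt_top.ne).ne'
  simp [h4]

/-- The Laplacian. -/
def lap (η : Plane → ℝ) (x : Plane) : ℝ :=
  ∑ i : Fin 2, fderiv ℝ (fun y => fderiv ℝ η y (EuclideanSpace.single i 1)) x
    (EuclideanSpace.single i 1)

/-- The regularised logarithmic potential. -/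
def logPot (δ : ℝ) (z : Plane) : ℝ := logCut (‖z‖ ^ 2 / δ ^ 2)

lemma contDiff_logPot (δ : ℝ) : ContDiff ℝ ∞ (logPot δ) :=
  contDiff_logCut.comp ((contDiff_norm_sq ℝ).div_const _)

lemma fderiv_comp_normSq {F : ℝ → ℝ} (hF : Differentiable ℝ F) (δ : ℝ) (z v : Plane) :
    fderiv ℝ (fun z : Plane => F (‖z‖ ^ 2 / δ ^ 2)) z v
      = deriv F (‖z‖ ^ 2 / δ ^ 2) * (2 * ⟪z, v⟫_ℝ / δ ^ 2) := by
  have h1 : HasFDerivAt (fun z : Plane => ‖z‖ ^ 2 / δ ^ 2)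
      ((δ ^ 2)⁻¹ • (2 • (innerSL ℝ z : Plane →L[ℝ] ℝ))) z := by
    have := (hasStrictFDerivAt_norm_sq z).hasFDerivAt.const_mul (δ ^ 2)⁻¹
    simpa [div_eq_inv_mul] using this
  have h2 := ((hF _).hasDerivAt.comp_hasFDerivAt z h1).fderiv
  simp only [Function.comp_def] at h2
  rw [h2]
  simp only [smul_apply, innerSL_apply_apply, smul_eq_mul, nsmul_eq_mul]
  push_cast
  ring

lemma lap_logPot (δ : ℝ) (z : Plane) : lap (logPot δ) z = kern δ z := by
  have hE : Differentiable ℝ logCut := contDiff_logCut.differentiable (by simp)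
  have hE' : Differentiable ℝ (deriv logCut) := contDiff_deriv_logCut.differentiable (by simp)
  have h1 : ∀ (i : Fin 2), (fun y => fderiv ℝ (logPot δ) y (EuclideanSpace.single i 1))
      = fun y => deriv logCut (‖y‖ ^ 2 / δ ^ 2) * (2 * y i / δ ^ 2) := fun i => by
    ext y
    have := fderiv_comp_normSq hE δ y (EuclideanSpace.single i 1)
    rw [EuclideanSpace.inner_single_right] at this
    have e : logPot δ = fun z => logCut (‖z‖ ^ 2 / δ ^ 2) := rfl
    rw [e]
    simpa using this
  have h2 : ∀ i : Fin 2, fderiv ℝ (fun y => fderiv ℝ (logPot δ) y (EuclideanSpace.single i 1)) z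
      (EuclideanSpace.single i 1) = deriv (deriv logCut) (‖z‖ ^ 2 / δ ^ 2) * (2 * z i / δ ^ 2) ^ 2
        + deriv logCut (‖z‖ ^ 2 / δ ^ 2) * (2 / δ ^ 2) := fun i => by
    rw [h1]
    have d1 : DifferentiableAt ℝ (fun y : Plane => deriv logCut (‖y‖ ^ 2 / δ ^ 2)) z :=
      ((contDiff_deriv_logCut.comp ((contDiff_norm_sq ℝ).div_const _)).differentiable
        (by simp : (∞ : WithTop ℕ∞) ≠ 0)) z
    have d2 : HasFDerivAt (fun y : Plane => 2 * y i / δ ^ 2)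
        ((2 / δ ^ 2) • (EuclideanSpace.proj i : Plane →L[ℝ] ℝ)) z := by
      have := ((EuclideanSpace.proj (𝕜 := ℝ) i : Plane →L[ℝ] ℝ).hasFDerivAt (x := z)).const_mul
        (2 / δ ^ 2)
      refine this.congr_of_eventuallyEq (Eventually.of_forall fun y => ?_)
      simp
      ring
    rw [fderiv_fun_mul d1 d2.differentiableAt, d2.fderiv]
    have h3 := fderiv_comp_normSq hE' δ z (EuclideanSpace.single i 1)
    rw [EuclideanSpace.inner_single_right] at h3
    simp only [add_apply, smul_apply, smul_eq_mul, h3]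
    simp
    ring
  rw [lap, Fin.sum_univ_two, h2, h2, kern, kernProfile]
  have h4 : ‖z‖ ^ 2 = z 0 ^ 2 + z 1 ^ 2 := by
    rw [EuclideanSpace.norm_sq_eq, Fin.sum_univ_two]
    simp
  rw [h4]
  by_cases hδ : δ = 0
  · simp [hδ]
  · field_simp
    ring

/-- The difference of two regularised logarithms, normalised to have compact support. -/
def logDiff (δ δ' : ℝ) (z : Plane) : ℝ :=
  logPot δ z - logPot δ' z + (2 * Real.log δ - 2 * Real.log δ')

lemma contDiff_logDiff (δ δ' : ℝ) : ContDiff ℝ ∞ (logDiff δ δ') :=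
  ((contDiff_logPot δ).sub (contDiff_logPot δ')).add contDiff_const

lemma logPot_of_ge {δ : ℝ} (hδ : 0 < δ) {z : Plane} (hz : δ ≤ ‖z‖) :
    logPot δ z = 2 * Real.log ‖z‖ - 2 * Real.log δ := by
  have hz0 : 0 < ‖z‖ := hδ.trans_le hz
  have : 1 ≤ ‖z‖ ^ 2 / δ ^ 2 := by
    rw [one_le_div (by positivity)]
    gcongr
  rw [logPot, logCut_of_ge (by linarith), Real.log_div (by positivity) (by positivity),
    Real.log_pow, Real.log_pow]
  norm_num

/-- Outside both balls the two regularized logarithms are genuine ones and differ by a constant,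
which the normalization cancels. -/
lemma tsupport_logDiff_subset {δ δ' : ℝ} (hδ : 0 < δ) (hδ' : 0 < δ') :
    tsupport (logDiff δ δ') ⊆ Metric.closedBall 0 (max δ δ') := by
  refine closure_minimal (fun z hz => ?_) Metric.isClosed_closedBall
  by_contra hcon
  rw [mem_closedBall_zero_iff, not_le, max_lt_iff] at hcon
  refine hz ?_
  rw [logDiff, logPot_of_ge hδ hcon.1.le, logPot_of_ge hδ' hcon.2.le]
  ring

/-- Kernels of different radii thus differ by the Laplacian of a compactly supported function, which
a weakly harmonic function does not see. -/
lemma lap_logDiff (δ δ' : ℝ) (z : Plane) : lap (logDiff δ δ') z = kern δ z - kern δ' z := by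
  have hd : ∀ δ, Differentiable ℝ (logPot δ) := fun δ => (contDiff_logPot δ).differentiable (by simp)
  have h1 : ∀ y v, fderiv ℝ (logDiff δ δ') y v = fderiv ℝ (logPot δ) y v
      - fderiv ℝ (logPot δ') y v := fun y v => by
    have : HasFDerivAt (logDiff δ δ') (fderiv ℝ (logPot δ) y - fderiv ℝ (logPot δ') y) y :=
      ((hd δ y).hasFDerivAt.sub (hd δ' y).hasFDerivAt).add_const _
    rw [this.fderiv]; rfl
  have hd2 : ∀ δ (v : Plane), Differentiable ℝ fun y => fderiv ℝ (logPot δ) y v := fun δ v =>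
    (((contDiff_logPot δ).fderiv_right (m := ∞) (by simp)).clm_apply
      contDiff_const).differentiable (by simp)
  rw [← lap_logPot, ← lap_logPot, lap, lap, lap, ← Finset.sum_sub_distrib]
  refine Finset.sum_congr rfl fun i _ => ?_
  simp only [h1]
  rw [fderiv_fun_sub (hd2 δ _ z) (hd2 δ' _ z)]
  rfl

end Kernel

/-! ### Test fields, divergence and biorthogonal fields -/

section TestFields

variable {Ω : Set Plane}

/-- The partial derivative `∂ᵢη`. -/
def pd (i : Fin 2) (η : Plane → ℝ) (x : Plane) : ℝ := fderiv ℝ η x (EuclideanSpace.single i 1)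

lemma contDiff_pd {η : Plane → ℝ} (h : ContDiff ℝ ∞ η) (i : Fin 2) : ContDiff ℝ ∞ (pd i η) :=
  (h.fderiv_right (m := ∞) (by simp)).clm_apply contDiff_const

lemma IsTestFunction.pd {η : Plane → ℝ} (h : IsTestFunction Ω η) (i : Fin 2) :
    IsTestFunction Ω (pd i η) :=
  ⟨contDiff_pd h.1 i, h.2.1.fderiv_apply (𝕜 := ℝ) _,
    (tsupport_fderiv_apply_subset η _).trans h.2.2⟩

lemma IsTestFunction.sum {W : Fin 2 → Plane → ℝ} (h : ∀ i, IsTestFunction Ω (W i)) :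
    IsTestFunction Ω (fun x => ∑ i, W i x) := by
  simpa only [Fin.sum_univ_two] using (h 0).add (h 1)

lemma IsTestFunction.sub {η ζ : Plane → ℝ} (h : IsTestFunction Ω η) (h' : IsTestFunction Ω ζ) :
    IsTestFunction Ω (fun x => η x - ζ x) := by
  have := h.add (h'.const_mul (-1))
  simpa [sub_eq_add_neg] using this

lemma isTestFunction_zero : IsTestFunction Ω (fun _ => 0) :=
  ⟨contDiff_const, HasCompactSupport.zero, by
    have : tsupport (fun _ : Plane => (0 : ℝ)) = ∅ := tsupport_eq_empty_iff.2 rfl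
    rw [this]
    exact empty_subset _⟩

lemma pd_add {η ζ : Plane → ℝ} (h : ContDiff ℝ ∞ η) (h' : ContDiff ℝ ∞ ζ) (i : Fin 2) (x : Plane) :
    pd i (fun x => η x + ζ x) x = pd i η x + pd i ζ x := by
  rw [pd, fderiv_fun_add (h.differentiable (by simp) x) (h'.differentiable (by simp) x)]
  rfl

lemma pd_sub {η ζ : Plane → ℝ} (h : ContDiff ℝ ∞ η) (h' : ContDiff ℝ ∞ ζ) (i : Fin 2) (x : Plane) :
    pd i (fun x => η x - ζ x) x = pd i η x - pd i ζ x := by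
  rw [pd, fderiv_fun_sub (h.differentiable (by simp) x) (h'.differentiable (by simp) x)]
  rfl

lemma pd_const_mul {η : Plane → ℝ} (h : ContDiff ℝ ∞ η) (c : ℝ) (i : Fin 2) (x : Plane) :
    pd i (fun x => c * η x) x = c * pd i η x := by
  rw [pd, fderiv_const_mul (h.differentiable (by simp) x)]
  rfl

lemma pd_comp_sub (η : Plane → ℝ) (y : Plane) (i : Fin 2) (x : Plane) :
    pd i (fun x => η (x - y)) x = pd i η (x - y) := by
  rw [pd, _root_.fderiv_comp_sub]
  rfl

lemma pd_comm {η : Plane → ℝ} (h : ContDiff ℝ ∞ η) (i j : Fin 2) (x : Plane) :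
    pd i (pd j η) x = pd j (pd i η) x := by
  have hd : DifferentiableAt ℝ (fderiv ℝ η) x :=
    (h.fderiv_right (m := ∞) (by simp)).differentiable (by simp) x
  have e : ∀ i j, pd i (pd j η) x = fderiv ℝ (fderiv ℝ η) x (EuclideanSpace.single i 1)
      (EuclideanSpace.single j 1) := fun i j => by
    have : pd j η = fun y => fderiv ℝ η y (EuclideanSpace.single j 1) := rfl
    rw [this, pd, fderiv_clm_apply hd (differentiableAt_const _)]
    simp
  have hs : IsSymmSndFDerivAt ℝ η x :=
    ((contDiff_infty.1 h 2).contDiffAt (x := x)).isSymmSndFDerivAt (by simp)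
  rw [e, e, hs.eq]

/-- The divergence of a vector field given by its components. -/
def dv (W : Fin 2 → Plane → ℝ) (x : Plane) : ℝ := ∑ i, pd i (W i) x

lemma lap_eq_dv (η : Plane → ℝ) (x : Plane) : lap η x = dv (fun i => pd i η) x := rfl

lemma IsTestFunction.lap {η : Plane → ℝ} (h : IsTestFunction Ω η) : IsTestFunction Ω (lap η) :=
  IsTestFunction.sum fun i => (h.pd i).pd i

lemma lap_comp_sub (η : Plane → ℝ) (y x : Plane) : lap (fun x => η (x - y)) x = lap η (x - y) := by
  rw [lap_eq_dv, lap_eq_dv, dv, dv]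
  refine Finset.sum_congr rfl fun i _ => ?_
  have : pd i (fun x => η (x - y)) = fun x => pd i η (x - y) := funext fun x => pd_comp_sub η y i x
  rw [this, pd_comp_sub]

lemma pd_lap {η : Plane → ℝ} (h : ContDiff ℝ ∞ η) (i : Fin 2) (x : Plane) :
    pd i (lap η) x = lap (pd i η) x := by
  have e : lap η = fun x => pd 0 (pd 0 η) x + pd 1 (pd 1 η) x := by
    ext x; rw [lap_eq_dv, dv, Fin.sum_univ_two]
  have e2 : ∀ j, pd i (pd j η) = pd j (pd i η) := fun j => funext fun x => pd_comm h i j x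
  rw [e, pd_add (contDiff_pd (contDiff_pd h _) _) (contDiff_pd (contDiff_pd h _) _),
    pd_comm (contDiff_pd h 0), pd_comm (contDiff_pd h 1), e2, e2, lap_eq_dv, dv, Fin.sum_univ_two]

/-- The pairing of a vector field with a field given by components. -/
def pairing (Ω : Set Plane) (g : Plane → Plane) (W : Fin 2 → Plane → ℝ) : ℝ :=
  ∫ x in Ω, ∑ i, g x i * W i x

lemma integrable_coord_mul {g : Plane → Plane} (hg : MemLp g 2 (volume.restrict Ω))
    {η : Plane → ℝ} (hη : IsTestFunction Ω η) (i : Fin 2) :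
    Integrable (fun x => g x i * η x) (volume.restrict Ω) :=
  (coord_memLp hg i).integrable_mul (p := 2) (q := 2) (test_memLp Ω hη)

lemma integrable_pairing {g : Plane → Plane} (hg : MemLp g 2 (volume.restrict Ω))
    {W : Fin 2 → Plane → ℝ} (hW : ∀ i, IsTestFunction Ω (W i)) :
    Integrable (fun x => ∑ i, g x i * W i x) (volume.restrict Ω) :=
  integrable_finsetSum _ fun i _ => integrable_coord_mul hg (hW i) i

lemma pairing_add {g : Plane → Plane} (hg : MemLp g 2 (volume.restrict Ω))
    {W W' : Fin 2 → Plane → ℝ} (hW : ∀ i, IsTestFunction Ω (W i))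
    (hW' : ∀ i, IsTestFunction Ω (W' i)) :
    pairing Ω g (fun i x => W i x + W' i x) = pairing Ω g W + pairing Ω g W' := by
  rw [pairing, pairing, pairing, ← integral_add (integrable_pairing hg hW) (integrable_pairing hg hW')]
  refine integral_congr_ae (Eventually.of_forall fun x => ?_)
  simp only [mul_add, Finset.sum_add_distrib]

lemma pairing_sub {g : Plane → Plane} (hg : MemLp g 2 (volume.restrict Ω))
    {W W' : Fin 2 → Plane → ℝ} (hW : ∀ i, IsTestFunction Ω (W i))
    (hW' : ∀ i, IsTestFunction Ω (W' i)) :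
    pairing Ω g (fun i x => W i x - W' i x) = pairing Ω g W - pairing Ω g W' := by
  rw [pairing, pairing, pairing, ← integral_sub (integrable_pairing hg hW) (integrable_pairing hg hW')]
  refine integral_congr_ae (Eventually.of_forall fun x => ?_)
  simp only [mul_sub, Finset.sum_sub_distrib]

lemma dv_add {W W' : Fin 2 → Plane → ℝ} (hW : ∀ i, IsTestFunction Ω (W i))
    (hW' : ∀ i, IsTestFunction Ω (W' i)) (x : Plane) :
    dv (fun i x => W i x + W' i x) x = dv W x + dv W' x := by
  simp only [dv, pd_add (hW _).1 (hW' _).1, Finset.sum_add_distrib]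

lemma dv_sub {W W' : Fin 2 → Plane → ℝ} (hW : ∀ i, IsTestFunction Ω (W i))
    (hW' : ∀ i, IsTestFunction Ω (W' i)) (x : Plane) :
    dv (fun i x => W i x - W' i x) x = dv W x - dv W' x := by
  simp only [dv, pd_sub (hW _).1 (hW' _).1, Finset.sum_sub_distrib]

/-- `g` is orthogonal to solenoidal test fields and to the gradients of `H¹(Ω)`. -/
structure IsBiorthogonal (Ω : Set Plane) (g : Plane → Plane) : Prop where
  memLp : MemLp g 2 (volume.restrict Ω)
  solenoidal : ∀ W : Fin 2 → Plane → ℝ, (∀ i, IsTestFunction Ω (W i)) → (∀ x, dv W x = 0) →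
    pairing Ω g W = 0
  gradient : ∀ q : H1 Ω, ∫ x in Ω, ⟪g x, sgrad q x⟫_ℝ = 0

/-- The difference of the two fields is a solenoidal test field. The pairing is therefore a function
of the divergence alone, from which the potential of `g` will be built. -/
lemma IsBiorthogonal.pairing_eq {g : Plane → Plane} (hg : IsBiorthogonal Ω g)
    {W W' : Fin 2 → Plane → ℝ} (hW : ∀ i, IsTestFunction Ω (W i))
    (hW' : ∀ i, IsTestFunction Ω (W' i)) (h : ∀ x, dv W x = dv W' x) :
    pairing Ω g W = pairing Ω g W' := by
  have := hg.solenoidal _ (fun i => (hW i).sub (hW' i)) fun x => by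
    rw [dv_sub hW hW', h, sub_self]
  rw [pairing_sub hg.memLp hW hW'] at this
  linarith

lemma IsBiorthogonal.pairing_pd {g : Plane → Plane} (hg : IsBiorthogonal Ω g) (hΩ : IsOpen Ω)
    {η : Plane → ℝ} (hη : IsTestFunction Ω η) : pairing Ω g (fun i => pd i η) = 0 := by
  rw [← hg.gradient (smoothH1 hΩ hη.1 hη.2.1), pairing]
  refine integral_congr_ae ?_
  filter_upwards [sgrad_smoothH1 hΩ hη.1 hη.2.1] with x hx
  rw [hx, PiLp.inner_apply]
  refine Finset.sum_congr rfl fun i _ => ?_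
  simp [pd, mul_comm]

/-- The components of a biorthogonal field are weakly harmonic. -/
lemma IsBiorthogonal.integral_mul_lap {g : Plane → Plane} (hg : IsBiorthogonal Ω g)
    (hΩ : IsOpen Ω) {η : Plane → ℝ} (hη : IsTestFunction Ω η) (i : Fin 2) :
    ∫ x in Ω, g x i * lap η x = 0 := by
  -- The field `Δη` in direction `i` has the same divergence as the gradient of `∂ᵢη`, namely
  -- `∂ᵢΔη`; the latter field pairs to zero with `g`.
  have hW : ∀ j, IsTestFunction Ω (if j = i then lap η else fun _ => 0) := fun j => by
    split_ifs
    · exact hη.lap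
    · exact isTestFunction_zero
  have h1 := hg.pairing_eq hW (fun j => (hη.pd i).pd j) fun x => by
    rw [← lap_eq_dv, ← pd_lap hη.1, dv, Finset.sum_eq_single i]
    · rw [if_pos rfl]
    · intro j _ hj
      rw [if_neg hj, pd, fderiv_fun_const]
      rfl
    · simp
  rw [hg.pairing_pd hΩ (hη.pd i), pairing] at h1
  rw [← h1]
  refine integral_congr_ae (Eventually.of_forall fun x => ?_)
  simp only
  rw [Finset.sum_eq_single i]
  · rw [if_pos rfl]
  · intro j _ hj
    rw [if_neg hj, mul_zero]
  · simp

lemma isTestFunction_comp_sub {ζ : Plane → ℝ} {δ : ℝ} {x : Plane} (hζ : ContDiff ℝ ∞ ζ)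
    (hs : tsupport ζ ⊆ Metric.closedBall 0 δ) (hb : Metric.closedBall x δ ⊆ Ω) :
    IsTestFunction Ω fun ξ => ζ (ξ - x) := by
  have h : tsupport (fun ξ => ζ (ξ - x)) ⊆ Metric.closedBall x δ := by
    refine closure_minimal (fun ξ hξ => ?_) Metric.isClosed_closedBall
    have := hs (subset_tsupport _ hξ)
    rwa [mem_closedBall_zero_iff, ← mem_closedBall_iff_norm] at this
  exact ⟨hζ.comp (contDiff_id.sub contDiff_const),
    HasCompactSupport.of_support_subset_isCompact (isCompact_closedBall x δ)
      ((subset_tsupport _).trans h), h.trans hb⟩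

lemma isTestFunction_kern {δ : ℝ} {x : Plane} (hδ : 0 < δ) (hb : Metric.closedBall x δ ⊆ Ω) :
    IsTestFunction Ω fun ξ => kern δ (ξ - x) :=
  isTestFunction_comp_sub (contDiff_kern δ) (tsupport_kern_subset hδ) hb

lemma isTestFunction_logDiff {δ δ' : ℝ} {x : Plane} (hδ : 0 < δ) (hδ' : 0 < δ')
    (hb : Metric.closedBall x δ ⊆ Ω) (hb' : Metric.closedBall x δ' ⊆ Ω) :
    IsTestFunction Ω fun ξ => logDiff δ δ' (ξ - x) := by
  refine isTestFunction_comp_sub (contDiff_logDiff δ δ') (tsupport_logDiff_subset hδ hδ') ?_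
  rcases max_cases δ δ' with h | h <;> rw [h.1] <;> assumption

/-- A mean value property: averages of the weakly harmonic components do not depend on the radius,
since the kernels differ by the Laplacian of a test function. -/
lemma IsBiorthogonal.integral_mul_kern_eq {g : Plane → Plane} (hg : IsBiorthogonal Ω g)
    (hΩ : IsOpen Ω) {δ δ' : ℝ} {x : Plane} (hδ : 0 < δ) (hδ' : 0 < δ')
    (hb : Metric.closedBall x δ ⊆ Ω) (hb' : Metric.closedBall x δ' ⊆ Ω) (i : Fin 2) :
    ∫ ξ in Ω, g ξ i * kern δ (ξ - x) = ∫ ξ in Ω, g ξ i * kern δ' (ξ - x) := by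
  have h := hg.integral_mul_lap hΩ (isTestFunction_logDiff hδ hδ' hb hb') i
  simp only [lap_comp_sub, lap_logDiff, mul_sub] at h
  rw [integral_sub (integrable_coord_mul hg.memLp (isTestFunction_kern hδ hb) i)
    (integrable_coord_mul hg.memLp (isTestFunction_kern hδ' hb') i)] at h
  linarith

end TestFields

/-! ### Moving the centre of the kernel along a segment -/

section Segment

/-- The average of the kernel along a segment. -/
def segKern (δ : ℝ) (h ξ : Plane) : ℝ := ∫ s in (0 : ℝ)..1, kern δ (ξ - s • h)

lemma continuous_kern_seg (δ : ℝ) (h ξ : Plane) : Continuous fun s : ℝ => kern δ (ξ - s • h) :=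
  (contDiff_kern δ).continuous.comp (continuous_const.sub (continuous_id.smul continuous_const))

/-- The average is the convolution of the kernel with the image of Lebesgue measure on the segment,
and convolution inherits the smoothness of the kernel. -/
lemma contDiff_segKern {δ : ℝ} (hδ : 0 < δ) (h : Plane) : ContDiff ℝ ∞ (segKern δ h) := by
  let ν : Measure Plane := (volume.restrict (Ioc (0 : ℝ) 1)).map fun s => s • h
  have hm : Continuous fun s : ℝ => s • h := continuous_id.smul continuous_const
  have hf : LocallyIntegrable (fun _ : Plane => (1 : ℝ)) ν := by
    have : IsFiniteMeasure ν := Measure.isFiniteMeasure_map _ _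
    exact (integrable_const _).locallyIntegrable
  have h1 := (hasCompactSupport_kern hδ).contDiff_convolution_right (n := ⊤)
    (ContinuousLinearMap.mul ℝ ℝ) hf (contDiff_kern δ)
  have h2 : segKern δ h = convolution (fun _ : Plane => (1 : ℝ)) (kern δ)
      (ContinuousLinearMap.mul ℝ ℝ) ν := by
    ext ξ
    rw [convolution, integral_map hm.aemeasurable, segKern,
      intervalIntegral.integral_of_le zero_le_one]
    · simp
    · refine Continuous.aestronglyMeasurable ?_
      simp only [ContinuousLinearMap.mul_apply', one_mul]
      exact (contDiff_kern δ).continuous.comp (continuous_const.sub continuous_id)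
  rw [h2]
  exact h1

lemma tsupport_segKern_subset {δ : ℝ} (hδ : 0 < δ) (h : Plane) :
    tsupport (segKern δ h) ⊆ Metric.closedBall 0 (δ + ‖h‖) := by
  refine closure_minimal (fun z hz => ?_) Metric.isClosed_closedBall
  by_contra hcon
  rw [mem_closedBall_zero_iff, not_le] at hcon
  refine hz ?_
  rw [segKern, intervalIntegral.integral_congr (g := fun _ => (0 : ℝ))]
  · simp
  · intro s hs
    rw [uIcc_of_le zero_le_one] at hs
    refine kern_eq_zero hδ ?_
    have h1 : ‖s • h‖ ≤ ‖h‖ := by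
      rw [norm_smul, Real.norm_of_nonneg hs.1]
      exact mul_le_of_le_one_left (norm_nonneg _) hs.2
    have h2 := norm_sub_norm_le z (s • h)
    linarith

/-- Consequently the field `h` times `segKern` is a compactly supported field whose divergence is
the kernel at `0` minus the kernel at `h`. -/
lemma fderiv_segKern {δ : ℝ} (hδ : 0 < δ) (h ξ : Plane) :
    fderiv ℝ (segKern δ h) ξ h = kern δ ξ - kern δ (ξ - h) := by
  have hd : DifferentiableAt ℝ (segKern δ h) ξ := (contDiff_segKern hδ h).differentiable (by simp) ξ
  have h1 : HasDerivAt (fun τ : ℝ => segKern δ h (ξ + τ • h)) (fderiv ℝ (segKern δ h) ξ h) 0 := by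
    have e : HasDerivAt (fun τ : ℝ => ξ + τ • h) h 0 := by
      simpa using ((hasDerivAt_id (0 : ℝ)).smul_const h).const_add ξ
    have hd' : HasFDerivAt (segKern δ h) (fderiv ℝ (segKern δ h) ξ) (ξ + (0 : ℝ) • h) := by
      simpa using hd.hasFDerivAt
    exact hd'.comp_hasDerivAt (0 : ℝ) e
  have hc := continuous_kern_seg δ h ξ
  let F : ℝ → ℝ := fun x => ∫ s in (0 : ℝ)..x, kern δ (ξ - s • h)
  have hF : ∀ x, HasDerivAt F (kern δ (ξ - x • h)) x := fun x =>
    intervalIntegral.integral_hasDerivAt_right (hc.intervalIntegrable _ _)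
      (hc.stronglyMeasurableAtFilter _ _) hc.continuousAt
  -- Moving `ξ` along `h` only shifts the interval of integration, so the derivative consists of the
  -- two endpoint values.
  have h2 : (fun τ : ℝ => segKern δ h (ξ + τ • h)) = fun τ => F (1 - τ) - F (0 - τ) := by
    ext τ
    rw [intervalIntegral.integral_interval_sub_left (hc.intervalIntegrable _ _)
      (hc.intervalIntegrable _ _), segKern,
      ← intervalIntegral.integral_comp_sub_right (fun s => kern δ (ξ - s • h)) τ]
    refine intervalIntegral.integral_congr fun s _ => ?_
    simp only [sub_smul]
    congr 1
    abel
  have h3 : HasDerivAt (fun τ : ℝ => F (1 - τ) - F (0 - τ))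
      (kern δ (ξ - (1 - 0 : ℝ) • h) * (-1) - kern δ (ξ - (0 - 0 : ℝ) • h) * (-1)) 0 :=
    ((hF _).comp (0 : ℝ) ((hasDerivAt_id (0 : ℝ)).const_sub 1)).sub
      ((hF _).comp (0 : ℝ) ((hasDerivAt_id (0 : ℝ)).const_sub 0))
  rw [h2] at h1
  rw [h1.unique h3]
  simp
  ring

lemma abs_segKern_sub_le {δ : ℝ} {L : ℝ≥0} (hL : LipschitzWith L (kern δ)) (h ξ : Plane) :
    |segKern δ h ξ - kern δ ξ| ≤ L * ‖h‖ := by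
  have hc := continuous_kern_seg δ h ξ
  have e : segKern δ h ξ - kern δ ξ = ∫ s in (0 : ℝ)..1, (kern δ (ξ - s • h) - kern δ ξ) := by
    rw [intervalIntegral.integral_sub (hc.intervalIntegrable _ _) (by simp)]
    simp [segKern]
  rw [e, ← Real.norm_eq_abs]
  have := intervalIntegral.norm_integral_le_of_norm_le_const (a := (0 : ℝ)) (b := 1)
    (f := fun s => kern δ (ξ - s • h) - kern δ ξ) (C := L * ‖h‖) fun s hs => by
      rw [uIoc_of_le zero_le_one] at hs
      refine (hL.norm_sub_le _ _).trans ?_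
      gcongr
      rw [sub_sub_cancel_left, norm_neg, norm_smul, Real.norm_of_nonneg hs.1.le]
      exact mul_le_of_le_one_left (norm_nonneg _) hs.2
  simpa using this

lemma exists_lipschitzWith_kern {δ : ℝ} (hδ : 0 < δ) : ∃ L : ℝ≥0, LipschitzWith L (kern δ) :=
  ContDiff.lipschitzWith_of_hasCompactSupport (hasCompactSupport_kern hδ) (contDiff_kern δ) (by simp)

end Segment

/-! ### The potential of a biorthogonal field -/

section Potential

variable {Ω : Set Plane} {g : Plane → Plane}

/-- Half the distance to the complement. -/
def rad (Ω : Set Plane) (x : Plane) : ℝ := Metric.infDist x Ωᶜ / 2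

lemma compl_nonempty_of_isBounded (hb : Bornology.IsBounded Ω) : Ωᶜ.Nonempty := by
  rw [nonempty_compl]
  rintro rfl
  exact NormedSpace.unbounded_univ ℝ Plane hb

lemma rad_pos (hΩ : IsOpen Ω) (hb : Bornology.IsBounded Ω) {x : Plane} (hx : x ∈ Ω) :
    0 < rad Ω x := by
  have : 0 < Metric.infDist x Ωᶜ :=
    (hΩ.isClosed_compl.notMem_iff_infDist_pos (compl_nonempty_of_isBounded hb)).1 (by simpa using hx)
  rw [rad]; linarith

lemma closedBall_subset_of_lt {x : Plane} {δ : ℝ} (h : δ < Metric.infDist x Ωᶜ) :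
    Metric.closedBall x δ ⊆ Ω := by
  intro y hy
  by_contra hcon
  have := Metric.infDist_le_dist_of_mem (x := x) (show y ∈ Ωᶜ from hcon)
  rw [Metric.mem_closedBall, dist_comm] at hy
  linarith

lemma closedBall_rad_subset (hΩ : IsOpen Ω) (hb : Bornology.IsBounded Ω) {x : Plane} (hx : x ∈ Ω) :
    Metric.closedBall x (rad Ω x) ⊆ Ω :=
  closedBall_subset_of_lt (by have := rad_pos hΩ hb hx; rw [rad] at *; linarith)

/-- There is a test field with divergence `kernel at x - kernel at y` whose pairing with `g`
is `s`. -/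
def Linked (Ω : Set Plane) (g : Plane → Plane) (x y : Plane) (s : ℝ) : Prop :=
  ∃ W : Fin 2 → Plane → ℝ, (∀ i, IsTestFunction Ω (W i)) ∧
    (∀ ξ, dv W ξ = kern (rad Ω x) (ξ - x) - kern (rad Ω y) (ξ - y)) ∧ pairing Ω g W = s

/-- Both fields have the same divergence, so `IsBiorthogonal.pairing_eq` applies. This is path
independence. -/
lemma Linked.unique (hg : IsBiorthogonal Ω g) {x y : Plane} {s s' : ℝ} (h : Linked Ω g x y s)
    (h' : Linked Ω g x y s') : s = s' := by
  obtain ⟨W, hW, hd, rfl⟩ := h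
  obtain ⟨W', hW', hd', rfl⟩ := h'
  exact hg.pairing_eq hW hW' fun x => by rw [hd, hd']

lemma Linked.trans (hg : IsBiorthogonal Ω g) {x y z : Plane} {s s' : ℝ} (h : Linked Ω g x y s)
    (h' : Linked Ω g y z s') : Linked Ω g x z (s + s') := by
  obtain ⟨W, hW, hd, rfl⟩ := h
  obtain ⟨W', hW', hd', rfl⟩ := h'
  exact ⟨_, fun i => (hW i).add (hW' i), fun ξ => by rw [dv_add hW hW', hd, hd']; ring,
    pairing_add hg.memLp hW hW'⟩

lemma Linked.symm (hg : IsBiorthogonal Ω g) {x y : Plane} {s : ℝ} (h : Linked Ω g x y s) :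
    Linked Ω g y x (-s) := by
  obtain ⟨W, hW, hd, rfl⟩ := h
  refine ⟨_, fun i => isTestFunction_zero.sub (hW i), fun ξ => ?_, ?_⟩
  · rw [dv_sub (fun _ => isTestFunction_zero) hW, hd]
    simp [dv, pd]
  · rw [pairing_sub hg.memLp (fun _ => isTestFunction_zero) hW]
    simp [pairing]

/-- Three fields are added: a gradient changing the radius at `x` to `δ`, the segment field carrying
the kernel from `x` to `y` at radius `δ`, and a gradient changing the radius at `y`. The gradients
pair to zero with `g`, so only the segment field counts. -/
lemma linked_of_near (hg : IsBiorthogonal Ω g) (hΩ : IsOpen Ω) (hb : Bornology.IsBounded Ω)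
    {x y : Plane} {δ : ℝ} (hx : x ∈ Ω) (hy : y ∈ Ω) (hδ : 0 < δ) (hxb : δ + ‖y - x‖ < Metric.infDist x Ωᶜ)
    (hyb : δ < Metric.infDist y Ωᶜ) :
    Linked Ω g x y (pairing Ω g fun i ξ => (y - x) i * segKern δ (y - x) (ξ - x)) := by
  have hxδ : Metric.closedBall x δ ⊆ Ω := closedBall_subset_of_lt (by linarith [norm_nonneg (y - x)])
  have t1 : IsTestFunction Ω fun ξ => logDiff (rad Ω x) δ (ξ - x) :=
    isTestFunction_logDiff (rad_pos hΩ hb hx) hδ (closedBall_rad_subset hΩ hb hx) hxδ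
  have t2 : IsTestFunction Ω fun ξ => logDiff δ (rad Ω y) (ξ - y) :=
    isTestFunction_logDiff hδ (rad_pos hΩ hb hy) (closedBall_subset_of_lt hyb)
      (closedBall_rad_subset hΩ hb hy)
  have t3 : IsTestFunction Ω fun ξ => segKern δ (y - x) (ξ - x) :=
    isTestFunction_comp_sub (contDiff_segKern hδ _) (tsupport_segKern_subset hδ _)
      (closedBall_subset_of_lt hxb)
  have t4 : ∀ i, IsTestFunction Ω fun ξ => (y - x) i * segKern δ (y - x) (ξ - x) :=
    fun i => t3.const_mul _
  refine ⟨_, fun i => ((t1.pd i).add (t2.pd i)).add (t4 i), fun ξ => ?_, ?_⟩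
  · rw [dv_add (fun i => (t1.pd i).add (t2.pd i)) t4, dv_add (fun i => t1.pd i) (fun i => t2.pd i),
      ← lap_eq_dv, ← lap_eq_dv, lap_comp_sub, lap_comp_sub, lap_logDiff, lap_logDiff]
    have e : dv (fun i ξ => (y - x) i * segKern δ (y - x) (ξ - x)) ξ
        = kern δ (ξ - x) - kern δ (ξ - y) := by
      have e1 : ∀ i, pd i (fun ξ => (y - x) i * segKern δ (y - x) (ξ - x)) ξ
          = (y - x) i * pd i (segKern δ (y - x)) (ξ - x) := fun i => by
        rw [pd_const_mul t3.1, pd_comp_sub]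
      have e2 := fderiv_segKern hδ (y - x) (ξ - x)
      rw [fderiv_eq_inner_pgrad, PiLp.inner_apply, sub_sub_sub_cancel_right] at e2
      rw [dv, ← e2]
      refine Finset.sum_congr rfl fun i _ => ?_
      rw [e1]
      simp [pd]
    rw [e]
    ring
  · rw [pairing_add hg.memLp (fun i => (t1.pd i).add (t2.pd i)) t4,
      pairing_add hg.memLp (fun i => t1.pd i) (fun i => t2.pd i), hg.pairing_pd hΩ t1,
      hg.pairing_pd hΩ t2]
    ring

lemma continuous_infDist_compl : Continuous fun y : Plane => Metric.infDist y Ωᶜ :=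
  Metric.continuous_infDist_pt _

lemma eventually_near (hΩ : IsOpen Ω) (hb : Bornology.IsBounded Ω) {x : Plane} (hx : x ∈ Ω) :
    ∀ᶠ y in 𝓝 x, y ∈ Ω ∧ rad Ω x / 2 + ‖y - x‖ < Metric.infDist x Ωᶜ ∧
      rad Ω x / 2 < Metric.infDist y Ωᶜ := by
  have h0 := rad_pos hΩ hb hx
  have e : Metric.infDist x Ωᶜ = 2 * rad Ω x := by rw [rad]; ring
  refine (hΩ.eventually_mem hx).and (Eventually.and ?_ ?_)
  · have : Tendsto (fun y => rad Ω x / 2 + ‖y - x‖) (𝓝 x) (𝓝 (rad Ω x / 2 + ‖x - x‖)) :=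
      (by fun_prop : Continuous fun y : Plane => rad Ω x / 2 + ‖y - x‖).continuousAt
    refine this.eventually_lt_const ?_
    simp only [sub_self, norm_zero]
    linarith
  · exact (continuous_infDist_compl.tendsto x).eventually_const_lt (by linarith)

/-- The harmonic representative of a biorthogonal field, up to the factor `∫ kern`. -/
def harmRep (Ω : Set Plane) (g : Plane → Plane) (x : Plane) : Plane :=
  WithLp.toLp 2 fun i => ∫ ξ in Ω, g ξ i * kern (rad Ω x) (ξ - x)

lemma IsBiorthogonal.integrable (hg : IsBiorthogonal Ω g) (hb : Bornology.IsBounded Ω) :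
    Integrable g (volume.restrict Ω) := by
  have : IsFiniteMeasure (volume.restrict Ω) := ⟨by
    rw [Measure.restrict_apply_univ]; exact hb.measure_lt_top⟩
  exact hg.memLp.integrable (by norm_num)

/-- The potential at `x` is the pairing of `g` with any test field whose divergence is the kernel at
a base point minus the kernel at `x`, a smoothed line integral. Such fields exist since `Ω` is
connected, and the value does not depend on the choice. The increment between nearby points is
computed by the segment field. -/
lemma exists_potential (hg : IsBiorthogonal Ω g) (hΩ : IsOpen Ω) (hb : Bornology.IsBounded Ω)
    (hc : IsConnected Ω) :
    ∃ p : Plane → ℝ, ∀ x ∈ Ω, HasFDerivAt p (innerSL ℝ (harmRep Ω g x)) x := by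
  obtain ⟨x₀, hx₀⟩ := hc.nonempty
  have hlink : ∀ x ∈ Ω, ∃ s, Linked Ω g x₀ x s := fun x hx => by
    refine hc.isPreconnected.induction₂ (fun x y => ∃ s, Linked Ω g x y s) (fun x hx => ?_)
      ?_ ?_ hx₀ hx
    · refine Filter.Eventually.filter_mono nhdsWithin_le_nhds ?_
      filter_upwards [eventually_near hΩ hb hx] with y hy
      exact ⟨_, linked_of_near hg hΩ hb hx hy.1 (half_pos (rad_pos hΩ hb hx)) hy.2.1 hy.2.2⟩
    · rintro x y z _ _ _ ⟨s, hs⟩ ⟨s', hs'⟩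
      exact ⟨_, hs.trans hg hs'⟩
    · rintro x y _ _ ⟨s, hs⟩
      exact ⟨_, hs.symm hg⟩
  choose! p hp using hlink
  refine ⟨p, fun x hx => ?_⟩
  set δ := rad Ω x / 2 with hδd
  have hδ : 0 < δ := half_pos (rad_pos hΩ hb hx)
  obtain ⟨L, hL⟩ := exists_lipschitzWith_kern hδ
  have hgi := hg.integrable hb
  have hxδ : Metric.closedBall x δ ⊆ Ω :=
    (Metric.closedBall_subset_closedBall (by have := rad_pos hΩ hb hx; linarith)).trans
      (closedBall_rad_subset hΩ hb hx)
  -- The segment average differs from the kernel at `x` by at most `L‖y - x‖`, and the field carries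
  -- another factor `y - x`; the error is therefore quadratic.
  have key : ∀ᶠ y in 𝓝 x, ‖p y - p x - innerSL ℝ (harmRep Ω g x) (y - x)‖
      ≤ (L * ∫ ξ in Ω, ‖g ξ‖) * ‖y - x‖ ^ 2 := by
    filter_upwards [eventually_near hΩ hb hx] with y hy
    have h1 := ((hp x hx).trans hg (linked_of_near hg hΩ hb hx hy.1 hδ hy.2.1 hy.2.2)).unique hg
      (hp y hy.1)
    have t3 : IsTestFunction Ω fun ξ => segKern δ (y - x) (ξ - x) :=
      isTestFunction_comp_sub (contDiff_segKern hδ _) (tsupport_segKern_subset hδ _)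
        (closedBall_subset_of_lt hy.2.1)
    have t4 := isTestFunction_kern (Ω := Ω) hδ hxδ
    have h2 : innerSL ℝ (harmRep Ω g x) (y - x)
        = pairing Ω g fun i ξ => (y - x) i * kern δ (ξ - x) := by
      rw [innerSL_apply_apply, PiLp.inner_apply, pairing, integral_finsetSum _ fun i _ =>
        integrable_coord_mul hg.memLp (t4.const_mul _) i]
      refine Finset.sum_congr rfl fun i _ => ?_
      have : harmRep Ω g x i = ∫ ξ in Ω, g ξ i * kern δ (ξ - x) :=
        hg.integral_mul_kern_eq hΩ (rad_pos hΩ hb hx) hδ (closedBall_rad_subset hΩ hb hx) hxδ i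
      rw [this]
      simp only [mul_left_comm _ ((y - x) i)]
      rw [integral_const_mul]
      simp
    have h3 : p y - p x - innerSL ℝ (harmRep Ω g x) (y - x)
        = ∫ ξ in Ω, (segKern δ (y - x) (ξ - x) - kern δ (ξ - x)) * ⟪g ξ, y - x⟫_ℝ := by
      rw [h2, ← h1, add_sub_cancel_left,
        ← pairing_sub hg.memLp (fun i => t3.const_mul _) (fun i => t4.const_mul _), pairing]
      refine integral_congr_ae (Eventually.of_forall fun ξ => ?_)
      simp only [PiLp.inner_apply, Finset.mul_sum]
      refine Finset.sum_congr rfl fun i _ => ?_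
      simp
      ring
    rw [h3]
    calc _ ≤ ∫ ξ in Ω, (L * ‖y - x‖ ^ 2) * ‖g ξ‖ := by
          refine norm_integral_le_of_norm_le (hgi.norm.const_mul _) (Eventually.of_forall fun ξ => ?_)
          rw [norm_mul]
          calc _ ≤ (L * ‖y - x‖) * (‖g ξ‖ * ‖y - x‖) := by
                gcongr
                · exact abs_segKern_sub_le hL _ _
                · exact norm_inner_le_norm _ _
            _ = _ := by ring
      _ = _ := by rw [integral_const_mul]; ring
  rw [hasFDerivAt_iff_isLittleO]
  refine (Asymptotics.IsBigO.of_bound (g := fun y => ‖y - x‖ ^ 2) (L * ∫ ξ in Ω, ‖g ξ‖)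
    ?_).trans_isLittleO ?_
  · filter_upwards [key] with y hy
    simpa using hy
  · have := Asymptotics.isLittleO_pow_sub_sub (E' := Plane) x (m := 2) one_lt_two
    simpa using this

end Potential

/-! ### The harmonic representative and the vanishing of biorthogonal fields -/

section HarmonicRepresentative

variable {Ω : Set Plane} {g : Plane → Plane}

lemma locallyIntegrable_indicator_coord (hΩ : IsOpen Ω) (hg : MemLp g 2 (volume.restrict Ω))
    (i : Fin 2) : LocallyIntegrable (Ω.indicator fun ξ => g ξ i) :=
  (memLp_indicator hΩ (coord_memLp hg i)).locallyIntegrable (by norm_num)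

lemma mollify_indicator (hΩ : IsOpen Ω) (a ζ : Plane → ℝ) (y : Plane) :
    mollify (Ω.indicator a) ζ y = ∫ ξ in Ω, a ξ * ζ (y - ξ) := by
  rw [mollify, ← integral_indicator hΩ.measurableSet]
  refine integral_congr_ae (Eventually.of_forall fun ξ => ?_)
  by_cases h : ξ ∈ Ω <;> simp [h]

/-- The radius in `harmRep` varies with the point; by the mean value property it may be replaced by
any fixed admissible one. Locally the representative is then a mollification, hence continuous. -/
lemma harmRep_apply_eq (hg : IsBiorthogonal Ω g) (hΩ : IsOpen Ω) (hb : Bornology.IsBounded Ω)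
    {δ : ℝ} {y : Plane} (hδ : 0 < δ) (hy : Metric.closedBall y δ ⊆ Ω) (i : Fin 2) :
    harmRep Ω g y i = mollify (Ω.indicator fun ξ => g ξ i) (kern δ) y := by
  have hyΩ : y ∈ Ω := hy (Metric.mem_closedBall_self hδ.le)
  have h := hg.integral_mul_kern_eq hΩ (rad_pos hΩ hb hyΩ) hδ (closedBall_rad_subset hΩ hb hyΩ) hy i
  rw [mollify_indicator hΩ]
  refine h.trans (integral_congr_ae (Eventually.of_forall fun ξ => ?_))
  simp only
  rw [← kern_neg, neg_sub]

lemma continuousOn_harmRep (hg : IsBiorthogonal Ω g) (hΩ : IsOpen Ω) (hb : Bornology.IsBounded Ω) :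
    ContinuousOn (harmRep Ω g) Ω := by
  refine fun x hx => ContinuousAt.continuousWithinAt ?_
  set δ := rad Ω x / 2 with hδd
  have hδ : 0 < δ := half_pos (rad_pos hΩ hb hx)
  have hc : Continuous fun y => (WithLp.toLp 2 fun i =>
      mollify (Ω.indicator fun ξ => g ξ i) (kern δ) y : Plane) := by
    refine (PiLp.continuous_toLp 2 _).comp (continuous_pi fun i => ?_)
    exact (contDiff_mollify (locallyIntegrable_indicator_coord hΩ hg.memLp i) (contDiff_kern δ)
      (hasCompactSupport_kern hδ)).continuous
  refine hc.continuousAt.congr ?_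
  filter_upwards [eventually_near hΩ hb hx] with y hy
  ext i
  exact (harmRep_apply_eq hg hΩ hb hδ (closedBall_subset_of_lt hy.2.2) i).symm

/-- The left side can be computed with kernels of every small radius and does not change. As the
radius tends to zero the kernels concentrate at the origin with constant mass, and the right side
appears. -/
lemma integral_harmRep_mul (hg : IsBiorthogonal Ω g) (hΩ : IsOpen Ω) (hb : Bornology.IsBounded Ω)
    {η : Plane → ℝ} (hη : IsTestFunction Ω η) (i : Fin 2) :
    ∫ x in Ω, harmRep Ω g x i * η x = (∫ z, kern 1 z) * ∫ x in Ω, g x i * η x := by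
  set p : Plane → ℝ := Ω.indicator fun ξ => g ξ i with hp
  have hploc : LocallyIntegrable p := locallyIntegrable_indicator_coord hΩ hg.memLp i
  obtain ⟨δ₀, hδ₀, hK⟩ := hη.2.1.isCompact.exists_cthickening_subset_open hΩ hη.2.2
  set P : Plane → ℝ := mollify p fun y => η (-y) with hP
  have hPc : Continuous P := by
    refine (contDiff_mollify hploc (hη.1.comp contDiff_neg) ?_).continuous
    exact hη.2.1.comp_homeomorph (Homeomorph.neg Plane)
  have hP0 : P 0 = ∫ x in Ω, g x i * η x := by
    rw [hP, hp, mollify_indicator hΩ]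
    simp
  -- All balls of radius at most `δ₀` centred on the support of `η` lie in `Ω`, so one radius serves
  -- the whole support. The mollification is then moved from `g` to `η`.
  have hA : ∀ δ, 0 < δ → δ ≤ δ₀ → ∫ x in Ω, harmRep Ω g x i * η x = ∫ y, kern δ y * P y := by
    intro δ hδ hδ'
    rw [hP, ← integral_mul_mollify_comm hploc hη.1.continuous hη.2.1 (contDiff_kern δ).continuous
      (hasCompactSupport_kern hδ), setIntegral_mul_of_tsupport hη.2.2]
    refine integral_congr_ae (Eventually.of_forall fun x => ?_)
    simp only [kern_neg]
    by_cases hx : x ∈ tsupport η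
    · rw [harmRep_apply_eq hg hΩ hb hδ, mul_comm]
      exact (Metric.closedBall_subset_cthickening hx δ).trans
        ((Metric.cthickening_mono hδ' _).trans hK)
    · rw [image_eq_zero_of_notMem_tsupport hx, mul_zero, zero_mul]
  rw [← hP0]
  refine eq_of_forall_dist_le fun ε hε => ?_
  set C := ∫ z, |kern 1 z| with hC
  have hC0 : 0 ≤ C := integral_nonneg fun _ => abs_nonneg _
  obtain ⟨r, hr, hrP⟩ := Metric.continuousAt_iff.1 hPc.continuousAt (ε / (C + 1)) (by positivity)
  set δ := min δ₀ (r / 2) with hδd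
  have hδ : 0 < δ := lt_min hδ₀ (half_pos hr)
  have hki : Integrable (kern δ) :=
    (contDiff_kern δ).continuous.integrable_of_hasCompactSupport (hasCompactSupport_kern hδ)
  have hkP : Integrable fun y => kern δ y * P y :=
    ((contDiff_kern δ).continuous.mul hPc).integrable_of_hasCompactSupport
      (hasCompactSupport_kern hδ).mul_right
  have e : (∫ x in Ω, harmRep Ω g x i * η x) - (∫ z, kern 1 z) * P 0
      = ∫ y, kern δ y * (P y - P 0) := by
    rw [hA δ hδ (min_le_left _ _), ← integral_kern hδ, ← integral_mul_const,
      ← integral_sub hkP (hki.mul_const _)]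
    simp only [mul_sub]
  rw [Real.dist_eq, e, ← Real.norm_eq_abs]
  calc _ ≤ ∫ y, |kern δ y| * (ε / (C + 1)) := by
        refine norm_integral_le_of_norm_le (hki.abs.mul_const _) (Eventually.of_forall fun y => ?_)
        rw [norm_mul, Real.norm_eq_abs (kern δ y)]
        by_cases hy : δ ≤ ‖y‖
        · rw [kern_eq_zero hδ hy, abs_zero, zero_mul, zero_mul]
        · gcongr
          have : dist y 0 < r := by
            rw [dist_zero_right]
            have := min_le_right δ₀ (r / 2)
            rw [not_le] at hy
            linarith
          exact (hrP this).le
    _ = C * (ε / (C + 1)) := by rw [integral_mul_const, integral_abs_kern hδ]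
    _ ≤ ε := by
        rw [mul_div_assoc', div_le_iff₀ (by positivity)]
        nlinarith

/-- A biorthogonal field agrees with its harmonic representative. -/
lemma harmRep_ae_eq (hg : IsBiorthogonal Ω g) (hΩ : IsOpen Ω) (hb : Bornology.IsBounded Ω) :
    harmRep Ω g =ᵐ[volume.restrict Ω] fun x => (∫ z, kern 1 z) • g x := by
  have hi : ∀ i : Fin 2, ∀ᵐ x ∂volume.restrict Ω,
      harmRep Ω g x i - (∫ z, kern 1 z) * g x i = 0 := fun i => by
    have h1 : LocallyIntegrableOn (fun x => harmRep Ω g x i) Ω :=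
      (((EuclideanSpace.proj (𝕜 := ℝ) i : Plane →L[ℝ] ℝ).continuous.comp_continuousOn
        (continuousOn_harmRep hg hΩ hb))).locallyIntegrableOn hΩ.measurableSet
    have h2 : IntegrableOn (fun x => (∫ z, kern 1 z) * g x i) Ω :=
      ((EuclideanSpace.proj (𝕜 := ℝ) i : Plane →L[ℝ] ℝ).integrable_comp
        (hg.integrable hb)).const_mul _
    have := hΩ.ae_eq_zero_of_integral_contDiff_smul_eq_zero (μ := volume)
      (h1.sub h2.locallyIntegrableOn) fun η hη hηc hηs => by
        have ht : IsTestFunction Ω η := ⟨hη, hηc, hηs⟩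
        have h3 := integral_harmRep_mul hg hΩ hb ht i
        have hInt : Integrable (fun x => harmRep Ω g x i * η x) (volume.restrict Ω) :=
          (integrable_mul_of_continuousOn hΩ
            ((EuclideanSpace.proj (𝕜 := ℝ) i : Plane →L[ℝ] ℝ).continuous.comp_continuousOn
            (continuousOn_harmRep hg hΩ hb)) hη.continuous hηc hηs).restrict
        rw [← integral_const_mul, ← sub_eq_zero, ← integral_sub hInt
          ((integrable_coord_mul hg.memLp ht i).const_mul _)] at h3
        have h4 : ∀ x, harmRep Ω g x i * η x - (∫ z, kern 1 z) * (g x i * η x)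
            = (harmRep Ω g x i - (∫ z, kern 1 z) * g x i) * η x := fun x => by ring
        simp only [h4] at h3
        rw [setIntegral_mul_of_tsupport hηs] at h3
        rw [← h3]
        refine integral_congr_ae (Eventually.of_forall fun x => ?_)
        simp [mul_comm]
    exact (ae_restrict_iff' hΩ.measurableSet).2 this
  filter_upwards [ae_all_iff.2 hi] with x hx
  ext i
  simpa using sub_eq_zero.1 (hx i)

/-- A field orthogonal to the solenoidal test fields and to all gradients vanishes. -/
theorem IsBiorthogonal.ae_eq_zero (hg : IsBiorthogonal Ω g) (hΩ : IsOpen Ω)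
    (hb : Bornology.IsBounded Ω) (hc : IsConnected Ω) : g =ᵐ[volume.restrict Ω] 0 := by
  have : IsFiniteMeasure (volume.restrict Ω) := ⟨by
    rw [Measure.restrict_apply_univ]; exact hb.measure_lt_top⟩
  obtain ⟨p, hp⟩ := exists_potential hg hΩ hb hc
  set c := ∫ z, kern 1 z with hcd
  -- Nothing bounds `p` near the boundary, so it may fail to lie in `H¹(Ω)`. Its arctangent is
  -- bounded, and the factor `1/(1 + p²)` keeps the gradient below a multiple of `|g|`.
  have hq : ∀ x ∈ Ω, HasFDerivAt (fun x => Real.arctan (p x))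
      ((1 / (1 + p x ^ 2)) • innerSL ℝ (harmRep Ω g x)) x := fun x hx => (hp x hx).arctan
  have hpc : ContinuousOn p Ω := fun x hx => (hp x hx).continuousAt.continuousWithinAt
  have hw : ContinuousOn (fun x => 1 / (1 + p x ^ 2)) Ω :=
    continuousOn_const.div (continuousOn_const.add (hpc.pow 2)) fun x _ => by positivity
  have hq1 : ContDiffOn ℝ 1 (fun x => Real.arctan (p x)) Ω := by
    rw [show (1 : WithTop ℕ∞) = 0 + 1 from rfl, contDiffOn_succ_iff_fderiv_of_isOpen hΩ]
    refine ⟨fun x hx => (hq x hx).differentiableAt.differentiableWithinAt, by simp, ?_⟩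
    rw [contDiffOn_zero]
    refine ContinuousOn.congr (hw.smul ((innerSL ℝ).continuous.comp_continuousOn
      (continuousOn_harmRep hg hΩ hb))) fun x hx => ?_
    exact (hq x hx).fderiv
  have hgrad : ∀ᵐ x ∂volume.restrict Ω, pgrad (fun x => Real.arctan (p x)) x
      = (c / (1 + p x ^ 2)) • g x := by
    filter_upwards [harmRep_ae_eq hg hΩ hb, ae_restrict_mem hΩ.measurableSet] with x hx hxΩ
    have : pgrad (fun x => Real.arctan (p x)) x = (1 / (1 + p x ^ 2)) • harmRep Ω g x := by
      refine ext_inner_right ℝ fun v => ?_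
      rw [← fderiv_eq_inner_pgrad, (hq x hxΩ).fderiv, inner_smul_left]
      rfl
    rw [this, hx, smul_smul]
    congr 1
    ring
  have hm1 : MemLp (fun x => Real.arctan (p x)) 2 (volume.restrict Ω) :=
    MemLp.of_bound ((Real.continuous_arctan.comp_continuousOn hpc).aestronglyMeasurable
      hΩ.measurableSet) (Real.pi / 2) (Eventually.of_forall fun x =>
        abs_le.2 ⟨(Real.neg_pi_div_two_lt_arctan _).le, (Real.arctan_lt_pi_div_two _).le⟩)
  have hws : AEStronglyMeasurable (fun x => c / (1 + p x ^ 2)) (volume.restrict Ω) := by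
    refine ContinuousOn.aestronglyMeasurable ?_ hΩ.measurableSet
    exact continuousOn_const.div (continuousOn_const.add (hpc.pow 2)) fun x _ => by positivity
  have hm2 : MemLp (pgrad fun x => Real.arctan (p x)) 2 (volume.restrict Ω) := by
    refine (memLp_congr_ae hgrad).2 ?_
    refine MemLp.of_le (hg.memLp.const_smul c) (hws.smul hg.memLp.1) (Eventually.of_forall fun x => ?_)
    simp only [Pi.smul_apply, norm_smul, norm_div]
    gcongr
    refine div_le_self (norm_nonneg _) ?_
    rw [Real.norm_of_nonneg (by positivity)]
    nlinarith [sq_nonneg (p x)]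
  have h0 := hg.gradient (mkH1 hm1 hm2 (hasWeakGradient_of_contDiffOn hΩ hq1))
  -- The gradient of `arctan p` is a positive function times `c g`. Orthogonality to it forces the
  -- weighted integral of `|g|²` to vanish, since `c` is not zero.
  have h1 : ∫ x in Ω, ‖g x‖ ^ 2 / (1 + p x ^ 2) = 0 := by
    have : c * ∫ x in Ω, ‖g x‖ ^ 2 / (1 + p x ^ 2) = 0 := by
      rw [← integral_const_mul, ← h0]
      refine integral_congr_ae ?_
      filter_upwards [hgrad, sgrad_mkH1 hm1 hm2 (hasWeakGradient_of_contDiffOn hΩ hq1)] with x hx hx'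
      rw [hx', hx, inner_smul_right, real_inner_self_eq_norm_sq]
      ring
    exact (mul_eq_zero.1 this).resolve_left integral_kern_one_ne_zero
  have hInt : Integrable (fun x => ‖g x‖ ^ 2 / (1 + p x ^ 2)) (volume.restrict Ω) := by
    refine (integrable_norm_sq_of_memLp hg.memLp).mono' ?_ (Eventually.of_forall fun x => ?_)
    · have := (hg.memLp.1.norm.pow 2).mul (hw.aestronglyMeasurable hΩ.measurableSet)
      refine this.congr (Eventually.of_forall fun x => ?_)
      simp [div_eq_mul_inv]
    · rw [Real.norm_of_nonneg (by positivity)]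
      exact div_le_self (by positivity) (by nlinarith [sq_nonneg (p x)])
  have h2 := (integral_eq_zero_iff_of_nonneg (fun x => by positivity) hInt).1 h1
  filter_upwards [h2] with x hx
  have h3 : (1 + p x ^ 2) ≠ 0 := by positivity
  simpa [h3] using hx

end HarmonicRepresentative

/-! ### Density of `V` in `H` -/

section Density

variable {Ω : Set Plane}

/-- When `p` is a test function this is the definition of the weak gradient of `q`; both sides are
continuous in `p`. Vanishing of `p` on the boundary replaces any condition on `q`. -/
lemma integral_sval_mul_sgrad (hΩ : IsOpen Ω) {p : H1 Ω} (hp : p ∈ H10 Ω) (q : H1 Ω) (i : Fin 2) :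
    ∫ x in Ω, sval p x * sgrad q x i = - ∫ x in Ω, sval q x * sgrad p x i := by
  obtain ⟨η, hη, hlim⟩ := exists_seq_test_of_mem_H10 hΩ hp
  have h1 := ((continuous_integral_mul (coord_memLp (Lp.memLp (sgrad q)) i)).comp
    (svalL Ω).continuous).continuousAt.tendsto.comp hlim
  have h2 := ((continuous_integral_inner (memLp_smul_const (Lp.memLp (sval q))
    (EuclideanSpace.single i 1))).comp (sgradL Ω).continuous).continuousAt.tendsto.comp hlim
  have e : ∀ r : H1 Ω, ∫ x in Ω, ⟪sval q x • EuclideanSpace.single i (1 : ℝ), sgrad r x⟫_ℝ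
      = ∫ x in Ω, sval q x * sgrad r x i := fun r => by
    refine integral_congr_ae (Eventually.of_forall fun x => ?_)
    simp [inner_smul_left, EuclideanSpace.inner_single_left]
  simp only [Function.comp_def, svalL_apply, sgradL_apply, e] at h1 h2
  refine tendsto_nhds_unique h1 (h2.neg.congr fun n => ?_)
  have h3 := hasWeakGradient_sgrad q (η n) (hη n) i
  have h4 : ∫ x in Ω, sval q x * sgrad (smoothH1 hΩ (hη n).1 (hη n).2.1) x i
      = ∫ x in Ω, sval q x * fderiv ℝ (η n) x (EuclideanSpace.single i 1) := by
    refine integral_congr_ae ?_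
    filter_upwards [sgrad_smoothH1 hΩ (hη n).1 (hη n).2.1] with x hx
    rw [hx, pgrad_apply]
  rw [h4, h3, neg_neg]
  refine integral_congr_ae ?_
  filter_upwards [sval_smoothH1 hΩ (hη n).1 (hη n).2.1] with x hx
  rw [hx, mul_comm]

/-- Integration by parts leaves the divergence of `v`, with no boundary term; in other words `V`
embeds into `H`. -/
lemma inner_vJ_sgrad (hΩ : IsOpen Ω) (v : V Ω) (q : H1 Ω) : ⟪vJ Ω v, sgrad q⟫_ℝ = 0 := by
  rw [real_inner_comm, vJ_apply, inner_velL]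
  have e : ∀ x, ⟪sgrad q x, vel v.1 x⟫_ℝ = ∑ i, sval (v.1 i) x * sgrad q x i := fun x => by
    rw [PiLp.inner_apply]
    refine Finset.sum_congr rfl fun i _ => ?_
    simp [vel]
  simp only [e]
  have hi : ∀ i, Integrable (fun x => sval q x * sgrad (v.1 i) x i) (volume.restrict Ω) := fun i =>
    (Lp.memLp _).integrable_mul (p := 2) (q := 2) (coord_memLp (Lp.memLp _) i)
  have hj : ∀ i, Integrable (fun x => sval (v.1 i) x * sgrad q x i) (volume.restrict Ω) := fun i =>
    (Lp.memLp _).integrable_mul (p := 2) (q := 2) (coord_memLp (Lp.memLp _) i)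
  rw [integral_finsetSum _ fun i _ => hj i]
  simp only [integral_sval_mul_sgrad hΩ (v.2.1 _) q, Finset.sum_neg_distrib]
  rw [← integral_finsetSum _ fun i _ => hi i, neg_eq_zero]
  refine integral_eq_zero_of_ae ?_
  filter_upwards [v.2.2] with x hx
  rw [← Finset.mul_sum]
  have : ∑ i, sgrad (v.1 i) x i = 0 := hx
  rw [this, mul_zero]
  rfl

/-- The smooth solenoidal field with given components, as an element of `V`. -/
lemma exists_V_of_test (hΩ : IsOpen Ω) {W : Fin 2 → Plane → ℝ} (hW : ∀ i, IsTestFunction Ω (W i))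
    (hd : ∀ x, dv W x = 0) :
    ∃ v : V Ω, vel v.1 =ᵐ[volume.restrict Ω] fun x => WithLp.toLp 2 fun i => W i x := by
  refine ⟨⟨WithLp.toLp 2 fun i => smoothH1 hΩ (hW i).1 (hW i).2.1,
    fun i => smoothH1_mem_H10 hΩ (hW i), ?_⟩, ?_⟩
  · filter_upwards [ae_all_iff.2 fun i => sgrad_smoothH1 hΩ (hW i).1 (hW i).2.1] with x hx
    rw [← hd x, dv]
    refine Finset.sum_congr rfl fun i _ => ?_
    exact congrArg (fun y : Plane => y i) (hx i)
  · filter_upwards [ae_all_iff.2 fun i => sval_smoothH1 hΩ (hW i).1 (hW i).2.1] with x hx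
    ext i
    exact hx i

/-- `V` is dense in `H`. -/
theorem mem_closure_range_vJ (hΩ : IsOpen Ω) (hb : Bornology.IsBounded Ω) (hc : IsConnected Ω)
    {ψ : L2 Ω Plane} (hψ : ψ ∈ H Ω) : ψ ∈ closure (range (vJ Ω)) := by
  set S : Submodule ℝ (L2 Ω Plane) := (LinearMap.range (vJ Ω : V Ω →ₗ[ℝ] L2 Ω Plane)).topologicalClosure
  have hS : IsClosed (S : Set (L2 Ω Plane)) := Submodule.isClosed_topologicalClosure _
  have : CompleteSpace S := hS.completeSpace_coe
  set Pψ := S.starProjection ψ with hPψ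
  have hmem : Pψ ∈ S := Submodule.starProjection_apply_mem _ _
  have horth : ∀ v : V Ω, ⟪ψ - Pψ, vJ Ω v⟫_ℝ = 0 := fun v => by
    refine Submodule.starProjection_inner_eq_zero ψ _ (subset_closure ?_)
    exact ⟨v, rfl⟩
  -- The residual of the projection onto the closure of `V` is orthogonal to solenoidal test fields
  -- by construction. It is orthogonal to gradients because both `ψ` and its projection are.
  have hB : IsBiorthogonal Ω (ψ - Pψ : L2 Ω Plane) := by
    refine ⟨Lp.memLp _, fun W hW hd => ?_, fun q => ?_⟩
    · obtain ⟨v, hv⟩ := exists_V_of_test hΩ hW hd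
      rw [← horth v, vJ_apply, inner_velL, pairing]
      refine integral_congr_ae ?_
      filter_upwards [hv] with x hx
      rw [hx, PiLp.inner_apply]
      refine Finset.sum_congr rfl fun i _ => ?_
      simp [mul_comm]
    · rw [← L2.inner_def, inner_sub_left, L2.inner_def, hψ q, zero_sub, neg_eq_zero]
      have hcl : IsClosed {h : L2 Ω Plane | ⟪h, sgrad q⟫_ℝ = 0} :=
        isClosed_eq (continuous_id.inner continuous_const) continuous_const
      refine closure_minimal (s := range (vJ Ω)) ?_ hcl hmem
      rintro _ ⟨v, rfl⟩
      exact inner_vJ_sgrad hΩ v q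
  have h0 : ψ - Pψ = 0 := Lp.ext ((hB.ae_eq_zero hΩ hb hc).trans (Lp.coeFn_zero _ _ _).symm)
  rw [sub_eq_zero.1 h0]
  exact hmem

end Density

/-! ### Multiplication operators and their strong convergence -/

section MultiplicationOperators

lemma tendsto_Lp_of_dominated {α F : Type*} [MeasurableSpace α] {ν : Measure α}
    [NormedAddCommGroup F] [InnerProductSpace ℝ F] {f : ℕ → Lp F 2 ν} {f' : Lp F 2 ν} {h : α → ℝ}
    (hh : MemLp h 2 ν) (hb : ∀ n, ∀ᵐ x ∂ν, ‖f n x‖ ≤ h x)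
    (hlim : ∀ᵐ x ∂ν, Tendsto (fun n => f n x) atTop (𝓝 (f' x))) : Tendsto f atTop (𝓝 f') := by
  rw [tendsto_iff_norm_sub_tendsto_zero]
  have h1 : Tendsto (fun n => ∫ x, ‖f n x - f' x‖ ^ 2 ∂ν) atTop (𝓝 (∫ _, (0 : ℝ) ∂ν)) := by
    refine tendsto_integral_of_dominated_convergence (fun x => (2 * h x) ^ 2)
      (fun n => (((Lp.memLp (f n)).1.sub (Lp.memLp f').1).norm.pow 2)) ?_ (fun n => ?_) ?_
    · simpa [mul_pow] using integrable_norm_sq_of_memLp (hh.const_mul 2)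
    · filter_upwards [ae_all_iff.2 hb, hlim] with x h1 h2
      have h3 : ‖f' x‖ ≤ h x := le_of_tendsto' h2.norm h1
      rw [Real.norm_of_nonneg (by positivity)]
      gcongr
      exact (norm_sub_le _ _).trans (by linarith [h1 n])
    · filter_upwards [hlim] with x hx
      have := ((hx.sub_const (f' x)).norm).pow 2
      simpa using this
  have h2 : ∀ n, ‖f n - f'‖ = √(∫ x, ‖f n x - f' x‖ ^ 2 ∂ν) := fun n => by
    rw [← Real.sqrt_sq (norm_nonneg (f n - f')), Lp_norm_sq_eq_integral]
    congr 1
    refine integral_congr_ae ?_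
    filter_upwards [Lp.coeFn_sub (f n) f'] with x hx
    rw [hx]
    rfl
  simp only [h2]
  simpa using h1.sqrt

/-- A uniform bound on the operators makes pointwise convergence at the limit point enough, although
the argument moves with `n`. -/
lemma tendsto_clm_apply {X : Type*} [NormedAddCommGroup X] [NormedSpace ℝ X] {P : ℕ → X →L[ℝ] X}
    {P' : X →L[ℝ] X} {C : ℝ} (hC : ∀ n x, ‖P n x‖ ≤ C * ‖x‖) {x : ℕ → X} {x' : X}
    (hP : Tendsto (fun n => P n x') atTop (𝓝 (P' x'))) (hx : Tendsto x atTop (𝓝 x')) :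
    Tendsto (fun n => P n (x n)) atTop (𝓝 (P' x')) := by
  have h1 : Tendsto (fun n => P n (x n - x')) atTop (𝓝 0) := by
    have h2 : Tendsto (fun n => C * ‖x n - x'‖) atTop (𝓝 0) := by
      simpa using (tendsto_iff_norm_sub_tendsto_zero.1 hx).const_mul C
    exact squeeze_zero_norm (fun n => hC n _) h2
  simpa using h1.add hP

lemma tendsto_compLp {α X : Type*} [MeasurableSpace α] {ν : Measure α} [NormedAddCommGroup X]
    [InnerProductSpace ℝ X] {P : ℕ → X →L[ℝ] X} {P' : X →L[ℝ] X} {C : ℝ}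
    (hC : ∀ n x, ‖P n x‖ ≤ C * ‖x‖) (hP : ∀ x, Tendsto (fun n => P n x) atTop (𝓝 (P' x)))
    (y : Lp X 2 ν) : Tendsto (fun n => (P n).compLp y) atTop (𝓝 (P'.compLp y)) := by
  refine tendsto_Lp_of_dominated (h := fun t => C * ‖y t‖) ((Lp.memLp y).norm.const_mul C)
    (fun n => ?_) ?_
  · filter_upwards [(P n).coeFn_compLp y] with t ht
    rw [ht]
    exact hC n _
  · filter_upwards [P'.coeFn_compLp y, ae_all_iff.2 fun n => (P n).coeFn_compLp y] with t h1 h2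
    simp only [h1, h2]
    exact hP _

lemma norm_compLp_le {α X : Type*} [MeasurableSpace α] {ν : Measure α} [NormedAddCommGroup X]
    [NormedSpace ℝ X] {P : X →L[ℝ] X} {C : ℝ}
    (hC : ∀ x, ‖P x‖ ≤ C * ‖x‖) (y : Lp X 2 ν) : ‖P.compLp y‖ ≤ C * ‖y‖ := by
  refine Lp.norm_le_mul_norm_of_ae_le_mul ?_
  filter_upwards [P.coeFn_compLp y] with t ht
  rw [ht]
  exact hC _

variable {Ω : Set Plane}

/-- `M` is the operator of multiplication by `m`, with a bound `C`. -/
structure IsMulOp (m : Plane → ℝ) (C : ℝ) (M : L2 Ω Plane →L[ℝ] L2 Ω Plane) : Prop where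
  coe : ∀ g : L2 Ω Plane, M g =ᵐ[volume.restrict Ω] fun x => m x • g x
  bound : ∀ g : L2 Ω Plane, ‖M g‖ ≤ C * ‖g‖

lemma exists_isMulOp {m : Plane → ℝ} {C : ℝ}
    (hm : AEStronglyMeasurable m (volume.restrict Ω))
    (hC : ∀ᵐ x ∂volume.restrict Ω, |m x| ≤ C) :
    ∃ M : L2 Ω Plane →L[ℝ] L2 Ω Plane, IsMulOp m C M := by
  have hmem : ∀ g : L2 Ω Plane, MemLp (fun x => m x • g x) 2 (volume.restrict Ω) := fun g => by
    refine MemLp.of_le_mul (c := C) (Lp.memLp g) (hm.smul (Lp.memLp g).1) ?_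
    filter_upwards [hC] with x hx
    rw [norm_smul]
    gcongr
    exact hx
  have hbd : ∀ g : L2 Ω Plane, ‖(hmem g).toLp _‖ ≤ C * ‖g‖ := fun g => by
    refine Lp.norm_le_mul_norm_of_ae_le_mul ?_
    filter_upwards [(hmem g).coeFn_toLp, hC] with x h1 h2
    rw [h1, norm_smul]
    gcongr
    exact h2
  refine ⟨LinearMap.mkContinuous
    { toFun := fun g => (hmem g).toLp _
      map_add' := fun g h => Lp.ext ?_
      map_smul' := fun c g => Lp.ext ?_ } C hbd, fun g => (hmem g).coeFn_toLp, hbd⟩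
  · filter_upwards [(hmem (g + h)).coeFn_toLp, (hmem g).coeFn_toLp, (hmem h).coeFn_toLp,
      Lp.coeFn_add g h, Lp.coeFn_add ((hmem g).toLp _) ((hmem h).toLp _)] with x h1 h2 h3 h4 h5
    rw [h1, h5, Pi.add_apply, h2, h3, h4, Pi.add_apply, smul_add]
  · filter_upwards [(hmem (c • g)).coeFn_toLp, (hmem g).coeFn_toLp, Lp.coeFn_smul c g,
      Lp.coeFn_smul c ((hmem g).toLp _)] with x h1 h2 h3 h4
    rw [h1, RingHom.id_apply, h4, Pi.smul_apply, h2, h3, Pi.smul_apply, smul_comm]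

lemma IsMulOp.inner {m : Plane → ℝ} {C : ℝ} {M : L2 Ω Plane →L[ℝ] L2 Ω Plane}
    (h : IsMulOp m C M) (g g' : L2 Ω Plane) :
    ⟪M g, g'⟫_ℝ = ∫ x in Ω, m x * ⟪g x, g' x⟫_ℝ := by
  rw [L2.inner_def]
  refine integral_congr_ae ?_
  filter_upwards [h.coe g] with x hx
  rw [hx, inner_smul_left]
  rfl

lemma IsMulOp.inner_nonneg {m : Plane → ℝ} {C : ℝ} {M : L2 Ω Plane →L[ℝ] L2 Ω Plane}
    (h : IsMulOp m C M) (hm : ∀ᵐ x ∂volume.restrict Ω, 0 ≤ m x) (g : L2 Ω Plane) :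
    0 ≤ ⟪M g, g⟫_ℝ := by
  rw [h.inner]
  refine integral_nonneg_of_ae ?_
  filter_upwards [hm] with x hx
  exact mul_nonneg hx real_inner_self_nonneg

/-- Designs converge only almost everywhere, so multiplication operators are compared at a fixed
`g`, by dominated convergence with majorant `C ‖g‖`. Convergence in operator norm is not needed. -/
lemma tendsto_mulOp {m : ℕ → Plane → ℝ} {m' : Plane → ℝ} {C : ℝ}
    {M : ℕ → L2 Ω Plane →L[ℝ] L2 Ω Plane} {M' : L2 Ω Plane →L[ℝ] L2 Ω Plane}
    (h : ∀ n, IsMulOp (m n) C (M n)) (h' : IsMulOp m' C M')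
    (hC : ∀ n, ∀ᵐ x ∂volume.restrict Ω, |m n x| ≤ C)
    (hm : ∀ᵐ x ∂volume.restrict Ω, Tendsto (fun n => m n x) atTop (𝓝 (m' x))) (g : L2 Ω Plane) :
    Tendsto (fun n => M n g) atTop (𝓝 (M' g)) := by
  refine tendsto_Lp_of_dominated (h := fun x => C * ‖g x‖) ((Lp.memLp g).norm.const_mul C)
    (fun n => ?_) ?_
  · filter_upwards [(h n).coe g, hC n] with x h1 h2
    rw [h1, norm_smul]
    gcongr
    exact h2
  · filter_upwards [h'.coe g, ae_all_iff.2 fun n => (h n).coe g, hm] with x h1 h2 h3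
    simp only [h1, h2]
    exact h3.smul_const _

lemma PorousFunction.continuous {α : ℝ → ℝ} (hα : PorousFunction α) : Continuous α := by
  obtain ⟨K, hK⟩ := hα.lipschitz
  exact hK.continuous

lemma PorousFunction.exists_bound {α : ℝ → ℝ} (hα : PorousFunction α) :
    ∃ C, 0 ≤ C ∧ ∀ s, |s| ≤ 1 → |α s| ≤ C := by
  obtain ⟨C, hC⟩ := (isCompact_Icc (a := (-1 : ℝ)) (b := 1)).exists_bound_of_continuousOn
    hα.continuous.continuousOn
  exact ⟨C, (norm_nonneg _).trans (hC 0 (by norm_num)), fun s hs => hC s (abs_le.1 hs)⟩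

lemma aestronglyMeasurable_comp_sval {α : ℝ → ℝ} (hα : Continuous α) (φ : H1 Ω) :
    AEStronglyMeasurable (fun x => α (sval φ x)) (volume.restrict Ω) :=
  hα.comp_aestronglyMeasurable (Lp.memLp (sval φ)).1

lemma ae_abs_comp_sval_le {α : ℝ → ℝ} {C : ℝ} (hC : ∀ s, |s| ≤ 1 → |α s| ≤ C) {φ : H1 Ω}
    (hφ : φ ∈ admissible Ω) : ∀ᵐ x ∂volume.restrict Ω, |α (sval φ x)| ≤ C := by
  have hφ' : ∀ᵐ x ∂(volume.restrict Ω), |sval φ x| ≤ 1 := hφ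
  filter_upwards [hφ'] with x hx
  exact hC _ hx

end MultiplicationOperators

/-! ### Well-posedness of the state equations and dependence on the design -/

section States

variable {Ω : Set Plane} {α : ℝ → ℝ} {φ : H1 Ω} {C μ T : ℝ} {M : L2 Ω Plane →L[ℝ] L2 Ω Plane}

lemma aForm_eq (hM : IsMulOp (fun x => α (sval φ x)) C M) (u v : V Ω) :
    aForm μ α φ u.1 v.1 = μ * ⟪vD Ω u, vD Ω v⟫_ℝ + ⟪M (vJ Ω u), vJ Ω v⟫_ℝ := by
  rw [aForm, vD_apply, vD_apply, inner_jacL_jacL, hM.inner, vJ_apply, vJ_apply]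
  congr 1
  refine integral_congr_ae ?_
  filter_upwards [velL_coe u.1, velL_coe v.1] with x h1 h2
  rw [h1, h2]

/-- The part of order zero of the operator of `a_φ`, relative to the inner product of `V`. -/
def zerothOp (M : L2 Ω Plane →L[ℝ] L2 Ω Plane) (μ : ℝ) : V Ω →L[ℝ] V Ω :=
  (vJ Ω).adjoint ∘L (M - μ • ContinuousLinearMap.id ℝ (L2 Ω Plane)) ∘L vJ Ω

lemma zerothOp_apply (u : V Ω) :
    zerothOp M μ u = (vJ Ω).adjoint (M (vJ Ω u) - μ • vJ Ω u) := rfl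

lemma inner_zerothOp (u v : V Ω) :
    ⟪zerothOp M μ u, v⟫_ℝ = ⟪M (vJ Ω u), vJ Ω v⟫_ℝ - μ * ⟪vJ Ω u, vJ Ω v⟫_ℝ := by
  rw [zerothOp_apply, ContinuousLinearMap.adjoint_inner_left, inner_sub_left, inner_smul_left]
  rfl

/-- The inner product of `V` contains the `L²` part, so `μ u` represents more than the viscous term
and the surplus `μ` times the `L²` product is subtracted here. Hence the lower bound is `-μ` instead
of `0`. -/
lemma isZerothOrder_zerothOp (hM : IsMulOp (fun x => α (sval φ x)) C M) (hC : 0 ≤ C)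
    (hα : ∀ s, 0 ≤ α s) (hμ : 0 < μ) :
    IsZerothOrder (vJ Ω) (zerothOp M μ) μ (‖(vJ Ω).adjoint‖ * (C + μ)) := by
  refine ⟨by positivity, fun u => ?_, fun u => ?_⟩
  · rw [zerothOp_apply, mul_assoc]
    refine ((vJ Ω).adjoint.le_opNorm _).trans ?_
    gcongr
    refine (norm_sub_le _ _).trans ?_
    rw [norm_smul, Real.norm_of_nonneg hμ.le, add_mul]
    gcongr
    exact hM.bound _
  · rw [inner_zerothOp, real_inner_self_eq_norm_sq]
    have := hM.inner_nonneg (Eventually.of_forall fun x => hα _) (vJ Ω u)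
    linarith

lemma aForm_eq_zerothOp (hM : IsMulOp (fun x => α (sval φ x)) C M) (u v : V Ω) :
    aForm μ α φ u.1 v.1 = ⟪μ • u + zerothOp M μ u, v⟫_ℝ := by
  rw [aForm_eq hM, inner_add_left, inner_zerothOp, inner_smul_left, V.inner_eq]
  simp only [conj_trivial]
  ring

lemma memLp_adjoint {f : ℝ → L2 Ω Plane} (hf : MemLp f 2 (timeMeasure T)) :
    MemLp (fun t => (vJ Ω).adjoint (f t)) 2 (timeMeasure T) :=
  (vJ Ω).adjoint.comp_memLp' hf

lemma inner_adjoint_vJ (g : L2 Ω Plane) (ψ : V Ω) :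
    ⟪(vJ Ω).adjoint g, ψ⟫_ℝ = ∫ x in Ω, ⟪g x, vel ψ.1 x⟫_ℝ := by
  rw [ContinuousLinearMap.adjoint_inner_left, vJ_apply, inner_velL]

lemma ae_eq_vJ_iff (w : L2 Ω Plane) (v : V Ω) :
    w =ᵐ[volume.restrict Ω] vel v.1 ↔ w = vJ Ω v := by
  rw [vJ_apply]
  constructor
  · intro h
    exact Lp.ext (h.trans (velL_coe v.1).symm)
  · rintro rfl
    exact velL_coe v.1

/-- The weak formulation as an abstract evolution problem. -/
lemma isWeakSolutionT_iff (hT : 0 < T) (hM : IsMulOp (fun x => α (sval φ x)) C M) {c : ℝ}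
    (hΩ : IsOpen Ω) (hc : IsLadyzhenskayaConstant Ω c) {f : ℝ → L2 Ω Plane}
    {u₀ : L2 Ω Plane} {u : Lp (V Ω) 2 (timeMeasure T)} :
    IsWeakSolutionT μ α T f u₀ φ u ↔ ∃ w, IsNSTraj (vJ Ω) T μ (zerothOp M μ) (vB hΩ hc)
      (fun t => (vJ Ω).adjoint (f t)) u w ∧ w 0 = u₀ := by
  have heq : ∀ (t : ℝ) (ψ : V Ω), aForm μ α φ (u t).1 ψ.1 + bForm (u t).1 (u t).1 ψ.1
      = ⟪μ • u t + zerothOp M μ (u t) + vB hΩ hc (u t) (u t), ψ⟫_ℝ := fun t ψ => by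
    rw [aForm_eq_zerothOp hM, inner_add_left _ (vB hΩ hc (u t) (u t)), inner_vB]
  constructor
  · rintro ⟨⟨u', hu', hd, he⟩, w, hw, hwu, hw0⟩
    refine ⟨w, ?_, hw0⟩
    set F : ℝ → V Ω := fun t => (InnerProductSpace.toDual ℝ (V Ω)).symm (u' t) with hF
    have hFi : ∀ t ψ, ⟪F t, ψ⟫_ℝ = u' t ψ := fun t ψ => InnerProductSpace.toDual_symm_apply
    have hFm : MemLp F 2 (timeMeasure T) :=
      (InnerProductSpace.toDual ℝ (V Ω)).symm.toContinuousLinearEquiv.toContinuousLinearMap.comp_memLp' hu'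
    have hwu' : ∀ᵐ t ∂timeMeasure T, w t = vJ Ω (u t) := by
      filter_upwards [hwu] with t ht
      exact (ae_eq_vJ_iff _ _).1 ht
    have htraj : IsTraj (vJ Ω) T u F w := by
      refine ⟨Lp.memLp u, hFm, hw, hwu', fun ψ => ?_⟩
      -- The continuous representative makes `⟪w, J ψ⟫` a continuous function with an integrable
      -- weak derivative, hence a primitive of it.
      refine isPrimitiveOn_of_weakDeriv hT (hw.inner continuousOn_const)
        (integrable_inner_of_memLp hFm (memLp_const ψ)) fun η hη => ?_
      have h1 := hd η hη ψ
      simp only [← hFi] at h1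
      rw [← h1]
      refine integral_congr_ae ?_
      filter_upwards [hwu'] with t ht
      rw [ht, vJ_apply, vJ_apply, inner_velL_velL]
    refine htraj.congr hT.le (EventuallyEq.refl _ _) ?_
    filter_upwards [he] with t ht
    have h3 : F t = (vJ Ω).adjoint (f t)
        - (μ • u t + zerothOp M μ (u t) + vB hΩ hc (u t) (u t)) := by
      rw [eq_sub_iff_add_eq]
      refine ext_inner_right ℝ fun ψ => ?_
      have h2 := ht ψ
      rwa [add_assoc, heq, ← hFi, ← inner_adjoint_vJ, ← inner_add_left] at h2
    rw [h3]
    abel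
  · rintro ⟨w, h, hw0⟩
    refine ⟨⟨fun t => InnerProductSpace.toDual ℝ (V Ω) ((vJ Ω).adjoint (f t) - μ • u t
      - zerothOp M μ (u t) - vB hΩ hc (u t) (u t)), ?_, fun η hη ψ => ?_,
      Eventually.of_forall fun t ψ => ?_⟩, w, h.continuousOn, ?_, hw0⟩
    · exact (InnerProductSpace.toDual ℝ (V Ω)).toContinuousLinearEquiv.toContinuousLinearMap.comp_memLp'
        h.memLp_deriv
    · have h1 := (h.primitive ψ).integral_deriv_mul hT hη
      simp only [InnerProductSpace.toDual_apply_apply]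
      rw [← h1]
      refine integral_congr_ae ?_
      filter_upwards [h.ae_eq] with t ht
      rw [ht, vJ_apply, vJ_apply, inner_velL_velL]
    · rw [add_assoc, heq, InnerProductSpace.toDual_apply_apply, ← inner_adjoint_vJ, ← inner_add_left]
      congr 1
      abel
    · filter_upwards [h.ae_eq] with t ht
      exact (ae_eq_vJ_iff _ _).2 ht

/-- Existence and uniqueness for the time-dependent problem. -/
theorem existsUnique_isWeakSolutionT (hΩ : IsOpen Ω) (hΩc : IsConnected Ω)
    (hb : Bornology.IsBounded Ω) (hT : 0 < T) (hμ : 0 < μ) (hα : PorousFunction α)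
    {f : ℝ → L2 Ω Plane} (hf : MemLp f 2 (timeMeasure T)) {u₀ : L2 Ω Plane} (hu₀ : u₀ ∈ H Ω)
    (hφ : φ ∈ admissible Ω) :
    ∃! u : Lp (V Ω) 2 (timeMeasure T), IsWeakSolutionT μ α T f u₀ φ u := by
  obtain ⟨c, hc⟩ := exists_isLadyzhenskayaConstant hΩ
  obtain ⟨C, hC0, hC⟩ := hα.exists_bound
  obtain ⟨M, hM⟩ := exists_isMulOp (aestronglyMeasurable_comp_sval hα.continuous φ)
    (ae_abs_comp_sval_le hC hφ)
  have hK := isZerothOrder_zerothOp hM hC0 hα.nonneg hμ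
  have hg := memLp_adjoint (Ω := Ω) hf
  have hJc := isCompactOperator_vJ hΩ hb
  have hJ := vJ_injective hΩ
  obtain ⟨u, w, h, hw0⟩ := exists_nsTraj hT hJc hJ hμ (isConvective_vB hΩ hc) hK
    (mem_closure_range_vJ hΩ hb hΩc hu₀) hg
  have hu : h.memLp.toLp u =ᵐ[timeMeasure T] u := h.memLp.coeFn_toLp
  refine ⟨h.memLp.toLp u, (isWeakSolutionT_iff hT hM hΩ hc).2 ⟨w, ?_, hw0⟩, fun u' hu' => ?_⟩
  · refine IsTraj.congr hT.le h hu.symm ?_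
    filter_upwards [hu] with t ht
    rw [ht]
  · obtain ⟨w', h', hw0'⟩ := (isWeakSolutionT_iff hT hM hΩ hc).1 hu'
    -- With equal data and equal operators the constant of the stability estimate is zero.
    have h0 := (IsNSTraj.stability hT hJc hJ hμ (isConvective_vB hΩ hc) hK h' h hg hg rfl rfl).2
    simp only [hw0', hw0, sub_self, norm_zero, integral_zero, mul_zero, zero_pow two_ne_zero, add_zero, zero_mul] at h0
    have h1 : ∫ t, ‖u' t - u t‖ ^ 2 ∂timeMeasure T = 0 := by
      have h2 : 0 ≤ ∫ t, ‖u' t - u t‖ ^ 2 ∂timeMeasure T := integral_nonneg fun _ => by positivity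
      nlinarith
    have h2 := (integral_eq_zero_iff_of_nonneg (fun t => by positivity)
      (integrable_norm_sq_of_memLp ((Lp.memLp u').sub h.memLp))).1 h1
    refine Lp.ext ?_
    filter_upwards [h2, hu] with t h3 h4
    rw [h4]
    simpa [sub_eq_zero] using h3

lemma isWeakSolutionT_stateT {f : ℝ → L2 Ω Plane} {u₀ : L2 Ω Plane}
    (h : ∃ u, IsWeakSolutionT μ α T f u₀ φ u) :
    IsWeakSolutionT μ α T f u₀ φ (stateT μ α T f u₀ φ) := by
  rw [stateT, dif_pos h]
  exact h.choose_spec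

/-- The time-dependent state depends continuously on the design. -/
theorem tendsto_stateT (hΩ : IsOpen Ω) (hΩc : IsConnected Ω)
    (hb : Bornology.IsBounded Ω) (hT : 0 < T) (hμ : 0 < μ) (hα : PorousFunction α)
    {f : ℝ → L2 Ω Plane} (hf : MemLp f 2 (timeMeasure T)) {u₀ : L2 Ω Plane} (hu₀ : u₀ ∈ H Ω)
    {φs : ℕ → H1 Ω} (hφs : ∀ n, φs n ∈ admissible Ω) (hφ : φ ∈ admissible Ω)
    (hlim : ∀ᵐ x ∂volume.restrict Ω, Tendsto (fun n => sval (φs n) x) atTop (𝓝 (sval φ x))) :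
    Tendsto (fun n => stateT μ α T f u₀ (φs n)) atTop (𝓝 (stateT μ α T f u₀ φ)) := by
  obtain ⟨c, hc⟩ := exists_isLadyzhenskayaConstant hΩ
  obtain ⟨C, hC0, hC⟩ := hα.exists_bound
  obtain ⟨M, hM⟩ := exists_isMulOp (aestronglyMeasurable_comp_sval hα.continuous φ)
    (ae_abs_comp_sval_le hC hφ)
  choose Ms hMs using fun n => exists_isMulOp
    (aestronglyMeasurable_comp_sval hα.continuous (φs n)) (ae_abs_comp_sval_le hC (hφs n))
  have hsol : ∀ {φ : H1 Ω}, φ ∈ admissible Ω →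
      IsWeakSolutionT μ α T f u₀ φ (stateT μ α T f u₀ φ) := fun hφ =>
    isWeakSolutionT_stateT (existsUnique_isWeakSolutionT hΩ hΩc hb hT hμ hα hf hu₀ hφ).exists
  obtain ⟨w, hw, hw0⟩ := (isWeakSolutionT_iff hT hM hΩ hc).1 (hsol hφ)
  choose ws hws hws0 using fun n => (isWeakSolutionT_iff hT (hMs n) hΩ hc).1 (hsol (hφs n))
  have hg := memLp_adjoint (Ω := Ω) hf
  set u := stateT μ α T f u₀ φ with hu
  set us : ℕ → Lp (V Ω) 2 (timeMeasure T) := fun n => stateT μ α T f u₀ (φs n) with hus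
  set y : Lp (L2 Ω Plane) 2 (timeMeasure T) := (vJ Ω).compLp u with hy
  set Λ := ∫ t, (2 * μ + 2 * ((c ^ 2) ^ 2 / μ ^ 3) * (‖w t‖ ^ 2 * ‖u t‖ ^ 2)) ∂(timeMeasure T) with hΛ
  have hΛ0 : 0 ≤ Λ := integral_nonneg fun t => by positivity
  have hΛ1 : 0 ≤ 1 + Λ * Real.exp Λ := by positivity
  set A := 2 / μ * (2 / μ) * ‖(vJ Ω).adjoint‖ ^ 2 * (1 + Λ * Real.exp Λ) with hA
  -- The limit state plays the role of the second solution. Thus `Λ` is independent of `n`, and the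
  -- difference of the operators acts on the fixed function `y = J u`.
  have key : ∀ n, ‖us n - u‖ ^ 2 ≤ A * ‖(Ms n).compLp y - M.compLp y‖ ^ 2 := fun n => by
    have hst := (IsNSTraj.stability hT (isCompactOperator_vJ hΩ hb) (vJ_injective hΩ) hμ
      (isConvective_vB hΩ hc) (isZerothOrder_zerothOp (hMs n) hC0 hα.nonneg hμ) (hws n) hw hg hg
      rfl hΛ).2
    have e1 : ‖us n - u‖ ^ 2 = ∫ t, ‖us n t - u t‖ ^ 2 ∂timeMeasure T := by
      rw [Lp_norm_sq_eq_integral]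
      refine integral_congr_ae ?_
      filter_upwards [Lp.coeFn_sub (us n) u] with t ht
      rw [ht]
      rfl
    have e2 : ∫ t, ‖(vJ Ω).adjoint (f t) - (vJ Ω).adjoint (f t)
          - (zerothOp (Ms n) μ (u t) - zerothOp M μ (u t))‖ ^ 2 ∂timeMeasure T
        ≤ ‖(vJ Ω).adjoint‖ ^ 2 * ‖(Ms n).compLp y - M.compLp y‖ ^ 2 := by
      rw [Lp_norm_sq_eq_integral, ← integral_const_mul]
      refine integral_mono_of_nonneg (Eventually.of_forall fun t => by positivity)
        ((integrable_norm_sq_of_memLp (Lp.memLp _)).const_mul _) ?_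
      filter_upwards [Lp.coeFn_sub ((Ms n).compLp y) (M.compLp y), (Ms n).coeFn_compLp y,
        M.coeFn_compLp y, (vJ Ω).coeFn_compLp u] with t h1 h2 h3 h4
      rw [h1, Pi.sub_apply, h2, h3, h4, ← mul_pow]
      gcongr
      rw [sub_self, zero_sub, norm_neg, zerothOp_apply, zerothOp_apply, ← map_sub,
        sub_sub_sub_cancel_right]
      exact (vJ Ω).adjoint.le_opNorm _
    rw [← e1, hws0, hw0, sub_self, norm_zero, zero_pow two_ne_zero, zero_add] at hst
    have h3 : μ / 2 * ‖us n - u‖ ^ 2 ≤ 2 / μ * (‖(vJ Ω).adjoint‖ ^ 2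
        * ‖(Ms n).compLp y - M.compLp y‖ ^ 2) * (1 + Λ * Real.exp Λ) := by
      refine hst.trans (mul_le_mul_of_nonneg_right ?_ hΛ1)
      exact mul_le_mul_of_nonneg_left e2 (by positivity)
    calc ‖us n - u‖ ^ 2 = 2 / μ * (μ / 2 * ‖us n - u‖ ^ 2) := by field_simp
      _ ≤ 2 / μ * (2 / μ * (‖(vJ Ω).adjoint‖ ^ 2
        * ‖(Ms n).compLp y - M.compLp y‖ ^ 2) * (1 + Λ * Real.exp Λ)) := mul_le_mul_of_nonneg_left h3 (by positivity)
      _ = _ := by rw [hA]; ring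
  have hconv := tendsto_compLp (fun n => (hMs n).bound) (tendsto_mulOp hMs hM
    (fun n => ae_abs_comp_sval_le hC (hφs n)) (by
      filter_upwards [hlim] with x hx
      exact (hα.continuous.tendsto _).comp hx)) y
  rw [tendsto_iff_norm_sub_tendsto_zero] at hconv ⊢
  have h1 : Tendsto (fun n => ‖us n - u‖ ^ 2) atTop (𝓝 0) :=
    squeeze_zero (fun n => by positivity) key (by simpa using (hconv.pow 2).const_mul A)
  simpa using h1.sqrt

lemma isWeakSolutionS_iff (hM : IsMulOp (fun x => α (sval φ x)) C M) {c : ℝ}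
    (hΩ : IsOpen Ω) (hc : IsLadyzhenskayaConstant Ω c) {fs : L2 Ω Plane} {v : V Ω} :
    IsWeakSolutionS μ α fs φ v ↔ IsNSStationary (vJ Ω) (vD Ω) M (vB hΩ hc) fs μ v := by
  refine forall_congr' fun ψ => ?_
  rw [aForm_eq hM, inner_vB, vJ_apply ψ, inner_velL fs]

lemma isWeakSolutionS_stateS {fs : L2 Ω Plane} (h : ∃ v, IsWeakSolutionS μ α fs φ v) :
    IsWeakSolutionS μ α fs φ (stateS μ α fs φ) := by
  rw [stateS, dif_pos h]
  exact h.choose_spec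

/-- The contraction constant of the stationary problem, with `N = cL cP` and Poincaré constant `cP`,
written as in the smallness assumption. -/
lemma smallness_of_lt {cP cL F : ℝ} (hμ : 0 < μ) (h : 2 * cP ^ 2 * cL * F < μ ^ 2) :
    cL * cP * (cP * F / μ) / μ < 1 / 2 := by
  rw [mul_div_assoc', div_div, div_lt_div_iff₀ (by positivity) two_pos]
  linarith

/-- Existence and uniqueness for the stationary problem with small data. -/
theorem existsUnique_isWeakSolutionS (hΩ : IsOpen Ω) (hμ : 0 < μ) (hα : PorousFunction α)
    {fs : L2 Ω Plane} {cP cL : ℝ} (hP : IsPoincareConstant Ω cP) (hL : IsLadyzhenskayaConstant Ω cL)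
    (hsmall : 2 * cP ^ 2 * cL * ‖fs‖ < μ ^ 2) (hφ : φ ∈ admissible Ω) :
    ∃! v : V Ω, IsWeakSolutionS μ α fs φ v := by
  obtain ⟨C, hC0, hC⟩ := hα.exists_bound
  obtain ⟨M, hM⟩ := exists_isMulOp (aestronglyMeasurable_comp_sval hα.continuous φ)
    (ae_abs_comp_sval_le hC hφ)
  have hD := isDirichletConvective_vB hΩ hP hL
  have hM0 := hM.inner_nonneg (Eventually.of_forall fun x => hα.nonneg _)
  have hs := smallness_of_lt hμ hsmall
  obtain ⟨v, hv⟩ := hD.exists_stationary hμ hM0 (hs.trans (by norm_num))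
  refine ⟨v, (isWeakSolutionS_iff hM hΩ hL).2 hv, fun v' hv' => ?_⟩
  have h1 := hD.stability hμ hM0 hM0 hs ((isWeakSolutionS_iff hM hΩ hL).1 hv') hv
  rw [sub_self, norm_zero, mul_zero] at h1
  have h2 := hD.norm_sq_le (v' - v)
  have h3 : ‖vD Ω (v' - v)‖ = 0 := le_antisymm h1 (norm_nonneg _)
  rw [h3, zero_pow two_ne_zero, mul_zero] at h2
  exact sub_eq_zero.1 (norm_eq_zero.1 (pow_eq_zero_iff two_ne_zero |>.1 (le_antisymm h2 (by positivity))))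

/-- The stationary state depends continuously on the design. -/
theorem tendsto_stateS (hΩ : IsOpen Ω) (hμ : 0 < μ) (hα : PorousFunction α)
    {fs : L2 Ω Plane} {cP cL : ℝ} (hP : IsPoincareConstant Ω cP) (hL : IsLadyzhenskayaConstant Ω cL)
    (hsmall : 2 * cP ^ 2 * cL * ‖fs‖ < μ ^ 2)
    {φs : ℕ → H1 Ω} (hφs : ∀ n, φs n ∈ admissible Ω) (hφ : φ ∈ admissible Ω)
    (hlim : ∀ᵐ x ∂volume.restrict Ω, Tendsto (fun n => sval (φs n) x) atTop (𝓝 (sval φ x))) :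
    Tendsto (fun n => stateS μ α fs (φs n)) atTop (𝓝 (stateS μ α fs φ)) := by
  obtain ⟨C, hC0, hC⟩ := hα.exists_bound
  obtain ⟨M, hM⟩ := exists_isMulOp (aestronglyMeasurable_comp_sval hα.continuous φ)
    (ae_abs_comp_sval_le hC hφ)
  choose Ms hMs using fun n => exists_isMulOp
    (aestronglyMeasurable_comp_sval hα.continuous (φs n)) (ae_abs_comp_sval_le hC (hφs n))
  have hsol : ∀ {φ : H1 Ω}, φ ∈ admissible Ω → IsWeakSolutionS μ α fs φ (stateS μ α fs φ) :=
    fun hφ => isWeakSolutionS_stateS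
      (existsUnique_isWeakSolutionS hΩ hμ hα hP hL hsmall hφ).exists
  have hD := isDirichletConvective_vB hΩ hP hL
  set v := stateS μ α fs φ with hv
  have key : ∀ n, ‖stateS μ α fs (φs n) - v‖ ^ 2
      ≤ (1 + cP ^ 2) * (2 * cP / μ * ‖Ms n (vJ Ω v) - M (vJ Ω v)‖) ^ 2 := fun n => by
    refine (hD.norm_sq_le _).trans ?_
    gcongr
    exact hD.stability hμ ((hMs n).inner_nonneg (Eventually.of_forall fun x => hα.nonneg _))
      (hM.inner_nonneg (Eventually.of_forall fun x => hα.nonneg _)) (smallness_of_lt hμ hsmall)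
      ((isWeakSolutionS_iff (hMs n) hΩ hL).1 (hsol (hφs n)))
      ((isWeakSolutionS_iff hM hΩ hL).1 (hsol hφ))
  have hconv := tendsto_mulOp hMs hM (fun n => ae_abs_comp_sval_le hC (hφs n)) (by
      filter_upwards [hlim] with x hx
      exact (hα.continuous.tendsto _).comp hx) (vJ Ω v)
  rw [tendsto_iff_norm_sub_tendsto_zero] at hconv ⊢
  have h1 : Tendsto (fun n => ‖stateS μ α fs (φs n) - v‖ ^ 2) atTop (𝓝 0) :=
    squeeze_zero (fun n => by positivity) key
      (by simpa using ((hconv.const_mul (2 * cP / μ)).pow 2).const_mul (1 + cP ^ 2))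
  simpa using h1.sqrt

end States

/-! ### The direct method and continuity of the cost -/

section Minimizers

variable {Ω : Set Plane} {φ : H1 Ω}

lemma energy_eq (hb : Bornology.IsBounded Ω) (c₀ ε : ℝ) (hφ : φ ∈ admissible Ω) :
    energy c₀ ε φ = 1 / (2 * c₀) * (ε / 2 * ‖sgrad φ‖ ^ 2
      + 1 / ε * ∫ x in Ω, (1 - sval φ x ^ 2) / 2) := by
  have : IsFiniteMeasure (volume.restrict Ω) := ⟨by simpa using hb.measure_lt_top⟩
  have hφ' : ∀ᵐ x ∂(volume.restrict Ω), |sval φ x| ≤ 1 := hφ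
  have h1 : Integrable (fun x => (1 - sval φ x ^ 2) / 2) (volume.restrict Ω) := by
    have := integrable_norm_sq_of_memLp (Lp.memLp (sval φ))
    simp only [Real.norm_eq_abs, sq_abs] at this
    exact ((integrable_const 1).sub this).div_const 2
  rw [energy, Lp_norm_sq_eq_integral, ← integral_const_mul (ε / 2), ← integral_const_mul (1 / ε),
    ← integral_add ((integrable_norm_sq_of_memLp (Lp.memLp _)).const_mul _) (h1.const_mul _)]
  congr 1
  refine integral_congr_ae ?_
  filter_upwards [hφ'] with x hx
  simp only [doubleObstacle]
  rw [if_pos hx, EReal.toReal_coe]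

lemma integral_obstacle_nonneg (hφ : φ ∈ admissible Ω) :
    0 ≤ ∫ x in Ω, (1 - sval φ x ^ 2) / 2 := by
  have hφ' : ∀ᵐ x ∂(volume.restrict Ω), |sval φ x| ≤ 1 := hφ
  refine integral_nonneg_of_ae ?_
  filter_upwards [hφ'] with x hx
  have : sval φ x ^ 2 ≤ 1 := (sq_le_one_iff_abs_le_one _).2 hx
  exact div_nonneg (by linarith) two_pos.le

lemma tendsto_integral_obstacle (hb : Bornology.IsBounded Ω) {φs : ℕ → H1 Ω}
    (hφs : ∀ n, φs n ∈ admissible Ω)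
    (hlim : ∀ᵐ x ∂volume.restrict Ω, Tendsto (fun n => sval (φs n) x) atTop (𝓝 (sval φ x))) :
    Tendsto (fun n => ∫ x in Ω, (1 - sval (φs n) x ^ 2) / 2) atTop
      (𝓝 (∫ x in Ω, (1 - sval φ x ^ 2) / 2)) := by
  have : IsFiniteMeasure (volume.restrict Ω) := ⟨by simpa using hb.measure_lt_top⟩
  refine tendsto_integral_of_dominated_convergence (fun _ => 1) (fun n => ?_) (integrable_const _)
    (fun n => ?_) ?_
  · exact aestronglyMeasurable_comp_sval (α := fun s => (1 - s ^ 2) / 2) (by fun_prop) (φs n)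
  · have hφ' : ∀ᵐ x ∂(volume.restrict Ω), |sval (φs n) x| ≤ 1 := hφs n
    filter_upwards [hφ'] with x hx
    have : sval (φs n) x ^ 2 ≤ 1 := (sq_le_one_iff_abs_le_one _).2 hx
    rw [Real.norm_eq_abs, abs_le]
    constructor <;> nlinarith [sq_nonneg (sval (φs n) x)]
  · filter_upwards [hlim] with x hx
    exact ((hx.pow 2).const_sub 1).div_const 2

lemma zero_mem_admissible : (0 : H1 Ω) ∈ admissible Ω := by
  change ∀ᵐ x ∂(volume.restrict Ω), |((0 : L2 Ω ℝ) : Plane → ℝ) x| ≤ 1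
  filter_upwards [Lp.coeFn_zero ℝ 2 (volume.restrict Ω)] with x hx
  rw [hx]
  simp

/-- The direct method for the sum of a continuous functional and the Ginzburg–Landau energy. -/
theorem exists_minimizer (hΩ : IsOpen Ω) (hb : Bornology.IsBounded Ω) {γ ε c₀ : ℝ} (hγ : 0 < γ)
    (hε : 0 < ε) (hc₀ : 0 < c₀) {Q : H1 Ω → ℝ} (hQ0 : ∀ φ ∈ admissible Ω, 0 ≤ Q φ)
    (hQ : ∀ (φs : ℕ → H1 Ω) (φ : H1 Ω), (∀ n, φs n ∈ admissible Ω) → φ ∈ admissible Ω →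
      (∀ᵐ x ∂volume.restrict Ω, Tendsto (fun n => sval (φs n) x) atTop (𝓝 (sval φ x))) →
      Tendsto (fun n => Q (φs n)) atTop (𝓝 (Q φ))) :
    ∃ φ ∈ admissible Ω, ∀ φ' ∈ admissible Ω,
      Q φ + γ * energy c₀ ε φ ≤ Q φ' + γ * energy c₀ ε φ' := by
  set R : H1 Ω → ℝ := fun φ => Q φ + γ * energy c₀ ε φ with hR
  set κ := γ * (1 / (2 * c₀) * (ε / 2)) with hκ
  set lam := γ * (1 / (2 * c₀) * (1 / ε)) with hlam
  have hκ0 : 0 < κ := by positivity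
  have hlam0 : 0 < lam := by positivity
  have hRe : ∀ φ ∈ admissible Ω, R φ = Q φ + κ * ‖sgrad φ‖ ^ 2
      + lam * ∫ x in Ω, (1 - sval φ x ^ 2) / 2 := fun φ hφ => by
    simp only [hR]
    rw [energy_eq hb c₀ ε hφ, hκ, hlam]
    ring
  have hRlow : ∀ φ ∈ admissible Ω, κ * ‖sgrad φ‖ ^ 2 ≤ R φ := fun φ hφ => by
    rw [hRe φ hφ]
    have h1 := hQ0 φ hφ
    have h2 := mul_nonneg hlam0.le (integral_obstacle_nonneg hφ)
    linarith
  have hne : (R '' admissible Ω).Nonempty := ⟨_, mem_image_of_mem R zero_mem_admissible⟩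
  have hbdd : BddBelow (R '' admissible Ω) := ⟨0, by
    rintro _ ⟨φ, hφ, rfl⟩
    exact le_trans (by positivity) (hRlow φ hφ)⟩
  set I := sInf (R '' admissible Ω) with hI
  have hseq : ∀ n : ℕ, ∃ φ ∈ admissible Ω, R φ < I + 1 / ((n : ℝ) + 1) := fun n => by
    obtain ⟨_, ⟨φ, hφ, rfl⟩, h⟩ := exists_lt_of_csInf_lt hne
      (lt_add_of_pos_right I (Nat.one_div_pos_of_nat (n := n) (α := ℝ)))
    exact ⟨φ, hφ, h⟩
  choose φs hφs hlt using hseq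
  have hgrad : ∀ n, ‖sgrad (φs n)‖ ≤ √((I + 1) / κ) := fun n => by
    refine Real.le_sqrt_of_sq_le ?_
    rw [le_div_iff₀ hκ0, mul_comm]
    refine (hRlow _ (hφs n)).trans ((hlt n).le.trans ?_)
    have : 1 / ((n : ℝ) + 1) ≤ 1 := by
      rw [div_le_one (by positivity)]
      linarith [(Nat.cast_nonneg n : (0 : ℝ) ≤ n)]
    linarith
  obtain ⟨φ, hφ, ns, hns, hae, hweak⟩ := exists_admissible_limit hΩ hb hφs hgrad
  refine ⟨φ, hφ, fun χ hχ => ?_⟩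
  have hRI : R φ ≤ I := by
    -- Weak lower semicontinuity by linearization: `‖∇φₙ‖² ≥ 2⟪∇φₙ, ∇φ⟫ - ‖∇φ‖²`, and the right side
    -- converges to `‖∇φ‖²`. The obstacle term converges by dominated convergence.
    have hl : Tendsto (fun n => Q (φs (ns n)) + κ * (2 * ⟪sgrad (φs (ns n)), sgrad φ⟫_ℝ - ‖sgrad φ‖ ^ 2)
        + lam * ∫ x in Ω, (1 - sval (φs (ns n)) x ^ 2) / 2) atTop (𝓝 (R φ)) := by
      rw [hRe φ hφ]
      have h1 := (((hweak (sgrad φ)).const_mul 2).sub_const (‖sgrad φ‖ ^ 2)).const_mul κ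
      rw [real_inner_self_eq_norm_sq, two_mul, add_sub_cancel_right] at h1
      exact ((hQ _ _ (fun n => hφs (ns n)) hφ hae).add h1).add
        ((tendsto_integral_obstacle hb (fun n => hφs (ns n)) hae).const_mul lam)
    have hr : Tendsto (fun n => I + 1 / ((ns n : ℝ) + 1)) atTop (𝓝 I) := by
      have := (tendsto_one_div_add_atTop_nhds_zero_nat (𝕜 := ℝ)).comp hns.tendsto_atTop
      simpa [Function.comp_def] using this.const_add I
    refine le_of_tendsto_of_tendsto' hl hr fun n => le_trans ?_ (hlt (ns n)).le
    rw [hRe _ (hφs (ns n))]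
    gcongr
    have h1 := norm_sub_sq_real (sgrad (φs (ns n))) (sgrad φ)
    nlinarith [sq_nonneg ‖sgrad (φs (ns n)) - sgrad φ‖]
  exact hRI.trans (csInf_le hbdd (mem_image_of_mem R hχ))

/-- The weight of the tracking term. -/
def trackWeight (S : Set Plane) (φ : H1 Ω) (x : Plane) : ℝ :=
  (sval φ x + 1) / 2 * S.indicator (fun _ => (1 : ℝ)) x

lemma aestronglyMeasurable_trackWeight {S : Set Plane} (hS : MeasurableSet S) (φ : H1 Ω) :
    AEStronglyMeasurable (trackWeight S φ) (volume.restrict Ω) :=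
  (aestronglyMeasurable_comp_sval (α := fun s => (s + 1) / 2) (by fun_prop) φ).mul
    (aestronglyMeasurable_const.indicator hS)

lemma trackWeight_mem {S : Set Plane} (hφ : φ ∈ admissible Ω) :
    ∀ᵐ x ∂volume.restrict Ω, 0 ≤ trackWeight S φ x ∧ trackWeight S φ x ≤ 1 := by
  have hφ' : ∀ᵐ x ∂(volume.restrict Ω), |sval φ x| ≤ 1 := hφ
  filter_upwards [hφ'] with x hx
  rw [abs_le] at hx
  by_cases h : x ∈ S
  · simp only [trackWeight, indicator_of_mem h, mul_one]
    constructor <;> linarith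
  · simp [trackWeight, indicator_of_notMem h]

lemma abs_trackWeight_le {S : Set Plane} (hφ : φ ∈ admissible Ω) :
    ∀ᵐ x ∂volume.restrict Ω, |trackWeight S φ x| ≤ 1 := by
  filter_upwards [trackWeight_mem (S := S) hφ] with x hx
  rw [abs_of_nonneg hx.1]
  exact hx.2

lemma cost_eq {β : ℝ → ℝ} {S : Set Plane} {ud : Plane → Plane}
    {P M : L2 Ω Plane →L[ℝ] L2 Ω Plane} {C : ℝ} (hP : IsMulOp (trackWeight S φ) 1 P)
    (hM : IsMulOp (fun x => β (sval φ x)) C M)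
    (hd : MemLp (S.indicator ud) 2 (volume.restrict Ω)) (v : V Ω) :
    cost β S ud v.1 φ = ⟪P (vJ Ω v - hd.toLp _), vJ Ω v - hd.toLp _⟫_ℝ
      + ⟪M (vJ Ω v), vJ Ω v⟫_ℝ := by
  rw [cost, hP.inner, hM.inner]
  congr 1
  · refine integral_congr_ae ?_
    filter_upwards [Lp.coeFn_sub (vJ Ω v) (hd.toLp _), velL_coe v.1, hd.coeFn_toLp] with x h1 h2 h3
    rw [h1, Pi.sub_apply, vJ_apply, h2, h3, real_inner_self_eq_norm_sq, trackWeight]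
    by_cases h : x ∈ S
    · simp only [indicator_of_mem h]
      ring
    · simp [indicator_of_notMem h]
  · refine integral_congr_ae ?_
    filter_upwards [velL_coe v.1] with x h2
    rw [vJ_apply, h2, real_inner_self_eq_norm_sq]

lemma cost_nonneg {β : ℝ → ℝ} (hβ : ∀ s, 0 ≤ β s) (S : Set Plane) (ud : Plane → Plane)
    (v : H1Vec Ω) (hφ : φ ∈ admissible Ω) : 0 ≤ cost β S ud v φ := by
  refine add_nonneg (integral_nonneg_of_ae ?_)
    (integral_nonneg fun x => mul_nonneg (hβ _) (by positivity))
  filter_upwards [trackWeight_mem (S := S) hφ] with x hx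
  have : (sval φ x + 1) / 2 * ‖vel v x - ud x‖ ^ 2 * S.indicator (fun _ => (1 : ℝ)) x
      = trackWeight S φ x * ‖vel v x - ud x‖ ^ 2 := by rw [trackWeight]; ring
  rw [this]
  exact mul_nonneg hx.1 (by positivity)

/-- Written with quadratic forms on `L²(0,T;L²(Ω)²)`, the time-integrated cost passes to the limit
by the same argument as the stationary one. -/
lemma integral_cost_eq {T : ℝ} {β : ℝ → ℝ} {S : Set Plane} {ud : Plane → Plane}
    {P M : L2 Ω Plane →L[ℝ] L2 Ω Plane} {C : ℝ} (hP : IsMulOp (trackWeight S φ) 1 P)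
    (hM : IsMulOp (fun x => β (sval φ x)) C M)
    (hd : MemLp (S.indicator ud) 2 (volume.restrict Ω)) (u : Lp (V Ω) 2 (timeMeasure T)) :
    ∫ t in Ioo 0 T, cost β S ud (u t).1 φ
      = ⟪P.compLpL 2 (timeMeasure T) ((vJ Ω).compLpL 2 (timeMeasure T) u
          - (memLp_const (hd.toLp _)).toLp _),
        (vJ Ω).compLpL 2 (timeMeasure T) u - (memLp_const (hd.toLp _)).toLp _⟫_ℝ
        + ⟪M.compLpL 2 (timeMeasure T) ((vJ Ω).compLpL 2 (timeMeasure T) u),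
          (vJ Ω).compLpL 2 (timeMeasure T) u⟫_ℝ := by
  set Y := (vJ Ω).compLpL 2 (timeMeasure T) u with hY
  set D : Lp (L2 Ω Plane) 2 (timeMeasure T) := (memLp_const (hd.toLp _)).toLp _ with hD
  rw [L2.inner_def, L2.inner_def, ← integral_add (L2.integrable_inner _ _) (L2.integrable_inner _ _)]
  refine integral_congr_ae ?_
  filter_upwards [Lp.coeFn_sub Y D, P.coeFn_compLp (Y - D), M.coeFn_compLp Y,
    (vJ Ω).coeFn_compLp u, (memLp_const (hd.toLp _) : MemLp (fun _ : ℝ => hd.toLp _) 2 (timeMeasure T)).coeFn_toLp] with t h1 h2 h3 h4 h5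
  rw [cost_eq hP hM hd]
  have e1 : (P.compLpL 2 (timeMeasure T) (Y - D)) t = P ((Y - D : Lp _ _ _) t) := h2
  have e2 : (M.compLpL 2 (timeMeasure T) Y) t = M (Y t) := h3
  have e3 : Y t = vJ Ω (u t) := h4
  have e4 : D t = hd.toLp _ := h5
  rw [e1, e2, h1, Pi.sub_apply, e3, e4]

lemma tendsto_quadratic {X : Type*} [NormedAddCommGroup X] [InnerProductSpace ℝ X]
    {P : ℕ → X →L[ℝ] X} {P' : X →L[ℝ] X} {C : ℝ} (hC : ∀ n x, ‖P n x‖ ≤ C * ‖x‖) {x : ℕ → X} {x' : X}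
    (hP : Tendsto (fun n => P n x') atTop (𝓝 (P' x'))) (hx : Tendsto x atTop (𝓝 x')) :
    Tendsto (fun n => ⟪P n (x n), x n⟫_ℝ) atTop (𝓝 ⟪P' x', x'⟫_ℝ) :=
  (tendsto_clm_apply hC hP hx).inner hx

/-- The data needed to pass to the limit in the cost functional. -/
lemma exists_cost_operators {β : ℝ → ℝ} (hβ : PorousFunction β) {S : Set Plane}
    (hS : MeasurableSet S) {φs : ℕ → H1 Ω} (hφs : ∀ n, φs n ∈ admissible Ω)
    (hφ : φ ∈ admissible Ω)
    (hlim : ∀ᵐ x ∂volume.restrict Ω, Tendsto (fun n => sval (φs n) x) atTop (𝓝 (sval φ x))) :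
    ∃ (C : ℝ) (Ps Ms : ℕ → L2 Ω Plane →L[ℝ] L2 Ω Plane) (P M : L2 Ω Plane →L[ℝ] L2 Ω Plane),
      (∀ n, IsMulOp (trackWeight S (φs n)) 1 (Ps n)) ∧ IsMulOp (trackWeight S φ) 1 P ∧
      (∀ n, IsMulOp (fun x => β (sval (φs n) x)) C (Ms n)) ∧ IsMulOp (fun x => β (sval φ x)) C M ∧
      (∀ g, Tendsto (fun n => Ps n g) atTop (𝓝 (P g))) ∧
      ∀ g, Tendsto (fun n => Ms n g) atTop (𝓝 (M g)) := by
  obtain ⟨C, hC0, hC⟩ := hβ.exists_bound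
  obtain ⟨M, hM⟩ := exists_isMulOp (aestronglyMeasurable_comp_sval hβ.continuous φ)
    (ae_abs_comp_sval_le hC hφ)
  choose Ms hMs using fun n => exists_isMulOp
    (aestronglyMeasurable_comp_sval hβ.continuous (φs n)) (ae_abs_comp_sval_le hC (hφs n))
  obtain ⟨P, hP⟩ := exists_isMulOp (aestronglyMeasurable_trackWeight hS φ)
    (abs_trackWeight_le (S := S) hφ)
  choose Ps hPs using fun n => exists_isMulOp
    (aestronglyMeasurable_trackWeight hS (φs n)) (abs_trackWeight_le (S := S) (hφs n))
  refine ⟨C, Ps, Ms, P, M, hPs, hP, hMs, hM,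
    tendsto_mulOp hPs hP (fun n => abs_trackWeight_le (hφs n)) ?_,
    tendsto_mulOp hMs hM (fun n => ae_abs_comp_sval_le hC (hφs n)) ?_⟩
  · filter_upwards [hlim] with x hx
    exact ((hx.add_const 1).div_const 2).mul_const _
  · filter_upwards [hlim] with x hx
    exact (hβ.continuous.tendsto _).comp hx

lemma tendsto_cost {β : ℝ → ℝ} (hβ : PorousFunction β) {S : Set Plane} (hS : MeasurableSet S)
    {ud : Plane → Plane} (hd : MemLp (S.indicator ud) 2 (volume.restrict Ω)) {φs : ℕ → H1 Ω}
    (hφs : ∀ n, φs n ∈ admissible Ω) (hφ : φ ∈ admissible Ω)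
    (hlim : ∀ᵐ x ∂volume.restrict Ω, Tendsto (fun n => sval (φs n) x) atTop (𝓝 (sval φ x)))
    {v : ℕ → V Ω} {v' : V Ω} (hv : Tendsto v atTop (𝓝 v')) :
    Tendsto (fun n => cost β S ud (v n).1 (φs n)) atTop (𝓝 (cost β S ud v'.1 φ)) := by
  obtain ⟨C, Ps, Ms, P, M, hPs, hP, hMs, hM, h1, h2⟩ := exists_cost_operators hβ hS hφs hφ hlim
  rw [cost_eq hP hM hd]
  simp only [fun n => cost_eq (hPs n) (hMs n) hd (v n)]
  have hJ := ((vJ Ω).continuous.tendsto v').comp hv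
  exact (tendsto_quadratic (fun n => (hPs n).bound) (h1 _) (hJ.sub_const _)).add
    (tendsto_quadratic (fun n => (hMs n).bound) (h2 _) hJ)

lemma tendsto_integral_cost {T : ℝ} {β : ℝ → ℝ} (hβ : PorousFunction β) {S : Set Plane}
    (hS : MeasurableSet S) {ud : Plane → Plane}
    (hd : MemLp (S.indicator ud) 2 (volume.restrict Ω)) {φs : ℕ → H1 Ω}
    (hφs : ∀ n, φs n ∈ admissible Ω) (hφ : φ ∈ admissible Ω)
    (hlim : ∀ᵐ x ∂volume.restrict Ω, Tendsto (fun n => sval (φs n) x) atTop (𝓝 (sval φ x)))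
    {u : ℕ → Lp (V Ω) 2 (timeMeasure T)} {u' : Lp (V Ω) 2 (timeMeasure T)}
    (hu : Tendsto u atTop (𝓝 u')) :
    Tendsto (fun n => ∫ t in Ioo 0 T, cost β S ud (u n t).1 (φs n)) atTop
      (𝓝 (∫ t in Ioo 0 T, cost β S ud (u' t).1 φ)) := by
  obtain ⟨C, Ps, Ms, P, M, hPs, hP, hMs, hM, h1, h2⟩ := exists_cost_operators hβ hS hφs hφ hlim
  have hJ : Tendsto (fun n => (vJ Ω).compLpL 2 (timeMeasure T) (u n)) atTop
      (𝓝 ((vJ Ω).compLpL 2 (timeMeasure T) u')) :=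
    (((vJ Ω).compLpL 2 (timeMeasure T)).continuous.tendsto u').comp hu
  have hq : ∀ {K : ℝ} {Qs : ℕ → L2 Ω Plane →L[ℝ] L2 Ω Plane} {Q : L2 Ω Plane →L[ℝ] L2 Ω Plane},
      (∀ n g, ‖Qs n g‖ ≤ K * ‖g‖) → (∀ g, Tendsto (fun n => Qs n g) atTop (𝓝 (Q g))) →
      ∀ {y : ℕ → Lp (L2 Ω Plane) 2 (timeMeasure T)} {y' : Lp (L2 Ω Plane) 2 (timeMeasure T)},
      Tendsto y atTop (𝓝 y') →
      Tendsto (fun n => ⟪(Qs n).compLpL 2 (timeMeasure T) (y n), y n⟫_ℝ) atTop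
        (𝓝 ⟪Q.compLpL 2 (timeMeasure T) y', y'⟫_ℝ) := by
    intro K Qs Q hK hQ y y' hy
    exact tendsto_quadratic (P := fun n => (Qs n).compLpL 2 (timeMeasure T))
      (P' := Q.compLpL 2 (timeMeasure T)) (C := K) (fun n => norm_compLp_le (hK n))
      (tendsto_compLp hK hQ y') hy
  have h3 := (hq (fun n => (hPs n).bound) h1
    (hJ.sub_const ((memLp_const (hd.toLp _)).toLp _))).add (hq (fun n => (hMs n).bound) h2 hJ)
  rw [integral_cost_eq hP hM hd]
  exact h3.congr fun n => (integral_cost_eq (hPs n) (hMs n) hd (u n)).symm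

end Minimizers

end PhaseFieldNS

end

theorem theorem4p1
    (Ω : Set Plane) (hΩo : IsOpen Ω) (hΩc : IsConnected Ω) (hΩb : Bornology.IsBounded Ω)
    (ω : Set Plane) (hω : MeasurableSet ω) (hωΩ : ω ⊆ Ω)
    (T μ γ ε c₀ : ℝ) (hT : 0 < T) (hμ : 0 < μ) (hγ : 0 < γ) (hε : 0 < ε) (hc₀ : 0 < c₀)
    (α β : ℝ → ℝ) (hα : PorousFunction α) (hβ : PorousFunction β)
    (f : ℝ → L2 Ω Plane) (hf : MemLp f 2 (timeMeasure T)) (fs : L2 Ω Plane)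
    (u₀ : L2 Ω Plane) (hu₀ : u₀ ∈ PhaseFieldNS.H Ω)
    (ud : Plane → Plane) (hud : MemLp ud 2 (volume.restrict ω)) :
    -- the time-dependent problem: `S_T` is well defined and `J_T` has a global minimizer
    ((∀ φ ∈ admissible Ω, ∃! u : Lp (V Ω) 2 (timeMeasure T), IsWeakSolutionT μ α T f u₀ φ u) ∧
      ∃ φT ∈ admissible Ω, ∀ φ ∈ admissible Ω,
        reducedT μ α β T f u₀ ω ud γ c₀ ε φT ≤ reducedT μ α β T f u₀ ω ud γ c₀ ε φ) ∧
    -- the stationary problem, under the smallness condition that makes `S_s` well defined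
    (∀ cP cL : ℝ, IsPoincareConstant Ω cP → IsLadyzhenskayaConstant Ω cL →
      2 * cP ^ 2 * cL * ‖fs‖ < μ ^ 2 →
      (∀ φ ∈ admissible Ω, ∃! v : V Ω, IsWeakSolutionS μ α fs φ v) ∧
      ∃ φs ∈ admissible Ω, ∀ φ ∈ admissible Ω,
        reducedS μ α β fs ω ud γ c₀ ε φs ≤ reducedS μ α β fs ω ud γ c₀ ε φ) := by
  -- The target is given on `ω` only. Since the tracking term carries `χ_ω`, it may be replaced by
  -- its extension by zero.
  have hd : MemLp (ω.indicator ud) 2 (volume.restrict Ω) :=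
    ((memLp_indicator_iff_restrict hω).2 hud).restrict Ω
  refine ⟨⟨fun φ hφ => existsUnique_isWeakSolutionT hΩo hΩc hΩb hT hμ hα hf hu₀ hφ, ?_⟩,
    fun cP cL hP hL hsmall =>
      ⟨fun φ hφ => existsUnique_isWeakSolutionS hΩo hμ hα hP hL hsmall hφ, ?_⟩⟩
  -- The reduced objective is a nonnegative functional plus the energy; continuity of that
  -- functional along a.e. convergent designs combines continuity of the cost with that of the
  -- state.
  · refine exists_minimizer hΩo hΩb hγ hε hc₀
      (Q := fun φ => 1 / T * ∫ t in Ioo 0 T, cost β ω ud (stateT μ α T f u₀ φ t).1 φ)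
      (fun φ hφ => mul_nonneg (by positivity)
        (integral_nonneg fun t => cost_nonneg hβ.nonneg ω ud _ hφ)) ?_
    intro φs φ hφs hφ hlim
    exact (tendsto_integral_cost hβ hω hd hφs hφ hlim
      (tendsto_stateT hΩo hΩc hΩb hT hμ hα hf hu₀ hφs hφ hlim)).const_mul _
  · refine exists_minimizer hΩo hΩb hγ hε hc₀
      (Q := fun φ => cost β ω ud (stateS μ α fs φ).1 φ)
      (fun φ hφ => cost_nonneg hβ.nonneg ω ud _ hφ) ?_
    intro φs φ hφs hφ hlim
    exact tendsto_cost hβ hω hd hφs hφ hlim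
      (tendsto_stateS hΩo hμ hα hP hL hsmall hφs hφ hlim)
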